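/- Let $n\in\{2,3\}$, $0<\rho_-<\rho_+$, $g,L>0$, $\lambda\in(0,\tfrac12)$, $A=\frac{\rho_+-\rho_-}{\rho_++\rho_-}$, and let $\Omega=\mathbb T^{n-1}\times(-L,L)$ with $|\mathbb T|=1$. Let $$F_\lambda(r)=-\lambda\frac{(\rho_+-r)(r-\rho_-)}{\rho_++\rho_--r},\qquad r\in[\rho_-,\rho_+],$$ let $\rho_0(x)=\rho_+$ for $x_n>0$, $\rho_0(x)=\rho_-$ for $x_n<0$, and let $\bar\rho=\bar\rho(x_n,t)$ be the entropy solution on $\mathbb R\times(0,\infty)$ of the Riemann problem $$\partial_t\bar\rho+gt\,\partial_{x_n}F_\lambda(\bar\rho)=0,\qquad \bar\rho(\cdot,0)=\rho_0 .$$ Let $T>0$ be such that the mixing zone $\big\{-\frac{\lambda}{1+A}Agt^2<x_n<\frac{\lambda}{1-A}Agt^2\big\}$ does not reach the boundary up to time $T$, i.e. its closure at time $t=T$ is contained in $\{-L<x_n<L\}$. Then for every $\varepsilon>0$ there are a density $\nu=\nu(x_n,t)\le 0$ with $$\big|\nu-(1-2\lambda)g^2tF_\lambda(\bar\rho)\big|\le\varepsilon\,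 t\,(\rho_+-\bar\rho)(\bar\rho-\rho_-)\quad\text{a.e. in }(-L,L)\times(0,T),$$ a bounded pressure $p$ with an $L^1$ trace on $\partial\Omega\times(0,T)$, and infinitely many pairwise different $(\rho_k,v_k)\in L^\infty(\Omega\times(0,T);\mathbb R\times\mathbb R^n)$, $k\in\mathbb N$, such that each $(\rho_k,v_k,p)$ is a weak solution of $$\partial_t(\rho v)+\operatorname{div}(\rho v\otimes v)+\nabla p=-\rho g e_n,\qquad \operatorname{div}v=0,\qquad \partial_t\rho+\operatorname{div}(\rho v)=0,$$ $$\partial_t\big(\tfrac12\rho|v|^2+\rho gx_n\big)+\operatorname{div}\big((\tfrac12\rho|v|^2+\rho gx_n+p)v\big)\le0$$ in $\Omega\times(0,T)$, with $v\cdot\vec n=0$ on $\partial\Omega\times(0,T)$ and initial data $(\rho_0,0)$ (tested with $C_c^\infty(\overline\Omega\times[0,T))$ functions, nonnegative ones in the inequality), and: 1. the left-hand side of the energy inequality (the local dissipation measure) is equal to $\nu$; 2. $\rho_k\in\{\rho_-,\rho_+\}$ a.e.; 3. $\int_{\mathbb T^{n-1}}\rho_k(x',x_n,t)\,dx'=\bar\rho(x_n,t)$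 for a.e. $(x_n,t)\in(-L,L)\times(0,T)$; 4. $\rho_k=\rho_0$ and $v_k=0$ a.e. outside the mixing zone; 5. for a.e. $t\in(0,T)$ the total energy $E_k(t)=\int_\Omega\frac12\rho_k|v_k|^2+\rho_kgx_n\,dx$, with $E(0)=\int_\Omega\rho_0gx_n\,dx$, satisfies $$\Big|\frac{E_k(t)-E(0)}{\rho_+-\rho_-}-\lambda^2\big(\lambda-\tfrac12\big)\frac{g^3t^4A^2}{3(1-A^2)}\Big|\le\varepsilon t^4 .$$ Moreover $\rho_k\rightharpoonup\bar\rho$, $v_k\rightharpoonup0$ and $\rho_kv_k\rightharpoonup gtF_\lambda(\bar\rho)e_n$ weakly in $L^2(\Omega\times(0,T))$ as $k\to\infty$. -/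

import Mathlib

open MeasureTheory Set Filter Topology
open scoped ContDiff ENNReal

namespace RayleighTaylor

noncomputable section

/-! ### The periodic channel

The channel `𝕋^d × (-L, L)` with `n = d + 1` and `|𝕋| = 1`. Functions on the channel are
functions on `ℝ^n` that are `1`-periodic in the first `d` variables; integrals over the channel are
integrals over the fundamental cell `[0,1)^d × (-L, L)`. -/

/-- `ℝ^n` with `n = d + 1`; the last coordinate is the vertical one. -/
abbrev Space (d : ℕ) : Type := EuclideanSpace ℝ (Fin (d + 1))

/-- The upward unit vector `e_n`. -/
def eUp (d : ℕ) : Space d := EuclideanSpace.single (Fin.last d) 1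

/-- The vertical coordinate `x_n`. -/
def height {d : ℕ} (x : Space d) : ℝ := x (Fin.last d)

/-- The point with horizontal coordinates `x'` and vertical coordinate `s`. -/
def atHeight {d : ℕ} (x' : Fin d → ℝ) (s : ℝ) : Space d :=
  WithLp.toLp 2 (Fin.snoc (α := fun _ => ℝ) x' s)

/-- The fundamental cell `[0,1)^d` of the torus `𝕋^d`. -/
def torusCell (d : ℕ) : Set (Fin d → ℝ) := {x' | ∀ i, x' i ∈ Ico (0 : ℝ) 1}

/-- The fundamental cell `[0,1)^d × (-L, L)` of the channel `Ω`. -/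
def channel (d : ℕ) (L : ℝ) : Set (Space d) :=
  {x | (∀ i : Fin d, x i.castSucc ∈ Ico (0 : ℝ) 1) ∧ height x ∈ Ioo (-L) L}

/-- `Ω × (0, T)`. -/
def spaceTime (d : ℕ) (L T : ℝ) : Set (Space d × ℝ) := channel d L ×ˢ Ioo 0 T

/-- `1`-periodicity in the horizontal variables. -/
def HPeriodic {d : ℕ} {β : Type*} (f : Space d × ℝ → β) : Prop :=
  ∀ (x : Space d) (t : ℝ) (i : Fin d), f (x + EuclideanSpace.single i.castSucc 1, t) = f (x, t)

/-- Test functions of class `C_c^∞(closure Ω × [0, T))`: restrictions of smooth horizontally periodic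
functions which vanish for times close to `T`. They need not vanish at time `0`, nor at the top and
bottom of the channel. -/
structure IsTest {d : ℕ} {F : Type*} [NormedAddCommGroup F] [NormedSpace ℝ F] (T : ℝ)
    (Φ : Space d × ℝ → F) : Prop where
  smooth : ContDiff ℝ ∞ Φ
  periodic : HPeriodic Φ
  support : ∃ T' < T, ∀ x t, T' ≤ t → Φ (x, t) = 0

/-- The time derivative `∂_t Φ`. -/
def dt {d : ℕ} {F : Type*} [NormedAddCommGroup F] [NormedSpace ℝ F]
    (Φ : Space d × ℝ → F) (z : Space d × ℝ) : F :=
  fderiv ℝ Φ z (0, 1)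

/-- The spatial directional derivative `(u · ∇) Φ`. -/
def dx {d : ℕ} {F : Type*} [NormedAddCommGroup F] [NormedSpace ℝ F]
    (Φ : Space d × ℝ → F) (z : Space d × ℝ) (u : Space d) : F :=
  fderiv ℝ Φ z (u, 0)

/-- The spatial divergence `div Φ`. -/
def divergence {d : ℕ} (Φ : Space d × ℝ → Space d) (z : Space d × ℝ) : ℝ :=
  ∑ i : Fin (d + 1), dx Φ z (EuclideanSpace.single i 1) i

/-! ### Weak solutions of the inhomogeneous Euler equations -/

/-- The weak form of
`∂_t(ρ|v|²/2 + ρ g x_n) + div((ρ|v|²/2 + ρ g x_n + p) v)`, tested with `Ψ` after integration by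
parts; with `ν` the energy dissipation measure this is `-ν[Ψ]`. -/
def energyForm {d : ℕ} (g L T : ℝ) (ρ₀ : Space d → ℝ) (v₀ : Space d → Space d)
    (ρ : Space d × ℝ → ℝ) (v : Space d × ℝ → Space d) (p : Space d × ℝ → ℝ)
    (Ψ : Space d × ℝ → ℝ) : ℝ :=
  (∫ z in spaceTime d L T,
      ((ρ z * ‖v z‖ ^ 2 / 2 + ρ z * g * height z.1) * dt Ψ z
        + (ρ z * ‖v z‖ ^ 2 / 2 + ρ z * g * height z.1 + p z) * dx Ψ z (v z)))
    + ∫ x in channel d L, (ρ₀ x * ‖v₀ x‖ ^ 2 / 2 + ρ₀ x * g * height x) * Ψ (x, 0)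

/-- The values of `p` on `𝕋^d × {c}` (`c = ±L`) are integrable over `𝕋^d × (0, T)` and are
the `L¹` trace of `p` from inside the channel; `σ = ±1` is the sign of `c`, so that `c - σ r` with
small `r > 0` lies in the channel. -/
structure HasL1Trace {d : ℕ} (T c σ : ℝ) (p : Space d × ℝ → ℝ) : Prop where
  integrable : IntegrableOn (fun y : (Fin d → ℝ) × ℝ => p (atHeight y.1 c, y.2))
    (torusCell d ×ˢ Ioo 0 T)
  trace : Tendsto
    (fun h : ℝ => ENNReal.ofReal h⁻¹ *
      ∫⁻ y in (torusCell d ×ˢ Ioo (0 : ℝ) T) ×ˢ Ioo (0 : ℝ) h,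
        ‖p (atHeight y.1.1 (c - σ * y.2), y.1.2) - p (atHeight y.1.1 c, y.1.2)‖ₑ)
    (𝓝[>] 0) (𝓝 0)

/-- `(ρ, v, p)` is a bounded weak solution of the incompressible inhomogeneous Euler equations with
gravity `g`, with local energy inequality and the no-penetration condition on the channel during
`(0, T)`, with initial data `(ρ₀, v₀)`. -/
structure IsWeakSolution {d : ℕ} (g L T : ℝ) (ρ₀ : Space d → ℝ) (v₀ : Space d → Space d)
    (ρ : Space d × ℝ → ℝ) (v : Space d × ℝ → Space d) (p : Space d × ℝ → ℝ) : Prop where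
  periodic_ρ : HPeriodic ρ
  periodic_v : HPeriodic v
  periodic_p : HPeriodic p
  bounded_ρ : MemLp ρ ∞ (volume.restrict (spaceTime d L T))
  bounded_v : MemLp v ∞ (volume.restrict (spaceTime d L T))
  bounded_p : MemLp p ∞ (volume.restrict (spaceTime d L T))
  trace_top : HasL1Trace T L 1 p
  trace_bottom : HasL1Trace T (-L) (-1) p
  momentum : ∀ Φ : Space d × ℝ → Space d, IsTest T Φ →
    (∫ z in spaceTime d L T,
        (inner ℝ (ρ z • v z) (dt Φ z) + inner ℝ (ρ z • v z) (dx Φ z (v z))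
          + p z * divergence Φ z - g * ρ z * height (Φ z)))
      - (∫ y in torusCell d ×ˢ Ioo (0 : ℝ) T,
          (p (atHeight y.1 L, y.2) * height (Φ (atHeight y.1 L, y.2))
            - p (atHeight y.1 (-L), y.2) * height (Φ (atHeight y.1 (-L), y.2))))
      + (∫ x in channel d L, inner ℝ (ρ₀ x • v₀ x) (Φ (x, 0))) = 0
  incompressible : ∀ Ψ : Space d × ℝ → ℝ, IsTest T Ψ →
    ∫ z in spaceTime d L T, dx Ψ z (v z) = 0
  mass : ∀ Ψ : Space d × ℝ → ℝ, IsTest T Ψ →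
    (∫ z in spaceTime d L T, (ρ z * dt Ψ z + dx Ψ z (ρ z • v z)))
      + (∫ x in channel d L, ρ₀ x * Ψ (x, 0)) = 0
  energy : ∀ Ψ : Space d × ℝ → ℝ, IsTest T Ψ →
    (∀ x : Space d, ∀ t : ℝ, height x ∈ Icc (-L) L → t ∈ Ico 0 T → 0 ≤ Ψ (x, t)) →
    0 ≤ energyForm g L T ρ₀ v₀ ρ v p Ψ

/-- The energy dissipation measure of `(ρ, v, p)` on `closure Ω × [0, T)` is absolutely continuous with
the horizontally constant density `(x, t) ↦ ν (x_n, t)`. -/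
def HasDissipation {d : ℕ} (g L T : ℝ) (ρ₀ : Space d → ℝ) (v₀ : Space d → Space d)
    (ρ : Space d × ℝ → ℝ) (v : Space d × ℝ → Space d) (p : Space d × ℝ → ℝ)
    (ν : ℝ × ℝ → ℝ) : Prop :=
  ∀ Ψ : Space d × ℝ → ℝ, IsTest T Ψ →
    energyForm g L T ρ₀ v₀ ρ v p Ψ = -∫ z in spaceTime d L T, ν (height z.1, z.2) * Ψ z

/-- The total energy `∫_Ω ρ|v|²/2 + ρ g x_n dx` of a density and a velocity on the channel. -/
def totalEnergy {d : ℕ} (g L : ℝ) (ρ : Space d → ℝ) (v : Space d → Space d) : ℝ :=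
  ∫ x in channel d L, (ρ x * ‖v x‖ ^ 2 / 2 + ρ x * g * height x)

/-! ### The coarse-grained conservation law -/

/-- The flat two-phase profile: `ρ₊` above `0`, `ρ₋` below. -/
def flat (ρm ρp : ℝ) (s : ℝ) : ℝ := if 0 < s then ρp else ρm

/-- The Atwood number. -/
def atwood (ρm ρp : ℝ) : ℝ := (ρp - ρm) / (ρp + ρm)

/-- The flux function `F_λ` (used on `[ρ₋, ρ₊]` only). -/
def flux (ρm ρp lam : ℝ) (r : ℝ) : ℝ := -lam * ((ρp - r) * (r - ρm) / (ρp + ρm - r))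

/-- `r (s, t)` is the (Kruzhkov) entropy solution on `ℝ × (0, ∞)` of the Riemann problem
`∂_t r + g t ∂_s F(r) = 0`, `r(·, 0) = flat ρ₋ ρ₊`, with values in the interval `[ρ₋, ρ₊]` on which
`F` is given. The constants `k = ρ₋` and `k = ρ₊` give the weak form of the equation itself. -/
structure IsEntropySolution (ρm ρp g : ℝ) (F : ℝ → ℝ) (r : ℝ × ℝ → ℝ) : Prop where
  measurable : AEStronglyMeasurable r (volume.restrict (univ ×ˢ Ioi (0 : ℝ)))
  range : ∀ᵐ z ∂(volume.restrict ((univ : Set ℝ) ×ˢ Ioi (0 : ℝ))), r z ∈ Icc ρm ρp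
  entropy : ∀ k ∈ Icc ρm ρp, ∀ φ : ℝ × ℝ → ℝ, ContDiff ℝ ∞ φ → HasCompactSupport φ →
    (∀ z, 0 ≤ φ z) →
    0 ≤ (∫ z in (univ : Set ℝ) ×ˢ Ioi (0 : ℝ),
          (|r z - k| * fderiv ℝ φ z (0, 1)
            + g * z.2 * (Real.sign (r z - k) * (F (r z) - F k)) * fderiv ℝ φ z (1, 0)))
        + ∫ s : ℝ, |flat ρm ρp s - k| * φ (s, 0)

/-- The mixing zone at time `t`: `-λ/(1+A) A g t² < s < λ/(1-A) A g t²`. -/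
def mixingZone (ρm ρp g lam t : ℝ) : Set ℝ :=
  Ioo (-(lam / (1 + atwood ρm ρp) * atwood ρm ρp * g * t ^ 2))
    (lam / (1 - atwood ρm ρp) * atwood ρm ρp * g * t ^ 2)

end

end RayleighTaylor

set_option linter.unusedSimpArgs false

namespace RayleighTaylor

noncomputable section

/-! ### Convex hulls in finite dimension -/

/-! The solutions come from convex integration around an explicit horizontally averaged flow, with
the local energy balance treated as one more linear equation.

Relaxation. The pressure is fixed beforehand as a function of height and time. Then volume, mass,
momentum and energy are linear in the state made of density, velocity, momentum, momentum flux and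
energy flux. The only nonlinearity is the pointwise constraint that the state lies in `phaseSet`. A
strict subsolution is a continuous solution of the linear system with values in the interior of the
convex hull of this set. Since all solutions obtained from one subsolution share its tested linear
equations, they share its pressure and its dissipation. The oscillations added are exact horizontal
derivatives in the density and in the trace of the momentum flux, so the horizontal averages of
density and kinetic energy are shared as well.

Convex integration. On the hull, `gap` is the variance of any Young measure representing the state
(`IsBarycenter.gap_eq`), so it is nonnegative, concave and zero exactly on the phases. If it is
large, two atoms of the measure differ substantially, and moving weight between them is admissible
(`exists_direction`). The difference of two pure states is a plane wave direction: a sheet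
transported by both velocities needs no pressure jump, and each side solves its own conservation
laws. `sheet` localizes this wave exactly by third-order potentials built on free fall, which
accounts for gravity, and by a correction that accounts for the nonconstant pressure. Concavity
turns the oscillation into a definite loss of the gap, locally in `exists_local_perturbation` and,
by a Besicovitch covering, globally in `exists_perturbation`: the integral I of the gap drops by at
least a multiple of I². Iterating with increments almost orthogonal to all earlier terms gives
strong L² convergence (`exists_tendsto_of_decrease`), and the limit has zero gap
(`exists_mem_phaseSet_near`).

Subsolution. Write q for `ρp + ρm` minus the averaged density and H for (ρp − q)(q − ρm). Let the
heavy fluid sink with velocity −λgt(q − ρm)/q and the light fluid rise with λgt(ρp − q)/q. The mean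
velocity is then zero and the mean momentum is gtF, so conservation of mass is the stated
conservation law. Its solution is the rarefaction wave, given by y = gt²D/2 with D the derivative of
F with respect to the density. It is continuous for positive times, which yields the Kruzhkov
inequalities with equality. The vertical momentum balance determines the pressure, and the energy
balance gives the dissipation (1 − 2λ)g²tF, since pressure does no mean work. This two-velocity
mixture is not in the interior of the hull. Isotropic fluctuations of variance et²H² put it there
(`mixture_mem_interior_hull`, `Mixing.state_mem_interior_hull`). The variance is quadratic in H so
that its effect on the dissipation is still divisible by H and hence of size etH, as the prescribed
accuracy demands; the energy changes by O(et⁴). Choosing e small is `Mixing.exists_strength`.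

Conclusion. Convex integration is applied inside one cell of the mixing zone and the result is
continued periodically. On two-phase states the linear equations are the Euler equations
(`Mixing.IsTurbulent.isWeakSolution`). A sequence that is weakly close to the subsolution converges
to it; since the averaged density is never a phase value in the zone, pairwise different members can
be selected. -/

theorem sum_eq_sum_of_embedding {ι κ M : Type*} [Fintype ι] [Fintype κ] [AddCommMonoid M]
    (e : ι ↪ κ) (f : κ → M) (hf : ∀ j, j ∉ range e → f j = 0) : ∑ j, f j = ∑ i, f (e i) := by
  rw [← Finset.sum_map Finset.univ e f]
  symm
  apply Finset.sum_subset (Finset.subset_univ _)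
  intro j _ hj
  apply hf
  rintro ⟨i, rfl⟩
  simp at hj

/-- Carathéodory's theorem with a fixed number of points. -/
theorem exists_stdSimplex_of_mem_convexHull {V : Type*} [AddCommGroup V] [Module ℝ V]
    [FiniteDimensional ℝ V] {n : ℕ} (hn : Module.finrank ℝ V + 1 ≤ n) {s : Set V} {x : V}
    (hx : x ∈ convexHull ℝ s) :
    ∃ w ∈ stdSimplex ℝ (Fin n), ∃ k : Fin n → V, (∀ i, k i ∈ s) ∧ ∑ i, w i • k i = x := by
  obtain ⟨ι, _, z, w, hz, hi, hw, hw1, hx⟩ := eq_pos_convex_span_of_mem_convexHull hx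
  have hcard : Fintype.card ι ≤ n := by
    refine hi.card_le_finrank_succ.trans (le_trans ?_ hn)
    gcongr
    exact Submodule.finrank_le _
  obtain ⟨e⟩ : Nonempty (ι ↪ Fin n) := by
    apply Function.Embedding.nonempty_of_card_le
    simpa using hcard
  have hne : Nonempty ι := by
    by_contra h
    rw [not_nonempty_iff] at h
    simp at hw1
  obtain ⟨i₀⟩ := hne
  classical
  -- The representation is padded to exactly `n` points: the additional indices carry weight zero
  -- and repeat one existing point.
  let w' : Fin n → ℝ := Function.extend e w 0
  let k' : Fin n → V := Function.extend e z (fun _ => z i₀)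
  have hw'0 : ∀ j, j ∉ range e → w' j = 0 := by
    intro j hj
    exact Function.extend_apply' _ _ _ hj
  have hw'e : ∀ i, w' (e i) = w i := fun i => e.injective.extend_apply _ _ _
  have hk'e : ∀ i, k' (e i) = z i := fun i => e.injective.extend_apply _ _ _
  refine ⟨w', ⟨?_, ?_⟩, k', ?_, ?_⟩
  · intro j
    by_cases hj : j ∈ range e
    · obtain ⟨i, rfl⟩ := hj
      rw [hw'e]; exact (hw i).le
    · rw [hw'0 j hj]
  · rw [sum_eq_sum_of_embedding e w' hw'0]
    simp only [hw'e, hw1]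
  · intro j
    by_cases hj : j ∈ range e
    · obtain ⟨i, rfl⟩ := hj
      rw [hk'e]; exact hz ⟨i, rfl⟩
    · rw [show k' j = z i₀ from Function.extend_apply' _ _ _ hj]
      exact hz ⟨i₀, rfl⟩
  · rw [sum_eq_sum_of_embedding e (fun j => w' j • k' j) (fun j hj => by simp [hw'0 j hj])]
    simp only [hw'e, hk'e, hx]

/-- With a number of points depending only on the dimension, the hull is the continuous image of a
simplex times a power of `s`, which is compact. -/
theorem isCompact_convexHull_of_isCompact {V : Type*} [NormedAddCommGroup V] [NormedSpace ℝ V]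
    [FiniteDimensional ℝ V] {s : Set V} (hs : IsCompact s) : IsCompact (convexHull ℝ s) := by
  let n := Module.finrank ℝ V + 1
  have h1 : IsCompact ((stdSimplex ℝ (Fin n)) ×ˢ (univ.pi fun _ : Fin n => s)) :=
    (isCompact_stdSimplex ℝ (Fin n)).prod (isCompact_univ_pi fun _ => hs)
  have h2 : Continuous fun p : (Fin n → ℝ) × (Fin n → V) => ∑ i, p.1 i • p.2 i := by fun_prop
  convert h1.image h2 using 1
  ext x
  constructor
  · intro hx
    obtain ⟨w, hw, k, hk, hx⟩ := exists_stdSimplex_of_mem_convexHull le_rfl hx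
    exact ⟨(w, k), ⟨hw, fun i _ => hk i⟩, hx⟩
  · rintro ⟨⟨w, k⟩, ⟨hw, hk⟩, rfl⟩
    exact (convex_convexHull ℝ s).sum_mem (fun i _ => hw.1 i) hw.2
      (fun i _ => subset_convexHull ℝ s (hk i (mem_univ i)))

/-! ### The phase-space geometry

A state collects density, velocity, momentum, momentum flux and energy flux
`(ρ, v₁, v₂, m₁, m₂, σ₁₁, σ₁₂, σ₂₂, Q₁, Q₂)`, in the plane spanned by the first horizontal and the
vertical direction. -/

/-- The states of the relaxed system. -/
abbrev State : Type := EuclideanSpace ℝ (Fin 10)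

/-- The state of a fluid of density `ρ` and velocity `(a, b)`. -/
def pureState (ρ a b : ℝ) : State :=
  !₂[ρ, a, b, ρ * a, ρ * b, ρ * a ^ 2, ρ * a * b, ρ * b ^ 2, ρ * (a ^ 2 + b ^ 2) * a / 2,
    ρ * (a ^ 2 + b ^ 2) * b / 2]

section
variable (ρ a b : ℝ)
@[simp] theorem pureState_0 : pureState ρ a b 0 = ρ := rfl
@[simp] theorem pureState_1 : pureState ρ a b 1 = a := rfl
@[simp] theorem pureState_2 : pureState ρ a b 2 = b := rfl
@[simp] theorem pureState_3 : pureState ρ a b 3 = ρ * a := rfl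
@[simp] theorem pureState_4 : pureState ρ a b 4 = ρ * b := rfl
@[simp] theorem pureState_5 : pureState ρ a b 5 = ρ * a ^ 2 := rfl
@[simp] theorem pureState_6 : pureState ρ a b 6 = ρ * a * b := rfl
@[simp] theorem pureState_7 : pureState ρ a b 7 = ρ * b ^ 2 := rfl
@[simp] theorem pureState_8 : pureState ρ a b 8 = ρ * (a ^ 2 + b ^ 2) * a / 2 := rfl
@[simp] theorem pureState_9 : pureState ρ a b 9 = ρ * (a ^ 2 + b ^ 2) * b / 2 := rfl
end

theorem State.ext {z w : State} (h0 : z 0 = w 0) (h1 : z 1 = w 1) (h2 : z 2 = w 2)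
    (h3 : z 3 = w 3) (h4 : z 4 = w 4) (h5 : z 5 = w 5) (h6 : z 6 = w 6) (h7 : z 7 = w 7)
    (h8 : z 8 = w 8) (h9 : z 9 = w 9) : z = w := by
  ext i
  fin_cases i <;> assumption

theorem continuous_pureState : Continuous fun p : ℝ × ℝ × ℝ => pureState p.1 p.2.1 p.2.2 := by
  unfold pureState
  refine (PiLp.continuous_toLp 2 _).comp (continuous_pi fun i => ?_)
  fin_cases i <;> (simp; fun_prop)

/-- The states of the two phases with velocity components bounded by `R`. -/
def phaseSet (ρm ρp R : ℝ) : Set State :=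
  {z | ∃ ρ a b : ℝ, (ρ = ρm ∨ ρ = ρp) ∧ |a| ≤ R ∧ |b| ≤ R ∧ z = pureState ρ a b}

theorem isCompact_phaseSet (ρm ρp R : ℝ) : IsCompact (phaseSet ρm ρp R) := by
  have h : IsCompact (({ρm, ρp} : Set ℝ) ×ˢ (Icc (-R) R ×ˢ Icc (-R) R)) :=
    ((Set.toFinite _).isCompact).prod (isCompact_Icc.prod isCompact_Icc)
  convert h.image continuous_pureState using 1
  ext z
  constructor
  · rintro ⟨ρ, a, b, hρ, ha, hb, rfl⟩
    exact ⟨(ρ, a, b), ⟨hρ, abs_le.1 ha, abs_le.1 hb⟩, rfl⟩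
  · rintro ⟨⟨ρ, a, b⟩, ⟨hρ, ha, hb⟩, rfl⟩
    exact ⟨ρ, a, b, hρ, abs_le.2 ha, abs_le.2 hb, rfl⟩

/-- The convex hull of the two phases. -/
def hull (ρm ρp R : ℝ) : Set State := convexHull ℝ (phaseSet ρm ρp R)

theorem isCompact_hull (ρm ρp R : ℝ) : IsCompact (hull ρm ρp R) :=
  isCompact_convexHull_of_isCompact (isCompact_phaseSet ρm ρp R)

/-- A concave function which is positive on the hull except on the phases themselves. -/
def gap (ρm ρp : ℝ) (z : State) : ℝ :=
  (ρp - z 0) * (z 0 - ρm) + z 5 + z 7 - (z 3 ^ 2 + z 4 ^ 2) / z 0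

/-- A finite Young measure on the two phases with barycenter `z`. -/
structure IsBarycenter (ρm ρp R : ℝ) (w ρ a b : Fin 11 → ℝ) (z : State) : Prop where
  simplex : w ∈ stdSimplex ℝ (Fin 11)
  phase : ∀ i, ρ i = ρm ∨ ρ i = ρp
  abs_fst : ∀ i, |a i| ≤ R
  abs_snd : ∀ i, |b i| ≤ R
  eq : ∑ i, w i • pureState (ρ i) (a i) (b i) = z

theorem exists_isBarycenter {ρm ρp R : ℝ} {z : State} (hz : z ∈ hull ρm ρp R) :
    ∃ w ρ a b, IsBarycenter ρm ρp R w ρ a b z := by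
  obtain ⟨w, hw, k, hk, hz⟩ := exists_stdSimplex_of_mem_convexHull (n := 11) (by simp) hz
  choose ρ a b h using hk
  refine ⟨w, ρ, a, b, hw, fun i => (h i).1, fun i => (h i).2.1, fun i => (h i).2.2.1, ?_⟩
  rw [← hz]
  exact Finset.sum_congr rfl fun i _ => by rw [(h i).2.2.2]

namespace IsBarycenter

variable {ρm ρp R : ℝ} {w ρ a b : Fin 11 → ℝ} {z : State}

theorem apply (h : IsBarycenter ρm ρp R w ρ a b z) (j : Fin 10) :
    z j = ∑ i, w i * pureState (ρ i) (a i) (b i) j := by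
  rw [← h.eq]
  simp

theorem mem_hull (h : IsBarycenter ρm ρp R w ρ a b z) : z ∈ hull ρm ρp R := by
  rw [← h.eq]
  exact (convex_convexHull ℝ _).sum_mem (fun i _ => h.simplex.1 i) h.simplex.2
    (fun i _ => subset_convexHull ℝ _ ⟨_, _, _, h.phase i, h.abs_fst i, h.abs_snd i, rfl⟩)

theorem lower (h : IsBarycenter ρm ρp R w ρ a b z) (hρ : ρm < ρp) (i : Fin 11) : ρm ≤ ρ i := by
  rcases h.phase i with h | h <;> linarith

theorem upper (h : IsBarycenter ρm ρp R w ρ a b z) (hρ : ρm < ρp) (i : Fin 11) : ρ i ≤ ρp := by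
  rcases h.phase i with h | h <;> linarith

theorem density_mem (h : IsBarycenter ρm ρp R w ρ a b z) (hρ : ρm < ρp) :
    z 0 ∈ Icc ρm ρp := by
  have h1 := h.simplex.2
  rw [h.apply 0]
  simp only [pureState_0]
  constructor
  · calc ρm = ∑ i, w i * ρm := by rw [← Finset.sum_mul, h1, one_mul]
      _ ≤ _ := Finset.sum_le_sum fun i _ => mul_le_mul_of_nonneg_left (h.lower hρ i) (h.simplex.1 i)
  · calc _ ≤ ∑ i, w i * ρp :=
          Finset.sum_le_sum fun i _ => mul_le_mul_of_nonneg_left (h.upper hρ i) (h.simplex.1 i)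
      _ = ρp := by rw [← Finset.sum_mul, h1, one_mul]

/-- Both phase densities are roots of one quadratic, so the second moment of the density is affine
in the mean. The gap is therefore a variance: that of the density plus the mass-weighted one of the
velocity about the mean `m / ρ`. -/
theorem gap_eq (h : IsBarycenter ρm ρp R w ρ a b z) (hz : z 0 ≠ 0) :
    gap ρm ρp z = ∑ i, w i * ((ρ i - z 0) ^ 2 + ρ i * ((a i - z 3 / z 0) ^ 2
      + (b i - z 4 / z 0) ^ 2)) := by
  have e : ∀ i, w i * ((ρ i - z 0) ^ 2 + ρ i * ((a i - z 3 / z 0) ^ 2 + (b i - z 4 / z 0) ^ 2))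
      = (z 0 ^ 2 - ρm * ρp) * w i + (ρm + ρp - 2 * z 0 + (z 3 / z 0) ^ 2 + (z 4 / z 0) ^ 2)
        * (w i * ρ i) - 2 * (z 3 / z 0) * (w i * (ρ i * a i)) - 2 * (z 4 / z 0)
        * (w i * (ρ i * b i)) + w i * (ρ i * a i ^ 2) + w i * (ρ i * b i ^ 2) := by
    intro i
    have : ρ i ^ 2 = (ρm + ρp) * ρ i - ρm * ρp := by
      rcases h.phase i with h | h <;> rw [h] <;> ring
    linear_combination (w i) * this
  have h0 := h.apply 0
  have h3 := h.apply 3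
  have h4 := h.apply 4
  have h5 := h.apply 5
  have h7 := h.apply 7
  simp only [pureState_0, pureState_3, pureState_4, pureState_5, pureState_7] at h0 h3 h4 h5 h7
  simp only [e, Finset.sum_add_distrib, Finset.sum_sub_distrib, ← Finset.mul_sum, ← h0, ← h3, ← h4,
    ← h5, ← h7, h.simplex.2, gap]
  field_simp
  ring

end IsBarycenter

theorem density_mem_of_mem_hull {ρm ρp R : ℝ} (hρ : ρm < ρp) {z : State}
    (hz : z ∈ hull ρm ρp R) : z 0 ∈ Icc ρm ρp := by
  obtain ⟨w, ρ, a, b, h⟩ := exists_isBarycenter hz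
  exact h.density_mem hρ

theorem gap_nonneg {ρm ρp R : ℝ} (hρm : 0 < ρm) (hρ : ρm < ρp) {z : State}
    (hz : z ∈ hull ρm ρp R) : 0 ≤ gap ρm ρp z := by
  obtain ⟨w, ρ, a, b, h⟩ := exists_isBarycenter hz
  rw [h.gap_eq (by linarith [(h.density_mem hρ).1])]
  refine Finset.sum_nonneg fun i _ => mul_nonneg (h.simplex.1 i) ?_
  have := h.lower hρ i
  have : 0 ≤ ρ i := by linarith
  positivity

/-- A vanishing variance makes all atoms of positive weight coincide, so the barycenter is that
single pure state. -/
theorem mem_phaseSet_of_gap_eq_zero {ρm ρp R : ℝ} (hρm : 0 < ρm) (hρ : ρm < ρp) {z : State}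
    (hz : z ∈ hull ρm ρp R) (hG : gap ρm ρp z = 0) : z ∈ phaseSet ρm ρp R := by
  obtain ⟨w, ρ, a, b, h⟩ := exists_isBarycenter hz
  have hpos : ∀ i, 0 < ρ i := fun i => by linarith [h.lower hρ i]
  rw [h.gap_eq (by linarith [(h.density_mem hρ).1]), Finset.sum_eq_zero_iff_of_nonneg
    (fun i _ => mul_nonneg (h.simplex.1 i) (by have := hpos i; positivity))] at hG
  have key : ∀ i, w i ≠ 0 → ρ i = z 0 ∧ a i = z 3 / z 0 ∧ b i = z 4 / z 0 := by
    intro i hi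
    have := hpos i
    have h1 := (mul_eq_zero.1 (hG i (Finset.mem_univ i))).resolve_left hi
    have h2 : 0 ≤ ρ i * ((a i - z 3 / z 0) ^ 2 + (b i - z 4 / z 0) ^ 2) := by positivity
    have h3 : (ρ i - z 0) ^ 2 = 0 := by nlinarith [sq_nonneg (ρ i - z 0)]
    have h4 : ρ i * ((a i - z 3 / z 0) ^ 2 + (b i - z 4 / z 0) ^ 2) = 0 := by linarith
    have h5 := (mul_eq_zero.1 h4).resolve_left this.ne'
    refine ⟨?_, ?_, ?_⟩
    · have := pow_eq_zero_iff (two_ne_zero) |>.1 h3; linarith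
    · have : (a i - z 3 / z 0) ^ 2 = 0 := by
        nlinarith [sq_nonneg (a i - z 3 / z 0), sq_nonneg (b i - z 4 / z 0)]
      have := pow_eq_zero_iff (two_ne_zero) |>.1 this; linarith
    · have : (b i - z 4 / z 0) ^ 2 = 0 := by
        nlinarith [sq_nonneg (a i - z 3 / z 0), sq_nonneg (b i - z 4 / z 0)]
      have := pow_eq_zero_iff (two_ne_zero) |>.1 this; linarith
  obtain ⟨i, hi⟩ : ∃ i, w i ≠ 0 := by
    by_contra! hc
    have := h.simplex.2
    simp [hc] at this
  refine ⟨ρ i, a i, b i, h.phase i, h.abs_fst i, h.abs_snd i, ?_⟩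
  rw [← h.eq]
  calc _ = ∑ j, w j • pureState (ρ i) (a i) (b i) := by
        refine Finset.sum_congr rfl fun j _ => ?_
        by_cases hj : w j = 0
        · simp [hj]
        · rw [(key j hj).1, (key j hj).2.1, (key j hj).2.2, (key i hi).1, (key i hi).2.1,
            (key i hi).2.2]
    _ = _ := by rw [← Finset.sum_smul, h.simplex.2, one_smul]

/-- The second-order part of the gap at `z` in the direction `w`. -/
def gapForm (ρp : ℝ) (z w : State) : ℝ :=
  w 0 ^ 2 + ((w 3 - z 3 / z 0 * w 0) ^ 2 + (w 4 - z 4 / z 0 * w 0) ^ 2) / ρp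

/-- The first-order part of the gap at `z`. -/
def gapSlope (ρm ρp : ℝ) (z : State) : State :=
  !₂[ρp + ρm - 2 * z 0 + (z 3 / z 0) ^ 2 + (z 4 / z 0) ^ 2, 0, 0, -2 * (z 3 / z 0),
    -2 * (z 4 / z 0), 1, 0, 1, 0, 0]

theorem inner_gapSlope (ρm ρp : ℝ) (z w : State) :
    inner ℝ w (gapSlope ρm ρp z) = (ρp + ρm - 2 * z 0 + (z 3 / z 0) ^ 2 + (z 4 / z 0) ^ 2) * w 0
      - 2 * (z 3 / z 0) * w 3 - 2 * (z 4 / z 0) * w 4 + w 5 + w 7 := by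
  rw [PiLp.inner_apply]
  simp [Fin.sum_univ_succ, gapSlope, -mul_eq_mul_right_iff, -mul_eq_mul_left_iff]
  ring_nf

/-- The second-order remainder is exact, with the new density `z 0 + w 0` as denominator; replacing
it by the larger `ρp` gives a form that no longer depends on the new state. -/
theorem gap_add_le {ρm ρp : ℝ} {z w : State} (hz : 0 < z 0) (hzw : 0 < z 0 + w 0)
    (hzp : z 0 + w 0 ≤ ρp) :
    gap ρm ρp (z + w) ≤ gap ρm ρp z + inner ℝ w (gapSlope ρm ρp z) - gapForm ρp z w := by
  have e : gap ρm ρp (z + w) = gap ρm ρp z + inner ℝ w (gapSlope ρm ρp z)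
      - (w 0 ^ 2 + ((w 3 - z 3 / z 0 * w 0) ^ 2 + (w 4 - z 4 / z 0 * w 0) ^ 2) / (z 0 + w 0)) := by
    rw [inner_gapSlope]
    simp only [gap, PiLp.add_apply]
    field_simp
    ring
  rw [e, gapForm]
  gcongr

namespace IsBarycenter

variable {ρm ρp R : ℝ} {w ρ a b : Fin 11 → ℝ} {z : State}

/-- Transferring the weight `τ` from atom `j` to atom `i` (or back, for negative `τ`) keeps all
weights nonnegative and their sum equal to one. -/
theorem add_smul_mem_hull (h : IsBarycenter ρm ρp R w ρ a b z) (i j : Fin 11) {τ : ℝ}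
    (hi : |τ| ≤ w i) (hj : |τ| ≤ w j) :
    z + τ • (pureState (ρ i) (a i) (b i) - pureState (ρ j) (a j) (b j)) ∈ hull ρm ρp R := by
  rw [abs_le] at hi hj
  by_cases hij : i = j
  · subst hij
    simpa using h.mem_hull
  let k : Fin 11 → State := fun l => pureState (ρ l) (a l) (b l)
  have e : z + τ • (k i - k j) = ∑ l, (w l + τ * ((if l = i then 1 else 0)
      - (if l = j then 1 else 0))) • k l := by
    simp only [mul_sub, add_smul, sub_smul, mul_ite, mul_one, mul_zero, ite_smul, zero_smul,
      Finset.sum_add_distrib, Finset.sum_sub_distrib, Finset.sum_ite_eq', Finset.mem_univ, if_true,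
      smul_sub]
    rw [← h.eq]
  change z + τ • (k i - k j) ∈ _
  rw [e]
  refine (convex_convexHull ℝ _).sum_mem (fun l _ => ?_) ?_
    (fun l _ => subset_convexHull ℝ _ ⟨_, _, _, h.phase l, h.abs_fst l, h.abs_snd l, rfl⟩)
  · by_cases h1 : l = i
    · have h2 : l ≠ j := fun h2 => hij (h1.symm.trans h2)
      subst h1
      simp [h2]; linarith
    · by_cases h2 : l = j
      · subst h2
        simp [h1]; linarith
      · simpa [h1, h2] using h.simplex.1 l
  · simp [Finset.sum_add_distrib, mul_sub, h.simplex.2]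

theorem abs_momentum_le (h : IsBarycenter ρm ρp R w ρ a b z) (hρm : 0 < ρm) (hρ : ρm < ρp) :
    |z 3| ≤ R * z 0 ∧ |z 4| ≤ R * z 0 := by
  have hρ0 : ∀ i, 0 ≤ ρ i := fun i => by linarith [h.lower hρ i]
  rw [h.apply 0, h.apply 3, h.apply 4, Finset.mul_sum]
  constructor
  all_goals
    refine (Finset.abs_sum_le_sum_abs _ _).trans (Finset.sum_le_sum fun i _ => ?_)
    simp only [pureState_0, pureState_3, pureState_4, abs_mul, abs_of_nonneg (h.simplex.1 i),
      abs_of_nonneg (hρ0 i)]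
  · nlinarith [mul_le_mul_of_nonneg_left (h.abs_fst i) (mul_nonneg (h.simplex.1 i) (hρ0 i))]
  · nlinarith [mul_le_mul_of_nonneg_left (h.abs_snd i) (mul_nonneg (h.simplex.1 i) (hρ0 i))]

theorem abs_meanVelocity_le (h : IsBarycenter ρm ρp R w ρ a b z) (hρm : 0 < ρm) (hρ : ρm < ρp) :
    |z 3 / z 0| ≤ R ∧ |z 4 / z 0| ≤ R := by
  have hz : 0 < z 0 := by linarith [(h.density_mem hρ).1]
  have := h.abs_momentum_le hρm hρ
  rw [abs_div, abs_div, abs_of_pos hz, div_le_iff₀ hz, div_le_iff₀ hz]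
  exact this

/-- Some pair of atoms carries a fixed fraction of the gap. -/
theorem exists_pair (hρm : 0 < ρm) (hρ : ρm < ρp) (h : IsBarycenter ρm ρp R w ρ a b z) :
    ∃ i j, 2 * gap ρm ρp z / (121 * (1 + 1 / ρm)) ≤ w i * w j * ((ρ i - ρ j) ^ 2
      + (ρ i * (a i - z 3 / z 0) - ρ j * (a j - z 3 / z 0)) ^ 2
      + (ρ i * (b i - z 4 / z 0) - ρ j * (b j - z 4 / z 0)) ^ 2) := by
  have hz : 0 < z 0 := by linarith [(h.density_mem hρ).1]
  set u := z 3 / z 0 with hu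
  set v := z 4 / z 0 with hv
  -- The variables are density and momentum relative to the mean velocity, because these enter
  -- `gapForm`; passing from the velocity variance to this one costs the factor `1 / ρm`. All three
  -- are centred, since `u` and `v` are momentum over density.
  set N : ℝ := ∑ i, w i * ((ρ i - z 0) ^ 2 + (ρ i * (a i - u)) ^ 2 + (ρ i * (b i - v)) ^ 2) with hN
  have hgap : gap ρm ρp z ≤ (1 + 1 / ρm) * N := by
    rw [h.gap_eq hz.ne', hN, Finset.mul_sum]
    refine Finset.sum_le_sum fun i _ => ?_
    have h1 := h.lower hρ i
    have h0 := h.simplex.1 i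
    have h2 : ∀ x : ℝ, ρ i * x ^ 2 ≤ 1 / ρm * (ρ i * x) ^ 2 := by
      intro x
      rw [one_div, ← div_eq_inv_mul, le_div_iff₀ hρm]
      have : 0 ≤ ρ i := by linarith
      nlinarith [mul_le_mul_of_nonneg_left h1 (mul_nonneg this (sq_nonneg x))]
    have h3 : 0 < 1 / ρm := by positivity
    rw [mul_left_comm]
    refine mul_le_mul_of_nonneg_left ?_ h0
    nlinarith [h2 (a i - u), h2 (b i - v), sq_nonneg (ρ i * (a i - u)),
      sq_nonneg (ρ i * (b i - v)), mul_nonneg h3.le (sq_nonneg (ρ i - z 0))]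
  have e0 := h.apply 0
  have e3 := h.apply 3
  have e4 := h.apply 4
  simp only [pureState_0, pureState_3, pureState_4] at e0 e3 e4
  have m0 : ∑ i, w i * (ρ i - z 0) = 0 := by
    simp only [mul_sub, Finset.sum_sub_distrib, ← Finset.sum_mul, h.simplex.2, ← e0]; ring
  have m1 : ∑ i, w i * (ρ i * (a i - u)) = 0 := by
    have : ∀ i, w i * (ρ i * (a i - u)) = w i * (ρ i * a i) - w i * ρ i * u := fun i => by ring
    rw [Finset.sum_congr rfl fun i _ => this i, Finset.sum_sub_distrib, ← Finset.sum_mul, ← e0, ← e3, hu]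
    field_simp
    ring
  have m2 : ∑ i, w i * (ρ i * (b i - v)) = 0 := by
    have : ∀ i, w i * (ρ i * (b i - v)) = w i * (ρ i * b i) - w i * ρ i * v := fun i => by ring
    rw [Finset.sum_congr rfl fun i _ => this i, Finset.sum_sub_distrib, ← Finset.sum_mul, ← e0, ← e4, hv]
    field_simp
    ring
  have pair : ∀ x : Fin 11 → ℝ, ∑ i, w i * x i = 0 →
      ∑ p : Fin 11 × Fin 11, w p.1 * w p.2 * (x p.1 - x p.2) ^ 2 = 2 * ∑ i, w i * x i ^ 2 := by
    intro x hx
    rw [Fintype.sum_prod_type]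
    have : ∀ i j, w i * w j * (x i - x j) ^ 2 = w i * x i ^ 2 * w j - 2 * (w i * x i) * (w j * x j)
        + w i * (w j * x j ^ 2) := fun i j => by ring
    simp only [this, Finset.sum_add_distrib, Finset.sum_sub_distrib, ← Finset.mul_sum, hx,
      h.simplex.2, ← Finset.sum_mul]
    ring
  have hsum : ∑ p : Fin 11 × Fin 11, w p.1 * w p.2 * ((ρ p.1 - ρ p.2) ^ 2
      + (ρ p.1 * (a p.1 - u) - ρ p.2 * (a p.2 - u)) ^ 2
      + (ρ p.1 * (b p.1 - v) - ρ p.2 * (b p.2 - v)) ^ 2) = 2 * N := by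
    have p0 := pair (fun i => ρ i - z 0) m0
    have p1 := pair (fun i => ρ i * (a i - u)) m1
    have p2 := pair (fun i => ρ i * (b i - v)) m2
    simp only [hN, mul_add, Finset.sum_add_distrib]
    rw [← p1, ← p2, ← p0]
    simp
  -- Pigeonhole: one of the 11² = 121 ordered pairs carries at least the average of the double sum.
  obtain ⟨⟨i, j⟩, -, hij⟩ := Finset.exists_le_of_sum_le (s := Finset.univ)
    (f := fun _ : Fin 11 × Fin 11 => 2 * N / 121) Finset.univ_nonempty (by
      rw [hsum]
      simp only [Finset.sum_const, Finset.card_univ, Fintype.card_prod, Fintype.card_fin]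
      norm_num
      linarith)
  refine ⟨i, j, le_trans ?_ hij⟩
  rw [div_le_div_iff₀ (by positivity) (by norm_num)]
  nlinarith

end IsBarycenter

/-- Every interior point of the hull can be moved inside the hull along a line spanned by the
difference of two states joined by a vortex sheet, far enough to reduce the gap. -/
theorem exists_direction {ρm ρp R : ℝ} (hρm : 0 < ρm) (hρ : ρm < ρp) :
    ∃ c > 0, ∀ z ∈ interior (hull ρm ρp R), ∃ ρ₁ ρ₂ a₁ b₁ a₂ b₂ s : ℝ,
      (b₁ ≠ b₂ ∨ (a₁ = a₂ ∧ b₁ = b₂)) ∧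
      (∀ θ ∈ Icc (-1 : ℝ) 1, z + θ • s • (pureState ρ₁ a₁ b₁ - pureState ρ₂ a₂ b₂)
        ∈ interior (hull ρm ρp R)) ∧
      c * gap ρm ρp z ^ 2 ≤ gapForm ρp z (s • (pureState ρ₁ a₁ b₁ - pureState ρ₂ a₂ b₂)) := by
  have hρp : 0 < ρp := hρm.trans hρ
  -- `D` bounds the squared jump between two atoms. The loss is quadratic in the weights and linear
  -- in the squared jump `W`; the factor `W / D ≤ 1` makes it quadratic in `W` too, hence comparable
  -- with the squared gap.
  set D : ℝ := ρp ^ 2 + 2 * (4 * R * ρp) ^ 2 with hD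
  have hD0 : 0 < D := by positivity
  set c : ℝ := 1 / (4 * D * (1 + ρp)) * (2 / (121 * (1 + 1 / ρm))) ^ 2 with hc
  have hc0 : 0 < c := by positivity
  -- The factor 1/2 is given up for a possible small change of the direction below.
  refine ⟨c / 2, by positivity, fun z hz => ?_⟩
  have hzh := interior_subset hz
  obtain ⟨w, ρ, a, b, h⟩ := exists_isBarycenter hzh
  obtain ⟨i, j, hij⟩ := h.exists_pair hρm hρ
  have hz0 : 0 < z 0 := by linarith [(h.density_mem hρ).1]
  -- Half of the transferable weight: the full transfer stays in the hull, and the midpoint between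
  -- a hull point and the interior point `z` is interior.
  set s := min (w i) (w j) / 2 with hs
  have hwi := h.simplex.1 i
  have hwj := h.simplex.1 j
  have hw1 : ∀ l, w l ≤ 1 := fun l => by
    rw [← h.simplex.2]; exact Finset.single_le_sum (fun l _ => h.simplex.1 l) (Finset.mem_univ l)
  have hsw : w i * w j / 2 ≤ s := by
    rw [hs]
    have := le_min (mul_le_of_le_one_right hwi (hw1 j)) (mul_le_of_le_one_left hwj (hw1 i))
    linarith
  have hs0 : 0 ≤ s := le_trans (by positivity) hsw
  let k : ℝ → State := fun t => pureState (ρ i) (a i) (b i) - pureState (ρ j) (a j) t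
  have hk : Continuous k := by
    refine continuous_const.sub (continuous_pureState.comp ?_ (f := fun t => (ρ j, a j, t)))
    fun_prop
  have hseg : ∀ θ ∈ Icc (-1 : ℝ) 1, z + θ • s • k (b j) ∈ interior (hull ρm ρp R) := by
    intro θ hθ
    have hθ' : |2 * θ * s| ≤ min (w i) (w j) := by
      rw [abs_mul, abs_mul, abs_of_nonneg hs0, abs_two]
      have : |θ| ≤ 1 := abs_le.2 hθ
      calc 2 * |θ| * s ≤ 2 * 1 * s := by gcongr
        _ = _ := by rw [hs]; ring
    have h1 := h.add_smul_mem_hull i j (hθ'.trans (min_le_left _ _)) (hθ'.trans (min_le_right _ _))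
    have h2 := (convex_convexHull ℝ (phaseSet ρm ρp R)).combo_interior_self_mem_interior hz h1
      (a := 1 / 2) (b := 1 / 2) (by norm_num) (by norm_num) (by norm_num)
    have e : z + θ • s • k (b j) = (1 / 2 : ℝ) • z + (1 / 2 : ℝ) • (z + (2 * θ * s) •
        (pureState (ρ i) (a i) (b i) - pureState (ρ j) (a j) (b j))) := by
      simp only [k]
      module
    rw [e]
    exact h2
  have hform : c * gap ρm ρp z ^ 2 ≤ gapForm ρp z (s • k (b j)) := by
    set u := z 3 / z 0 with hu
    set v := z 4 / z 0 with hv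
    set X := ρ i - ρ j with hX
    set Y := ρ i * (a i - u) - ρ j * (a j - u) with hY
    set Z := ρ i * (b i - v) - ρ j * (b j - v) with hZ
    have e1 : gapForm ρp z (s • k (b j)) = s ^ 2 * (X ^ 2 + (Y ^ 2 + Z ^ 2) / ρp) := by
      simp only [gapForm, k, PiLp.smul_apply, PiLp.sub_apply, pureState_0, pureState_3, pureState_4,
        smul_eq_mul, ← hu, ← hv]
      rw [hX, hY, hZ]
      ring
    have hu' := h.abs_meanVelocity_le hρm hρ
    rw [← hu, ← hv] at hu'
    have hR : 0 ≤ R := (abs_nonneg _).trans hu'.1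
    have hρl : ∀ l, 0 ≤ ρ l := fun l => by linarith [h.lower hρ l]
    have bound : ∀ (x : Fin 11 → ℝ) (t : ℝ), (∀ l, |x l| ≤ R) → |t| ≤ R → ∀ l m,
        |ρ l * (x l - t) - ρ m * (x m - t)| ≤ 4 * R * ρp := by
      intro x t hx ht l m
      have : ∀ l, |ρ l * (x l - t)| ≤ 2 * R * ρp := by
        intro l
        rw [abs_mul, abs_of_nonneg (hρl l), mul_comm]
        exact mul_le_mul ((abs_sub _ _).trans (by linarith [hx l])) (h.upper hρ l) (hρl l)
          (by positivity)
      linarith [abs_sub (ρ l * (x l - t)) (ρ m * (x m - t)), this l, this m]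
    have hDle : X ^ 2 + Y ^ 2 + Z ^ 2 ≤ D := by
      have hX' : |X| ≤ ρp := by
        rw [hX, abs_le]
        constructor <;> linarith [h.lower hρ i, h.lower hρ j, h.upper hρ i, h.upper hρ j]
      have h1 := sq_le_sq' (abs_le.1 hX').1 (abs_le.1 hX').2
      have hY' := bound a u h.abs_fst hu'.1 i j
      have h2 := sq_le_sq' (abs_le.1 hY').1 (abs_le.1 hY').2
      have hZ' := bound b v h.abs_snd hu'.2 i j
      have h3 := sq_le_sq' (abs_le.1 hZ').1 (abs_le.1 hZ').2
      linarith
    set W := X ^ 2 + Y ^ 2 + Z ^ 2 with hW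
    have hW0 : 0 ≤ W := by positivity
    have h1 : W / (1 + ρp) ≤ X ^ 2 + (Y ^ 2 + Z ^ 2) / ρp := by
      rw [div_le_iff₀ (by positivity), hW]
      have e : (X ^ 2 + (Y ^ 2 + Z ^ 2) / ρp) * (1 + ρp)
        = X ^ 2 + Y ^ 2 + Z ^ 2 + (X ^ 2 * ρp + (Y ^ 2 + Z ^ 2) / ρp) := by field_simp; ring
      rw [e]
      have : 0 ≤ X ^ 2 * ρp + (Y ^ 2 + Z ^ 2) / ρp := by positivity
      linarith
    have hG0 := gap_nonneg hρm hρ hzh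
    calc c * gap ρm ρp z ^ 2
        = 1 / (4 * D * (1 + ρp)) * (2 * gap ρm ρp z / (121 * (1 + 1 / ρm))) ^ 2 := by
          rw [hc]; ring
      _ ≤ 1 / (4 * D * (1 + ρp)) * (w i * w j * W) ^ 2 := by gcongr
      _ = (w i * w j / 2) ^ 2 * (W / (1 + ρp)) * (W / D) := by field_simp; ring
      _ ≤ (w i * w j / 2) ^ 2 * (W / (1 + ρp)) * 1 := by
          gcongr; exact (div_le_one hD0).2 hDle
      _ ≤ s ^ 2 * (X ^ 2 + (Y ^ 2 + Z ^ 2) / ρp) := by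
          rw [mul_one]; gcongr
      _ = _ := e1.symm
  rcases (gap_nonneg hρm hρ hzh).eq_or_lt' with hG | hG
  · refine ⟨ρm, ρm, 0, 0, 0, 0, 0, by simp, fun θ _ => by simpa using hz, ?_⟩
    simp [hG, gapForm]
  have ev1 : ∀ᶠ t in 𝓝 (b j), c / 2 * gap ρm ρp z ^ 2 < gapForm ρp z (s • k t) := by
    have : Continuous fun t => gapForm ρp z (s • k t) := by
      have h1 : ∀ n : Fin 10, Continuous fun t => (s • k t) n := fun n =>
        (PiLp.continuous_apply 2 _ n).comp (hk.const_smul s)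
      unfold gapForm
      fun_prop
    refine this.continuousAt.eventually (lt_mem_nhds (lt_of_lt_of_le ?_ hform))
    have : 0 < c * gap ρm ρp z ^ 2 := by positivity
    linarith
  have ev2 : ∀ᶠ t in 𝓝 (b j), ∀ θ ∈ Icc (-1 : ℝ) 1, z + θ • s • k t ∈ interior (hull ρm ρp R) := by
    refine isCompact_Icc.eventually_forall_of_forall_eventually fun θ hθ => ?_
    have : Continuous fun p : ℝ × ℝ => z + p.2 • s • k p.1 := by fun_prop
    exact this.continuousAt.eventually (isOpen_interior.mem_nhds (hseg θ hθ))
  obtain ⟨t, ⟨ht1, ht2⟩, ht⟩ := (((ev1.and ev2).filter_mono nhdsWithin_le_nhds).and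
    (eventually_mem_nhdsWithin (a := b j) (s := {b j}ᶜ))).exists
  by_cases hb : b i = b j
  · refine ⟨ρ i, ρ j, a i, b i, a j, t, s, Or.inl ?_, ht2, ht1.le⟩
    rw [hb]; exact fun h => ht h.symm
  · refine ⟨ρ i, ρ j, a i, b i, a j, b j, s, Or.inl hb, hseg, le_trans ?_ hform⟩
    have : 0 < c * gap ρm ρp z ^ 2 := by positivity
    linarith

end

noncomputable section

/-! ### Iteration in a Hilbert space -/

section Iteration

variable {H : Type*} [NormedAddCommGroup H] [InnerProductSpace ℝ H]

/-- A bounded sequence whose increments are almost orthogonal to the earlier terms converges. -/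
theorem cauchySeq_of_almost_orthogonal {z : ℕ → H} {B ε : ℝ} (hε : 0 < ε) (hB : ∀ k, ‖z k‖ ≤ B)
    (h : ∀ m n, m ≤ n → |inner ℝ (z n - z m) (z m)| ≤ ε * (1 / 2) ^ m) : CauchySeq z := by
  -- Almost orthogonality allows the squared norms to decrease by at most `2 * ε * (1 / 2) ^ n`; the
  -- subtracted geometric term compensates this and makes `b` monotone.
  let b : ℕ → ℝ := fun n => ‖z n‖ ^ 2 - 4 * (ε * (1 / 2) ^ n)
  have key : ∀ m n, m ≤ n → ‖z n - z m‖ ^ 2 ≤ b n - b m + 2 * (ε * (1 / 2) ^ m) := by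
    intro m n hmn
    have h1 := h m n hmn
    have h2 : ‖z n‖ ^ 2 = ‖z n - z m‖ ^ 2 + 2 * inner ℝ (z n - z m) (z m) + ‖z m‖ ^ 2 := by
      rw [← norm_add_sq_real, sub_add_cancel]
    have h3 : ε * (1 / 2 : ℝ) ^ n ≤ ε * (1 / 2) ^ m := by
      gcongr ε * ?_
      exact pow_le_pow_of_le_one (by norm_num) (by norm_num) hmn
    simp only [b]
    linarith [neg_abs_le (inner ℝ (z n - z m) (z m))]
  have hmono : Monotone b := by
    refine monotone_nat_of_le_succ fun n => ?_
    have h1 := h n (n + 1) (Nat.le_succ n)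
    have h2 : ‖z (n + 1)‖ ^ 2 = ‖z (n + 1) - z n‖ ^ 2 + 2 * inner ℝ (z (n + 1) - z n) (z n)
        + ‖z n‖ ^ 2 := by
      rw [← norm_add_sq_real, sub_add_cancel]
    simp only [b, pow_succ]
    have := sq_nonneg ‖z (n + 1) - z n‖
    linarith [neg_abs_le (inner ℝ (z (n + 1) - z n) (z n))]
  have hbdd : BddAbove (range b) := by
    refine ⟨B ^ 2, ?_⟩
    rintro _ ⟨n, rfl⟩
    have h1 : ‖z n‖ ^ 2 ≤ B ^ 2 := pow_le_pow_left₀ (norm_nonneg _) (hB n) 2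
    have h2 : 0 < 4 * (ε * (1 / 2 : ℝ) ^ n) := by positivity
    simp only [b]
    linarith
  have hconv := tendsto_atTop_ciSup hmono hbdd
  set β := ⨆ n, b n
  have hle : ∀ n, b n ≤ β := fun n => le_ciSup hbdd n
  refine cauchySeq_of_le_tendsto_0' (fun m => Real.sqrt (β - b m + 2 * (ε * (1 / 2) ^ m))) ?_ ?_
  · intro m n hmn
    rw [dist_comm, dist_eq_norm]
    apply Real.le_sqrt_of_sq_le
    linarith [key m n hmn, hle n]
  · have h1 : Tendsto (fun m => β - b m + 2 * (ε * (1 / 2 : ℝ) ^ m)) atTop (𝓝 (β - β + 2 * (ε * 0))) :=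
      (hconv.const_sub β).add (((tendsto_pow_atTop_nhds_zero_of_lt_one (by norm_num)
        (by norm_num)).const_mul ε).const_mul 2)
    have h2 := h1.sqrt
    simpa using h2

/-- If the elements of a bounded set can be perturbed weakly inside the set so as to decrease a
nonnegative functional by a quadratic amount, then iterating the perturbations gives strongly
convergent sequences along which the functional tends to zero. -/
theorem exists_tendsto_of_decrease [CompleteSpace H] {X : Set H} {𝒢 : H → ℝ} {c B : ℝ} (hc : 0 < c)
    (hB : ∀ z ∈ X, ‖z‖ ≤ B) (hG : ∀ z ∈ X, 0 ≤ 𝒢 z)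
    (step : ∀ z ∈ X, ∀ F : Finset H, ∀ ε > 0, ∃ z' ∈ X, (∀ f ∈ F, |inner ℝ (z' - z) f| ≤ ε) ∧
      𝒢 z' ≤ 𝒢 z - c * 𝒢 z ^ 2)
    {z₀ : H} (hz₀ : z₀ ∈ X) (F : Finset H) {ε : ℝ} (hε : 0 < ε) :
    ∃ (z : ℕ → H) (zl : H), (∀ k, z k ∈ X) ∧ Tendsto z atTop (𝓝 zl) ∧
      Tendsto (fun k => 𝒢 (z k)) atTop (𝓝 0) ∧ ∀ f ∈ F, |inner ℝ (zl - z₀) f| ≤ ε := by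
  classical
  choose! nxt hnX hnF hnG using step
  -- The recursion carries the current point together with the given tests and all points reached so
  -- far, so that every later increment is almost orthogonal to each of them.
  let s : ℕ → H × Finset H := fun n => Nat.rec (z₀, insert z₀ F)
    (fun k p => (nxt p.1 p.2 (ε * (1 / 2) ^ (k + 1)),
      insert (nxt p.1 p.2 (ε * (1 / 2) ^ (k + 1))) p.2)) n
  have hs1 : ∀ k, (s (k + 1)).1 = nxt (s k).1 (s k).2 (ε * (1 / 2) ^ (k + 1)) := fun k => rfl
  have hs2 : ∀ k, (s (k + 1)).2 = insert (s (k + 1)).1 (s k).2 := fun k => rfl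
  have hpos : ∀ k : ℕ, 0 < ε * (1 / 2 : ℝ) ^ k := fun k => by positivity
  have hX : ∀ k, (s k).1 ∈ X := by
    intro k
    induction k with
    | zero => exact hz₀
    | succ k ih => rw [hs1]; exact hnX _ ih _ _ (hpos _)
  have hmonoF : ∀ m n, m ≤ n → (s m).2 ⊆ (s n).2 := by
    intro m n hmn
    induction n, hmn using Nat.le_induction with
    | base => exact subset_rfl
    | succ n _ ih => rw [hs2]; exact ih.trans (Finset.subset_insert _ _)
  have hmem : ∀ k, (s k).1 ∈ (s k).2 := by
    intro k
    cases k with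
    | zero => exact Finset.mem_insert_self _ _
    | succ k => rw [hs2]; exact Finset.mem_insert_self _ _
  have hinc : ∀ m n, m ≤ n → ∀ f ∈ (s m).2,
      |inner ℝ ((s n).1 - (s m).1) f| ≤ ε * (1 / 2) ^ m - ε * (1 / 2) ^ n := by
    intro m n hmn f hf
    induction n, hmn using Nat.le_induction with
    | base => simp
    | succ n hmn ih =>
      have h1 := hnF _ (hX n) (s n).2 _ (hpos (n + 1)) f (hmonoF m n hmn hf)
      rw [← hs1] at h1
      rw [← sub_add_sub_cancel _ (s n).1 _, inner_add_left]
      refine (abs_add_le _ _).trans ?_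
      have h2 : ε * (1 / 2 : ℝ) ^ (n + 1) = ε * (1 / 2) ^ n / 2 := by ring
      linarith
  have hcauchy : CauchySeq fun k => (s k).1 := by
    refine cauchySeq_of_almost_orthogonal hε (fun k => hB _ (hX k)) fun m n hmn => ?_
    linarith [hinc m n hmn _ (hmem m), hpos n]
  obtain ⟨zl, hzl⟩ := cauchySeq_tendsto_of_complete hcauchy
  refine ⟨fun k => (s k).1, zl, hX, hzl, ?_, fun f hf => ?_⟩
  · have hdec : ∀ k, 𝒢 (s (k + 1)).1 ≤ 𝒢 (s k).1 - c * 𝒢 (s k).1 ^ 2 := by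
      intro k
      rw [hs1]
      exact hnG _ (hX k) _ _ (hpos _)
    have hanti : Antitone fun k => 𝒢 (s k).1 := by
      refine antitone_nat_of_succ_le fun k => ?_
      have : 0 ≤ c * 𝒢 (s k).1 ^ 2 := by positivity
      linarith [hdec k]
    have hbdd : BddBelow (range fun k => 𝒢 (s k).1) := by
      refine ⟨0, ?_⟩
      rintro _ ⟨k, rfl⟩
      exact hG _ (hX k)
    have hlim := tendsto_atTop_ciInf hanti hbdd
    set l := ⨅ k, 𝒢 (s k).1
    have hlim1 := (tendsto_add_atTop_iff_nat 1).2 hlim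
    -- Passing to the limit in the quadratic decrease leaves zero as the only possible limit.
    have : l ≤ l - c * l ^ 2 :=
      le_of_tendsto_of_tendsto' hlim1 (hlim.sub ((hlim.pow 2).const_mul c)) hdec
    have hl : l = 0 := by
      have : c * l ^ 2 = 0 := le_antisymm (by linarith) (by positivity)
      simpa [hc.ne'] using this
    rwa [hl] at hlim
  · have h1 : Tendsto (fun k => |inner ℝ ((s k).1 - z₀) f|) atTop (𝓝 |inner ℝ (zl - z₀) f|) :=
      ((hzl.sub_const z₀).inner tendsto_const_nhds).abs
    refine le_of_tendsto' h1 fun k => ?_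
    have := hinc 0 k (Nat.zero_le k) f (Finset.mem_insert_of_mem hf)
    simp only [pow_zero, mul_one] at this
    have h2 := hpos k
    exact this.trans (by linarith)

end Iteration

/-! ### Oscillating functions -/

section Oscillation

variable {E : Type*} [NormedAddCommGroup E] [NormedSpace ℝ E]

/-- This is the Riemann–Lebesgue lemma along the ray of frequencies spanned by `ℓ`, with the factor
`-1 / (2π)` translating into the normalization of the Fourier transform. -/
theorem tendsto_integral_mul_exp [FiniteDimensional ℝ E] [MeasurableSpace E] [BorelSpace E]
    (μ : Measure E) [μ.IsAddHaarMeasure] {ℓ : E →L[ℝ] ℝ} (hℓ : ℓ ≠ 0) (f : E → ℝ) :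
    Tendsto (fun N : ℕ => ∫ z, Complex.exp ((N * ℓ z : ℝ) * Complex.I) * (f z : ℂ) ∂μ) atTop
      (𝓝 0) := by
  have h := tendsto_integral_exp_smul_cocompact (fun z => (f z : ℂ)) μ
  have h2 : Tendsto (fun N : ℕ => (-(N / (2 * Real.pi)) : ℝ) • ℓ) atTop
      (cocompact (StrongDual ℝ E)) := by
    rw [← Metric.cobounded_eq_cocompact, ← tendsto_norm_atTop_iff_cobounded]
    simp only [norm_smul, norm_neg, norm_div, Real.norm_natCast]
    refine Tendsto.atTop_mul_const (norm_pos_iff.2 hℓ) ?_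
    have : (0 : ℝ) < |2 * Real.pi| := by positivity
    exact tendsto_natCast_atTop_atTop.atTop_div_const this
  refine (h.comp h2).congr fun N => ?_
  refine integral_congr_ae (Eventually.of_forall fun z => ?_)
  simp only [Circle.smul_def, Real.fourierChar_apply, smul_eq_mul]
  congr 3
  simp
  field_simp

theorem tendsto_integral_mul_sin [FiniteDimensional ℝ E] [MeasurableSpace E] [BorelSpace E]
    (μ : Measure E) [μ.IsAddHaarMeasure] {ℓ : E →L[ℝ] ℝ} (hℓ : ℓ ≠ 0) {f : E → ℝ}
    (hf : Integrable f μ) :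
    Tendsto (fun N : ℕ => ∫ z, f z * Real.sin (N * ℓ z) ∂μ) atTop (𝓝 0) := by
  have h := (Complex.continuous_im.tendsto _).comp (tendsto_integral_mul_exp μ hℓ f)
  simp only [Complex.zero_im] at h
  refine h.congr fun N => ?_
  have hi : Integrable (fun z => Complex.exp ((N * ℓ z : ℝ) * Complex.I) * (f z : ℂ)) μ := by
    refine hf.ofReal.bdd_mul (c := 1) (Continuous.aestronglyMeasurable (by fun_prop))
      (Eventually.of_forall fun z => ?_)
    rw [Complex.norm_exp_ofReal_mul_I]
  have := integral_im hi
  simp only [RCLike.im_to_complex] at this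
  rw [Function.comp_apply, ← this]
  refine integral_congr_ae (Eventually.of_forall fun z => ?_)
  simp only [Complex.im_mul_ofReal, Complex.exp_ofReal_mul_I_im]
  ring

theorem tendsto_integral_mul_cos [FiniteDimensional ℝ E] [MeasurableSpace E] [BorelSpace E]
    (μ : Measure E) [μ.IsAddHaarMeasure] {ℓ : E →L[ℝ] ℝ} (hℓ : ℓ ≠ 0) {f : E → ℝ}
    (hf : Integrable f μ) :
    Tendsto (fun N : ℕ => ∫ z, f z * Real.cos (N * ℓ z) ∂μ) atTop (𝓝 0) := by
  have h := (Complex.continuous_re.tendsto _).comp (tendsto_integral_mul_exp μ hℓ f)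
  simp only [Complex.zero_re] at h
  refine h.congr fun N => ?_
  have hi : Integrable (fun z => Complex.exp ((N * ℓ z : ℝ) * Complex.I) * (f z : ℂ)) μ := by
    refine hf.ofReal.bdd_mul (c := 1) (Continuous.aestronglyMeasurable (by fun_prop))
      (Eventually.of_forall fun z => ?_)
    rw [Complex.norm_exp_ofReal_mul_I]
  have := integral_re hi
  simp only [RCLike.re_to_complex] at this
  rw [Function.comp_apply, ← this]
  refine integral_congr_ae (Eventually.of_forall fun z => ?_)
  simp only [Complex.re_mul_ofReal, Complex.exp_ofReal_mul_I_re]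
  ring

/-- The mean of `sin²` of a rapidly oscillating phase over a set of finite measure is `1/2`. -/
theorem tendsto_integral_sin_sq [FiniteDimensional ℝ E] [MeasurableSpace E] [BorelSpace E]
    (μ : Measure E) [μ.IsAddHaarMeasure] {ℓ : E →L[ℝ] ℝ} (hℓ : ℓ ≠ 0) {s : Set E}
    (hs : MeasurableSet s) (hμs : μ s ≠ ⊤) :
    Tendsto (fun N : ℕ => ∫ z in s, Real.sin (N * ℓ z) ^ 2 ∂μ) atTop (𝓝 (μ.real s / 2)) := by
  have hf : Integrable (s.indicator fun _ => (1 : ℝ)) μ :=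
    (integrable_indicator_iff hs).2 (integrableOn_const hμs)
  have h2 : (2 : ℝ) • ℓ ≠ 0 := by simpa using hℓ
  have h := (tendsto_integral_mul_cos μ h2 hf).const_mul (-(1 / 2)) |>.const_add (μ.real s / 2)
  rw [mul_zero, add_zero] at h
  refine h.congr fun N => ?_
  have e : ∀ z, s.indicator (fun _ => (1 : ℝ)) z * Real.cos (N * ((2 : ℝ) • ℓ) z)
      = s.indicator (fun z => Real.cos (N * ((2 : ℝ) • ℓ) z)) z := by
    intro z
    by_cases hz : z ∈ s <;> simp [hz]
  simp only [e]
  rw [integral_indicator hs]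
  have e2 : ∀ z, Real.sin (N * ℓ z) ^ 2 = 1 / 2 + -(1 / 2) * Real.cos (N * ((2 : ℝ) • ℓ) z) := by
    intro z
    have : (N : ℝ) * ((2 : ℝ) • ℓ) z = 2 * (N * ℓ z) := by simp; ring
    rw [this, Real.cos_two_mul, Real.cos_sq']
    ring
  simp only [e2]
  have hc : IntegrableOn (fun z => Real.cos (N * ((2 : ℝ) • ℓ) z)) s μ := by
    refine Measure.integrableOn_of_bounded (M := 1) hμs
      (Continuous.aestronglyMeasurable (by fun_prop)) ?_
    exact Eventually.of_forall fun z => by simpa using Real.abs_cos_le_one _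
  have hone : Integrable (fun _ : E => (1 / 2 : ℝ)) (μ.restrict s) := integrableOn_const hμs
  rw [integral_add hone (hc.const_mul _), integral_const_mul]
  simp [Measure.real, mul_comm]
  ring

/-- The derivative of `f` along the vector field `e`. -/
def along (e : E → E) (f : E → ℝ) (z : E) : ℝ := fderiv ℝ f z (e z)

theorem contDiff_along {e : E → E} (he : ContDiff ℝ ∞ e) {f : E → ℝ} (hf : ContDiff ℝ ∞ f) :
    ContDiff ℝ ∞ (along e f) :=
  (hf.fderiv_right (m := ∞) le_rfl).clm_apply he

/-- `f N = N^{-k} (a cos (N ℓ) + b sin (N ℓ))` with smooth amplitudes `a`, `b` supported in `s`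
and depending smoothly on `1 / N`, with limits `a₀`, `b₀`. -/
def IsOsc (s : Set E) (ℓ : E →L[ℝ] ℝ) (k : ℕ) (f : ℕ → E → ℝ) (a₀ b₀ : E → ℝ) : Prop :=
  ∃ a b : ℝ × E → ℝ, ContDiff ℝ ∞ a ∧ ContDiff ℝ ∞ b ∧
    (∀ ε, ∀ z ∉ s, a (ε, z) = 0 ∧ b (ε, z) = 0) ∧ (∀ z, a (0, z) = a₀ z ∧ b (0, z) = b₀ z) ∧
    ∀ N : ℕ, 0 < N → ∀ z, f N z = (N : ℝ)⁻¹ ^ k *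
      (a ((N : ℝ)⁻¹, z) * Real.cos (N * ℓ z) + b ((N : ℝ)⁻¹, z) * Real.sin (N * ℓ z))

namespace IsOsc

variable {s : Set E} {ℓ : E →L[ℝ] ℝ} {k : ℕ} {f g : ℕ → E → ℝ} {a₀ b₀ a₁ b₁ : E → ℝ}

theorem of_cos {χ : E → ℝ} (hχ : ContDiff ℝ ∞ χ) (hs : ∀ z ∉ s, χ z = 0) :
    IsOsc s ℓ k (fun N z => (N : ℝ)⁻¹ ^ k * (χ z * Real.cos (N * ℓ z))) χ 0 :=
  ⟨fun p => χ p.2, 0, hχ.comp contDiff_snd, contDiff_const, fun _ z hz => ⟨hs z hz, rfl⟩,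
    fun _ => ⟨rfl, rfl⟩, fun N _ z => by simp⟩

theorem add (hf : IsOsc s ℓ k f a₀ b₀) (hg : IsOsc s ℓ k g a₁ b₁) :
    IsOsc s ℓ k (fun N z => f N z + g N z) (fun z => a₀ z + a₁ z) (fun z => b₀ z + b₁ z) := by
  obtain ⟨a, b, ha, hb, h1, h2, h3⟩ := hf
  obtain ⟨a', b', ha', hb', h1', h2', h3'⟩ := hg
  refine ⟨fun p => a p + a' p, fun p => b p + b' p, ha.add ha', hb.add hb', fun ε z hz => ?_,
    fun z => ?_, fun N hN z => ?_⟩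
  · simp [h1 ε z hz, h1' ε z hz]
  · simp [h2 z, h2' z]
  · simp only [h3 N hN, h3' N hN]; ring

theorem smul (hf : IsOsc s ℓ k f a₀ b₀) {c : E → ℝ} (hc : ContDiff ℝ ∞ c) :
    IsOsc s ℓ k (fun N z => c z * f N z) (fun z => c z * a₀ z) (fun z => c z * b₀ z) := by
  obtain ⟨a, b, ha, hb, h1, h2, h3⟩ := hf
  refine ⟨fun p => c p.2 * a p, fun p => c p.2 * b p, (hc.comp contDiff_snd).mul ha,
    (hc.comp contDiff_snd).mul hb, fun ε z hz => ?_, fun z => ?_, fun N hN z => ?_⟩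
  · simp [h1 ε z hz]
  · simp [h2 z]
  · simp only [h3 N hN]; ring

/-- A derivative that hits the phase produces a factor `N`, which lowers the order by one and
exchanges sine and cosine. A derivative that hits an amplitude comes with an extra `1 / N`, which is
absorbed in the dependence of the new amplitude on `ε`. -/
theorem along (hs : IsClosed s) (hf : IsOsc s ℓ (k + 1) f a₀ b₀) {e : E → E}
    (he : ContDiff ℝ ∞ e) :
    IsOsc s ℓ k (fun N => along e (f N)) (fun z => b₀ z * ℓ (e z)) (fun z => -(a₀ z * ℓ (e z))) := by
  obtain ⟨a, b, ha, hb, h1, h2, h3⟩ := hf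
  have hd : ∀ {a : ℝ × E → ℝ}, ContDiff ℝ ∞ a →
      ContDiff ℝ ∞ fun p : ℝ × E => fderiv ℝ a p (0, e p.2) := fun ha =>
    (ha.fderiv_right (m := ∞) le_rfl).clm_apply (contDiff_const.prodMk (he.comp contDiff_snd))
  have hℓe : ContDiff ℝ ∞ fun p : ℝ × E => ℓ (e p.2) := ℓ.contDiff.comp (he.comp contDiff_snd)
  refine ⟨fun p => p.1 * fderiv ℝ a p (0, e p.2) + b p * ℓ (e p.2),
    fun p => p.1 * fderiv ℝ b p (0, e p.2) - a p * ℓ (e p.2), ?_, ?_, fun ε z hz => ?_,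
    fun z => ?_, fun N hN z => ?_⟩
  · exact (contDiff_fst.mul (hd ha)).add (hb.mul hℓe)
  · exact (contDiff_fst.mul (hd hb)).sub (ha.mul hℓe)
  · have hnear : ∀ᶠ p in 𝓝 (ε, z), p.2 ∉ s :=
      (continuous_snd.tendsto (ε, z)).eventually (hs.isOpen_compl.mem_nhds (x := z) hz)
    have ea : a =ᶠ[𝓝 (ε, z)] fun _ => 0 := hnear.mono fun p hp => (h1 p.1 p.2 hp).1
    have eb : b =ᶠ[𝓝 (ε, z)] fun _ => 0 := hnear.mono fun p hp => (h1 p.1 p.2 hp).2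
    simp [ea.fderiv_eq, eb.fderiv_eq, h1 ε z hz]
  · simp [h2 z]
  · have hN' : (N : ℝ) ≠ 0 := by positivity
    have hpart : ∀ {a : ℝ × E → ℝ}, ContDiff ℝ ∞ a →
        HasFDerivAt (fun z => a ((N : ℝ)⁻¹, z))
          ((fderiv ℝ a ((N : ℝ)⁻¹, z)).comp (ContinuousLinearMap.inr ℝ ℝ E)) z := fun ha =>
      ((ha.differentiable (by simp)) _).hasFDerivAt.comp z (hasFDerivAt_prodMk_right _ _)
    have hθ : HasFDerivAt (fun z => (N : ℝ) * ℓ z) ((N : ℝ) • ℓ) z := ℓ.hasFDerivAt.const_mul _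
    have hF : HasFDerivAt (f N) _ z :=
      ((((hpart ha).mul hθ.cos).add ((hpart hb).mul hθ.sin)).const_mul ((N : ℝ)⁻¹ ^ (k + 1))).congr_of_eventuallyEq
        (Eventually.of_forall fun z => h3 N hN z)
    simp only [RayleighTaylor.along]
    rw [hF.fderiv]
    simp
    field_simp
    ring

/-- The derivative of the amplitudes is negligible as `N → ∞`. -/
theorem eventually_le (hs : IsCompact s) (hf : IsOsc s ℓ 0 f a₀ b₀) {τ : ℝ} (hτ : 0 < τ) :
    ∀ᶠ N : ℕ in atTop, ∀ z,
      |f N z - (a₀ z * Real.cos (N * ℓ z) + b₀ z * Real.sin (N * ℓ z))| ≤ τ := by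
  obtain ⟨a, b, ha, hb, h1, h2, h3⟩ := hf
  have key : ∀ {a : ℝ × E → ℝ}, ContDiff ℝ ∞ a → ∀ᶠ ε in 𝓝 (0 : ℝ), ∀ z ∈ s,
      |a (ε, z) - a (0, z)| < τ / 2 := by
    intro a ha
    refine hs.eventually_forall_of_forall_eventually fun z hz => ?_
    have hc : Continuous fun p : ℝ × E => |a p - a (0, p.2)| := by
      have := ha.continuous
      fun_prop
    refine (hc.tendsto (0, z)).eventually (gt_mem_nhds ?_)
    simpa using hτ
  have hinv : Tendsto (fun N : ℕ => (N : ℝ)⁻¹) atTop (𝓝 0) := tendsto_inv_atTop_nhds_zero_nat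
  filter_upwards [hinv.eventually (key ha), hinv.eventually (key hb), eventually_gt_atTop 0] with
    N hNa hNb hN z
  rw [h3 N hN z, ← (h2 z).1, ← (h2 z).2, pow_zero, one_mul]
  by_cases hz : z ∈ s
  · have e : a ((N : ℝ)⁻¹, z) * Real.cos (N * ℓ z) + b ((N : ℝ)⁻¹, z) * Real.sin (N * ℓ z)
        - (a (0, z) * Real.cos (N * ℓ z) + b (0, z) * Real.sin (N * ℓ z))
        = (a ((N : ℝ)⁻¹, z) - a (0, z)) * Real.cos (N * ℓ z)
          + (b ((N : ℝ)⁻¹, z) - b (0, z)) * Real.sin (N * ℓ z) := by ring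
    rw [e]
    refine (abs_add_le _ _).trans ?_
    rw [abs_mul, abs_mul]
    have c1 := Real.abs_cos_le_one (N * ℓ z)
    have c2 := Real.abs_sin_le_one (N * ℓ z)
    have d1 := mul_le_mul (hNa z hz).le c1 (abs_nonneg _) (by positivity)
    have d2 := mul_le_mul (hNb z hz).le c2 (abs_nonneg _) (by positivity)
    linarith
  · simp [h1 _ z hz, hτ.le]

/-- Oscillating functions of lower order are negligible. -/
theorem eventually_le_of_succ (hs : IsCompact s) (hf : IsOsc s ℓ (k + 1) f a₀ b₀) {τ : ℝ}
    (hτ : 0 < τ) : ∀ᶠ N : ℕ in atTop, ∀ z, |f N z| ≤ τ := by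
  have h0 : IsOsc s ℓ 0 f 0 0 := by
    obtain ⟨a, b, ha, hb, h1, h2, h3⟩ := hf
    refine ⟨fun p => p.1 ^ (k + 1) * a p, fun p => p.1 ^ (k + 1) * b p,
      (contDiff_fst.pow _).mul ha, (contDiff_fst.pow _).mul hb, fun ε z hz => ?_, fun z => ?_,
      fun N hN z => ?_⟩
    · simp [h1 ε z hz]
    · simp
    · simp only [h3 N hN]; ring
  filter_upwards [h0.eventually_le hs hτ] with N hN z
  simpa using hN z

end IsOsc

end Oscillation

end

noncomputable section

/-! ### Constant-coefficient derivatives -/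

section Derivatives

variable {E : Type*} [NormedAddCommGroup E] [NormedSpace ℝ E]

/-- The derivative of `f` in the direction `u`. -/
abbrev deriv_dir (u : E) (f : E → ℝ) : E → ℝ := along (fun _ => u) f

variable {f h : E → ℝ} {u v : E}

theorem contDiff_deriv_dir (u : E) (hf : ContDiff ℝ ∞ f) : ContDiff ℝ ∞ (deriv_dir u f) :=
  contDiff_along contDiff_const hf

theorem deriv_dir_add (hf : ContDiff ℝ ∞ f) (hh : ContDiff ℝ ∞ h) :
    deriv_dir u (fun z => f z + h z) = fun z => deriv_dir u f z + deriv_dir u h z := by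
  ext z
  simp [along, fderiv_fun_add (hf.differentiable (by simp) z) (hh.differentiable (by simp) z)]

theorem deriv_dir_mul (hf : ContDiff ℝ ∞ f) (hh : ContDiff ℝ ∞ h) :
    deriv_dir u (fun z => f z * h z) = fun z => deriv_dir u f z * h z + f z * deriv_dir u h z := by
  ext z
  simp [along, fderiv_fun_mul (hf.differentiable (by simp) z) (hh.differentiable (by simp) z)]
  ring

theorem deriv_dir_comm (hf : ContDiff ℝ ∞ f) :
    deriv_dir u (deriv_dir v f) = deriv_dir v (deriv_dir u f) := by
  ext z
  have hd : DifferentiableAt ℝ (fderiv ℝ f) z :=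
    (hf.fderiv_right (m := ∞) le_rfl).differentiable (by simp) z
  have key : ∀ a b : E, deriv_dir a (deriv_dir b f) z = fderiv ℝ (fderiv ℝ f) z a b := by
    intro a b
    have : HasFDerivAt (deriv_dir b f) _ z := hd.hasFDerivAt.clm_apply (hasFDerivAt_const b z)
    rw [deriv_dir, along, this.fderiv]
    simp
  rw [key, key]
  exact hf.contDiffAt.isSymmSndFDerivAt (by simp; exact WithTop.coe_le_coe.2 (le_top : (2 : ℕ∞) ≤ ⊤)) u v

theorem tsupport_deriv_dir_subset (u : E) (f : E → ℝ) : tsupport (deriv_dir u f) ⊆ tsupport f := by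
  refine (closure_mono ?_).trans (tsupport_fderiv_subset ℝ (f := f))
  intro z hz
  rw [Function.mem_support] at hz ⊢
  intro h0
  apply hz
  simp [along, h0]

/-- Integration by parts. -/
theorem integral_mul_deriv_dir [FiniteDimensional ℝ E] [MeasurableSpace E] [BorelSpace E]
    {μ : Measure E} [μ.IsAddHaarMeasure] {f f' ψ : E → ℝ} (hf : Continuous f)
    (hfs : HasCompactSupport f) (hf' : Continuous f') (hfs' : HasCompactSupport f')
    (hd : ∀ z, HasLineDerivAt ℝ f (f' z) z u) (hψ : ContDiff ℝ ∞ ψ) :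
    ∫ z, f z * deriv_dir u ψ z ∂μ = -∫ z, f' z * ψ z ∂μ := by
  have hψc := hψ.continuous
  have hψ'c := (contDiff_deriv_dir u hψ).continuous
  refine integral_bilinear_hasLineDerivAt_right_eq_neg_left_of_integrable
    (B := ContinuousLinearMap.mul ℝ ℝ) (f := f) (f' := f') (g := ψ) (g' := deriv_dir u ψ) (v := u)
    ?_ ?_ ?_ (fun z _ => hd z) (fun z _ => ?_)
  · exact (hf'.mul hψc).integrable_of_hasCompactSupport hfs'.mul_right
  · exact (hf.mul hψ'c).integrable_of_hasCompactSupport hfs.mul_right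
  · exact (hf.mul hψc).integrable_of_hasCompactSupport hfs.mul_right
  · exact (hψ.differentiable (by simp) z).hasFDerivAt.hasLineDerivAt u

theorem hasLineDerivAt_deriv_dir (hf : ContDiff ℝ ∞ f) (z : E) :
    HasLineDerivAt ℝ f (deriv_dir u f z) z u :=
  (hf.differentiable (by simp) z).hasFDerivAt.hasLineDerivAt u

theorem integral_mul_deriv_dir_of_contDiff [FiniteDimensional ℝ E] [MeasurableSpace E]
    [BorelSpace E] {μ : Measure E} [μ.IsAddHaarMeasure] {f ψ : E → ℝ} (hf : ContDiff ℝ ∞ f)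
    (hfs : HasCompactSupport f) (hψ : ContDiff ℝ ∞ ψ) :
    ∫ z, f z * deriv_dir u ψ z ∂μ = -∫ z, deriv_dir u f z * ψ z ∂μ :=
  integral_mul_deriv_dir hf.continuous hfs (contDiff_deriv_dir u hf).continuous
    (hfs.mono' (subset_closure.trans (tsupport_deriv_dir_subset u f)))
    (hasLineDerivAt_deriv_dir hf) hψ

theorem integrable_mul_of_hasCompactSupport [FiniteDimensional ℝ E] [MeasurableSpace E]
    [BorelSpace E] {μ : Measure E} [μ.IsAddHaarMeasure] {f ψ : E → ℝ} (hf : Continuous f)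
    (hfs : HasCompactSupport f) (hψ : Continuous ψ) : Integrable (fun z => f z * ψ z) μ :=
  (hf.mul hψ).integrable_of_hasCompactSupport hfs.mul_right

/-- The weak form of a balance law for smooth compactly supported fields. -/
theorem integral_balance [FiniteDimensional ℝ E] [MeasurableSpace E]
    [BorelSpace E] {μ : Measure E} [μ.IsAddHaarMeasure] {u v w : E} {F G H k ψ : E → ℝ}
    (hF : ContDiff ℝ ∞ F) (hG : ContDiff ℝ ∞ G) (hH : ContDiff ℝ ∞ H) (hk : Continuous k)
    (hFs : HasCompactSupport F) (hGs : HasCompactSupport G) (hHs : HasCompactSupport H)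
    (hks : HasCompactSupport k) (hψ : ContDiff ℝ ∞ ψ)
    (h : ∀ z, deriv_dir u F z + deriv_dir v G z + deriv_dir w H z + k z = 0) :
    Integrable (fun z => F z * deriv_dir u ψ z + G z * deriv_dir v ψ z + H z * deriv_dir w ψ z
      - k z * ψ z) μ ∧
    ∫ z, (F z * deriv_dir u ψ z + G z * deriv_dir v ψ z + H z * deriv_dir w ψ z - k z * ψ z) ∂μ
      = 0 := by
  have hi : ∀ {F : E → ℝ} {u : E}, ContDiff ℝ ∞ F → HasCompactSupport F →
      Integrable (fun z => F z * deriv_dir u ψ z) μ := fun hF hFs =>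
    integrable_mul_of_hasCompactSupport hF.continuous hFs (contDiff_deriv_dir _ hψ).continuous
  have hi' : ∀ {F : E → ℝ} {u : E}, ContDiff ℝ ∞ F → HasCompactSupport F →
      Integrable (fun z => deriv_dir u F z * ψ z) μ := fun {F u} hF hFs =>
    integrable_mul_of_hasCompactSupport (contDiff_deriv_dir u hF).continuous
      (hFs.mono' (subset_closure.trans (tsupport_deriv_dir_subset u F))) hψ.continuous
  have hik := integrable_mul_of_hasCompactSupport (μ := μ) hk hks hψ.continuous
  have i1 : Integrable (fun z => F z * deriv_dir u ψ z + G z * deriv_dir v ψ z) μ :=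
    (hi hF hFs).add (hi hG hGs)
  have i2 : Integrable (fun z => F z * deriv_dir u ψ z + G z * deriv_dir v ψ z
      + H z * deriv_dir w ψ z) μ := i1.add (hi hH hHs)
  have j1 : Integrable (fun z => deriv_dir u F z * ψ z + deriv_dir v G z * ψ z) μ :=
    (hi' hF hFs).add (hi' hG hGs)
  have j2 : Integrable (fun z => deriv_dir u F z * ψ z + deriv_dir v G z * ψ z
      + deriv_dir w H z * ψ z) μ := j1.add (hi' hH hHs)
  refine ⟨i2.sub hik, ?_⟩
  rw [integral_sub i2 hik, integral_add i1 (hi hH hHs), integral_add (hi hF hFs) (hi hG hGs),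
    integral_mul_deriv_dir_of_contDiff hF hFs hψ, integral_mul_deriv_dir_of_contDiff hG hGs hψ,
    integral_mul_deriv_dir_of_contDiff hH hHs hψ]
  have e : ∫ z, (deriv_dir u F z * ψ z + deriv_dir v G z * ψ z + deriv_dir w H z * ψ z + k z * ψ z)
      ∂μ = 0 := by
    rw [← integral_zero E ℝ (μ := μ)]
    refine integral_congr_ae (Eventually.of_forall fun z => ?_)
    simp only [← add_mul, h z, zero_mul]
  rw [integral_add j2 hik, integral_add j1 (hi' hH hHs),
    integral_add (hi' hF hFs) (hi' hG hGs)] at e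
  linarith

end Derivatives

/-! ### Potentials for vortex sheets -/

section Potential

variable {d : ℕ}

/-- The horizontal direction of the oscillations. -/
def dirX (d : ℕ) : Space d × ℝ := (EuclideanSpace.single 0 1, 0)

/-- The vertical direction. -/
def dirY (d : ℕ) : Space d × ℝ := (EuclideanSpace.single (Fin.last d) 1, 0)

/-- The time direction. -/
def dirT (d : ℕ) : Space d × ℝ := (0, 1)

variable (g b t₀ : ℝ)

/-- The velocity of a particle in free fall. -/
def fall (z : Space d × ℝ) : ℝ := b - g * (z.2 - t₀)

/-- The space-time direction of vertical free fall. -/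
def fallDir (z : Space d × ℝ) : Space d × ℝ := dirT d + fall g b t₀ z • dirY d

variable (d) in
theorem contDiff_fall : ContDiff ℝ ∞ (fall (d := d) g b t₀) := by
  unfold fall
  fun_prop

theorem contDiff_fallDir : ContDiff ℝ ∞ (fallDir (d := d) g b t₀) :=
  contDiff_const.add ((contDiff_fall d g b t₀).smul contDiff_const)

theorem hasFDerivAt_fall (z : Space d × ℝ) :
    HasFDerivAt (fall g b t₀) (-(g • ContinuousLinearMap.snd ℝ (Space d) ℝ)) z :=
  ((hasFDerivAt_snd.sub_const t₀).const_mul g).const_sub b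

@[simp] theorem deriv_dirX_fall (z : Space d × ℝ) : deriv_dir (dirX d) (fall g b t₀) z = 0 := by
  simp [along, (hasFDerivAt_fall g b t₀ z).fderiv, dirX]

@[simp] theorem deriv_dirY_fall (z : Space d × ℝ) : deriv_dir (dirY d) (fall g b t₀) z = 0 := by
  simp [along, (hasFDerivAt_fall g b t₀ z).fderiv, dirY]

@[simp] theorem deriv_dirT_fall (z : Space d × ℝ) : deriv_dir (dirT d) (fall g b t₀) z = -g := by
  simp [along, (hasFDerivAt_fall g b t₀ z).fderiv, dirT]

/-- Derivative along vertical free fall. -/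
abbrev derivA (f : Space d × ℝ → ℝ) : Space d × ℝ → ℝ := along (fallDir g b t₀) f

/-- Derivative in the horizontal direction. -/
abbrev derivX (f : Space d × ℝ → ℝ) : Space d × ℝ → ℝ := deriv_dir (dirX d) f

/-- Derivative in the vertical direction. -/
abbrev derivY (f : Space d × ℝ → ℝ) : Space d × ℝ → ℝ := deriv_dir (dirY d) f

variable {g b t₀} {f : Space d × ℝ → ℝ}

theorem derivA_eq (f : Space d × ℝ → ℝ) :
    derivA g b t₀ f = fun z => deriv_dir (dirT d) f z + fall g b t₀ z * derivY f z := by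
  ext z
  simp [along, fallDir]

theorem contDiff_derivA (hf : ContDiff ℝ ∞ f) : ContDiff ℝ ∞ (derivA g b t₀ f) :=
  contDiff_along (contDiff_fallDir g b t₀) hf

theorem contDiff_derivX (hf : ContDiff ℝ ∞ f) : ContDiff ℝ ∞ (derivX f) := contDiff_deriv_dir _ hf

theorem contDiff_derivY (hf : ContDiff ℝ ∞ f) : ContDiff ℝ ∞ (derivY f) := contDiff_deriv_dir _ hf

/-- The free fall velocity depends on time only, so the horizontal derivative commutes with the
transport derivative; all identities for the potentials rest on this. -/
theorem derivX_derivA (hf : ContDiff ℝ ∞ f) :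
    derivX (derivA g b t₀ f) = derivA g b t₀ (derivX f) := by
  rw [derivA_eq, derivA_eq, derivX, deriv_dir_add (contDiff_deriv_dir _ hf)
    ((contDiff_fall d g b t₀).mul (contDiff_deriv_dir _ hf)), deriv_dir_mul (contDiff_fall d g b t₀)
    (contDiff_deriv_dir _ hf), deriv_dir_comm hf (u := dirX d) (v := dirT d),
    deriv_dir_comm hf (u := dirX d) (v := dirY d)]
  simp

theorem tsupport_derivA_subset (f : Space d × ℝ → ℝ) : tsupport (derivA g b t₀ f) ⊆ tsupport f := by
  refine (closure_mono ?_).trans (tsupport_fderiv_subset ℝ (f := f))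
  intro z hz
  rw [Function.mem_support] at hz ⊢
  intro h0
  apply hz
  simp [along, h0]

theorem hasCompactSupport_deriv_dir {u : Space d × ℝ} (hf : HasCompactSupport f) :
    HasCompactSupport (deriv_dir u f) :=
  hf.mono' (subset_closure.trans (tsupport_deriv_dir_subset u f))

theorem hasCompactSupport_derivA (hf : HasCompactSupport f) :
    HasCompactSupport (derivA g b t₀ f) :=
  hf.mono' (subset_closure.trans (tsupport_derivA_subset f))

variable (g b t₀) (η : Space d × ℝ → ℝ)

/-- The third-order potentials of a stream of unit density with velocity `(α, fall)`: density. -/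
def potR : Space d × ℝ → ℝ := derivX (derivX (derivX η))
/-- Horizontal momentum. -/
def potM1 : Space d × ℝ → ℝ := fun z => -derivX (derivX (derivA g b t₀ η)) z
/-- Vertical momentum. -/
def potM2 : Space d × ℝ → ℝ := fun z => fall g b t₀ z * potR η z
/-- Momentum flux. -/
def potS11 : Space d × ℝ → ℝ := derivX (derivA g b t₀ (derivA g b t₀ η))
/-- Momentum flux. -/
def potS12 : Space d × ℝ → ℝ := fun z => fall g b t₀ z * potM1 g b t₀ η z
/-- Momentum flux. -/
def potS22 : Space d × ℝ → ℝ := fun z => fall g b t₀ z * potM2 g b t₀ η z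
/-- Horizontal energy flux. -/
def potQ1 : Space d × ℝ → ℝ := fun z =>
  -(1 / 2) * derivA g b t₀ (derivA g b t₀ (derivA g b t₀ η)) z
    + (1 / 2) * (fall g b t₀ z * potS12 g b t₀ η z)
/-- Kinetic energy. -/
def potE : Space d × ℝ → ℝ := fun z => (1 / 2) * (potS11 g b t₀ η z + potS22 g b t₀ η z)
/-- Vertical energy flux. -/
def potQ2 : Space d × ℝ → ℝ := fun z => fall g b t₀ z * potE g b t₀ η z

variable {η}


theorem contDiff_potR (hη : ContDiff ℝ ∞ η) : ContDiff ℝ ∞ (potR η) :=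
  contDiff_derivX (contDiff_derivX (contDiff_derivX hη))
theorem contDiff_potM1 (hη : ContDiff ℝ ∞ η) : ContDiff ℝ ∞ (potM1 g b t₀ η) :=
  (contDiff_derivX (contDiff_derivX (contDiff_derivA hη))).neg
theorem contDiff_potM2 (hη : ContDiff ℝ ∞ η) : ContDiff ℝ ∞ (potM2 g b t₀ η) :=
  (contDiff_fall d g b t₀).mul (contDiff_potR hη)
theorem contDiff_potS11 (hη : ContDiff ℝ ∞ η) : ContDiff ℝ ∞ (potS11 g b t₀ η) :=
  contDiff_derivX (contDiff_derivA (contDiff_derivA hη))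
theorem contDiff_potS12 (hη : ContDiff ℝ ∞ η) : ContDiff ℝ ∞ (potS12 g b t₀ η) :=
  (contDiff_fall d g b t₀).mul (contDiff_potM1 g b t₀ hη)
theorem contDiff_potS22 (hη : ContDiff ℝ ∞ η) : ContDiff ℝ ∞ (potS22 g b t₀ η) :=
  (contDiff_fall d g b t₀).mul (contDiff_potM2 g b t₀ hη)
theorem contDiff_potQ1 (hη : ContDiff ℝ ∞ η) : ContDiff ℝ ∞ (potQ1 g b t₀ η) :=
  (contDiff_const.mul (contDiff_derivA (contDiff_derivA (contDiff_derivA hη)))).add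
    (contDiff_const.mul ((contDiff_fall d g b t₀).mul (contDiff_potS12 g b t₀ hη)))
theorem contDiff_potE (hη : ContDiff ℝ ∞ η) : ContDiff ℝ ∞ (potE g b t₀ η) :=
  contDiff_const.mul ((contDiff_potS11 g b t₀ hη).add (contDiff_potS22 g b t₀ hη))
theorem contDiff_potQ2 (hη : ContDiff ℝ ∞ η) : ContDiff ℝ ∞ (potQ2 g b t₀ η) :=
  (contDiff_fall d g b t₀).mul (contDiff_potE g b t₀ hη)

/-- Each potential arises from the preceding one by trading a horizontal derivative for minus the
derivative along free fall. Horizontal divergence and transport by the vertical velocity then cancel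
identically. -/
theorem derivX_potM1 (hη : ContDiff ℝ ∞ η) : derivX (potM1 g b t₀ η) = fun z => -derivA g b t₀ (potR η) z := by
  have e1 : derivX (derivX (derivA g b t₀ η)) = derivA g b t₀ (derivX (derivX η)) := by
    rw [derivX_derivA hη, derivX_derivA (contDiff_derivX hη)]
  ext z
  have : potM1 g b t₀ η = fun z => (-1 : ℝ) * derivA g b t₀ (derivX (derivX η)) z := by
    ext z; simp [potM1, e1]
  rw [this, derivX, deriv_dir_mul contDiff_const
    (contDiff_derivA (contDiff_derivX (contDiff_derivX hη)))]
  have e2 : deriv_dir (dirX d) (derivA g b t₀ (derivX (derivX η))) z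
      = derivA g b t₀ (potR η) z := congrFun (derivX_derivA (g := g) (b := b) (t₀ := t₀)
    (contDiff_derivX (contDiff_derivX hη))) z
  have e3 : deriv_dir (dirX d) (fun _ => (-1 : ℝ)) z = 0 := by simp [along]
  beta_reduce
  rw [e2, e3]
  ring

theorem derivX_potS11 (hη : ContDiff ℝ ∞ η) : derivX (potS11 g b t₀ η) = fun z => -derivA g b t₀ (potM1 g b t₀ η) z := by
  have e : derivX (potS11 g b t₀ η) = derivA g b t₀ (derivX (derivX (derivA g b t₀ η))) := by
    unfold potS11
    rw [derivX_derivA (contDiff_derivA hη), derivX_derivA (contDiff_derivX (contDiff_derivA hη))]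
  rw [e]
  ext z
  have e2 : potM1 g b t₀ η = fun z => -derivX (derivX (derivA g b t₀ η)) z := rfl
  rw [e2]
  simp only [derivA, along, fderiv_fun_neg]
  simp
  rfl

theorem deriv_dir_mul_fall_of_eq_zero {u : Space d × ℝ}
    (hu : ∀ z, deriv_dir u (fall g b t₀) z = 0) (hf : ContDiff ℝ ∞ f) :
    deriv_dir u (fun z => fall g b t₀ z * f z) = fun z => fall g b t₀ z * deriv_dir u f z := by
  rw [deriv_dir_mul (contDiff_fall d g b t₀) hf]
  ext z
  simp [hu]

theorem derivX_fall_mul (hf : ContDiff ℝ ∞ f) :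
    derivX (fun z => fall g b t₀ z * f z) = fun z => fall g b t₀ z * derivX f z :=
  deriv_dir_mul_fall_of_eq_zero g b t₀ (deriv_dirX_fall g b t₀) hf

theorem derivY_fall_mul (hf : ContDiff ℝ ∞ f) :
    derivY (fun z => fall g b t₀ z * f z) = fun z => fall g b t₀ z * derivY f z :=
  deriv_dir_mul_fall_of_eq_zero g b t₀ (deriv_dirY_fall g b t₀) hf

theorem derivT_fall_mul (hf : ContDiff ℝ ∞ f) (z : Space d × ℝ) :
    deriv_dir (dirT d) (fun z => fall g b t₀ z * f z) z
      = -g * f z + fall g b t₀ z * deriv_dir (dirT d) f z := by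
  rw [deriv_dir_mul (contDiff_fall d g b t₀) hf]
  simp

theorem deriv_dir_const_mul {u : Space d × ℝ} (c : ℝ) (hf : ContDiff ℝ ∞ f) :
    deriv_dir u (fun z => c * f z) = fun z => c * deriv_dir u f z := by
  rw [deriv_dir_mul contDiff_const hf]
  ext z
  simp [along]


theorem hasCompactSupport_potR (hs : HasCompactSupport η) : HasCompactSupport (potR η) :=
  hasCompactSupport_deriv_dir (hasCompactSupport_deriv_dir (hasCompactSupport_deriv_dir hs))
theorem hasCompactSupport_potM1 (hs : HasCompactSupport η) : HasCompactSupport (potM1 g b t₀ η) :=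
  (hasCompactSupport_deriv_dir (hasCompactSupport_deriv_dir (hasCompactSupport_derivA hs))).neg
theorem hasCompactSupport_potM2 (hs : HasCompactSupport η) : HasCompactSupport (potM2 g b t₀ η) :=
  (hasCompactSupport_potR hs).mul_left
theorem hasCompactSupport_potS11 (hs : HasCompactSupport η) : HasCompactSupport (potS11 g b t₀ η) :=
  hasCompactSupport_deriv_dir (hasCompactSupport_derivA (hasCompactSupport_derivA hs))
theorem hasCompactSupport_potS12 (hs : HasCompactSupport η) : HasCompactSupport (potS12 g b t₀ η) :=
  (hasCompactSupport_potM1 g b t₀ hs).mul_left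
theorem hasCompactSupport_potS22 (hs : HasCompactSupport η) : HasCompactSupport (potS22 g b t₀ η) :=
  (hasCompactSupport_potM2 g b t₀ hs).mul_left
theorem hasCompactSupport_potQ1 (hs : HasCompactSupport η) : HasCompactSupport (potQ1 g b t₀ η) :=
  (hasCompactSupport_derivA (hasCompactSupport_derivA (hasCompactSupport_derivA hs))).mul_left.add
    ((hasCompactSupport_potS12 g b t₀ hs).mul_left.mul_left)
theorem hasCompactSupport_potE (hs : HasCompactSupport η) : HasCompactSupport (potE g b t₀ η) :=
  ((hasCompactSupport_potS11 g b t₀ hs).add (hasCompactSupport_potS22 g b t₀ hs)).mul_left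
theorem hasCompactSupport_potQ2 (hs : HasCompactSupport η) : HasCompactSupport (potQ2 g b t₀ η) :=
  (hasCompactSupport_potE g b t₀ hs).mul_left


theorem potential_mass (hη : ContDiff ℝ ∞ η) (z : Space d × ℝ) :
    deriv_dir (dirT d) (potR η) z + derivX (potM1 g b t₀ η) z + derivY (potM2 g b t₀ η) z + 0
      = 0 := by
  have h1 : derivY (potM2 g b t₀ η) = fun z => fall g b t₀ z * derivY (potR η) z :=
    derivY_fall_mul g b t₀ (contDiff_potR hη)
  rw [h1, derivX_potM1 g b t₀ hη, derivA_eq]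
  ring

theorem potential_momentum_fst (hη : ContDiff ℝ ∞ η) (z : Space d × ℝ) :
    deriv_dir (dirT d) (potM1 g b t₀ η) z + derivX (potS11 g b t₀ η) z
      + derivY (potS12 g b t₀ η) z + 0 = 0 := by
  have h1 : derivY (potS12 g b t₀ η) = fun z => fall g b t₀ z * derivY (potM1 g b t₀ η) z :=
    derivY_fall_mul g b t₀ (contDiff_potM1 g b t₀ hη)
  rw [h1, derivX_potS11 g b t₀ hη, derivA_eq]
  ring

/-- The vertical velocity of the stream loses `g` per unit time, and this produces precisely the
gravity term. -/
theorem potential_momentum_snd (hη : ContDiff ℝ ∞ η) (z : Space d × ℝ) :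
    deriv_dir (dirT d) (potM2 g b t₀ η) z + derivX (potS12 g b t₀ η) z
      + derivY (potS22 g b t₀ η) z + g * potR η z = 0 := by
  have h1 : derivY (potS22 g b t₀ η) = fun z => fall g b t₀ z * derivY (potM2 g b t₀ η) z :=
    derivY_fall_mul g b t₀ (contDiff_potM2 g b t₀ hη)
  have h2 : derivY (potM2 g b t₀ η) = fun z => fall g b t₀ z * derivY (potR η) z :=
    derivY_fall_mul g b t₀ (contDiff_potR hη)
  have h3 : derivX (potS12 g b t₀ η) = fun z => fall g b t₀ z * derivX (potM1 g b t₀ η) z :=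
    derivX_fall_mul g b t₀ (contDiff_potM1 g b t₀ hη)
  have h4 : deriv_dir (dirT d) (potM2 g b t₀ η) z = _ :=
    derivT_fall_mul g b t₀ (contDiff_potR hη) z
  rw [h1, h2, h3, h4, derivX_potM1 g b t₀ hη, derivA_eq]
  ring

/-- The transport derivatives of the kinetic energy cancel against the two parts of the horizontal
energy flux, except where time differentiates the squared fall velocity; that term is the work of
gravity. -/
theorem potential_energy (hη : ContDiff ℝ ∞ η) (z : Space d × ℝ) :
    deriv_dir (dirT d) (potE g b t₀ η) z + derivX (potQ1 g b t₀ η) z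
      + derivY (potQ2 g b t₀ η) z + g * potM2 g b t₀ η z = 0 := by
  have hS11 := contDiff_potS11 g b t₀ hη
  have hS22 := contDiff_potS22 g b t₀ hη
  have hE : ∀ u, deriv_dir u (potE g b t₀ η) = fun z =>
      (1 / 2) * (deriv_dir u (potS11 g b t₀ η) z + deriv_dir u (potS22 g b t₀ η) z) := by
    intro u
    unfold potE
    rw [deriv_dir_const_mul _ (hS11.add hS22), deriv_dir_add hS11 hS22]
  have h1 : derivY (potQ2 g b t₀ η) = fun z => fall g b t₀ z * derivY (potE g b t₀ η) z :=
    derivY_fall_mul g b t₀ (contDiff_potE g b t₀ hη)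
  have hA3 := contDiff_derivA (g := g) (b := b) (t₀ := t₀) (contDiff_derivA (g := g) (b := b)
    (t₀ := t₀) (contDiff_derivA (g := g) (b := b) (t₀ := t₀) hη))
  have hfS12 := (contDiff_fall d g b t₀).mul (contDiff_potS12 g b t₀ hη)
  have h2 : derivX (potQ1 g b t₀ η) = fun z => -(1 / 2) * derivA g b t₀ (potS11 g b t₀ η) z
      + (1 / 2) * (fall g b t₀ z * (fall g b t₀ z * derivX (potM1 g b t₀ η) z)) := by
    unfold potQ1
    rw [derivX, deriv_dir_add (contDiff_const.mul hA3) (contDiff_const.mul hfS12),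
      deriv_dir_const_mul _ hA3, deriv_dir_const_mul _ hfS12]
    have e1 := derivX_fall_mul g b t₀ (contDiff_potS12 g b t₀ hη)
    have e2 : derivX (potS12 g b t₀ η) = fun z => fall g b t₀ z * derivX (potM1 g b t₀ η) z :=
      derivX_fall_mul g b t₀ (contDiff_potM1 g b t₀ hη)
    have e3 := derivX_derivA (g := g) (b := b) (t₀ := t₀) (contDiff_derivA (g := g) (b := b)
      (t₀ := t₀) (contDiff_derivA (g := g) (b := b) (t₀ := t₀) hη))
    simp only [derivX] at e1 e2 e3
    rw [e1, e2, e3]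
    rfl
  have h3 : derivY (potS22 g b t₀ η) = fun z => fall g b t₀ z * derivY (potM2 g b t₀ η) z :=
    derivY_fall_mul g b t₀ (contDiff_potM2 g b t₀ hη)
  have h4 : derivY (potM2 g b t₀ η) = fun z => fall g b t₀ z * derivY (potR η) z :=
    derivY_fall_mul g b t₀ (contDiff_potR hη)
  have h5 : deriv_dir (dirT d) (potM2 g b t₀ η) z = _ :=
    derivT_fall_mul g b t₀ (contDiff_potR hη) z
  have h6 : deriv_dir (dirT d) (potS22 g b t₀ η) z = _ :=
    derivT_fall_mul g b t₀ (contDiff_potM2 g b t₀ hη) z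
  rw [h1, h2, hE, derivY, hE, derivX_potM1 g b t₀ hη]
  simp only [derivY] at h3 h4
  simp only [h3, h4, h6, h5, derivA_eq, potM2]
  ring

/-- The trace of the momentum flux is an exact horizontal derivative. This keeps the horizontal
average of the kinetic energy unchanged, as the form of `potR` does for the density. -/
theorem potential_trace (hη : ContDiff ℝ ∞ η) : (fun z => potS11 g b t₀ η z + potS22 g b t₀ η z)
    = derivX (fun z => derivA g b t₀ (derivA g b t₀ η) z
      + fall g b t₀ z * (fall g b t₀ z * derivX (derivX η) z)) := by
  have h2 := contDiff_derivX (contDiff_derivX hη)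
  rw [derivX, deriv_dir_add (contDiff_derivA (contDiff_derivA hη))
    ((contDiff_fall d g b t₀).mul ((contDiff_fall d g b t₀).mul h2))]
  have e1 := derivX_fall_mul g b t₀ ((contDiff_fall d g b t₀).mul h2)
  have e2 := derivX_fall_mul g b t₀ h2
  simp only [derivX] at e1 e2
  rw [e1, e2]
  rfl

end Potential

end

/-! ### Localized vortex sheets as exact solutions of the relaxed system -/

noncomputable section

instance (d : ℕ) : (volume : Measure (Space d × ℝ)).IsAddHaarMeasure :=
  Measure.prod.instIsAddHaarMeasure _ _

theorem inner_state (w : State) (c₀ c₁ c₂ c₃ c₄ c₅ c₆ c₇ c₈ c₉ : ℝ) :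
    inner ℝ w !₂[c₀, c₁, c₂, c₃, c₄, c₅, c₆, c₇, c₈, c₉] = w 0 * c₀ + w 1 * c₁ + w 2 * c₂ + w 3 * c₃
      + w 4 * c₄ + w 5 * c₅ + w 6 * c₆ + w 7 * c₇ + w 8 * c₈ + w 9 * c₉ := by
  rw [PiLp.inner_apply]
  simp [Fin.sum_univ_succ, -mul_eq_mul_right_iff, -mul_eq_mul_left_iff]
  ring_nf

theorem State.norm_le {w : State} {τ : ℝ} (hτ : 0 ≤ τ) (h : ∀ j, |w j| ≤ τ) : ‖w‖ ≤ 4 * τ := by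
  rw [EuclideanSpace.norm_eq]
  refine Real.sqrt_le_sqrt (x := ∑ i, ‖w i‖ ^ 2) (y := (4 * τ) ^ 2) ?_ |>.trans
    (Real.sqrt_sq (by positivity)).le
  calc ∑ i, ‖w i‖ ^ 2 ≤ ∑ _i : Fin 10, τ ^ 2 := Finset.sum_le_sum fun i _ => by
        have := h i
        rw [Real.norm_eq_abs]
        exact pow_le_pow_left₀ (abs_nonneg _) this 2
    _ = 10 * τ ^ 2 := by simp
    _ ≤ _ := by nlinarith [sq_nonneg τ]

section Sheet

variable {d : ℕ}

/-- The fields against which perturbations of a subsolution have to vanish: the relaxed equations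
(volume, mass, two momentum components, energy) and the horizontal averages of the density and of
the kinetic energy. -/
def nullField (g : ℝ) (p ψ : Space d × ℝ → ℝ) : Fin 7 → Space d × ℝ → State
  | 0 => fun z => !₂[0, derivX ψ z, derivY ψ z, 0, 0, 0, 0, 0, 0, 0]
  | 1 => fun z => !₂[deriv_dir (dirT d) ψ z, 0, 0, derivX ψ z, derivY ψ z, 0, 0, 0, 0, 0]
  | 2 => fun z => !₂[0, 0, 0, deriv_dir (dirT d) ψ z, 0, derivX ψ z, derivY ψ z, 0, 0, 0]
  | 3 => fun z => !₂[-g * ψ z, 0, 0, 0, deriv_dir (dirT d) ψ z, 0, derivX ψ z, derivY ψ z, 0, 0]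
  | 4 => fun z => !₂[0, p z * derivX ψ z, p z * derivY ψ z, 0, -g * ψ z,
      deriv_dir (dirT d) ψ z / 2, 0, deriv_dir (dirT d) ψ z / 2, derivX ψ z, derivY ψ z]
  | 5 => fun z => !₂[ψ z, 0, 0, 0, 0, 0, 0, 0, 0, 0]
  | 6 => fun z => !₂[0, 0, 0, 0, 0, ψ z, 0, ψ z, 0, 0]

/-- Admissible test functions for `nullField`: for horizontal averages they must not depend on the
first horizontal variable. -/
def IsNullTest (j : Fin 7) (ψ : Space d × ℝ → ℝ) : Prop :=
  ContDiff ℝ ∞ ψ ∧ (5 ≤ j → ∀ z, derivX ψ z = 0)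

/-- `py` is the vertical derivative on `O` of the horizontally constant pressure `p`. -/
structure IsPressure (O : Set (Space d × ℝ)) (p py : Space d × ℝ → ℝ) : Prop where
  continuousOn : ContinuousOn p O
  continuousOn_deriv : ContinuousOn py O
  vertical : ∀ z ∈ O, HasLineDerivAt ℝ p (py z) z (dirY d)
  horizontal : ∀ z ∈ O, HasLineDerivAt ℝ p 0 z (dirX d)
  horizontal_deriv : ∀ z ∈ O, HasLineDerivAt ℝ py 0 z (dirX d)

theorem continuous_mul_of_tsupport {E : Type*} [TopologicalSpace E] {O : Set E} (hO : IsOpen O)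
    {q ζ : E → ℝ} (hq : ContinuousOn q O) (hζ : Continuous ζ) (hs : tsupport ζ ⊆ O) :
    Continuous fun z => q z * ζ z := by
  refine continuous_of_tsupport fun z hz => ?_
  have hz' : z ∈ O := hs (closure_mono (Function.support_mul_subset_right q ζ) hz)
  exact (hq.continuousAt (hO.mem_nhds hz')).mul hζ.continuousAt

theorem hasLineDerivAt_mul_of_tsupport {E : Type*} [NormedAddCommGroup E] [NormedSpace ℝ E]
    {O : Set E} {q q' ζ : E → ℝ} {u : E} (hq : ∀ z ∈ O, HasLineDerivAt ℝ q (q' z) z u)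
    (hζ : ContDiff ℝ ∞ ζ) (hs : tsupport ζ ⊆ O) (z : E) :
    HasLineDerivAt ℝ (fun z => q z * ζ z) (q' z * ζ z + q z * deriv_dir u ζ z) z u := by
  by_cases hz : z ∈ O
  · have h1 : HasDerivAt (fun t : ℝ => q (z + t • u)) (q' z) 0 := hq z hz
    have h2 : HasDerivAt (fun t : ℝ => ζ (z + t • u)) (deriv_dir u ζ z) 0 :=
      hasLineDerivAt_deriv_dir hζ z
    have := h1.mul h2
    simp only [zero_smul, add_zero] at this
    exact this
  · have hz' : z ∉ tsupport ζ := fun h => hz (hs h)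
    have h0 : ζ =ᶠ[𝓝 z] 0 := notMem_tsupport_iff_eventuallyEq.1 hz'
    have h1 : (fun z => q z * ζ z) =ᶠ[𝓝 z] fun _ => 0 := h0.mono fun y hy => by simp [hy]
    have h2 : deriv_dir u ζ z = 0 := by
      simp [along, h0.fderiv_eq]
    rw [h2, h0.self_of_nhds]
    have h3 : HasFDerivAt (fun z => q z * ζ z) (0 : E →L[ℝ] ℝ) z :=
      (hasFDerivAt_const (0 : ℝ) z).congr_of_eventuallyEq h1
    simpa using h3.hasLineDerivAt u

/-- The pressure times the rotated gradient of `ζ` is not divergence-free, because the pressure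
varies vertically. Adding `py * ζ` to the horizontal component completes it to the rotated gradient
of `p * ζ`. No second derivative of the pressure is needed, since neither `p` nor `py` varies
horizontally. -/
theorem IsPressure.integral_eq_zero {O : Set (Space d × ℝ)} (hO : IsOpen O)
    {p py ζ ψ : Space d × ℝ → ℝ} (hp : IsPressure O p py) (hζ : ContDiff ℝ ∞ ζ)
    (hζc : HasCompactSupport ζ) (hζO : tsupport ζ ⊆ O) (hψ : ContDiff ℝ ∞ ψ) :
    Integrable (fun z => p z * derivX ζ z * derivY ψ z
      - (py z * ζ z + p z * derivY ζ z) * derivX ψ z) ∧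
    ∫ z, (p z * derivX ζ z * derivY ψ z - (py z * ζ z + p z * derivY ζ z) * derivX ψ z) = 0 := by
  have hX := contDiff_derivX hζ
  have hY := contDiff_derivY hζ
  have hXs : tsupport (derivX ζ) ⊆ O := (tsupport_deriv_dir_subset _ _).trans hζO
  have hYs : tsupport (derivY ζ) ⊆ O := (tsupport_deriv_dir_subset _ _).trans hζO
  have hXYs : tsupport (derivX (derivY ζ)) ⊆ O := (tsupport_deriv_dir_subset _ _).trans hYs
  have hYXs : tsupport (derivY (derivX ζ)) ⊆ O := (tsupport_deriv_dir_subset _ _).trans hXs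
  have hXc := hasCompactSupport_deriv_dir (u := dirX d) hζc
  have hYc := hasCompactSupport_deriv_dir (u := dirY d) hζc
  have c1 := continuous_mul_of_tsupport hO hp.continuousOn hX.continuous hXs
  have c2 := continuous_mul_of_tsupport hO hp.continuousOn_deriv hζ.continuous hζO
  have c3 := continuous_mul_of_tsupport hO hp.continuousOn hY.continuous hYs
  have c4 := continuous_mul_of_tsupport hO hp.continuousOn_deriv hX.continuous hXs
  have c5 := continuous_mul_of_tsupport hO hp.continuousOn (contDiff_derivX hY).continuous hXYs
  have c6 := continuous_mul_of_tsupport hO hp.continuousOn (contDiff_derivY hX).continuous hYXs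
  have e1 := integral_mul_deriv_dir (μ := volume) c1 hXc.mul_left (c4.add c6)
    (hXc.mul_left.add (hasCompactSupport_deriv_dir hXc).mul_left)
    (fun z => hasLineDerivAt_mul_of_tsupport hp.vertical hX hXs z) hψ
  have e2 := integral_mul_deriv_dir (μ := volume) (c2.add c3) (hζc.mul_left.add hYc.mul_left)
    (c4.add c5) (hXc.mul_left.add (hasCompactSupport_deriv_dir hYc).mul_left) (u := dirX d)
    (fun z => by
      have h1 := hasLineDerivAt_mul_of_tsupport hp.horizontal_deriv hζ hζO z
      have h2 := hasLineDerivAt_mul_of_tsupport hp.horizontal hY hYs z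
      rw [zero_mul, zero_add] at h1 h2
      exact HasDerivAt.add h1 h2) hψ
  have i1 := integrable_mul_of_hasCompactSupport (μ := volume) c1 hXc.mul_left
    (contDiff_derivY hψ).continuous
  have i2 := integrable_mul_of_hasCompactSupport (μ := volume) (c2.add c3)
    (hζc.mul_left.add hYc.mul_left) (contDiff_derivX hψ).continuous
  refine ⟨i1.sub i2, ?_⟩
  refine (integral_sub i1 i2).trans ?_
  refine (congrArg₂ (· - ·) e1 e2).trans ?_
  have h0 : derivX (derivY ζ) = derivY (derivX ζ) := deriv_dir_comm hζ
  simp only [derivX, derivY] at h0 ⊢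
  rw [h0]
  ring

variable (g ρ₁ ρ₂ b₁ b₂ t₀ : ℝ) (py η : Space d × ℝ → ℝ)

/-- The localized oscillation between two streams separated by vortex sheets. -/
def sheet (z : Space d × ℝ) : State :=
  !₂[ρ₁ * potR η z - ρ₂ * potR η z,
    -(b₁ - b₂) * derivY (derivX (derivX η)) z,
    (b₁ - b₂) * potR η z,
    ρ₁ * potM1 g b₁ t₀ η z - ρ₂ * potM1 g b₂ t₀ η z,
    ρ₁ * potM2 g b₁ t₀ η z - ρ₂ * potM2 g b₂ t₀ η z,
    ρ₁ * potS11 g b₁ t₀ η z - ρ₂ * potS11 g b₂ t₀ η z,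
    ρ₁ * potS12 g b₁ t₀ η z - ρ₂ * potS12 g b₂ t₀ η z,
    ρ₁ * potS22 g b₁ t₀ η z - ρ₂ * potS22 g b₂ t₀ η z,
    ρ₁ * potQ1 g b₁ t₀ η z - ρ₂ * potQ1 g b₂ t₀ η z
      - (b₁ - b₂) * (py z * derivX (derivX η) z),
    ρ₁ * potQ2 g b₁ t₀ η z - ρ₂ * potQ2 g b₂ t₀ η z]

variable {g ρ₁ ρ₂ b₁ b₂ t₀ py η}

theorem continuous_sheet {O : Set (Space d × ℝ)} (hO : IsOpen O) (hpy : ContinuousOn py O)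
    (hη : ContDiff ℝ ∞ η) (hηO : tsupport η ⊆ O) :
    Continuous (sheet g ρ₁ ρ₂ b₁ b₂ t₀ py η) := by
  have hXX := contDiff_derivX (contDiff_derivX hη)
  have c0 := continuous_mul_of_tsupport hO hpy hXX.continuous
    ((tsupport_deriv_dir_subset _ _).trans ((tsupport_deriv_dir_subset _ _).trans hηO))
  have cR := (contDiff_potR hη).continuous
  have cY := (contDiff_derivY hXX).continuous
  have c1 := fun b => (contDiff_potM1 g b t₀ hη).continuous
  have c2 := fun b => (contDiff_potM2 g b t₀ hη).continuous
  have c3 := fun b => (contDiff_potS11 g b t₀ hη).continuous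
  have c4 := fun b => (contDiff_potS12 g b t₀ hη).continuous
  have c5 := fun b => (contDiff_potS22 g b t₀ hη).continuous
  have c6 := fun b => (contDiff_potQ1 g b t₀ hη).continuous
  have c7 := fun b => (contDiff_potQ2 g b t₀ hη).continuous
  have hcc : ∀ {F : ℝ → Space d × ℝ → ℝ}, (∀ b, Continuous (F b)) →
      Continuous fun z => ρ₁ * F b₁ z - ρ₂ * F b₂ z := fun h =>
    (continuous_const.mul (h b₁)).sub (continuous_const.mul (h b₂))
  unfold sheet
  refine (PiLp.continuous_toLp 2 _).comp (continuous_pi fun i => ?_)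
  fin_cases i
  · exact (continuous_const.mul cR).sub (continuous_const.mul cR)
  · exact continuous_const.mul cY
  · exact continuous_const.mul cR
  · exact hcc c1
  · exact hcc c2
  · exact hcc c3
  · exact hcc c4
  · exact hcc c5
  · exact (hcc c6).sub (continuous_const.mul c0)
  · exact hcc c7

theorem sheet_eq_zero {z : Space d × ℝ} (hz : z ∉ tsupport η) :
    sheet g ρ₁ ρ₂ b₁ b₂ t₀ py η z = 0 := by
  have hD : ∀ {u : Space d × ℝ} {f : Space d × ℝ → ℝ}, z ∉ tsupport f →
      z ∉ tsupport (deriv_dir u f) := fun h h' => h (tsupport_deriv_dir_subset _ _ h')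
  have hA : ∀ {b : ℝ} {f : Space d × ℝ → ℝ}, z ∉ tsupport f →
      z ∉ tsupport (derivA g b t₀ f) := fun h h' => h (tsupport_derivA_subset _ h')
  have h0 : ∀ {f : Space d × ℝ → ℝ}, z ∉ tsupport f → f z = 0 := fun h =>
    image_eq_zero_of_notMem_tsupport h
  have e1 := h0 (hD (u := dirX d) (hD (u := dirX d) hz))
  have e2 := h0 (hD (u := dirX d) (hD (u := dirX d) (hD (u := dirX d) hz)))
  have e3 := h0 (hD (u := dirY d) (hD (u := dirX d) (hD (u := dirX d) hz)))
  have e4 := fun b => h0 (hD (u := dirX d) (hD (u := dirX d) (hA (b := b) hz)))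
  have e5 := fun b => h0 (hD (u := dirX d) (hA (b := b) (hA (b := b) hz)))
  have e6 := fun b => h0 (hA (b := b) (hA (b := b) (hA (b := b) hz)))
  apply State.ext <;> simp [sheet, potR, potM1, potM2, potS11, potS12, potS22, potQ1, potQ2, potE,
    e1, e2, e3, e4, e5, e6]

/-- Localized vortex sheets solve the relaxed equations. -/
theorem integral_inner_sheet_nullField {O : Set (Space d × ℝ)} (hO : IsOpen O)
    {p : Space d × ℝ → ℝ} (hp : IsPressure O p py) (hη : ContDiff ℝ ∞ η)
    (hηc : HasCompactSupport η) (hηO : tsupport η ⊆ O) {j : Fin 7} {ψ : Space d × ℝ → ℝ}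
    (hψ : IsNullTest j ψ) :
    ∫ z, inner ℝ (sheet g ρ₁ ρ₂ b₁ b₂ t₀ py η z) (nullField g p ψ j z) = 0 := by
  obtain ⟨hψ, hψX⟩ := hψ
  have hz : ContDiff ℝ ∞ (fun _ : Space d × ℝ => (0 : ℝ)) := contDiff_const
  have hzs : HasCompactSupport (fun _ : Space d × ℝ => (0 : ℝ)) := HasCompactSupport.zero
  have hXX := contDiff_derivX (contDiff_derivX hη)
  have hXXc := hasCompactSupport_deriv_dir (u := dirX d)
    (hasCompactSupport_deriv_dir (u := dirX d) hηc)
  have hXXO : tsupport (derivX (derivX η)) ⊆ O :=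
    (tsupport_deriv_dir_subset _ _).trans ((tsupport_deriv_dir_subset _ _).trans hηO)
  have incomp := integral_balance (μ := volume) (u := dirX d) (v := dirY d) (w := dirT d)
    (contDiff_derivY hXX) ((contDiff_potR hη).neg) hz (k := fun _ => 0) continuous_const
    (hasCompactSupport_deriv_dir hXXc) (hasCompactSupport_potR hηc).neg hzs hzs hψ (fun z => by
      have h1 : deriv_dir (dirX d) (derivY (derivX (derivX η))) z = derivY (potR η) z :=
        congrFun (deriv_dir_comm hXX) z
      have h2 : deriv_dir (dirY d) (fun z => -potR η z) z = -derivY (potR η) z := by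
        simp [along, fderiv_fun_neg]
      rw [h1, h2]
      simp [along])
  have mass := fun b => integral_balance (μ := volume) (contDiff_potR hη)
    (contDiff_potM1 g b t₀ hη) (contDiff_potM2 g b t₀ hη) continuous_const
    (hasCompactSupport_potR hηc) (hasCompactSupport_potM1 g b t₀ hηc)
    (hasCompactSupport_potM2 g b t₀ hηc) hzs hψ (potential_mass g b t₀ hη)
  have mom1 := fun b => integral_balance (μ := volume) (contDiff_potM1 g b t₀ hη)
    (contDiff_potS11 g b t₀ hη) (contDiff_potS12 g b t₀ hη) continuous_const
    (hasCompactSupport_potM1 g b t₀ hηc) (hasCompactSupport_potS11 g b t₀ hηc)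
    (hasCompactSupport_potS12 g b t₀ hηc) hzs hψ (potential_momentum_fst g b t₀ hη)
  have mom2 := fun b => integral_balance (μ := volume) (contDiff_potM2 g b t₀ hη)
    (contDiff_potS12 g b t₀ hη) (contDiff_potS22 g b t₀ hη)
    (continuous_const.mul (contDiff_potR hη).continuous)
    (hasCompactSupport_potM2 g b t₀ hηc) (hasCompactSupport_potS12 g b t₀ hηc)
    (hasCompactSupport_potS22 g b t₀ hηc) (hasCompactSupport_potR hηc).mul_left hψ
    (potential_momentum_snd g b t₀ hη)
  have ener := fun b => integral_balance (μ := volume) (contDiff_potE g b t₀ hη)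
    (contDiff_potQ1 g b t₀ hη) (contDiff_potQ2 g b t₀ hη)
    (continuous_const.mul (contDiff_potM2 g b t₀ hη).continuous)
    (hasCompactSupport_potE g b t₀ hηc) (hasCompactSupport_potQ1 g b t₀ hηc)
    (hasCompactSupport_potQ2 g b t₀ hηc) (hasCompactSupport_potM2 g b t₀ hηc).mul_left hψ
    (potential_energy g b t₀ hη)
  have press := hp.integral_eq_zero hO hXX hXXc hXXO hψ
  have two : ∀ {F : ℝ → Space d × ℝ → ℝ} {f : Space d × ℝ → ℝ},
      -- Apart from the velocity and the pressure correction, the sheet is a linear combination of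
      -- two streams, each of which satisfies the balance laws with its own fall velocity.
      (∀ b, Integrable (F b) ∧ ∫ z, F b z = 0) → (∀ z, f z = ρ₁ * F b₁ z - ρ₂ * F b₂ z) →
      Integrable f ∧ ∫ z, f z = 0 := by
    intro F f hF hf
    have e : f = fun z => ρ₁ * F b₁ z - ρ₂ * F b₂ z := funext hf
    rw [e]
    refine ⟨((hF b₁).1.const_mul _).sub ((hF b₂).1.const_mul _), ?_⟩
    rw [integral_sub ((hF b₁).1.const_mul _) ((hF b₂).1.const_mul _), integral_const_mul,
      integral_const_mul, (hF b₁).2, (hF b₂).2]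
    simp
  have avg : ∀ {F f : Space d × ℝ → ℝ}, ContDiff ℝ ∞ F → HasCompactSupport F →
      (∀ z, derivX ψ z = 0) → (∀ z, f z = derivX F z * ψ z) → Integrable f ∧ ∫ z, f z = 0 := by
    intro F f hF hFc h0 hf
    have e : f = fun z => derivX F z * ψ z := funext hf
    have := integral_mul_deriv_dir_of_contDiff (μ := volume) (u := dirX d) hF hFc hψ
    simp only [derivX] at h0
    simp only [h0, mul_zero, integral_zero] at this
    rw [e]
    refine ⟨integrable_mul_of_hasCompactSupport (contDiff_derivX hF).continuous
      (hasCompactSupport_deriv_dir hFc) hψ.continuous, ?_⟩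
    linarith
  fin_cases j <;> simp only [nullField, inner_state, sheet]
  · refine (integral_congr_ae (Eventually.of_forall fun z => ?_)).trans
      ((integral_const_mul (-(b₁ - b₂)) _).trans (by rw [incomp.2, mul_zero]))
    simp
    ring
  · refine (two mass fun z => ?_).2
    simp
    ring
  · refine (two mom1 fun z => ?_).2
    simp
    ring
  · refine (two mom2 fun z => ?_).2
    simp
    ring
  · obtain ⟨h1, h2⟩ := two ener (fun z => rfl)
    refine (integral_congr_ae (Eventually.of_forall fun z => ?_)).trans
      ((integral_add h1 (press.1.const_mul (b₁ - b₂))).trans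
        (by rw [h2, integral_const_mul, press.2, mul_zero, add_zero]))
    have hR : potR η z = derivX (derivX (derivX η)) z := rfl
    simp [potE]
    rw [← hR]
    ring
  · refine (avg (F := fun z => (ρ₁ - ρ₂) * derivX (derivX η) z) (contDiff_const.mul hXX)
      hXXc.mul_left (hψX le_rfl) fun z => ?_).2
    have := congrFun (deriv_dir_const_mul (u := dirX d) (ρ₁ - ρ₂) hXX) z
    simp only [derivX] at this ⊢
    rw [this]
    simp only [potR, derivX, along]
    simp [-mul_eq_mul_right_iff]
    ring
  · have h2 := fun b => contDiff_derivA (g := g) (b := b) (t₀ := t₀)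
      (contDiff_derivA (g := g) (b := b) (t₀ := t₀) hη)
    have hF := fun b => (h2 b).add ((contDiff_fall d g b t₀).mul
      ((contDiff_fall d g b t₀).mul hXX))
    have hFc := fun b => (hasCompactSupport_derivA (g := g) (b := b) (t₀ := t₀)
      (hasCompactSupport_derivA (g := g) (b := b) (t₀ := t₀) hηc)).add
      ((hXXc.mul_left (f := fall g b t₀)).mul_left (f := fall g b t₀))
    have := two (f := fun z => ρ₁ * ((potS11 g b₁ t₀ η z + potS22 g b₁ t₀ η z) * ψ z)
      - ρ₂ * ((potS11 g b₂ t₀ η z + potS22 g b₂ t₀ η z) * ψ z)) (fun b => avg (hF b) (hFc b)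
        (hψX (by decide)) (f := fun z => (potS11 g b t₀ η z + potS22 g b t₀ η z) * ψ z) fun z => by
          have := congrFun (potential_trace g b t₀ hη) z
          exact congrArg (· * ψ z) this) fun z => rfl
    refine (integral_congr_ae (Eventually.of_forall fun z => ?_)).trans this.2
    simp
    ring

/-! ### The leading order of oscillating vortex sheets -/

theorem IsOsc.congr {E : Type*} [NormedAddCommGroup E] [NormedSpace ℝ E] {s : Set E}
    {ℓ : E →L[ℝ] ℝ} {k : ℕ} {f f' : ℕ → E → ℝ} {a₀ b₀ a₁ b₁ : E → ℝ}
    (h : IsOsc s ℓ k f a₀ b₀) (hf : ∀ N z, f' N z = f N z) (ha : ∀ z, a₁ z = a₀ z)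
    (hb : ∀ z, b₁ z = b₀ z) : IsOsc s ℓ k f' a₁ b₁ := by
  obtain rfl : f' = f := funext fun N => funext (hf N)
  obtain rfl : a₁ = a₀ := funext ha
  obtain rfl : b₁ = b₀ := funext hb
  exact h

/-- The oscillating potential. -/
def oscPotential {E : Type*} [NormedAddCommGroup E] [NormedSpace ℝ E] (ℓ : E →L[ℝ] ℝ) (χ : E → ℝ)
    (N : ℕ) (z : E) : ℝ := (N : ℝ)⁻¹ ^ 3 * (χ z * Real.cos (N * ℓ z))

theorem contDiff_oscPotential {E : Type*} [NormedAddCommGroup E] [NormedSpace ℝ E]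
    (ℓ : E →L[ℝ] ℝ) {χ : E → ℝ} (hχ : ContDiff ℝ ∞ χ) (N : ℕ) :
    ContDiff ℝ ∞ (oscPotential ℓ χ N) :=
  contDiff_const.mul (hχ.mul (Real.contDiff_cos.comp (contDiff_const.mul ℓ.contDiff)))

theorem tsupport_oscPotential_subset {E : Type*} [NormedAddCommGroup E] [NormedSpace ℝ E]
    (ℓ : E →L[ℝ] ℝ) (χ : E → ℝ) (N : ℕ) : tsupport (oscPotential ℓ χ N) ⊆ tsupport χ := by
  refine closure_mono fun z hz => ?_
  rw [Function.mem_support] at hz ⊢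
  intro h
  exact hz (by simp [oscPotential, h])

section Asymptotics

variable {s : Set (Space d × ℝ)} {ℓ : Space d × ℝ →L[ℝ] ℝ} {χ : Space d × ℝ → ℝ}

theorem isOsc_along_three (hs : IsClosed s) (hχ : ContDiff ℝ ∞ χ) (hχs : ∀ z ∉ s, χ z = 0)
    {e₁ e₂ e₃ : Space d × ℝ → Space d × ℝ} (h₁ : ContDiff ℝ ∞ e₁) (h₂ : ContDiff ℝ ∞ e₂)
    (h₃ : ContDiff ℝ ∞ e₃) :
    IsOsc s ℓ 0 (fun N => along e₃ (along e₂ (along e₁ (oscPotential ℓ χ N)))) (fun _ => 0)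
      (fun z => χ z * (ℓ (e₁ z) * ℓ (e₂ z) * ℓ (e₃ z))) := by
  have h := (((IsOsc.of_cos (s := s) (ℓ := ℓ) (k := 3) hχ hχs).along hs h₁).along hs h₂).along hs h₃
  refine h.congr (fun N z => rfl) (fun z => ?_) (fun z => ?_)
  · simp
  · simp; ring

variable (g ρ₁ ρ₂ b₁ b₂ t₀ ℓ) in
/-- The amplitude of an oscillating vortex sheet. -/
def sheetAmplitude (z : Space d × ℝ) : State :=
  pureState ρ₁ (-ℓ (fallDir g b₁ t₀ z)) (fall g b₁ t₀ z)
    - pureState ρ₂ (-ℓ (fallDir g b₂ t₀ z)) (fall g b₂ t₀ z)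

theorem continuous_sheetAmplitude :
    Continuous (sheetAmplitude g ρ₁ ρ₂ b₁ b₂ t₀ ℓ) := by
  have h1 := fun b => (contDiff_fall d g b t₀).continuous
  have h2 := fun b => ℓ.continuous.comp (contDiff_fallDir (d := d) g b t₀).continuous
  exact (continuous_pureState.comp (continuous_const.prodMk ((h2 b₁).neg.prodMk (h1 b₁)))).sub
    (continuous_pureState.comp (continuous_const.prodMk ((h2 b₂).neg.prodMk (h1 b₂))))

/-- Only derivatives of the phase survive in the limit. Three of them turn the cosine into a sine,
with symbol 1 for the horizontal direction and minus the horizontal stream velocity for free fall,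
so the potentials reproduce the components of a pure state. The pressure correction contains only
two derivatives and is of order `1 / N`. -/
theorem eventually_norm_sheet_sub_le (hs : IsCompact s) (hχ : ContDiff ℝ ∞ χ)
    (hχs : ∀ z ∉ s, χ z = 0) (hℓ : ℓ (dirX d) = 1) {C : ℝ} (hC : ∀ z ∈ s, |py z| ≤ C) {τ : ℝ}
    (hτ : 0 < τ) : ∀ᶠ N : ℕ in atTop, ∀ z,
      ‖sheet g ρ₁ ρ₂ b₁ b₂ t₀ py (oscPotential ℓ χ N) z
        - (χ z * Real.sin (N * ℓ z)) • sheetAmplitude g ρ₁ ρ₂ b₁ b₂ t₀ ℓ z‖ ≤ τ := by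
  have hX : ContDiff ℝ ∞ fun _ : Space d × ℝ => dirX d := contDiff_const
  have hY : ContDiff ℝ ∞ fun _ : Space d × ℝ => dirY d := contDiff_const
  have hA := fun b => contDiff_fallDir (d := d) g b t₀
  have hb := fun b => contDiff_fall d g b t₀
  have hc : ∀ c : ℝ, ContDiff ℝ ∞ fun _ : Space d × ℝ => c := fun c => contDiff_const
  have oR := isOsc_along_three (ℓ := ℓ) hs.isClosed hχ hχs hX hX hX
  have oY := isOsc_along_three (ℓ := ℓ) hs.isClosed hχ hχs hX hX hY
  have oM := fun b => isOsc_along_three (ℓ := ℓ) hs.isClosed hχ hχs (hA b) hX hX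
  have oS := fun b => isOsc_along_three (ℓ := ℓ) hs.isClosed hχ hχs (hA b) (hA b) hX
  have oQ := fun b => isOsc_along_three (ℓ := ℓ) hs.isClosed hχ hχs (hA b) (hA b) (hA b)
  have oP : IsOsc s ℓ 1 (fun N => derivX (derivX (oscPotential ℓ χ N))) _ _ :=
    ((IsOsc.of_cos (s := s) (ℓ := ℓ) (k := 3) hχ hχs).along hs.isClosed hX).along hs.isClosed hX
  have two : ∀ {F : ℝ → ℕ → Space d × ℝ → ℝ} {B : ℝ → Space d × ℝ → ℝ},
      (∀ b, IsOsc s ℓ 0 (F b) (fun _ => 0) (B b)) →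
      IsOsc s ℓ 0 (fun N z => ρ₁ * F b₁ N z - ρ₂ * F b₂ N z) (fun _ => 0)
        (fun z => ρ₁ * B b₁ z - ρ₂ * B b₂ z) := by
    intro F B h
    exact (((h b₁).smul (hc ρ₁)).add ((h b₂).smul (hc (-ρ₂)))).congr (fun N z => by ring)
      (fun z => by ring) (fun z => by ring)
  have sm : ∀ {f : ℕ → Space d × ℝ → ℝ} {B c : Space d × ℝ → ℝ}, ContDiff ℝ ∞ c →
      IsOsc s ℓ 0 f (fun _ => 0) B →
      IsOsc s ℓ 0 (fun N z => c z * f N z) (fun _ => 0) (fun z => c z * B z) := fun hc h =>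
    (h.smul hc).congr (fun N z => rfl) (fun z => by simp) (fun z => rfl)
  have ad : ∀ {f f' : ℕ → Space d × ℝ → ℝ} {B B' : Space d × ℝ → ℝ},
      IsOsc s ℓ 0 f (fun _ => 0) B → IsOsc s ℓ 0 f' (fun _ => 0) B' →
      IsOsc s ℓ 0 (fun N z => f N z + f' N z) (fun _ => 0) (fun z => B z + B' z) := fun h h' =>
    (h.add h').congr (fun N z => rfl) (fun z => by simp) (fun z => rfl)
  have o0 := two fun _ => oR
  have o1 := sm (hc (-(b₁ - b₂))) oY
  have o2 := sm (hc (b₁ - b₂)) oR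
  have oM1 := fun b => sm (hc (-1)) (oM b)
  have o3 := two oM1
  have o4 := two fun b => sm (hb b) oR
  have o5 := two oS
  have o6 := two fun b => sm (hb b) (oM1 b)
  have o7 := two fun b => sm (hb b) (sm (hb b) oR)
  have o8 := two fun b => ad (sm (hc (-(1 / 2))) (oQ b))
    (sm (hc (1 / 2)) (sm (hb b) (sm (hb b) (oM1 b))))
  have o9 := two fun b => sm (hb b) (sm (hc (1 / 2)) (ad (oS b) (sm (hb b) (sm (hb b) oR))))
  -- The added ones keep the denominator positive when the vertical velocities agree or `C`
  -- vanishes.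
  have hD : 0 < |b₁ - b₂| * (|C| + 1) + 1 := by positivity
  have hτ' : 0 < τ / 8 := by positivity
  filter_upwards [o0.eventually_le hs hτ', o1.eventually_le hs hτ', o2.eventually_le hs hτ',
    o3.eventually_le hs hτ', o4.eventually_le hs hτ', o5.eventually_le hs hτ',
    o6.eventually_le hs hτ', o7.eventually_le hs hτ', o8.eventually_le hs hτ',
    o9.eventually_le hs hτ', oP.eventually_le_of_succ hs
      (show 0 < τ / 8 / (|b₁ - b₂| * (|C| + 1) + 1) by positivity)] with
    N n0 n1 n2 n3 n4 n5 n6 n7 n8 n9 nP z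
  have hlast : |(b₁ - b₂) * (py z * derivX (derivX (oscPotential ℓ χ N)) z)| ≤ τ / 8 := by
    by_cases hz : z ∈ s
    · have h1 : |py z| ≤ |C| + 1 := (hC z hz).trans (by linarith [le_abs_self C])
      rw [abs_mul, abs_mul, ← mul_assoc]
      calc |b₁ - b₂| * |py z| * |derivX (derivX (oscPotential ℓ χ N)) z|
          ≤ |b₁ - b₂| * (|C| + 1) * (τ / 8 / (|b₁ - b₂| * (|C| + 1) + 1)) := by
            gcongr
            exact nP z
        _ ≤ (|b₁ - b₂| * (|C| + 1) + 1) * (τ / 8 / (|b₁ - b₂| * (|C| + 1) + 1)) := by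
            gcongr
            linarith
        _ = τ / 8 := by field_simp
    · have h0 : z ∉ tsupport χ := by
        have : tsupport χ ⊆ s := closure_minimal (fun y hy => by
          by_contra h; exact hy (hχs y h)) hs.isClosed
        exact fun h => hz (this h)
      have h1 : z ∉ tsupport (derivX (derivX (oscPotential ℓ χ N))) := fun h =>
        h0 (tsupport_oscPotential_subset ℓ χ N (tsupport_deriv_dir_subset _ _
          (tsupport_deriv_dir_subset _ _ h)))
      rw [image_eq_zero_of_notMem_tsupport h1]
      simp
      positivity
  -- The jump of the horizontal velocities is `-(b₁ - b₂) * ℓ (dirY d)`, which matches the stream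
  -- function: incompressibility of the wave is consistent with transport by both streams.
  have hfd : ∀ b, ℓ (fallDir g b t₀ z) = ℓ (dirT d) + fall g b t₀ z * ℓ (dirY d) := by
    intro b; simp [fallDir]
  have hdiff : fall g b₁ t₀ z - fall g b₂ t₀ z = b₁ - b₂ := by simp [fall]
  refine (State.norm_le (τ := τ / 4) (by positivity) fun j => ?_).trans (by linarith)
  have hfin : ∀ {x y : ℝ}, |x| ≤ τ / 8 → y = x → |y| ≤ τ / 4 := by
    rintro x y h rfl; linarith
  fin_cases j
  · refine hfin (n0 z) ?_
    simp [sheet, sheetAmplitude, potR, hℓ]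
    ring
  · refine hfin (n1 z) ?_
    simp [sheet, sheetAmplitude, hℓ, hfd, ← hdiff]
    ring
  · refine hfin (n2 z) ?_
    simp [sheet, sheetAmplitude, potR, hℓ, ← hdiff]
    ring
  · refine hfin (n3 z) ?_
    simp [sheet, sheetAmplitude, potM1, hℓ]
    ring
  · refine hfin (n4 z) ?_
    simp [sheet, sheetAmplitude, potM2, potR, hℓ]
    ring
  · refine hfin (n5 z) ?_
    simp [sheet, sheetAmplitude, potS11, hℓ]
    ring
  · refine hfin (n6 z) ?_
    simp [sheet, sheetAmplitude, potS12, potM1, hℓ]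
    ring
  · refine hfin (n7 z) ?_
    simp [sheet, sheetAmplitude, potS22, potM2, potR, hℓ]
    ring
  · have h := (abs_sub _ _).trans (add_le_add (n8 z) hlast)
    rw [show τ / 8 + τ / 8 = τ / 4 by ring] at h
    refine le_trans (le_of_eq (congrArg _ ?_)) h
    simp [sheet, sheetAmplitude, potQ1, potS12, potM1, hℓ]
    ring
  · refine hfin (n9 z) ?_
    simp [sheet, sheetAmplitude, potQ2, potE, potS11, potS22, potM2, potR, hℓ]
    ring

end Asymptotics

end Sheet

end

/-! ### Frequencies, room in the hull and averages of oscillations -/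

noncomputable section

/-- A state of zero gap has an extreme density, and an interior point can be moved to larger and to
smaller densities. -/
theorem gap_pos_of_mem_interior {ρm ρp R : ℝ} (hρm : 0 < ρm) (hρ : ρm < ρp) {z : State}
    (hz : z ∈ interior (hull ρm ρp R)) : 0 < gap ρm ρp z := by
  refine lt_of_le_of_ne (gap_nonneg hρm hρ (interior_subset hz)) fun h => ?_
  obtain ⟨ρ, a, b, h1, -, -, h2⟩ := mem_phaseSet_of_gap_eq_zero hρm hρ (interior_subset hz) h.symm
  have hc : Continuous fun t : ℝ => z + t • pureState 1 0 0 := by fun_prop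
  have hev : ∀ᶠ t in 𝓝 (0 : ℝ), z + t • pureState 1 0 0 ∈ interior (hull ρm ρp R) :=
    hc.continuousAt.eventually_mem (isOpen_interior.mem_nhds (by simpa using hz))
  obtain ⟨τ, hτ, hball⟩ := Metric.eventually_nhds_iff.1 hev
  have hp := density_mem_of_mem_hull hρ (interior_subset (hball (y := τ / 2) (by
    rw [Real.dist_eq, sub_zero, abs_of_pos (by positivity)]; linarith)))
  have hm := density_mem_of_mem_hull hρ (interior_subset (hball (y := -(τ / 2)) (by
    rw [Real.dist_eq, sub_zero, abs_neg, abs_of_pos (by positivity)]; linarith)))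
  simp [h2] at hp hm
  rcases h1 with h1 | h1 <;> rw [h1] at hp hm <;> linarith [hp.1, hp.2, hm.1, hm.2]

theorem continuousAt_gap {ρm ρp : ℝ} {z : State} (hz : z 0 ≠ 0) : ContinuousAt (gap ρm ρp) z := by
  unfold gap
  fun_prop (disch := assumption)

theorem continuousAt_gapSlope {ρm ρp : ℝ} {z : State} (hz : z 0 ≠ 0) :
    ContinuousAt (gapSlope ρm ρp) z := by
  unfold gapSlope
  refine (PiLp.continuous_toLp 2 _).continuousAt.comp (continuousAt_pi.2 fun i => ?_)
  fin_cases i <;> simp <;> fun_prop (disch := assumption)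

theorem gapForm_smul {ρp : ℝ} {z w : State} (θ : ℝ) :
    gapForm ρp z (θ • w) = θ ^ 2 * gapForm ρp z w := by
  simp [gapForm]
  ring

theorem continuousAt_gapForm {ρp : ℝ} {z w : State} (hz : z 0 ≠ 0) :
    ContinuousAt (fun q : State × State => gapForm ρp q.1 q.2) (z, w) := by
  unfold gapForm
  have : (z, w).1 0 ≠ 0 := hz
  fun_prop (disch := assumption)

section Perturbation

variable {d : ℕ}

/-- The frequency has to annihilate the space-time velocities of both streams, so that the sheets `ℓ
= const` move with either fluid. The difference of the two conditions determines the vertical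
component and one of them the temporal component. For equal velocities the quotient is 0 / 0 = 0,
and the sheet is a mere density jump. -/
theorem exists_frequency (hd : (0 : Fin (d + 1)) ≠ Fin.last d) {a₁ b₁ a₂ b₂ : ℝ}
    (h : b₁ ≠ b₂ ∨ (a₁ = a₂ ∧ b₁ = b₂)) : ∃ ℓ : Space d × ℝ →L[ℝ] ℝ, ℓ (dirX d) = 1 ∧
      -(ℓ (dirT d) + b₁ * ℓ (dirY d)) = a₁ ∧ -(ℓ (dirT d) + b₂ * ℓ (dirY d)) = a₂ := by
  set κ : ℝ := -(a₁ - a₂) / (b₁ - b₂) with hκ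
  set σ : ℝ := -a₁ - b₁ * κ with hσ
  refine ⟨(EuclideanSpace.proj (0 : Fin (d + 1))).comp (ContinuousLinearMap.fst ℝ (Space d) ℝ)
    + κ • (EuclideanSpace.proj (Fin.last d)).comp (ContinuousLinearMap.fst ℝ (Space d) ℝ)
    + σ • ContinuousLinearMap.snd ℝ (Space d) ℝ, ?_, ?_, ?_⟩
  · simp [dirX, hd.symm]
  · simp [dirY, dirT, hd, hσ]
  · simp [dirY, dirT, hd, hσ]
    rcases h with h | ⟨h1, h2⟩
    · have : b₁ - b₂ ≠ 0 := sub_ne_zero.2 h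
      rw [hκ]
      field_simp
      ring
    · rw [h1, h2]; ring

/-- In a small ball there is enough room to add vortex sheets, which reduce the gap. -/
theorem eventually_room {ρm ρp R : ℝ} (hρm : 0 < ρm) (hρ : ρm < ρp) {f A : Space d × ℝ → State}
    {z₀ : Space d × ℝ} (hf : ContinuousAt f z₀) (hA : ContinuousAt A z₀)
    (hfz : f z₀ ∈ interior (hull ρm ρp R))
    (hfA : ∀ θ ∈ Icc (-1 : ℝ) 1, f z₀ + θ • A z₀ ∈ interior (hull ρm ρp R)) {δ : ℝ}
    (hδ : 0 < δ) :
    ∃ τ > 0, ∀ᶠ z in 𝓝 z₀, ∀ e : State, ‖e‖ ≤ τ → ∀ θ ∈ Icc (-1 : ℝ) 1,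
      f z + (θ • A z + e) ∈ interior (hull ρm ρp R) ∧
      θ ^ 2 * gapForm ρp (f z₀) (A z₀) - δ ≤ gapForm ρp (f z) (θ • A z + e) := by
  have hfz0 : f z₀ 0 ≠ 0 := by
    linarith [(density_mem_of_mem_hull hρ (interior_subset hfz)).1]
  have key : ∀ᶠ q : (Space d × ℝ) × State in 𝓝 (z₀, 0), ∀ θ ∈ Icc (-1 : ℝ) 1,
      f q.1 + (θ • A q.1 + q.2) ∈ interior (hull ρm ρp R) ∧
      θ ^ 2 * gapForm ρp (f z₀) (A z₀) - δ ≤ gapForm ρp (f q.1) (θ • A q.1 + q.2) := by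
    -- Compactness of the interval of amplitudes gives one neighbourhood and one tolerance for all
    -- `θ`.
    refine isCompact_Icc.eventually_forall_of_forall_eventually fun θ hθ => ?_
    have c1 : ContinuousAt (fun y : ((Space d × ℝ) × State) × ℝ => f y.1.1) ((z₀, 0), θ) :=
      ContinuousAt.comp (f := fun y : ((Space d × ℝ) × State) × ℝ => y.1.1) hf (by fun_prop)
    have c2 : ContinuousAt (fun y : ((Space d × ℝ) × State) × ℝ => A y.1.1) ((z₀, 0), θ) :=
      ContinuousAt.comp (f := fun y : ((Space d × ℝ) × State) × ℝ => y.1.1) hA (by fun_prop)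
    have c3 : ContinuousAt (fun y : ((Space d × ℝ) × State) × ℝ => y.2 • A y.1.1 + y.1.2)
        ((z₀, 0), θ) := (continuousAt_snd.smul c2).add (by fun_prop)
    have c4 : ContinuousAt (fun y : ((Space d × ℝ) × State) × ℝ =>
        gapForm ρp (f y.1.1) (y.2 • A y.1.1 + y.1.2)
          - y.2 ^ 2 * gapForm ρp (f z₀) (A z₀)) ((z₀, 0), θ) :=
      (ContinuousAt.comp (f := fun y : ((Space d × ℝ) × State) × ℝ =>
        (f y.1.1, y.2 • A y.1.1 + y.1.2)) (g := fun q : State × State => gapForm ρp q.1 q.2)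
        (continuousAt_gapForm hfz0) (c1.prodMk c3)).sub (by fun_prop)
    have e1 := (c1.add c3).eventually_mem (isOpen_interior.mem_nhds (by simpa using hfA θ hθ))
    have e2 := c4.eventually_const_lt (u := -δ) (by simp [gapForm_smul, hδ])
    filter_upwards [e1, e2] with y h1 h2
    exact ⟨h1, by linarith⟩
  rw [nhds_prod_eq] at key
  obtain ⟨pa, hpa, pb, hpb, h⟩ := eventually_prod_iff.1 key
  obtain ⟨τ, hτ, hball⟩ := Metric.eventually_nhds_iff.1 hpb
  refine ⟨τ / 2, by positivity, hpa.mono fun z hz e he θ hθ => h hz (hball ?_) θ hθ⟩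
  rw [dist_zero_right]
  linarith

/-- The bump equals one on the ball of half the radius, which has the fraction `(1 / 2) ^ D` of the
volume, and the squared sine has mean 1/2 there. The factor 1/4 instead of 1/2 makes the bound hold
at large finite frequency. -/
theorem ae_le_setIntegral_bump_sin {E : Type*} [NormedAddCommGroup E] [NormedSpace ℝ E]
    [FiniteDimensional ℝ E] [Nontrivial E] [MeasurableSpace E] [BorelSpace E] (μ : Measure E)
    [μ.IsAddHaarMeasure] {ℓ : E →L[ℝ] ℝ} (hℓ : ℓ ≠ 0) {z₀ : E} (φ : ContDiffBump z₀)
    (hφ : φ.rIn = φ.rOut / 2) : ∀ᶠ N : ℕ in atTop,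
      (1 / 2) ^ (Module.finrank ℝ E) / 4 * μ.real (Metric.closedBall z₀ φ.rOut) ≤
        ∫ z in Metric.closedBall z₀ φ.rOut, (φ z * Real.sin (N * ℓ z)) ^ 2 ∂μ := by
  set D := Module.finrank ℝ E
  have hpos : 0 < μ.real (Metric.closedBall z₀ φ.rOut) :=
    ENNReal.toReal_pos (Metric.measure_closedBall_pos μ z₀ φ.rOut_pos).ne' measure_closedBall_lt_top.ne
  have hhalf : μ.real (Metric.closedBall z₀ φ.rIn)
      = (1 / 2) ^ D * μ.real (Metric.closedBall z₀ φ.rOut) := by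
    have h0 := φ.rOut_pos.le
    have h1 := φ.rIn_pos.le
    rw [Measure.real, Measure.real, Measure.addHaar_closedBall μ z₀ h1,
      Measure.addHaar_closedBall μ z₀ h0, ENNReal.toReal_mul, ENNReal.toReal_mul,
      ENNReal.toReal_ofReal (by positivity), ENNReal.toReal_ofReal (by positivity), hφ]
    ring
  have hlim := tendsto_integral_sin_sq μ hℓ (s := Metric.closedBall z₀ φ.rIn)
    Metric.isClosed_closedBall.measurableSet measure_closedBall_lt_top.ne
  have hc : (1 / 2) ^ D / 4 * μ.real (Metric.closedBall z₀ φ.rOut)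
      < μ.real (Metric.closedBall z₀ φ.rIn) / 2 := by
    rw [hhalf]
    have : (0 : ℝ) < (1 / 2) ^ D := by positivity
    nlinarith [mul_pos this hpos]
  filter_upwards [hlim.eventually_const_lt hc] with N hN
  refine hN.le.trans ?_
  have hint : IntegrableOn (fun z => (φ z * Real.sin (N * ℓ z)) ^ 2)
      (Metric.closedBall z₀ φ.rOut) μ :=
    (((φ.continuous).mul (by fun_prop)).pow 2).continuousOn.integrableOn_compact
      (isCompact_closedBall _ _)
  have hsub : Metric.closedBall z₀ φ.rIn ⊆ Metric.closedBall z₀ φ.rOut :=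
    Metric.closedBall_subset_closedBall φ.rIn_lt_rOut.le
  calc _ = ∫ z in Metric.closedBall z₀ φ.rIn, (φ z * Real.sin (N * ℓ z)) ^ 2 ∂μ := by
        refine setIntegral_congr_fun Metric.isClosed_closedBall.measurableSet fun z hz => ?_
        simp [φ.one_of_mem_closedBall hz]
    _ ≤ _ := setIntegral_mono_set hint (Eventually.of_forall fun z => sq_nonneg _)
        hsub.eventuallyLE

/-- Up to a uniformly small error the fields are a fixed amplitude times a fast sine, so
Riemann–Lebesgue gives weak convergence to zero. -/
theorem tendsto_integral_inner_of_norm_sub_le {E : Type*} [NormedAddCommGroup E] [NormedSpace ℝ E]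
    [FiniteDimensional ℝ E] [MeasurableSpace E] [BorelSpace E] (μ : Measure E)
    [μ.IsAddHaarMeasure] {ℓ : E →L[ℝ] ℝ} (hℓ : ℓ ≠ 0) {A h : E → State} {χ : E → ℝ}
    {P : ℕ → E → State} (hP : ∀ N, Continuous (P N)) (hA : Continuous A) (hχ : Continuous χ)
    (hχs : HasCompactSupport χ)
    (hPA : ∀ τ > 0, ∀ᶠ N : ℕ in atTop, ∀ z, ‖P N z - (χ z * Real.sin (N * ℓ z)) • A z‖ ≤ τ)
    (hh : Integrable h μ) : Tendsto (fun N => ∫ z, inner ℝ (P N z) (h z) ∂μ) atTop (𝓝 0) := by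
  have hcs : HasCompactSupport fun z => χ z • A z := hχs.smul_right
  obtain ⟨C, hC⟩ := (hχ.smul hA).bounded_above_of_compact_support hcs
  have i0 : Integrable (fun z => inner ℝ (χ z • A z) (h z)) μ := by
    refine (hh.norm.const_mul C).mono
      ((hχ.smul hA).aestronglyMeasurable.inner hh.aestronglyMeasurable)
      (Eventually.of_forall fun z => ?_)
    rw [norm_mul, norm_norm]
    refine (norm_inner_le_norm _ _).trans ?_
    gcongr
    exact (hC z).trans (Real.le_norm_self C)
  have h1 := tendsto_integral_mul_sin μ hℓ i0
  have h2 : Tendsto (fun N : ℕ => ∫ z, inner ℝ (P N z - (χ z * Real.sin (N * ℓ z)) • A z) (h z) ∂μ)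
      atTop (𝓝 0) := by
    rw [Metric.tendsto_atTop']
    intro ε hε
    have hI : 0 < ∫ z, ‖h z‖ ∂μ + 1 := by
      have := integral_nonneg (μ := μ) (f := fun z => ‖h z‖) fun z => norm_nonneg _
      positivity
    obtain ⟨N₀, hN₀⟩ := eventually_atTop.1
      (hPA (ε / 2 / (∫ z, ‖h z‖ ∂μ + 1)) (by positivity))
    refine ⟨N₀, fun N hN => ?_⟩
    rw [dist_zero_right]
    refine (norm_integral_le_of_norm_le
      (hh.norm.const_mul (ε / 2 / (∫ z, ‖h z‖ ∂μ + 1))) (Eventually.of_forall fun z => ?_)).trans_lt ?_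
    · refine (norm_inner_le_norm _ _).trans ?_
      gcongr
      exact hN₀ N hN.le z
    · rw [integral_const_mul, div_mul_eq_mul_div, div_lt_iff₀ hI]
      nlinarith
  have h3 := h1.add h2
  rw [add_zero] at h3
  refine h3.congr' ?_
  filter_upwards [hPA 1 one_pos] with N hN
  have hs : Continuous fun z => (χ z * Real.sin (N * ℓ z)) • A z :=
    (hχ.mul (by fun_prop)).smul hA
  rw [← integral_add]
  · congr 1
    ext z
    rw [inner_sub_left, real_inner_smul_left, real_inner_smul_left]
    ring
  · refine i0.norm.mono (i0.aestronglyMeasurable.mul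
      (Continuous.aestronglyMeasurable (by fun_prop))) (Eventually.of_forall fun z => ?_)
    rw [norm_mul, norm_norm]
    exact mul_le_of_le_one_right (norm_nonneg _) (Real.abs_sin_le_one _)
  · refine hh.norm.mono (((hP N).sub hs).aestronglyMeasurable.inner hh.aestronglyMeasurable)
      (Eventually.of_forall fun z => ?_)
    rw [norm_norm]
    refine (norm_inner_le_norm _ _).trans ?_
    exact mul_le_of_le_one_left (norm_nonneg _) (hN z)

end Perturbation

end

/-! ### Decreasing the gap in a small ball -/

noncomputable section

variable {d : ℕ}

theorem continuousOn_gap_comp {ρm ρp R : ℝ} (hρm : 0 < ρm) (hρ : ρm < ρp) {E : Type*}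
    [TopologicalSpace E] {s : Set E} {f : E → State} (hf : ContinuousOn f s)
    (hfU : ∀ z ∈ s, f z ∈ hull ρm ρp R) : ContinuousOn (fun z => gap ρm ρp (f z)) s := fun z hz => by
  have h0 : f z 0 ≠ 0 := by linarith [(density_mem_of_mem_hull hρ (hfU z hz)).1]
  exact (continuousAt_gap h0).comp_continuousWithinAt (hf z hz)

/-- The direction is chosen at the centre and used in the whole ball, where continuity of `f` makes
it admissible. The first-order change of the gap tends to zero by weak convergence, while concavity
yields a loss proportional to the squared gap at the centre. It matters that `c` precedes all other
data: it depends only on the dimension, the two densities and `R`, so losses in many balls can be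
added. -/
theorem exists_local_perturbation (d : ℕ) (hd : (0 : Fin (d + 1)) ≠ Fin.last d) {ρm ρp R : ℝ}
    (hρm : 0 < ρm) (hρ : ρm < ρp) : ∃ c > 0, ∀ {g : ℝ} {O : Set (Space d × ℝ)}
      {p py : Space d × ℝ → ℝ} {f : Space d × ℝ → State}, IsOpen O → IsPressure O p py →
      ContinuousOn f O → (∀ z ∈ O, f z ∈ interior (hull ρm ρp R)) → ∀ z₀ ∈ O,
      ∃ r₀ > 0, Metric.closedBall z₀ r₀ ⊆ O ∧ ∀ r, 0 < r → r ≤ r₀ →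
      ∃ P : ℕ → Space d × ℝ → State, (∀ N, Continuous (P N)) ∧
        (∀ N, ∀ z ∉ Metric.closedBall z₀ r, P N z = 0) ∧
        (∀ N j ψ, IsNullTest j ψ → ∫ z, inner ℝ (P N z) (nullField g p ψ j z) = 0) ∧
        (∀ h : Space d × ℝ → State, Integrable h →
          Tendsto (fun N => ∫ z, inner ℝ (P N z) (h z)) atTop (𝓝 0)) ∧
        ∀ᶠ N in atTop, (∀ z ∈ Metric.closedBall z₀ r, f z + P N z ∈ interior (hull ρm ρp R)) ∧
          ∫ z in Metric.closedBall z₀ r, gap ρm ρp (f z + P N z) ≤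
            (∫ z in Metric.closedBall z₀ r, gap ρm ρp (f z))
              - c * ∫ z in Metric.closedBall z₀ r, gap ρm ρp (f z) ^ 2 := by
  obtain ⟨c₁, hc₁, hdir⟩ := exists_direction (R := R) hρm hρ
  set κ : ℝ := (1 / 2) ^ (Module.finrank ℝ (Space d × ℝ)) / 4 with hκ
  have hκ0 : 0 < κ := by positivity
  refine ⟨κ * c₁ / 4, by positivity, fun {g O p py f} hO hp hf hfU z₀ hz₀ => ?_⟩
  obtain ⟨ρ₁, ρ₂, a₁, b₁, a₂, b₂, s, hab, hseg, hform⟩ := hdir _ (hfU z₀ hz₀)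
  obtain ⟨ℓ, hℓX, hℓ1, hℓ2⟩ := exists_frequency hd hab
  have hℓ0 : ℓ ≠ 0 := by rintro rfl; simp at hℓX
  set G₀ := gap ρm ρp (f z₀) with hG₀
  have hG₀pos : 0 < G₀ := gap_pos_of_mem_interior hρm hρ (hfU z₀ hz₀)
  set A' : Space d × ℝ → State := sheetAmplitude g ρ₁ ρ₂ b₁ b₂ z₀.2 ℓ with hA'
  set A : Space d × ℝ → State := fun z => s • A' z with hA
  have hA'c : Continuous A' := continuous_sheetAmplitude
  have hAc : Continuous A := hA'c.const_smul s
  have hAz₀ : A z₀ = s • (pureState ρ₁ a₁ b₁ - pureState ρ₂ a₂ b₂) := by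
    have h1 : ∀ b, fall g b z₀.2 z₀ = b := fun b => by simp [fall]
    simp [hA, hA', sheetAmplitude, fallDir, h1, ← hℓ1, ← hℓ2]
  have hfc : ContinuousAt f z₀ := hf.continuousAt (hO.mem_nhds hz₀)
  have hdens : ∀ z ∈ O, 0 < f z 0 := fun z hz => by
    linarith [(density_mem_of_mem_hull hρ (interior_subset (hfU z hz))).1]
  -- A quarter of the guaranteed mean loss. This error is spent twice: on the variation of `f` in
  -- the ball and on the first-order term.
  set δ : ℝ := κ * c₁ * G₀ ^ 2 / 4 with hδ
  have hδ0 : 0 < δ := by positivity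
  obtain ⟨τ, hτ, hroom⟩ := eventually_room hρm hρ hfc hAc.continuousAt (hfU z₀ hz₀)
    (by rw [hAz₀]; exact hseg) hδ0
  have hgc : ContinuousAt (fun z => gap ρm ρp (f z) ^ 2) z₀ :=
    (ContinuousAt.comp (continuousAt_gap (hdens z₀ hz₀).ne') hfc).pow 2
  have hg2 := hgc.eventually_lt_const (u := 2 * G₀ ^ 2) (by
    show G₀ ^ 2 < 2 * G₀ ^ 2
    nlinarith [pow_pos hG₀pos 2])
  obtain ⟨r₀, hr₀, hball⟩ := Metric.nhds_basis_closedBall.mem_iff.1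
    (inter_mem (inter_mem hroom hg2) (hO.mem_nhds hz₀))
  refine ⟨r₀, hr₀, fun z hz => (hball hz).2, fun r hr hrr => ?_⟩
  set B := Metric.closedBall z₀ r with hB
  have hBsub : B ⊆ Metric.closedBall z₀ r₀ := Metric.closedBall_subset_closedBall hrr
  have hBO : B ⊆ O := fun z hz => (hball (hBsub hz)).2
  have hBc : IsCompact B := isCompact_closedBall _ _
  have hBm : MeasurableSet B := hBc.measurableSet
  -- The inner radius is half the outer one, which fixes the volume fraction in `κ`.
  let φ : ContDiffBump z₀ := ⟨r / 2, r, by positivity, by linarith⟩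
  set χ : Space d × ℝ → ℝ := fun z => s * φ z with hχ
  have hφc : ContDiff ℝ ∞ φ := φ.contDiff
  have hχc : ContDiff ℝ ∞ χ := contDiff_const.mul hφc
  have hφB : ∀ z ∉ B, φ z = 0 := fun z hz => φ.zero_of_le_dist (by
    rw [hB, Metric.mem_closedBall, not_le] at hz; exact hz.le)
  have hχB : ∀ z ∉ B, χ z = 0 := fun z hz => by simp [hχ, hφB z hz]
  have hχs : tsupport χ ⊆ B := closure_minimal (fun z hz => by
    by_contra h; exact hz (hχB z h)) hBc.isClosed
  have hηs : ∀ N, tsupport (oscPotential ℓ χ N) ⊆ B := fun N =>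
    (tsupport_oscPotential_subset ℓ χ N).trans hχs
  have hηc : ∀ N, HasCompactSupport (oscPotential ℓ χ N) := fun N =>
    hBc.of_isClosed_subset (isClosed_tsupport _) (hηs N)
  obtain ⟨C, hC⟩ := hBc.exists_bound_of_continuousOn (hp.continuousOn_deriv.mono hBO)
  set P : ℕ → Space d × ℝ → State := fun N =>
    sheet g ρ₁ ρ₂ b₁ b₂ z₀.2 py (oscPotential ℓ χ N) with hP
  have hPc : ∀ N, Continuous (P N) := fun N =>
    continuous_sheet hO hp.continuousOn_deriv (contDiff_oscPotential ℓ hχc N) ((hηs N).trans hBO)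
  have hPA : ∀ τ > 0, ∀ᶠ N : ℕ in atTop, ∀ z, ‖P N z - (χ z * Real.sin (N * ℓ z)) • A' z‖ ≤ τ :=
    fun τ hτ => eventually_norm_sheet_sub_le hBc hχc hχB hℓX hC hτ
  have hweak : ∀ h : Space d × ℝ → State, Integrable h →
      Tendsto (fun N => ∫ z, inner ℝ (P N z) (h z)) atTop (𝓝 0) := fun h hh =>
    tendsto_integral_inner_of_norm_sub_le volume hℓ0 hPc hA'c hχc.continuous
      (hBc.of_isClosed_subset (isClosed_tsupport _) hχs) hPA hh
  refine ⟨P, hPc, fun N z hz => sheet_eq_zero fun h => hz (hηs N h), fun N j ψ hψ =>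
    integral_inner_sheet_nullField hO hp (contDiff_oscPotential ℓ hχc N) (hηc N)
      ((hηs N).trans hBO) hψ, hweak, ?_⟩
  have hslope : ContinuousOn (fun z => gapSlope ρm ρp (f z)) B := fun z hz =>
    (continuousAt_gapSlope (hdens z (hBO hz)).ne').comp_continuousWithinAt (hf.mono hBO z hz)
  -- The first-order part of the gap is one more admissible weak test function, once it is cut off
  -- outside the compact ball.
  have hsl := hweak (B.indicator fun z => gapSlope ρm ρp (f z))
    ((integrable_indicator_iff hBm).2 (hslope.integrableOn_compact hBc))
  set V := volume.real B with hV
  have hV0 : 0 < V :=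
    ENNReal.toReal_pos (Metric.measure_closedBall_pos _ z₀ hr).ne' measure_closedBall_lt_top.ne
  have hsl' := hsl.eventually_lt_const (u := δ * V) (by positivity)
  have hbs := ae_le_setIntegral_bump_sin volume hℓ0 φ rfl
  filter_upwards [hPA τ hτ, hsl', hbs] with N hN1 hN2 hN3
  have hpt : ∀ z ∈ B, f z + P N z ∈ interior (hull ρm ρp R) ∧
      gap ρm ρp (f z + P N z) ≤ gap ρm ρp (f z) + inner ℝ (P N z) (gapSlope ρm ρp (f z))
        - c₁ * G₀ ^ 2 * (φ z * Real.sin (N * ℓ z)) ^ 2 + δ := by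
    intro z hz
    have h1 := (hball (hBsub hz)).1.1 (P N z - (χ z * Real.sin (N * ℓ z)) • A' z) (hN1 z)
      (φ z * Real.sin (N * ℓ z)) (by
        rw [mem_Icc, ← abs_le, abs_mul, abs_of_nonneg φ.nonneg]
        exact mul_le_one₀ φ.le_one (abs_nonneg _) (Real.abs_sin_le_one _))
    have e : (φ z * Real.sin (N * ℓ z)) • A z + (P N z - (χ z * Real.sin (N * ℓ z)) • A' z)
        = P N z := by
      simp only [hA, hχ, smul_smul]
      rw [show φ z * Real.sin (N * ℓ z) * s = s * φ z * Real.sin (N * ℓ z) by ring]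
      abel
    rw [e] at h1
    refine ⟨h1.1, ?_⟩
    have hm := density_mem_of_mem_hull hρ (interior_subset h1.1)
    have hadd : (f z + P N z) 0 = f z 0 + P N z 0 := rfl
    rw [hadd] at hm
    have h2 := gap_add_le (ρm := ρm) (hdens z (hBO hz)) (by linarith [hm.1]) hm.2
    have h3 : c₁ * G₀ ^ 2 ≤ gapForm ρp (f z₀) (A z₀) := by rw [hAz₀]; exact hform
    have h4 := mul_le_mul_of_nonneg_left h3 (sq_nonneg (φ z * Real.sin (N * ℓ z)))
    have h5 := h1.2
    linarith
  refine ⟨fun z hz => (hpt z hz).1, ?_⟩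
  have cf : ContinuousOn (fun z => gap ρm ρp (f z)) B :=
    continuousOn_gap_comp hρm hρ (hf.mono hBO) fun z hz => interior_subset (hfU z (hBO hz))
  have ifP : IntegrableOn (fun z => gap ρm ρp (f z + P N z)) B :=
    (continuousOn_gap_comp hρm hρ ((hf.mono hBO).add (hPc N).continuousOn)
      fun z hz => interior_subset (hpt z hz).1).integrableOn_compact hBc
  have if1 : IntegrableOn (fun z => gap ρm ρp (f z)) B := cf.integrableOn_compact hBc
  have if2 : IntegrableOn (fun z => gap ρm ρp (f z) ^ 2) B := (cf.pow 2).integrableOn_compact hBc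
  have if3 : IntegrableOn (fun z => inner ℝ (P N z) (gapSlope ρm ρp (f z))) B :=
    ((hPc N).continuousOn.inner hslope).integrableOn_compact hBc
  have if4 : IntegrableOn (fun z => c₁ * G₀ ^ 2 * (φ z * Real.sin (N * ℓ z)) ^ 2) B :=
    ((continuous_const.mul ((φ.continuous.mul (by fun_prop)).pow 2)).continuousOn).integrableOn_compact
      hBc
  have if5 : IntegrableOn (fun _ : Space d × ℝ => δ) B :=
    continuousOn_const.integrableOn_compact hBc
  have hI := setIntegral_mono_on ifP (((if1.add if3).sub if4).add if5) hBm fun z hz => (hpt z hz).2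
  have e1 : ∫ z in B, (gap ρm ρp (f z) + inner ℝ (P N z) (gapSlope ρm ρp (f z))
      - c₁ * G₀ ^ 2 * (φ z * Real.sin (N * ℓ z)) ^ 2 + δ)
      = (∫ z in B, gap ρm ρp (f z)) + (∫ z in B, inner ℝ (P N z) (gapSlope ρm ρp (f z)))
      - c₁ * G₀ ^ 2 * (∫ z in B, (φ z * Real.sin (N * ℓ z)) ^ 2) + V * δ := by
    have a1 := integral_add if1 if3
    have a2 := integral_sub (if1.add if3) if4
    have a3 := integral_add ((if1.add if3).sub if4) if5
    simp only [Pi.add_apply, Pi.sub_apply] at a2 a3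
    rw [a3, a2, a1, integral_const_mul]
    simp [hV]
  have e2 : ∫ z, inner ℝ (P N z) (B.indicator (fun z => gapSlope ρm ρp (f z)) z)
      = ∫ z in B, inner ℝ (P N z) (gapSlope ρm ρp (f z)) := by
    rw [← integral_indicator hBm]
    congr 1
    ext z
    by_cases hz : z ∈ B <;> simp [hz]
  have hI2 : ∫ z in B, gap ρm ρp (f z) ^ 2 ≤ 2 * G₀ ^ 2 * V := by
    have := setIntegral_mono_on if2 (continuousOn_const.integrableOn_compact hBc) hBm
      (g := fun _ => 2 * G₀ ^ 2) fun z hz => (hball (hBsub hz)).1.2.le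
    refine this.trans (le_of_eq ?_)
    simp [hV]
    ring
  have hI' := hI.trans_eq e1
  rw [e2] at hN2
  have hN3' : c₁ * G₀ ^ 2 * (κ * V) ≤ c₁ * G₀ ^ 2 * ∫ z in B, (φ z * Real.sin (N * ℓ z)) ^ 2 :=
    mul_le_mul_of_nonneg_left hN3 (by positivity)
  have hI2' := mul_le_mul_of_nonneg_left hI2 (show 0 ≤ κ * c₁ / 4 by positivity)
  have hδV : δ * V = κ * c₁ * G₀ ^ 2 / 4 * V := by rw [hδ]
  -- The loss `κ * c₁ * G₀ ^ 2 * V` minus two errors `δ * V` leaves one half of it, and the integral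
  -- of the squared gap is at most `2 * G₀ ^ 2 * V`; hence the constant `κ * c₁ / 4`.
  nlinarith

end

/-! ### Decreasing the gap in the whole domain -/

noncomputable section

variable {d : ℕ}

theorem exists_bound_gap {ρm ρp : ℝ} (hρm : 0 < ρm) (hρ : ρm < ρp) (R : ℝ) :
    ∃ M, ∀ z ∈ hull ρm ρp R, |gap ρm ρp z| ≤ M :=
  (isCompact_hull ρm ρp R).exists_bound_of_continuousOn
    (continuousOn_gap_comp (f := fun z => z) hρm hρ continuousOn_id fun _ hz => hz)

theorem integrableOn_gap {ρm ρp R : ℝ} (hρm : 0 < ρm) (hρ : ρm < ρp) {O : Set (Space d × ℝ)}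
    (hO : IsOpen O) (hOv : volume O ≠ ⊤) {f : Space d × ℝ → State} (hf : ContinuousOn f O)
    (hfU : ∀ z ∈ O, f z ∈ hull ρm ρp R) : IntegrableOn (fun z => gap ρm ρp (f z)) O := by
  obtain ⟨M, hM⟩ := exists_bound_gap hρm hρ R
  exact IntegrableOn.of_bound hOv.lt_top
    ((continuousOn_gap_comp hρm hρ hf hfU).aestronglyMeasurable hO.measurableSet) M
    ((ae_restrict_iff' hO.measurableSet).2 (Eventually.of_forall fun z hz => hM _ (hfU z hz)))

theorem integrableOn_gap_sq {ρm ρp R : ℝ} (hρm : 0 < ρm) (hρ : ρm < ρp) {O : Set (Space d × ℝ)}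
    (hO : IsOpen O) (hOv : volume O ≠ ⊤) {f : Space d × ℝ → State} (hf : ContinuousOn f O)
    (hfU : ∀ z ∈ O, f z ∈ hull ρm ρp R) : IntegrableOn (fun z => gap ρm ρp (f z) ^ 2) O := by
  obtain ⟨M, hM⟩ := exists_bound_gap hρm hρ R
  refine IntegrableOn.of_bound hOv.lt_top
    (((continuousOn_gap_comp hρm hρ hf hfU).pow 2).aestronglyMeasurable hO.measurableSet) (M ^ 2)
    ((ae_restrict_iff' hO.measurableSet).2 (Eventually.of_forall fun z hz => ?_))
  rw [norm_pow]
  exact pow_le_pow_left₀ (norm_nonneg _) (hM _ (hfU z hz)) 2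

/-- Cauchy–Schwarz from the nonnegativity of a variance; `V + 1` in place of the total mass avoids a
division by zero. -/
theorem sq_integral_le {α : Type*} [MeasurableSpace α] {μ : Measure α} [IsFiniteMeasure μ]
    {u : α → ℝ} (hu : Integrable u μ) (hu2 : Integrable (fun x => u x ^ 2) μ) :
    (∫ x, u x ∂μ) ^ 2 ≤ (μ.real univ + 1) * ∫ x, u x ^ 2 ∂μ := by
  set V := μ.real univ
  have hV : 0 ≤ V := measureReal_nonneg
  set I := ∫ x, u x ∂μ
  set m := I / (V + 1) with hm
  have h0 : 0 ≤ ∫ x, (u x - m) ^ 2 ∂μ := integral_nonneg fun x => sq_nonneg _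
  have e : ∫ x, (u x - m) ^ 2 ∂μ = (∫ x, u x ^ 2 ∂μ) - 2 * m * I + V * m ^ 2 := by
    have h1 : ∀ x, (u x - m) ^ 2 = u x ^ 2 - 2 * m * u x + m ^ 2 := fun x => by ring
    have a1 := integral_sub hu2 (hu.const_mul (2 * m))
    have a2 := integral_add (hu2.sub (hu.const_mul (2 * m))) (integrable_const (m ^ 2))
    simp only [Pi.sub_apply] at a2
    simp only [h1]
    rw [a2, a1, integral_const_mul, integral_const, smul_eq_mul]
  rw [e] at h0
  have hI : I = m * (V + 1) := by rw [hm]; field_simp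
  rw [hI] at h0 ⊢
  nlinarith [sq_nonneg m]

theorem continuousOn_nullField {g : ℝ} {O : Set (Space d × ℝ)} {p ψ : Space d × ℝ → ℝ}
    (hp : ContinuousOn p O) (hψ : ContDiff ℝ ∞ ψ) (j : Fin 7) :
    ContinuousOn (nullField g p ψ j) O := by
  have h0 := hψ.continuous.continuousOn (s := O)
  have h1 := (contDiff_derivX hψ).continuous.continuousOn (s := O)
  have h2 := (contDiff_derivY hψ).continuous.continuousOn (s := O)
  have h3 := (contDiff_deriv_dir (dirT d) hψ).continuous.continuousOn (s := O)
  fin_cases j <;> unfold nullField <;>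
    refine (PiLp.continuous_toLp 2 _).comp_continuousOn (continuousOn_pi.2 fun i => ?_) <;>
    fin_cases i <;> simp <;> fun_prop

theorem exists_bound_nullField {g Cp : ℝ} {O : Set (Space d × ℝ)} (hO : Bornology.IsBounded O)
    {p ψ : Space d × ℝ → ℝ} (hp : ∀ z ∈ O, |p z| ≤ Cp) (hψ : ContDiff ℝ ∞ ψ) (j : Fin 7) :
    ∃ M, ∀ z ∈ O, ‖nullField g p ψ j z‖ ≤ M := by
  have hK : IsCompact (closure O) := hO.isCompact_closure
  obtain ⟨C0, h0⟩ := hK.exists_bound_of_continuousOn hψ.continuous.continuousOn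
  obtain ⟨C1, h1⟩ := hK.exists_bound_of_continuousOn (contDiff_derivX hψ).continuous.continuousOn
  obtain ⟨C2, h2⟩ := hK.exists_bound_of_continuousOn (contDiff_derivY hψ).continuous.continuousOn
  obtain ⟨C3, h3⟩ := hK.exists_bound_of_continuousOn
    (contDiff_deriv_dir (dirT d) hψ).continuous.continuousOn
  set C := |C0| + |C1| + |C2| + |C3| with hC
  have n0 := abs_nonneg C0
  have n1 := abs_nonneg C1
  have n2 := abs_nonneg C2
  have n3 := abs_nonneg C3
  have hC0 : 0 ≤ C := by positivity
  refine ⟨4 * ((1 + |g| + |Cp|) * C), fun z hz => State.norm_le (by positivity) fun i => ?_⟩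
  have hz' := subset_closure hz
  have k0 : |ψ z| ≤ C := (h0 z hz').trans (by linarith [le_abs_self C0])
  have k1 : |derivX ψ z| ≤ C := (h1 z hz').trans (by linarith [le_abs_self C1])
  have k2 : |derivY ψ z| ≤ C := (h2 z hz').trans (by linarith [le_abs_self C2])
  have k3 : |deriv_dir (dirT d) ψ z| ≤ C := (h3 z hz').trans (by linarith [le_abs_self C3])
  have kp : |p z| ≤ |Cp| := (hp z hz).trans (le_abs_self _)
  have ng := abs_nonneg g
  have np := abs_nonneg Cp
  have b0 : 0 ≤ (1 + |g| + |Cp|) * C := by positivity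
  have b1 : ∀ {x : ℝ}, |x| ≤ C → |x| ≤ (1 + |g| + |Cp|) * C := fun h => h.trans (by nlinarith)
  have b2 : |g| * |ψ z| ≤ (1 + |g| + |Cp|) * C := by
    nlinarith [mul_le_mul_of_nonneg_left k0 ng]
  have b3 : ∀ {x : ℝ}, |x| ≤ C → |p z| * |x| ≤ (1 + |g| + |Cp|) * C := fun h => by
    nlinarith [mul_le_mul kp h (abs_nonneg _) np]
  have b4 : |deriv_dir (dirT d) ψ z| / 2 ≤ (1 + |g| + |Cp|) * C := by
    linarith [b1 k3, abs_nonneg (deriv_dir (dirT d) ψ z)]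
  fin_cases j <;> fin_cases i <;> simp only [nullField] <;>
    first
    | (simpa using b0) | (simpa using b1 k0) | (simpa using b1 k1) | (simpa using b1 k2)
    | (simpa using b1 k3) | (simpa [abs_mul] using b2) | (simpa [abs_mul] using b3 k1)
    | (simpa [abs_mul] using b3 k2) | (simpa [abs_div] using b4)

theorem integrable_inner_of_bound {α : Type*} [MeasurableSpace α] {μ : Measure α}
    {Q h : α → State} {C : ℝ} (hQ : AEStronglyMeasurable Q μ) (hC : ∀ x, ‖Q x‖ ≤ C)
    (hh : Integrable h μ) : Integrable (fun x => inner ℝ (Q x) (h x)) μ := by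
  refine (hh.norm.const_mul C).mono (hQ.inner hh.aestronglyMeasurable)
    (Eventually.of_forall fun x => ?_)
  rw [norm_mul, norm_norm]
  refine (norm_inner_le_norm _ _).trans ?_
  gcongr
  exact (hC x).trans (Real.le_norm_self C)

theorem integrableOn_nullField {g Cp : ℝ} {O : Set (Space d × ℝ)} (hO : IsOpen O)
    (hOb : Bornology.IsBounded O) {p ψ : Space d × ℝ → ℝ} (hpc : ContinuousOn p O)
    (hp : ∀ z ∈ O, |p z| ≤ Cp) (hψ : ContDiff ℝ ∞ ψ) (j : Fin 7) :
    IntegrableOn (nullField g p ψ j) O := by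
  obtain ⟨M, hM⟩ := exists_bound_nullField (g := g) hOb hp hψ j
  exact IntegrableOn.of_bound hOb.measure_lt_top
    ((continuousOn_nullField hpc hψ j).aestronglyMeasurable hO.measurableSet) M
    ((ae_restrict_iff' hO.measurableSet).2 (Eventually.of_forall hM))

/-- Local perturbations in disjoint balls do not interact, so their losses add up to a multiple of
the integral of the squared gap, and Cauchy–Schwarz compares this with the square of the integral.
Finitely many balls are used, so one frequency serves all of them. -/
theorem exists_perturbation (hd : (0 : Fin (d + 1)) ≠ Fin.last d) {ρm ρp R : ℝ}
    (hρm : 0 < ρm) (hρ : ρm < ρp) {g Cp : ℝ} {O : Set (Space d × ℝ)} (hO : IsOpen O)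
    (hOb : Bornology.IsBounded O) {p py : Space d × ℝ → ℝ} (hp : IsPressure O p py)
    (hCp : ∀ z ∈ O, |p z| ≤ Cp) : ∃ c > 0, ∀ f : Space d × ℝ → State, ContinuousOn f O →
      (∀ z ∈ O, f z ∈ interior (hull ρm ρp R)) → ∀ {ι : Type} (F : Finset ι)
      (h : ι → Space d × ℝ → State), (∀ i ∈ F, IntegrableOn (h i) O) → ∀ ε > 0,
      ∃ Q : Space d × ℝ → State, Continuous Q ∧
        (∀ z ∈ O, f z + Q z ∈ interior (hull ρm ρp R)) ∧
        (∀ j ψ, IsNullTest j ψ → ∫ z in O, inner ℝ (Q z) (nullField g p ψ j z) = 0) ∧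
        (∀ i ∈ F, |∫ z in O, inner ℝ (Q z) (h i z)| ≤ ε) ∧
        ∫ z in O, gap ρm ρp (f z + Q z) ≤
          (∫ z in O, gap ρm ρp (f z)) - c * (∫ z in O, gap ρm ρp (f z)) ^ 2 := by
  classical
  have hOm := hO.measurableSet
  have hOv : volume O ≠ ⊤ := hOb.measure_lt_top.ne
  have : IsFiniteMeasure (volume.restrict O) := ⟨by simpa using hOb.measure_lt_top⟩
  obtain ⟨c₀, hc₀, hloc⟩ := exists_local_perturbation d hd (R := R) hρm hρ
  set V := (volume.restrict O).real univ with hV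
  have hV0 : 0 ≤ V := measureReal_nonneg
  refine ⟨c₀ / (2 * (V + 1)), by positivity, fun f hf hfU ι F h hh ε hε => ?_⟩
  have hfH : ∀ z ∈ O, f z ∈ hull ρm ρp R := fun z hz => interior_subset (hfU z hz)
  have ig := integrableOn_gap hρm hρ hO hOv hf hfH
  have ig2 := integrableOn_gap_sq hρm hρ hO hOv hf hfH
  have hl := hloc (g := g) hO hp hf hfU
  choose! r₀ hr₀ hr₀O hP using hl
  -- The admissible radii vary with the centre without a lower bound; the Besicovitch theorem still
  -- supplies disjoint balls that exhaust the domain up to a null set.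
  obtain ⟨t, r, htc, htO, hr, hcov, hdisj⟩ := Besicovitch.exists_disjoint_closedBall_covering_ae
    volume (fun _ => univ) O (fun x _ δ hδ => by simpa using hδ) r₀ hr₀
  set B : Space d × ℝ → Set (Space d × ℝ) := fun x => Metric.closedBall x (r x) with hBdef
  have hBm : ∀ x, MeasurableSet (B x) := fun x => Metric.isClosed_closedBall.measurableSet
  have hBO : ∀ x ∈ t, B x ⊆ O := fun x hx =>
    (Metric.closedBall_subset_closedBall (hr x hx).2.2.le).trans (hr₀O x (htO hx))
  have hcount : Countable t := htc.to_subtype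
  set I := ∫ z in O, gap ρm ρp (f z) ^ 2 with hI
  have hI0 : 0 ≤ I := integral_nonneg fun z => sq_nonneg _
  -- A finite subfamily retains half of the integral, which costs the factor 2 in the constant.
  obtain ⟨T, hT⟩ : ∃ T : Finset t, I / 2 ≤ ∑ x ∈ T, ∫ z in B x, gap ρm ρp (f z) ^ 2 := by
    rcases hI0.eq_or_lt with h0 | h0
    · exact ⟨∅, by simp [← h0]⟩
    have hU : (⋃ x : t, B x) ⊆ O := iUnion_subset fun x => hBO x x.2
    have hs := hasSum_integral_iUnion (μ := volume) (f := fun z => gap ρm ρp (f z) ^ 2)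
      (s := fun x : t => B x) (fun x => hBm x)
      (fun x y hxy => hdisj x.2 y.2 (Subtype.coe_injective.ne hxy)) (ig2.mono_set hU)
    have e : ∫ z in ⋃ x : t, B x, gap ρm ρp (f z) ^ 2 = I := by
      refine setIntegral_congr_set (hU.eventuallyLE.antisymm ?_)
      rw [ae_le_set]
      rw [biUnion_eq_iUnion] at hcov
      exact hcov
    rw [e] at hs
    obtain ⟨T, hT⟩ := (hs.eventually_const_lt (show I / 2 < I by linarith)).exists
    exact ⟨T, hT.le⟩
  choose! P hPc hP0 hPn hPw hPe using fun x : t => hP x (htO x.2) (r x) (hr x x.2).2.1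
    (hr x x.2).2.2.le
  have hPb : ∀ x N, ∃ C, ∀ z, ‖P x N z‖ ≤ C := fun x N =>
    (hPc x N).bounded_above_of_compact_support ((isCompact_closedBall _ _).of_isClosed_subset
      (isClosed_tsupport _) (closure_minimal (fun z hz => by
        by_contra h'; exact hz (hP0 x N z h')) Metric.isClosed_closedBall))
  have hPint : ∀ x N {k : Space d × ℝ → State}, IntegrableOn k O →
      IntegrableOn (fun z => inner ℝ (P x N z) (k z)) O := fun x N k hk => by
    obtain ⟨C, hC⟩ := hPb x N
    exact integrable_inner_of_bound (hPc x N).aestronglyMeasurable hC hk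
  have hPO : ∀ x N (k : Space d × ℝ → State),
      ∫ z in O, inner ℝ (P x N z) (k z) = ∫ z, inner ℝ (P x N z) (k z) := fun x N k => by
    refine setIntegral_eq_integral_of_forall_compl_eq_zero fun z hz => ?_
    rw [hP0 x N z fun h' => hz (hBO x x.2 h'), inner_zero_left]
  have hsum : ∀ N {k : Space d × ℝ → State}, IntegrableOn k O →
      ∫ z in O, inner ℝ (∑ x ∈ T, P x N z) (k z) = ∑ x ∈ T, ∫ z, inner ℝ (P x N z) (k z) :=
    fun N k hk => by
      simp only [sum_inner]
      rw [integral_finsetSum _ fun x _ => hPint x N hk]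
      exact Finset.sum_congr rfl fun x _ => hPO x N k
  have hw : ∀ i ∈ F, ∀ᶠ N in atTop, |∫ z in O, inner ℝ (∑ x ∈ T, P x N z) (h i z)| ≤ ε := by
    intro i hi
    have h1 : Tendsto (fun N => ∑ x ∈ T, ∫ z, inner ℝ (P x N z) (O.indicator (h i) z)) atTop
        (𝓝 (∑ x ∈ T, 0)) :=
      tendsto_finsetSum _ fun x _ => hPw x _ ((integrable_indicator_iff hOm).2 (hh i hi))
    rw [Finset.sum_const_zero] at h1
    have h2 := h1.abs
    rw [abs_zero] at h2
    filter_upwards [h2.eventually_lt_const hε] with N hN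
    rw [hsum N (hh i hi)]
    refine le_of_eq_of_le (congrArg _ (Finset.sum_congr rfl fun x _ => ?_)) hN.le
    rw [← hPO, ← hPO]
    refine setIntegral_congr_fun hOm fun z hz => ?_
    simp [hz]
  -- Only finitely many conditions are imposed, so a common frequency exists.
  obtain ⟨N, hN1, hN2⟩ := (((Finset.eventually_all F).2 hw).and
    ((Finset.eventually_all T).2 fun x _ => hPe x)).exists
  set Q : Space d × ℝ → State := fun z => ∑ x ∈ T, P x N z with hQ
  have hQB : ∀ x ∈ T, ∀ z ∈ B x, Q z = P x N z := by
    intro x hx z hz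
    refine Finset.sum_eq_single_of_mem x hx fun y hy hyx => hP0 y N z fun hz' => ?_
    exact (hdisj y.2 x.2 (Subtype.coe_injective.ne hyx)).le_bot ⟨hz', hz⟩
  have hQ0 : ∀ z, (∀ x ∈ T, z ∉ B x) → Q z = 0 := fun z hz =>
    Finset.sum_eq_zero fun x hx => hP0 x N z (hz x hx)
  have hQc : Continuous Q := continuous_finsetSum _ fun x _ => hPc x N
  have hQU : ∀ z ∈ O, f z + Q z ∈ interior (hull ρm ρp R) := by
    intro z hz
    by_cases hz' : ∃ x ∈ T, z ∈ B x
    · obtain ⟨x, hx, hzx⟩ := hz'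
      rw [hQB x hx z hzx]
      exact (hN2 x hx).1 z hzx
    · push Not at hz'
      rw [hQ0 z hz', add_zero]
      exact hfU z hz
  have igQ : IntegrableOn (fun z => gap ρm ρp (f z + Q z)) O :=
    integrableOn_gap hρm hρ hO hOv (hf.add hQc.continuousOn) fun z hz => interior_subset (hQU z hz)
  have igD : IntegrableOn (fun z => gap ρm ρp (f z) - gap ρm ρp (f z + Q z)) O := ig.sub igQ
  refine ⟨Q, hQc, hQU, fun j ψ hψ => ?_, fun i hi => hN1 i hi, ?_⟩
  · rw [hsum N (integrableOn_nullField hO hOb hp.continuousOn hCp hψ.1 j)]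
    exact Finset.sum_eq_zero fun x _ => hPn x N j ψ hψ
  have hdrop : ∫ z in O, (gap ρm ρp (f z) - gap ρm ρp (f z + Q z))
      = ∑ x ∈ T, ∫ z in B x, (gap ρm ρp (f z) - gap ρm ρp (f z + Q z)) := by
    rw [← integral_biUnion_finset T (fun x _ => hBm x)
      (fun x _ y _ hxy => hdisj x.2 y.2 (Subtype.coe_injective.ne hxy))
      (fun x _ => igD.mono_set (hBO x x.2))]
    refine setIntegral_eq_of_subset_of_forall_sdiff_eq_zero hOm
      (iUnion₂_subset fun x _ => hBO x x.2) fun z hz => ?_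
    rw [hQ0 z fun x hx h' => hz.2 (mem_iUnion₂.2 ⟨x, hx, h'⟩)]
    simp
  have hterm : ∀ x ∈ T, c₀ * ∫ z in B x, gap ρm ρp (f z) ^ 2
      ≤ ∫ z in B x, (gap ρm ρp (f z) - gap ρm ρp (f z + Q z)) := by
    intro x hx
    have h1 := (hN2 x hx).2
    rw [integral_sub (ig.mono_set (hBO x x.2)) (igQ.mono_set (hBO x x.2))]
    have h2 : ∫ z in B x, gap ρm ρp (f z + Q z) = ∫ z in B x, gap ρm ρp (f z + P x N z) :=
      setIntegral_congr_fun (hBm x) fun z hz => by simp only [hQB x hx z hz]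
    simp only [hBdef] at h1 h2 ⊢
    linarith
  have h1 := Finset.sum_le_sum hterm
  rw [← Finset.mul_sum, ← hdrop, integral_sub ig igQ] at h1
  have h2 := mul_le_mul_of_nonneg_left hT hc₀.le
  have h3 := sq_integral_le ig ig2
  have h4 : c₀ / (2 * (V + 1)) * (∫ z in O, gap ρm ρp (f z)) ^ 2 ≤ c₀ * (I / 2) := by
    calc _ ≤ c₀ / (2 * (V + 1)) * ((V + 1) * I) := by gcongr
      _ = _ := by field_simp
  linarith

end

/-! ### From strict subsolutions to two-phase states -/

noncomputable section

variable {d : ℕ}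

theorem integrable_inner_of_memLp {α : Type*} [MeasurableSpace α] {μ : Measure α} {E : Type*}
    [NormedAddCommGroup E] [InnerProductSpace ℝ E] {Q h : α → E}
    (hQ : MemLp Q 2 μ) (hh : MemLp h 2 μ) : Integrable (fun x => inner ℝ (Q x) (h x)) μ := by
  refine (L2.integrable_inner (𝕜 := ℝ) (hQ.toLp Q) (hh.toLp h)).congr ?_
  filter_upwards [hQ.coeFn_toLp, hh.coeFn_toLp] with x h1 h2
  rw [h1, h2]

/-- **Convex integration.** A strict subsolution of the relaxed equations can be approximated weakly
by solutions. -/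
theorem exists_mem_phaseSet_near (hd : (0 : Fin (d + 1)) ≠ Fin.last d) {ρm ρp R : ℝ}
    (hρm : 0 < ρm) (hρ : ρm < ρp) {g Cp : ℝ} {O : Set (Space d × ℝ)} (hO : IsOpen O)
    (hOb : Bornology.IsBounded O) {p py : Space d × ℝ → ℝ} (hp : IsPressure O p py)
    (hCp : ∀ z ∈ O, |p z| ≤ Cp) {f : Space d × ℝ → State} (hf : ContinuousOn f O)
    (hfU : ∀ z ∈ O, f z ∈ interior (hull ρm ρp R))
    (F : Finset (Lp State 2 (volume.restrict O))) {ε : ℝ} (hε : 0 < ε) :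
    ∃ w : Space d × ℝ → State, AEStronglyMeasurable w (volume.restrict O) ∧
      (∀ᵐ z ∂volume.restrict O, w z ∈ phaseSet ρm ρp R) ∧
      (∀ j ψ, IsNullTest j ψ → ∫ z in O, inner ℝ (w z - f z) (nullField g p ψ j z) = 0) ∧
      ∀ h ∈ F, |∫ z in O, inner ℝ (w z - f z) (h z)| ≤ ε := by
  classical
  have hOm := hO.measurableSet
  have hfin : IsFiniteMeasure (volume.restrict O) := ⟨by simpa using hOb.measure_lt_top⟩
  obtain ⟨c, hc, hstep⟩ := exists_perturbation (g := g) hd (R := R) hρm hρ hO hOb hp hCp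
  obtain ⟨C, hC⟩ := (isCompact_hull ρm ρp R).exists_bound_of_continuousOn continuousOn_id
  simp only [id] at hC
  obtain ⟨M, hM⟩ := exists_bound_gap hρm hρ R
  have hmem : ∀ {k : Space d × ℝ → State}, ContinuousOn k O → (∀ z ∈ O, k z ∈ hull ρm ρp R) →
      MemLp k 2 (volume.restrict O) := fun hk hkU => MemLp.of_bound (hk.aestronglyMeasurable hOm) C
        ((ae_restrict_iff' hOm).2 (Eventually.of_forall fun z hz => hC _ (hkU z hz)))
  have hfL := hmem hf fun z hz => interior_subset (hfU z hz)
  have hnL : ∀ (j : Fin 7) {ψ : Space d × ℝ → ℝ}, ContDiff ℝ ∞ ψ →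
      MemLp (nullField g p ψ j) 2 (volume.restrict O) := fun j ψ hψ => by
    obtain ⟨M, hM⟩ := exists_bound_nullField (g := g) hOb hCp hψ j
    exact MemLp.of_bound ((continuousOn_nullField hp.continuousOn hψ j).aestronglyMeasurable hOm) M
      ((ae_restrict_iff' hOm).2 (Eventually.of_forall hM))
  have hinner : ∀ (Z Z' H : Lp State 2 (volume.restrict O)), inner ℝ (Z - Z') H = ∫ z, inner ℝ (Z z - Z' z) (H z) ∂(volume.restrict O) := by
    intro Z Z' H
    rw [L2.inner_def]
    refine integral_congr_ae ?_
    filter_upwards [Lp.coeFn_sub Z Z'] with z hz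
    rw [hz, Pi.sub_apply]
  -- The continuous representative is retained because the perturbation step needs continuity; it is
  -- lost only in the limit.
  let X : Set (Lp State 2 (volume.restrict O)) := {Z | ∃ k : Space d × ℝ → State, ContinuousOn k O ∧
    (∀ z ∈ O, k z ∈ interior (hull ρm ρp R)) ∧ Z =ᵐ[volume.restrict O] k ∧
    ∀ j ψ, IsNullTest j ψ → ∫ z, inner ℝ (k z - f z) (nullField g p ψ j z) ∂(volume.restrict O) = 0}
  have hXhull : ∀ Z ∈ X, ∀ᵐ z ∂(volume.restrict O), Z z ∈ hull ρm ρp R := by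
    rintro Z ⟨k, -, hkU, hZk, -⟩
    filter_upwards [hZk, ae_restrict_mem hOm] with z h1 h2
    rw [h1]
    exact interior_subset (hkU z h2)
  have hXb : ∀ Z ∈ X, ‖Z‖ ≤ (measureUnivNNReal (volume.restrict O) : ℝ) ^ (2 : ℝ≥0∞).toReal⁻¹ * |C| := by
    intro Z hZ
    refine Lp.norm_le_of_ae_bound (abs_nonneg C) ?_
    filter_upwards [hXhull Z hZ] with z hz
    exact (hC _ hz).trans (le_abs_self C)
  have hXG : ∀ Z ∈ X, 0 ≤ ∫ z, gap ρm ρp (Z z) ∂(volume.restrict O) := fun Z hZ =>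
    integral_nonneg_of_ae ((hXhull Z hZ).mono fun z hz => gap_nonneg hρm hρ hz)
  have hXstep : ∀ Z ∈ X, ∀ F : Finset (Lp State 2 (volume.restrict O)), ∀ ε > 0, ∃ Z' ∈ X,
      (∀ H ∈ F, |inner ℝ (Z' - Z) H| ≤ ε) ∧
      ∫ z, gap ρm ρp (Z' z) ∂(volume.restrict O) ≤ (∫ z, gap ρm ρp (Z z) ∂(volume.restrict O)) - c * (∫ z, gap ρm ρp (Z z) ∂(volume.restrict O)) ^ 2 := by
    rintro Z ⟨k, hk, hkU, hZk, hkn⟩ F ε hε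
    obtain ⟨Q, hQ, hQU, hQn, hQF, hQg⟩ := hstep k hk hkU (ι := F)
      Finset.univ (fun H => (H : Lp State 2 (volume.restrict O))) (fun H _ =>
        (Lp.memLp (H : Lp State 2 (volume.restrict O))).integrable one_le_two) ε hε
    have hkQ := hk.add hQ.continuousOn
    have hkQL := hmem hkQ fun z hz => interior_subset (hQU z hz)
    have hkL := hmem hk fun z hz => interior_subset (hkU z hz)
    have hQL : MemLp Q 2 (volume.restrict O) := by
      refine (hkQL.sub hkL).ae_eq (Eventually.of_forall fun z => ?_)
      simp
    refine ⟨hkQL.toLp _, ⟨k + Q, hkQ, hQU, hkQL.coeFn_toLp, fun j ψ hψ => ?_⟩, fun H hH => ?_, ?_⟩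
    · rw [← add_zero (0 : ℝ)]
      nth_rw 1 [← hkn j ψ hψ]
      rw [← hQn j ψ hψ]
      refine Eq.trans ?_ (integral_add (integrable_inner_of_memLp (hkL.sub hfL) (hnL j hψ.1))
        (integrable_inner_of_memLp hQL (hnL j hψ.1)))
      refine integral_congr_ae (Eventually.of_forall fun z => ?_)
      simp only [Pi.add_apply, Pi.sub_apply]
      rw [← inner_add_left]
      congr 1
      abel
    · rw [hinner]
      refine le_of_eq_of_le (congrArg _ (integral_congr_ae ?_)) (hQF ⟨H, hH⟩ (Finset.mem_univ _))
      filter_upwards [hkQL.coeFn_toLp, hZk] with z h1 h2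
      rw [h1, h2]
      simp
    · have e1 : ∫ z, gap ρm ρp (hkQL.toLp _ z) ∂(volume.restrict O) = ∫ z in O, gap ρm ρp (k z + Q z) :=
        integral_congr_ae (hkQL.coeFn_toLp.mono fun z hz => by simp only [hz]; rfl)
      have e2 : ∫ z, gap ρm ρp (Z z) ∂(volume.restrict O) = ∫ z in O, gap ρm ρp (k z) :=
        integral_congr_ae (hZk.mono fun z hz => by simp only [hz])
      rw [e1, e2]
      exact hQg
  have hf0 : hfL.toLp f ∈ X := ⟨f, hf, hfU, hfL.coeFn_toLp, by simp⟩
  obtain ⟨Z, W, hZX, hZW, hZG, hWF⟩ := exists_tendsto_of_decrease hc hXb hXG hXstep hf0 F hε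
  -- The gap is nonlinear, so strong convergence is essential: a subsequence converges almost
  -- everywhere and the integrals of the bounded gaps pass to the limit, which is zero.
  obtain ⟨u, hu, hae⟩ := (tendstoInMeasure_of_tendsto_Lp hZW).exists_seq_tendsto_ae
  have hall : ∀ᵐ z ∂(volume.restrict O), ∀ n, Z n z ∈ hull ρm ρp R := ae_all_iff.2 fun n => hXhull _ (hZX n)
  have hWh : ∀ᵐ z ∂(volume.restrict O), W z ∈ hull ρm ρp R := by
    filter_upwards [hae, hall] with z h1 h2
    exact (isCompact_hull ρm ρp R).isClosed.mem_of_tendsto h1 (Eventually.of_forall fun n => h2 _)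
  have hgl : ∀ᵐ z ∂(volume.restrict O), Tendsto (fun n => gap ρm ρp (Z (u n) z)) atTop (𝓝 (gap ρm ρp (W z))) := by
    filter_upwards [hae, hWh] with z h1 h2
    have h0 : W z 0 ≠ 0 := by linarith [(density_mem_of_mem_hull hρ h2).1]
    exact (continuousAt_gap h0).tendsto.comp h1
  have hgm : ∀ n, AEStronglyMeasurable (fun z => gap ρm ρp (Z (u n) z)) (volume.restrict O) := by
    intro n
    obtain ⟨k, hk, hkU, hZk, -⟩ := hZX (u n)
    refine ((continuousOn_gap_comp hρm hρ hk fun z hz =>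
      interior_subset (hkU z hz)).aestronglyMeasurable hOm).congr (hZk.mono fun z hz => ?_)
    simp only [hz]
  have hlim := tendsto_integral_of_dominated_convergence (fun _ => M) hgm (integrable_const M)
    (fun n => hall.mono fun z hz => hM _ (hz _)) hgl
  have hG0 : ∫ z, gap ρm ρp (W z) ∂(volume.restrict O) = 0 :=
    tendsto_nhds_unique hlim (hZG.comp hu.tendsto_atTop)
  have hgW : Integrable (fun z => gap ρm ρp (W z)) (volume.restrict O) :=
    Integrable.of_bound (aestronglyMeasurable_of_tendsto_ae atTop hgm hgl) M
      (hWh.mono fun z hz => hM _ hz)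
  have hG := (integral_eq_zero_iff_of_nonneg_ae
    (hWh.mono fun z hz => gap_nonneg hρm hρ hz) hgW).1 hG0
  refine ⟨W, Lp.aestronglyMeasurable W, ?_, fun j ψ hψ => ?_, fun H hH => ?_⟩
  · filter_upwards [hWh, hG] with z h1 h2
    exact mem_phaseSet_of_gap_eq_zero hρm hρ h1 h2
  · have e : ∀ Y : Lp State 2 (volume.restrict O), inner ℝ (Y - hfL.toLp f) ((hnL j hψ.1).toLp _)
        = ∫ z, inner ℝ (Y z - f z) (nullField g p ψ j z) ∂(volume.restrict O) := by
      intro Y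
      rw [hinner]
      refine integral_congr_ae ?_
      filter_upwards [hfL.coeFn_toLp, (hnL j hψ.1).coeFn_toLp] with z h1 h2
      rw [h1, h2]
    have h0 : ∀ n, inner ℝ (Z n - hfL.toLp f) ((hnL j hψ.1).toLp _) = 0 := by
      intro n
      obtain ⟨k, -, -, hZk, hkn⟩ := hZX n
      rw [e, ← hkn j ψ hψ]
      exact integral_congr_ae (hZk.mono fun z hz => by simp only [hz])
    have h1 : Tendsto (fun n => inner ℝ (Z n - hfL.toLp f) ((hnL j hψ.1).toLp _)) atTop
        (𝓝 (inner ℝ (W - hfL.toLp f) ((hnL j hψ.1).toLp _))) :=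
      (hZW.sub tendsto_const_nhds).inner tendsto_const_nhds
    simp only [h0] at h1
    rw [← e]
    exact tendsto_nhds_unique h1 tendsto_const_nhds
  · have := hWF H hH
    rw [hinner] at this
    refine le_of_eq_of_le (congrArg _ (integral_congr_ae ?_)) this
    filter_upwards [hfL.coeFn_toLp] with z h1
    rw [h1]

end

/-! ### Turbulent mixtures in the interior of the hull -/

noncomputable section

/-- The condition `hk` is dual to surjectivity of the linear map from weights to total mass and
barycenter. This map is then open, so slightly changed positive weights of total mass one reach a
full neighbourhood. -/
theorem sum_smul_mem_interior_convexHull {V ι : Type*} [NormedAddCommGroup V]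
    [InnerProductSpace ℝ V] [FiniteDimensional ℝ V] [Fintype ι] {k : ι → V} {w : ι → ℝ}
    (hw : ∀ i, 0 < w i) (hw1 : ∑ i, w i = 1)
    (hk : ∀ (c₀ : ℝ) (f : V →ₗ[ℝ] ℝ), (∀ i, c₀ + f (k i) = 0) → c₀ = 0 ∧ f = 0) :
    ∑ i, w i • k i ∈ interior (convexHull ℝ (range k)) := by
  classical
  let Λ : (ι → ℝ) →ₗ[ℝ] ℝ × V :=
    { toFun := fun w => (∑ i, w i, ∑ i, w i • k i)
      map_add' := fun x y => by simp [Finset.sum_add_distrib, add_smul]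
      map_smul' := fun c x => by simp [Finset.mul_sum, Finset.smul_sum, mul_smul] }
  have hsurj : Function.Surjective Λ := by
    rw [← LinearMap.range_eq_top]
    -- A proper range lies in the kernel of a nonzero functional on `ℝ × V`; evaluated at unit
    -- weights this is exactly an affine function that `hk` excludes.
    by_contra h
    obtain ⟨φ, hφ0, hφ⟩ := Submodule.exists_le_ker_of_lt_top _ (lt_top_iff_ne_top.2 h)
    apply hφ0
    have h1 : ∀ i, φ (1, 0) + (φ.comp (LinearMap.inr ℝ ℝ V)) (k i) = 0 := by
      intro i
      have h2 : φ (Λ (Pi.single i 1)) = 0 := hφ ⟨_, rfl⟩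
      have h3 : Λ (Pi.single i 1) = (1, 0) + (0, k i) := by
        simp [Λ, Pi.single_apply]
      rw [h3, map_add] at h2
      exact h2
    obtain ⟨h4, h5⟩ := hk _ _ h1
    ext
    · simpa using h4
    · have := LinearMap.congr_fun h5
      simpa using this _
  have hcont : Continuous Λ := Λ.continuous_of_finiteDimensional
  have hopen : IsOpenMap Λ :=
    (⟨Λ, hcont⟩ : (ι → ℝ) →L[ℝ] ℝ × V).isOpenMap hsurj
  have hpos : IsOpen {w : ι → ℝ | ∀ i, 0 < w i} := by
    simp only [ofPred_forall]
    exact isOpen_iInter_of_finite fun i => isOpen_lt continuous_const (continuous_apply i)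
  have hU := (hopen _ hpos).preimage (Continuous.prodMk_right (1 : ℝ) : Continuous fun v : V => ((1 : ℝ), v))
  refine mem_interior.2 ⟨_, ?_, hU, ⟨w, hw, by simp [Λ, hw1]⟩⟩
  rintro v ⟨w', hw', h⟩
  obtain ⟨h1, rfl⟩ : ∑ i, w' i = 1 ∧ ∑ i, w' i • k i = v := by simpa [Λ] using h
  exact (convex_convexHull ℝ _).sum_mem (fun i _ => (hw' i).le) h1
    fun i _ => subset_convexHull ℝ _ (mem_range_self i)

/-- The mean state of a fluid of density `ρ` moving vertically with mean velocity `V`, with isotropic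
velocity fluctuations of variance `θ`. -/
def turbulentState (ρ V θ : ℝ) : State :=
  !₂[ρ, 0, V, 0, ρ * V, ρ * θ, 0, ρ * (V ^ 2 + θ), 0, ρ * (V ^ 3 + 4 * θ * V) / 2]

/-- Horizontal components of the velocity fluctuations. -/
def fluctX : Fin 12 → ℝ := ![1, -1, 2, -2, 0, 0, 0, 0, 1, -1, 1, -1]

/-- Vertical components of the velocity fluctuations. -/
def fluctY : Fin 12 → ℝ := ![0, 0, 0, 0, 1, -1, 2, -2, 1, -1, -1, 1]

theorem abs_fluctX_le (i : Fin 12) : |fluctX i| ≤ 2 := by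
  fin_cases i <;> norm_num [fluctX]

theorem abs_fluctY_le (i : Fin 12) : |fluctY i| ≤ 2 := by
  fin_cases i <;> norm_num [fluctY]

/-- The twelve fluctuations are symmetric under reflection of either axis, so their odd and mixed
moments vanish; the second moments are 14 / 12 = 7 / 6 in both directions. -/
theorem sum_pureState_fluct (ρ V a : ℝ) :
    ∑ i, (1 / 12 : ℝ) • pureState ρ (a * fluctX i) (V + a * fluctY i)
      = turbulentState ρ V (7 / 6 * a ^ 2) := by
  apply State.ext <;> simp [Fin.sum_univ_succ, turbulentState, fluctX, fluctY] <;> ring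

/-- On states of one density an affine function is a combination of 1, x, y, x², xy, y² and (x² +
y²) times x or y. The points are chosen to determine such a polynomial: radii 1 and 2 on the axes
separate linear, quadratic and cubic parts, and the diagonals detect xy. A single density cannot
separate velocity from momentum, nor the constant from the density. -/
theorem eq_zero_of_fluct {f : State →ₗ[ℝ] ℝ} {c₀ ρ V a : ℝ} (hρ : ρ ≠ 0) (ha : a ≠ 0)
    (h : ∀ i, c₀ + f (pureState ρ (a * fluctX i) (V + a * fluctY i)) = 0) :
    c₀ + ρ * f (EuclideanSpace.single 0 1) = 0 ∧
    f (EuclideanSpace.single 1 1) + ρ * f (EuclideanSpace.single 3 1) = 0 ∧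
    f (EuclideanSpace.single 2 1) + ρ * f (EuclideanSpace.single 4 1) = 0 ∧
    f (EuclideanSpace.single 5 1) = 0 ∧ f (EuclideanSpace.single 6 1) = 0 ∧
    f (EuclideanSpace.single 7 1) = 0 ∧ f (EuclideanSpace.single 8 1) = 0 ∧
    f (EuclideanSpace.single 9 1) = 0 := by
  have hf : ∀ z : State, f z = ∑ j, z j * f (EuclideanSpace.single j 1) := by
    intro z
    have : z = ∑ j, z j • EuclideanSpace.single j (1 : ℝ) := by
      ext i
      simp [Finset.sum_apply, Pi.single_apply]
    nth_rw 1 [this]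
    simp
  have hp : ∀ x y, c₀ + f (pureState ρ x y) = c₀ + ρ * f (EuclideanSpace.single 0 1)
      + x * (f (EuclideanSpace.single 1 1) + ρ * f (EuclideanSpace.single 3 1))
      + y * (f (EuclideanSpace.single 2 1) + ρ * f (EuclideanSpace.single 4 1))
      + ρ * (x ^ 2 * f (EuclideanSpace.single 5 1) + x * y * f (EuclideanSpace.single 6 1)
        + y ^ 2 * f (EuclideanSpace.single 7 1)
        + (x ^ 2 + y ^ 2) * (x * f (EuclideanSpace.single 8 1)
        + y * f (EuclideanSpace.single 9 1)) / 2) := by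
    intro x y
    rw [hf]
    simp [Fin.sum_univ_succ]
    ring
  simp only [hp] at h
  generalize c₀ + ρ * f (EuclideanSpace.single 0 1) = A₀ at *
  generalize f (EuclideanSpace.single 1 1) + ρ * f (EuclideanSpace.single 3 1) = A₁ at *
  generalize f (EuclideanSpace.single 2 1) + ρ * f (EuclideanSpace.single 4 1) = A₂ at *
  generalize f (EuclideanSpace.single 5 1) = c₅ at *
  generalize f (EuclideanSpace.single 6 1) = c₆ at *
  generalize f (EuclideanSpace.single 7 1) = c₇ at *
  generalize f (EuclideanSpace.single 8 1) = c₈ at *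
  generalize f (EuclideanSpace.single 9 1) = c₉ at *
  have h0 := h 0
  have h1 := h 1
  have h2 := h 2
  have h3 := h 3
  have h4 := h 4
  have h5 := h 5
  have h6 := h 6
  have h7 := h 7
  have h8 := h 8
  have h9 := h 9
  have h10 := h 10
  have h11 := h 11
  simp [fluctX, fluctY] at h0 h1 h2 h3 h4 h5 h6 h7 h8 h9 h10 h11
  -- Antisymmetrizing in the sign removes the even part, and weighting radius 2 against radius 1
  -- removes the linear part, so only the cubic coefficient remains.
  have e8 : c₈ = 0 := by
    have : ρ * a ^ 3 * c₈ = 0 := by linear_combination (1 / 6) * (h2 - h3 - 2 * (h0 - h1))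
    simpa [hρ, ha] using this
  have e9 : c₉ = 0 := by
    have : ρ * a ^ 3 * c₉ = 0 := by linear_combination (1 / 6) * (h6 - h7 - 2 * (h4 - h5))
    simpa [hρ, ha] using this
  subst e8 e9
  have e5 : c₅ = 0 := by
    have : ρ * a ^ 2 * c₅ = 0 := by linear_combination (1 / 6) * (h2 + h3 - h0 - h1)
    simpa [hρ, ha] using this
  have e7 : c₇ = 0 := by
    have : ρ * a ^ 2 * c₇ = 0 := by linear_combination (1 / 6) * (h6 + h7 - h4 - h5)
    simpa [hρ, ha] using this
  subst e5 e7
  have e6 : c₆ = 0 := by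
    have : ρ * a ^ 2 * c₆ = 0 := by linear_combination (1 / 4) * (h8 + h9 - h10 - h11)
    simpa [hρ, ha] using this
  subst e6
  have e1 : A₁ = 0 := by
    have : a * A₁ = 0 := by linear_combination (1 / 2) * (h0 - h1)
    simpa [ha] using this
  have e2 : A₂ = 0 := by
    have : a * A₂ = 0 := by linear_combination (1 / 2) * (h4 - h5)
    simpa [ha] using this
  subst e1 e2
  refine ⟨?_, rfl, rfl, rfl, rfl, rfl, rfl, rfl⟩
  linear_combination h0

/-- The same fluctuations are used in both phases. Two different densities resolve the ambiguities
that a single phase leaves, so no nontrivial affine function vanishes on all 24 states. -/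
theorem mixture_mem_interior_hull {ρm ρp R α Vp Vm a : ℝ} (hρm : 0 < ρm) (hρ : ρm < ρp)
    (hα : α ∈ Ioo (0 : ℝ) 1) (ha : 0 < a) (hp : |Vp| + 2 * a ≤ R) (hm : |Vm| + 2 * a ≤ R) :
    α • turbulentState ρp Vp (7 / 6 * a ^ 2) + (1 - α) • turbulentState ρm Vm (7 / 6 * a ^ 2)
      ∈ interior (hull ρm ρp R) := by
  let k : Fin 12 ⊕ Fin 12 → State := Sum.elim
    (fun i => pureState ρp (a * fluctX i) (Vp + a * fluctY i))
    (fun i => pureState ρm (a * fluctX i) (Vm + a * fluctY i))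
  let w : Fin 12 ⊕ Fin 12 → ℝ := Sum.elim (fun _ => α * (1 / 12)) (fun _ => (1 - α) * (1 / 12))
  have hsum : ∑ i, w i • k i
      = α • turbulentState ρp Vp (7 / 6 * a ^ 2) + (1 - α) • turbulentState ρm Vm (7 / 6 * a ^ 2) := by
    rw [← sum_pureState_fluct, ← sum_pureState_fluct, Fintype.sum_sum_type, Finset.smul_sum,
      Finset.smul_sum]
    simp only [w, k, Sum.elim_inl, Sum.elim_inr, mul_smul]
  have hX : ∀ i, |a * fluctX i| ≤ 2 * a := fun i => by
    rw [abs_mul, abs_of_pos ha]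
    nlinarith [abs_fluctX_le i]
  have hY : ∀ V i, |V + a * fluctY i| ≤ |V| + 2 * a := fun V i => by
    refine (abs_add_le _ _).trans ?_
    rw [abs_mul, abs_of_pos ha]
    nlinarith [abs_fluctY_le i]
  have hsub : range k ⊆ phaseSet ρm ρp R := by
    rintro _ ⟨i | i, rfl⟩
    · exact ⟨ρp, _, _, Or.inr rfl, (hX i).trans (by linarith [abs_nonneg Vp]), (hY Vp i).trans hp, rfl⟩
    · exact ⟨ρm, _, _, Or.inl rfl, (hX i).trans (by linarith [abs_nonneg Vp]), (hY Vm i).trans hm, rfl⟩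
  rw [← hsum]
  refine interior_mono (convexHull_mono hsub) (sum_smul_mem_interior_convexHull ?_ ?_ ?_)
  · rintro (i | i)
    · exact mul_pos hα.1 (by norm_num)
    · exact mul_pos (by linarith [hα.2]) (by norm_num)
  · simp [w, Fintype.sum_sum_type]
    ring
  · intro c₀ f h
    obtain ⟨p0, p1, p2, e5, e6, e7, e8, e9⟩ :=
      eq_zero_of_fluct (hρm.trans hρ).ne' ha.ne' fun i => h (Sum.inl i)
    obtain ⟨m0, m1, m2, -⟩ := eq_zero_of_fluct hρm.ne' ha.ne' fun i => h (Sum.inr i)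
    have hne : ρp - ρm ≠ 0 := sub_ne_zero.2 hρ.ne'
    have two : ∀ {x y : ℝ}, x + ρp * y = 0 → x + ρm * y = 0 → x = 0 ∧ y = 0 := by
      intro x y h1 h2
      have hy : y = 0 := by
        have : (ρp - ρm) * y = 0 := by linear_combination h1 - h2
        simpa [hne] using this
      subst hy
      exact ⟨by linarith, rfl⟩
    obtain ⟨h0, e0⟩ := two p0 m0
    obtain ⟨e1, e3⟩ := two p1 m1
    obtain ⟨e2, e4⟩ := two p2 m2
    refine ⟨h0, (EuclideanSpace.basisFun (Fin 10) ℝ).toBasis.ext fun j => ?_⟩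
    fin_cases j <;> simpa

end

/-! ### One-dimensional balance laws in weak form -/

noncomputable section

/-- The balance law `∂_t a + ∂_y b + c = 0` on `ℝ × (0, ∞)` in the variables `(y, t)`, with initial
data `a₀`, for continuous functions that are differentiable on all horizontal and vertical lines off
countably many points; `a'` is the time derivative of `a`. -/
structure IsBalance (a b c a' : ℝ × ℝ → ℝ) (a₀ : ℝ → ℝ) : Prop where
  continuousOn_density : ContinuousOn a {z | 0 < z.2}
  continuousOn_flux : ContinuousOn b {z | 0 < z.2}
  continuousOn_source : ContinuousOn c {z | 0 < z.2}
  measurable_deriv : Measurable a'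
  bounded_deriv : ∀ L τ T : ℝ, 0 < τ → ∃ M, ∀ y ∈ Icc (-L) L, ∀ t ∈ Icc τ T, |a' (y, t)| ≤ M
  deriv_time : ∀ y ≠ 0, ∃ s : Set ℝ, s.Countable ∧ ∀ t > 0, t ∉ s →
    HasDerivAt (fun t => a (y, t)) (a' (y, t)) t
  deriv_space : ∀ t > 0, ∃ s : Set ℝ, s.Countable ∧ ∀ y ∉ s,
    HasDerivAt (fun y => b (y, t)) (-a' (y, t) - c (y, t)) y
  initial : ∀ y ≠ 0, Tendsto (fun t => a (y, t)) (𝓝[>] 0) (𝓝 (a₀ y))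
  bounded : ∀ L T : ℝ, ∃ M, ∀ y ∈ Icc (-L) L, ∀ t ∈ Ioc 0 T,
    |a (y, t)| ≤ M ∧ |b (y, t)| ≤ M ∧ |c (y, t)| ≤ M

namespace IsBalance

variable {a b c a' : ℝ × ℝ → ℝ} {a₀ : ℝ → ℝ} {ψ : ℝ × ℝ → ℝ}

theorem hasDerivAt_snd (hψ : ContDiff ℝ ∞ ψ) (y t : ℝ) :
    HasDerivAt (fun t => ψ (y, t)) (fderiv ℝ ψ (y, t) (0, 1)) t := by
  have h1 : HasDerivAt (fun t : ℝ => (y, t)) ((0 : ℝ), (1 : ℝ)) t :=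
    (hasDerivAt_const t y).prodMk (hasDerivAt_id t)
  exact (hψ.differentiable (by simp) (y, t)).hasFDerivAt.comp_hasDerivAt t h1

theorem hasDerivAt_fst (hψ : ContDiff ℝ ∞ ψ) (y t : ℝ) :
    HasDerivAt (fun y => ψ (y, t)) (fderiv ℝ ψ (y, t) (1, 0)) y := by
  have h1 : HasDerivAt (fun y : ℝ => (y, t)) ((1 : ℝ), (0 : ℝ)) y :=
    (hasDerivAt_id y).prodMk (hasDerivAt_const y t)
  exact (hψ.differentiable (by simp) (y, t)).hasFDerivAt.comp_hasDerivAt y h1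

theorem continuous_fderiv_apply (hψ : ContDiff ℝ ∞ ψ) (u : ℝ × ℝ) :
    Continuous fun z => fderiv ℝ ψ z u :=
  (hψ.continuous_fderiv (by simp)).clm_apply continuous_const

/-- By Fubini the time part is integrated along vertical lines and the flux along horizontal ones,
with a fundamental theorem of calculus that tolerates countably many exceptional points on each
line. The unknown derivative `a'` enters both parts with opposite signs. The line over `y = 0`,
without any assumption on the time derivative, is a null set. -/
theorem integral_eq (h : IsBalance a b c a' a₀) (hψ : ContDiff ℝ ∞ ψ) {L τ T : ℝ} (hL : 0 < L)
    (hτ : 0 < τ) (hT : τ ≤ T) :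
    ∫ z in Ioo (-L) L ×ˢ Ioo τ T, (a z * fderiv ℝ ψ z (0, 1) + b z * fderiv ℝ ψ z (1, 0)
      - c z * ψ z) = (∫ y in Ioo (-L) L, (a (y, T) * ψ (y, T) - a (y, τ) * ψ (y, τ)))
      + ∫ t in Ioo τ T, (b (L, t) * ψ (L, t) - b (-L, t) * ψ (-L, t)) := by
  set K : Set (ℝ × ℝ) := Icc (-L) L ×ˢ Icc τ T with hK
  have hKc : IsCompact K := isCompact_Icc.prod isCompact_Icc
  have hKm : MeasurableSet K := hKc.measurableSet
  have hKp : K ⊆ {z | 0 < z.2} := fun z hz => hτ.trans_le hz.2.1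
  have hRK : Ioo (-L) L ×ˢ Ioo τ T ⊆ K := prod_mono Ioo_subset_Icc_self Ioo_subset_Icc_self
  have hψt := continuous_fderiv_apply hψ (0, 1)
  have hψy := continuous_fderiv_apply hψ (1, 0)
  have ca := h.continuousOn_density.mono hKp
  have cb := h.continuousOn_flux.mono hKp
  have cc := h.continuousOn_source.mono hKp
  obtain ⟨M, hM⟩ := h.bounded_deriv L τ T hτ
  obtain ⟨B, hB⟩ := hKc.exists_bound_of_continuousOn hψ.continuous.continuousOn
  have i1 : IntegrableOn (fun z => a z * fderiv ℝ ψ z (0, 1)) K :=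
    (ca.mul hψt.continuousOn).integrableOn_compact hKc
  have i2 : IntegrableOn (fun z => b z * fderiv ℝ ψ z (1, 0)) K :=
    (cb.mul hψy.continuousOn).integrableOn_compact hKc
  have i3 : IntegrableOn (fun z => c z * ψ z) K :=
    (cc.mul hψ.continuous.continuousOn).integrableOn_compact hKc
  have i4 : IntegrableOn (fun z => a' z * ψ z) K := by
    refine IntegrableOn.of_bound hKc.measure_lt_top
      (h.measurable_deriv.mul hψ.continuous.measurable).aestronglyMeasurable (|M| * |B|)
      ((ae_restrict_iff' hKm).2 (Eventually.of_forall fun z hz => ?_))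
    rw [norm_mul]
    exact mul_le_mul ((hM _ hz.1 _ hz.2).trans (le_abs_self M)) ((hB z hz).trans (le_abs_self B))
      (norm_nonneg _) (abs_nonneg M)
  have j1 : IntegrableOn (fun z => a z * fderiv ℝ ψ z (0, 1) + a' z * ψ z)
      (Ioo (-L) L ×ˢ Ioo τ T) := (i1.add i4).mono_set hRK
  have j2 : IntegrableOn (fun z => b z * fderiv ℝ ψ z (1, 0) + (-a' z - c z) * ψ z)
      (Ioo (-L) L ×ˢ Ioo τ T) := by
    refine IntegrableOn.congr_fun ((i2.sub (i4.add i3)).mono_set hRK) (fun z _ => ?_)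
      (measurableSet_Ioo.prod measurableSet_Ioo)
    simp only [Pi.sub_apply, Pi.add_apply]
    ring
  have e0 : ∫ z in Ioo (-L) L ×ˢ Ioo τ T, (a z * fderiv ℝ ψ z (0, 1) + b z * fderiv ℝ ψ z (1, 0)
      - c z * ψ z) = (∫ z in Ioo (-L) L ×ˢ Ioo τ T, (a z * fderiv ℝ ψ z (0, 1) + a' z * ψ z))
      + ∫ z in Ioo (-L) L ×ˢ Ioo τ T, (b z * fderiv ℝ ψ z (1, 0) + (-a' z - c z) * ψ z) := by
    rw [← integral_add j1 j2]
    congr 1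
    ext z
    ring
  rw [e0]
  congr 1
  · rw [Measure.volume_eq_prod, setIntegral_prod _ j1]
    refine setIntegral_congr_ae measurableSet_Ioo ?_
    filter_upwards [compl_mem_ae_iff.2 (measure_singleton (0 : ℝ))] with y hy hyL
    obtain ⟨s, hs, hd⟩ := h.deriv_time y hy
    have hyK : ∀ t ∈ Icc τ T, (y, t) ∈ K := fun t ht => ⟨Ioo_subset_Icc_self hyL, ht⟩
    have hcy : Continuous fun t : ℝ => (y, t) := by fun_prop
    have hmaps : MapsTo (fun t : ℝ => (y, t)) (Icc τ T) K := hyK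
    rw [← integral_Ioc_eq_integral_Ioo, ← intervalIntegral.integral_of_le hT]
    refine integral_eq_of_hasDerivAt_off_countable (fun t => a (y, t) * ψ (y, t)) _ hs ?_ ?_ ?_
    · rw [uIcc_of_le hT]
      exact (ca.comp hcy.continuousOn hmaps).mul (hψ.continuous.comp hcy).continuousOn
    · rw [min_eq_left hT, max_eq_right hT]
      intro t ht
      have := (hd t (hτ.trans ht.1.1) ht.2).mul (hasDerivAt_snd hψ y t)
      exact this.congr_deriv (by ring)
    · rw [intervalIntegrable_iff_integrableOn_Icc_of_le hT]
      refine IntegrableOn.add (((ca.comp hcy.continuousOn hmaps).mul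
        (hψt.comp hcy).continuousOn).integrableOn_compact isCompact_Icc) ?_
      refine IntegrableOn.of_bound isCompact_Icc.measure_lt_top
        ((h.measurable_deriv.comp hcy.measurable).mul
          (hψ.continuous.comp hcy).measurable).aestronglyMeasurable (|M| * |B|)
        ((ae_restrict_iff' measurableSet_Icc).2 (Eventually.of_forall fun t ht => ?_))
      rw [norm_mul]
      exact mul_le_mul ((hM _ (Ioo_subset_Icc_self hyL) _ ht).trans (le_abs_self M))
        ((hB _ (hyK t ht)).trans (le_abs_self B)) (norm_nonneg _) (abs_nonneg M)
  · rw [Measure.volume_eq_prod, ← Measure.prod_restrict, integral_prod_symm _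
      (by rw [Measure.prod_restrict]; exact j2)]
    refine setIntegral_congr_fun measurableSet_Ioo fun t ht => ?_
    have ht0 : 0 < t := hτ.trans ht.1
    obtain ⟨s, hs, hd⟩ := h.deriv_space t ht0
    have htK : ∀ y ∈ Icc (-L) L, (y, t) ∈ K := fun y hy => ⟨hy, Ioo_subset_Icc_self ht⟩
    have hct : Continuous fun y : ℝ => (y, t) := by fun_prop
    have hmaps : MapsTo (fun y : ℝ => (y, t)) (Icc (-L) L) K := htK
    have hLL : -L ≤ L := by linarith
    rw [← integral_Ioc_eq_integral_Ioo, ← intervalIntegral.integral_of_le hLL]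
    refine integral_eq_of_hasDerivAt_off_countable (fun y => b (y, t) * ψ (y, t)) _ hs ?_ ?_ ?_
    · rw [uIcc_of_le hLL]
      exact (cb.comp hct.continuousOn hmaps).mul (hψ.continuous.comp hct).continuousOn
    · intro y hy
      have := (hd y hy.2).mul (hasDerivAt_fst hψ y t)
      exact this.congr_deriv (by ring)
    · rw [intervalIntegrable_iff_integrableOn_Icc_of_le hLL]
      refine IntegrableOn.add (((cb.comp hct.continuousOn hmaps).mul
        (hψy.comp hct).continuousOn).integrableOn_compact isCompact_Icc) ?_
      have k1 : IntegrableOn (fun y => a' (y, t) * ψ (y, t)) (Icc (-L) L) := by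
        refine IntegrableOn.of_bound isCompact_Icc.measure_lt_top
          ((h.measurable_deriv.comp hct.measurable).mul
            (hψ.continuous.comp hct).measurable).aestronglyMeasurable (|M| * |B|)
          ((ae_restrict_iff' measurableSet_Icc).2 (Eventually.of_forall fun y hy => ?_))
        rw [norm_mul]
        exact mul_le_mul ((hM _ hy _ (Ioo_subset_Icc_self ht)).trans (le_abs_self M))
          ((hB _ (htK y hy)).trans (le_abs_self B)) (norm_nonneg _) (abs_nonneg M)
      have k2 : IntegrableOn (fun y => c (y, t) * ψ (y, t)) (Icc (-L) L) :=
        ((cc.comp hct.continuousOn hmaps).mul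
          (hψ.continuous.comp hct).continuousOn).integrableOn_compact isCompact_Icc
      refine (k1.add k2).neg.congr (Eventually.of_forall fun y => ?_)
      simp only [Pi.neg_apply, Pi.add_apply]
      ring

/-- The weak form of the initial boundary value problem for a balance law. -/
theorem weak (h : IsBalance a b c a' a₀) (hψ : ContDiff ℝ ∞ ψ) {L T : ℝ} (hL : 0 < L)
    (hT : 0 < T) (hψT : ∀ y, ψ (y, T) = 0) :
    (∫ z in Ioo (-L) L ×ˢ Ioo 0 T, (a z * fderiv ℝ ψ z (0, 1) + b z * fderiv ℝ ψ z (1, 0)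
      - c z * ψ z)) + (∫ y in Ioo (-L) L, a₀ y * ψ (y, 0))
      - ∫ t in Ioo 0 T, (b (L, t) * ψ (L, t) - b (-L, t) * ψ (-L, t)) = 0 := by
  set K : Set (ℝ × ℝ) := Icc (-L) L ×ˢ Icc 0 T with hK
  have hKc : IsCompact K := isCompact_Icc.prod isCompact_Icc
  obtain ⟨M, hM⟩ := h.bounded L T
  obtain ⟨B0, hB0⟩ := hKc.exists_bound_of_continuousOn hψ.continuous.continuousOn
  obtain ⟨B1, hB1⟩ := hKc.exists_bound_of_continuousOn (continuous_fderiv_apply hψ (0, 1)).continuousOn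
  obtain ⟨B2, hB2⟩ := hKc.exists_bound_of_continuousOn (continuous_fderiv_apply hψ (1, 0)).continuousOn
  have hM0 : 0 ≤ M := (abs_nonneg _).trans (hM 0 ⟨by linarith, by linarith⟩ T ⟨hT, le_rfl⟩).1
  -- The density is continuous only for positive times, so the lower time tends to zero along a
  -- decreasing sequence starting below `T`; boundedness and the pointwise initial limit give the
  -- initial term.
  set τ : ℕ → ℝ := fun n => T / (n + 2) with hτ
  have hτ0 : ∀ n, 0 < τ n := fun n => by positivity
  have hτT : ∀ n, τ n ≤ T := fun n => by
    rw [hτ]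
    exact div_le_self hT.le (by linarith [(Nat.cast_nonneg n : (0 : ℝ) ≤ n)])
  have hτanti : Antitone τ := fun m n hmn => by
    simp only [hτ]
    gcongr
  have hτlim : Tendsto τ atTop (𝓝 0) := by
    refine Tendsto.div_atTop tendsto_const_nhds ?_
    exact tendsto_atTop_add_const_right _ _ tendsto_natCast_atTop_atTop
  have hτlim' : Tendsto τ atTop (𝓝[>] 0) :=
    tendsto_nhdsWithin_iff.2 ⟨hτlim, Eventually.of_forall hτ0⟩
  have hUnion : ⋃ n, Ioo (τ n) T = Ioo 0 T := by
    ext t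
    simp only [mem_iUnion, mem_Ioo]
    refine ⟨fun ⟨n, h1, h2⟩ => ⟨(hτ0 n).trans h1, h2⟩, fun ⟨h1, h2⟩ => ?_⟩
    obtain ⟨n, hn⟩ := (hτlim.eventually_lt_const h1).exists
    exact ⟨n, hn, h2⟩
  have hmono : Monotone fun n => Ioo (τ n) T := fun m n hmn => Ioo_subset_Ioo_left (hτanti hmn)
  have hop : IsOpen (Ioo (-L) L ×ˢ Ioo 0 T : Set (ℝ × ℝ)) := isOpen_Ioo.prod isOpen_Ioo
  have hsub : (Ioo (-L) L ×ˢ Ioo 0 T : Set (ℝ × ℝ)) ⊆ {z | 0 < z.2} := fun z hz => hz.2.1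
  have hsubK : (Ioo (-L) L ×ˢ Ioo 0 T : Set (ℝ × ℝ)) ⊆ K :=
    prod_mono Ioo_subset_Icc_self Ioo_subset_Icc_self
  have hfin : volume (Ioo (-L) L ×ˢ Ioo 0 T : Set (ℝ × ℝ)) < ⊤ :=
    (measure_mono hsubK).trans_lt hKc.measure_lt_top
  have ig : IntegrableOn (fun z => a z * fderiv ℝ ψ z (0, 1) + b z * fderiv ℝ ψ z (1, 0)
      - c z * ψ z) (Ioo (-L) L ×ˢ Ioo 0 T) := by
    refine IntegrableOn.of_bound hfin (ContinuousOn.aestronglyMeasurable ?_ hop.measurableSet)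
      (M * |B1| + M * |B2| + M * |B0|)
      ((ae_restrict_iff' hop.measurableSet).2 (Eventually.of_forall fun z hz => ?_))
    · exact (((h.continuousOn_density.mono hsub).mul
        (continuous_fderiv_apply hψ (0, 1)).continuousOn).add
        ((h.continuousOn_flux.mono hsub).mul (continuous_fderiv_apply hψ (1, 0)).continuousOn)).sub
        ((h.continuousOn_source.mono hsub).mul hψ.continuous.continuousOn)
    · obtain ⟨m1, m2, m3⟩ := hM z.1 (Ioo_subset_Icc_self hz.1) z.2 ⟨hz.2.1, hz.2.2.le⟩
      have n1 := (hB1 z (hsubK hz)).trans (le_abs_self B1)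
      have n2 := (hB2 z (hsubK hz)).trans (le_abs_self B2)
      have n0 := (hB0 z (hsubK hz)).trans (le_abs_self B0)
      refine (norm_sub_le _ _).trans (add_le_add ((norm_add_le _ _).trans (add_le_add ?_ ?_)) ?_)
      all_goals
        rw [norm_mul]
        exact mul_le_mul (by assumption) (by assumption) (norm_nonneg _) hM0
  have l1 : Tendsto (fun n => ∫ z in Ioo (-L) L ×ˢ Ioo (τ n) T, (a z * fderiv ℝ ψ z (0, 1)
      + b z * fderiv ℝ ψ z (1, 0) - c z * ψ z)) atTop (𝓝 (∫ z in Ioo (-L) L ×ˢ Ioo 0 T,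
      (a z * fderiv ℝ ψ z (0, 1) + b z * fderiv ℝ ψ z (1, 0) - c z * ψ z))) := by
    have := tendsto_setIntegral_of_monotone (μ := volume) (s := fun n => Ioo (-L) L ×ˢ Ioo (τ n) T)
      (f := fun z => a z * fderiv ℝ ψ z (0, 1) + b z * fderiv ℝ ψ z (1, 0) - c z * ψ z)
      (fun n => measurableSet_Ioo.prod measurableSet_Ioo)
      (fun m n hmn => prod_mono le_rfl (hmono hmn)) (by rw [← prod_iUnion, hUnion]; exact ig)
    rwa [← prod_iUnion, hUnion] at this
  have l2 : Tendsto (fun n => ∫ t in Ioo (τ n) T, (b (L, t) * ψ (L, t) - b (-L, t) * ψ (-L, t)))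
      atTop (𝓝 (∫ t in Ioo 0 T, (b (L, t) * ψ (L, t) - b (-L, t) * ψ (-L, t)))) := by
    have i2 : IntegrableOn (fun t => b (L, t) * ψ (L, t) - b (-L, t) * ψ (-L, t)) (Ioo 0 T) := by
      have hc : ∀ y : ℝ, ContinuousOn (fun t => b (y, t) * ψ (y, t)) (Ioo 0 T) := fun y =>
        (h.continuousOn_flux.comp (f := fun t : ℝ => (y, t)) (by fun_prop)
          fun t ht => ht.1).mul (hψ.continuous.comp (by fun_prop)).continuousOn
      refine IntegrableOn.of_bound measure_Ioo_lt_top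
        (((hc L).sub (hc (-L))).aestronglyMeasurable measurableSet_Ioo) (M * |B0| + M * |B0|)
        ((ae_restrict_iff' measurableSet_Ioo).2 (Eventually.of_forall fun t ht => ?_))
      have hb : ∀ y ∈ Icc (-L) L, ‖b (y, t) * ψ (y, t)‖ ≤ M * |B0| := fun y hy => by
        rw [norm_mul]
        exact mul_le_mul (hM y hy t ⟨ht.1, ht.2.le⟩).2.1
          ((hB0 (y, t) ⟨hy, Ioo_subset_Icc_self ht⟩).trans (le_abs_self B0)) (norm_nonneg _) hM0
      exact (norm_sub_le _ _).trans (add_le_add (hb L ⟨by linarith, le_rfl⟩)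
        (hb (-L) ⟨le_rfl, by linarith⟩))
    have := tendsto_setIntegral_of_monotone (μ := volume) (s := fun n => Ioo (τ n) T)
      (f := fun t => b (L, t) * ψ (L, t) - b (-L, t) * ψ (-L, t)) (fun n => measurableSet_Ioo)
      hmono (by rw [hUnion]; exact i2)
    rwa [hUnion] at this
  have l3 : Tendsto (fun n => ∫ y in Ioo (-L) L, (a (y, T) * ψ (y, T) - a (y, τ n) * ψ (y, τ n)))
      atTop (𝓝 (∫ y in Ioo (-L) L, -(a₀ y * ψ (y, 0)))) := by
    simp only [hψT, mul_zero, zero_sub]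
    refine tendsto_integral_of_dominated_convergence (fun _ => M * |B0|) (fun n => ?_)
      (integrableOn_const measure_Ioo_lt_top.ne) (fun n => ?_) ?_
    · refine (ContinuousOn.neg ?_).aestronglyMeasurable measurableSet_Ioo
      exact (h.continuousOn_density.comp (f := fun y : ℝ => (y, τ n)) (by fun_prop)
          fun y _ => hτ0 n).mul (hψ.continuous.comp (by fun_prop)).continuousOn
    · refine (ae_restrict_iff' measurableSet_Ioo).2 (Eventually.of_forall fun y hy => ?_)
      rw [norm_neg, norm_mul]
      exact mul_le_mul (hM y (Ioo_subset_Icc_self hy) _ ⟨hτ0 n, hτT n⟩).1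
          ((hB0 (y, τ n) ⟨Ioo_subset_Icc_self hy, (hτ0 n).le, hτT n⟩).trans (le_abs_self B0))
          (norm_nonneg _) hM0
    · refine ae_restrict_of_ae ?_
      filter_upwards [compl_mem_ae_iff.2 (measure_singleton (0 : ℝ))] with y hy
      have h1 := (h.initial y hy).comp hτlim'
      have h2 : Tendsto (fun n => ψ (y, τ n)) atTop (𝓝 (ψ (y, 0))) :=
        (hψ.continuous.tendsto _).comp (tendsto_const_nhds.prodMk_nhds hτlim)
      exact (h1.mul h2).neg
  have e := fun n => h.integral_eq hψ hL (hτ0 n) (hτT n)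
  have hlim := tendsto_nhds_unique l1 ((l3.add l2).congr fun n => (e n).symm)
  rw [hlim, integral_neg]
  ring

end IsBalance

end

/-! ### The self-similar rarefaction profile -/

noncomputable section

/-- The parameters of a mixing profile; `e` is the strength of the velocity fluctuations. -/
structure Mixing where
  ρm : ℝ
  ρp : ℝ
  g : ℝ
  lam : ℝ
  e : ℝ
  ρm_pos : 0 < ρm
  ρm_lt : ρm < ρp
  g_pos : 0 < g
  lam_pos : 0 < lam

namespace Mixing

variable (S : Mixing)

/-- The self-similar variable. -/
def ratio (z : ℝ × ℝ) : ℝ := 1 + 2 * z.1 / (S.lam * S.g * z.2 ^ 2)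

/-- The self-similar variable, restricted to its values in the mixing zone. -/
def clamped (z : ℝ × ℝ) : ℝ := max (S.ρm / S.ρp) (min (S.ratio z) (S.ρp / S.ρm))

/-- The reflected density `ρ₊ + ρ₋ - r` of the rarefaction profile `r`. -/
def q (z : ℝ × ℝ) : ℝ := √(S.ρp * S.ρm / S.clamped z)

/-- The self-similar variable lies in this interval exactly in the mixing zone. -/
def zone : Set ℝ := Ioo (S.ρm / S.ρp) (S.ρp / S.ρm)

open Classical in
/-- The indicator of the mixing zone. -/
def on (z : ℝ × ℝ) : ℝ := if S.ratio z ∈ S.zone then 1 else 0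

/-- The time derivative of `q`. -/
def qt (z : ℝ × ℝ) : ℝ := S.on z * (S.q z * (1 - S.q z ^ 2 / (S.ρp * S.ρm)) / z.2)

/-- The space derivative of `q`. -/
def qy (z : ℝ × ℝ) : ℝ := S.on z * (-S.q z ^ 3 / (S.ρp * S.ρm * S.lam * S.g * z.2 ^ 2))

variable {S}

theorem ρp_pos : 0 < S.ρp := S.ρm_pos.trans S.ρm_lt

theorem left_pos : 0 < S.ρm / S.ρp := div_pos S.ρm_pos ρp_pos

theorem left_lt_one : S.ρm / S.ρp < 1 := (div_lt_one ρp_pos).2 S.ρm_lt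

theorem one_lt_right : 1 < S.ρp / S.ρm := (one_lt_div S.ρm_pos).2 S.ρm_lt

theorem left_lt_right : S.ρm / S.ρp < S.ρp / S.ρm := left_lt_one.trans one_lt_right

theorem clamped_pos (z : ℝ × ℝ) : 0 < S.clamped z := left_pos.trans_le (le_max_left _ _)

theorem clamped_mem (z : ℝ × ℝ) : S.clamped z ∈ Icc (S.ρm / S.ρp) (S.ρp / S.ρm) :=
  ⟨le_max_left _ _, max_le left_lt_right.le (min_le_right _ _)⟩

theorem q_sq (z : ℝ × ℝ) : S.q z ^ 2 * S.clamped z = S.ρp * S.ρm := by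
  have hc := S.clamped_pos z
  rw [q, Real.sq_sqrt (div_nonneg (mul_pos ρp_pos S.ρm_pos).le hc.le)]
  field_simp

theorem q_pos (z : ℝ × ℝ) : 0 < S.q z :=
  Real.sqrt_pos.2 (div_pos (mul_pos ρp_pos S.ρm_pos) (clamped_pos z))

theorem q_eq {z : ℝ × ℝ} {x : ℝ} (hx : 0 < x) (h : x ^ 2 * S.clamped z = S.ρp * S.ρm) :
    S.q z = x := by
  have h1 := S.q_sq z
  have h2 : S.q z ^ 2 = x ^ 2 := mul_right_cancel₀ (clamped_pos z).ne' (h1.trans h.symm)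
  exact (pow_left_inj₀ (q_pos z).le hx.le two_ne_zero).1 h2

theorem q_eq_ρp {z : ℝ × ℝ} (h : S.ratio z ≤ S.ρm / S.ρp) : S.q z = S.ρp := by
  have hp := S.ρp_pos
  refine q_eq hp ?_
  rw [clamped, min_eq_left (h.trans left_lt_right.le), max_eq_left h]
  field_simp

theorem q_eq_ρm {z : ℝ × ℝ} (h : S.ρp / S.ρm ≤ S.ratio z) : S.q z = S.ρm := by
  have hp := S.ρm_pos
  refine q_eq hp ?_
  rw [clamped, min_eq_right h, max_eq_right left_lt_right.le]
  field_simp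

theorem clamped_eq {z : ℝ × ℝ} (h : S.ratio z ∈ S.zone) : S.clamped z = S.ratio z := by
  rw [clamped, min_eq_left h.2.le, max_eq_right h.1.le]

theorem q_mem (z : ℝ × ℝ) : S.q z ∈ Icc S.ρm S.ρp := by
  have h1 := S.q_sq z
  obtain ⟨h2, h3⟩ := S.clamped_mem z
  have hm := S.ρm_pos
  have hp := S.ρp_pos
  have hq := S.q_pos z
  rw [div_le_iff₀ hp] at h2
  rw [le_div_iff₀ hm] at h3
  constructor
  · refine abs_le_of_sq_le_sq' ?_ hq.le |>.2
    by_contra! h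
    nlinarith [clamped_pos (S := S) z]
  · refine abs_le_of_sq_le_sq' ?_ hp.le |>.2
    by_contra! h
    nlinarith [clamped_pos (S := S) z]

theorem q_mem_Ioo {z : ℝ × ℝ} (h : S.ratio z ∈ S.zone) : S.q z ∈ Ioo S.ρm S.ρp := by
  have h1 := S.q_sq z
  rw [clamped_eq h] at h1
  obtain ⟨h2, h3⟩ := h
  have hm := S.ρm_pos
  have hp := S.ρp_pos
  have hq := S.q_mem z
  rw [div_lt_iff₀ hp] at h2
  rw [lt_div_iff₀ hm] at h3
  constructor
  · refine hq.1.lt_of_ne fun h => ?_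
    rw [← h] at h1
    nlinarith
  · refine hq.2.lt_of_ne fun h => ?_
    rw [h] at h1
    nlinarith

/-- Either `q` satisfies the equation of the rarefaction wave, or the fluid is unmixed. -/
theorem on_cases {z : ℝ × ℝ} (hz : 0 < z.2) :
    (S.on z = 1 ∧ S.q z ∈ Ioo S.ρm S.ρp ∧
      2 * z.1 * S.q z ^ 2 = S.lam * S.g * z.2 ^ 2 * (S.ρp * S.ρm - S.q z ^ 2)) ∨
    (S.on z = 0 ∧ (S.q z = S.ρm ∨ S.q z = S.ρp)) := by
  by_cases h : S.ratio z ∈ S.zone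
  · refine Or.inl ⟨if_pos h, q_mem_Ioo h, ?_⟩
    have h1 := S.q_sq z
    rw [clamped_eq h, ratio] at h1
    have := S.lam_pos
    have := S.g_pos
    have h2 : S.lam * S.g * z.2 ^ 2 ≠ 0 := by positivity
    rw [← h1]
    field_simp
    ring
  · refine Or.inr ⟨if_neg h, ?_⟩
    rw [zone, mem_Ioo, not_and_or, not_lt, not_lt] at h
    exact h.symm.imp q_eq_ρm q_eq_ρp

theorem continuousAt_ratio {z : ℝ × ℝ} (hz : 0 < z.2) : ContinuousAt S.ratio z := by
  have := S.lam_pos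
  have := S.g_pos
  have h2 : S.lam * S.g * z.2 ^ 2 ≠ 0 := by positivity
  unfold ratio
  fun_prop (disch := assumption)

theorem continuousAt_q {z : ℝ × ℝ} (hz : 0 < z.2) : ContinuousAt S.q z := by
  have h1 : ContinuousAt S.clamped z := by
    unfold clamped
    exact continuousAt_const.max ((continuousAt_ratio hz).min continuousAt_const)
  exact (continuousAt_const.div h1 (clamped_pos z).ne').sqrt

theorem measurable_ratio : Measurable S.ratio := by
  unfold ratio
  fun_prop

theorem measurable_q : Measurable S.q := by
  unfold q clamped
  exact (measurable_const.div (measurable_const.max (measurable_ratio.min measurable_const))).sqrt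

theorem measurable_on : Measurable S.on :=
  Measurable.ite (measurable_ratio measurableSet_Ioo) measurable_const measurable_const

theorem measurable_qt : Measurable S.qt := by
  have h1 := S.measurable_q
  have h2 := S.measurable_on
  unfold qt
  fun_prop

/-- The ends of the mixing zone and the level `κ`, where profiles may fail to be differentiable. -/
def singular (S : Mixing) (κ : ℝ) : Set ℝ := {S.ρm / S.ρp, S.ρp / S.ρm, κ}

theorem finite_singular (κ : ℝ) : (S.singular κ).Finite := by
  unfold singular
  exact Set.toFinite _

/-- For `y ≠ 0` the self-similar variable is injective in positive time. On `y = 0` it is constantly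
one, so a singular level could be occupied for all times. -/
theorem countable_singular_time (κ : ℝ) {y : ℝ} (hy : y ≠ 0) :
    {t : ℝ | 0 < t ∧ S.ratio (y, t) ∈ S.singular κ}.Countable := by
  refine (Set.Finite.of_injOn (f := fun t => S.ratio (y, t)) (fun t ht => ht.2) ?_
    (finite_singular κ)).countable
  rintro t ⟨ht, -⟩ t' ⟨ht', -⟩ h
  have := S.lam_pos
  have := S.g_pos
  simp only [ratio] at h
  have h1 : 2 * y / (S.lam * S.g * t ^ 2) = 2 * y / (S.lam * S.g * t' ^ 2) := by linarith
  rw [div_eq_div_iff (by positivity) (by positivity)] at h1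
  have h2 : t' ^ 2 = t ^ 2 := by
    have : 2 * y * (S.lam * S.g) ≠ 0 := by positivity
    apply mul_left_cancel₀ this
    linarith
  exact ((pow_left_inj₀ ht'.le ht.le two_ne_zero).1 h2).symm

theorem countable_singular_space (κ : ℝ) {t : ℝ} (ht : 0 < t) :
    {y : ℝ | S.ratio (y, t) ∈ S.singular κ}.Countable := by
  refine (Set.Finite.of_injOn (f := fun y => S.ratio (y, t)) (fun y hy => hy) ?_
    (finite_singular κ)).countable
  rintro y - y' - h
  have := S.lam_pos
  have := S.g_pos
  simp only [ratio] at h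
  have h1 : 2 * y / (S.lam * S.g * t ^ 2) = 2 * y' / (S.lam * S.g * t ^ 2) := by linarith
  rw [div_left_inj' (by positivity)] at h1
  linarith

theorem zone_or_outside {κ : ℝ} {z : ℝ × ℝ} (h : S.ratio z ∉ S.singular κ) :
    S.ratio z ∈ S.zone ∨ S.ratio z < S.ρm / S.ρp ∨ S.ρp / S.ρm < S.ratio z := by
  simp only [singular, mem_insert_iff, mem_singleton_iff, not_or] at h
  rcases lt_or_gt_of_ne h.1 with h1 | h1
  · exact Or.inr (Or.inl h1)
  rcases lt_or_gt_of_ne h.2.1 with h2 | h2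
  · exact Or.inl ⟨h1, h2⟩
  · exact Or.inr (Or.inr h2)

/-- Outside the closed mixing zone the profile is locally constant. -/
theorem eventually_q_eq {κ : ℝ} {z : ℝ × ℝ} (hz : 0 < z.2) (h : S.ratio z ∉ S.singular κ)
    (h' : S.ratio z ∉ S.zone) : S.on z = 0 ∧ ∀ᶠ z' in 𝓝 z, S.q z' = S.q z := by
  refine ⟨if_neg h', ?_⟩
  rcases (zone_or_outside h).resolve_left h' with h1 | h1
  · filter_upwards [(continuousAt_ratio hz).eventually_lt_const h1] with z' hz'
    rw [q_eq_ρp hz'.le, q_eq_ρp h1.le]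
  · filter_upwards [(continuousAt_ratio hz).eventually_const_lt h1] with z' hz'
    rw [q_eq_ρm hz'.le, q_eq_ρm h1.le]

/-- Along any curve that meets the open zone, the clamping is inactive and `q` is an explicit square
root; both partial derivatives are instances. -/
theorem hasDerivAt_q_aux {z : ℝ × ℝ} (hz : 0 < z.2) (h : S.ratio z ∈ S.zone)
    {γ : ℝ → ℝ × ℝ} {s ρ' : ℝ} (hγ : ContinuousAt γ s) (hγz : γ s = z)
    (hρ : HasDerivAt (fun s => S.ratio (γ s)) ρ' s) :
    HasDerivAt (fun s => S.q (γ s)) (-(S.q z ^ 3 * ρ' / (2 * (S.ρp * S.ρm)))) s := by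
  have hp := S.ρp_pos
  have hm := S.ρm_pos
  have hr0 : 0 < S.ratio z := left_pos.trans h.1
  have hq := S.q_sq z
  rw [clamped_eq h] at hq
  have hqe : S.q z = √(S.ρp * S.ρm / S.ratio z) := by rw [q, clamped_eq h]
  have h1 : HasDerivAt (fun s => √(S.ρp * S.ρm / S.ratio (γ s)))
      (-(S.q z ^ 3 * ρ' / (2 * (S.ρp * S.ρm)))) s := by
    have h2 := (((hasDerivAt_const s (S.ρp * S.ρm)).div hρ (by rw [hγz]; exact hr0.ne')).sqrt
      (by simp only [Pi.div_apply]; rw [hγz]; positivity))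
    refine h2.congr_deriv ?_
    simp only [Pi.div_apply]
    rw [hγz, ← hqe]
    have hq0 := (S.q_pos z).ne'
    have hr : S.ratio z = S.ρp * S.ρm / S.q z ^ 2 := by
      rw [eq_div_iff (pow_ne_zero 2 hq0)]; linarith
    rw [hr]
    field_simp
    ring
  refine h1.congr_of_eventuallyEq ?_
  have hev : ∀ᶠ s' in 𝓝 s, S.ratio (γ s') ∈ S.zone := by
    refine (ContinuousAt.comp (g := S.ratio) (by rw [hγz]; exact continuousAt_ratio hz)
      hγ).eventually_mem (isOpen_Ioo.mem_nhds ?_)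
    rw [Function.comp_apply, hγz]
    exact h
  filter_upwards [hev] with s' hs'
  rw [q, clamped_eq hs']

theorem hasDerivAt_q_time {κ : ℝ} {z : ℝ × ℝ} (hz : 0 < z.2) (h : S.ratio z ∉ S.singular κ) :
    HasDerivAt (fun t => S.q (z.1, t)) (S.qt z) z.2 := by
  have hγ : ContinuousAt (fun t : ℝ => (z.1, t)) z.2 := by fun_prop
  by_cases h' : S.ratio z ∈ S.zone
  · have hl := S.lam_pos
    have hg := S.g_pos
    have hp := S.ρp_pos
    have hm := S.ρm_pos
    have hr : HasDerivAt (fun t : ℝ => S.ratio (z.1, t)) (-(4 * z.1 / (S.lam * S.g * z.2 ^ 3))) z.2 := by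
      have h1 := ((hasDerivAt_const z.2 (2 * z.1)).div
        ((hasDerivAt_pow 2 z.2).const_mul (S.lam * S.g)) (by positivity)).const_add 1
      refine h1.congr_deriv ?_
      field_simp
      ring
    refine (hasDerivAt_q_aux hz h' hγ rfl hr).congr_deriv ?_
    rcases S.on_cases hz with ⟨h1, h2, h3⟩ | ⟨h1, -⟩
    · rw [qt, h1]
      have hq := S.q_pos z
      field_simp
      linear_combination (2 : ℝ) * h3
    · rw [on, if_pos h'] at h1
      exact absurd h1 one_ne_zero
  · obtain ⟨h0, h1⟩ := eventually_q_eq hz h h'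
    rw [qt, h0, zero_mul]
    exact (hasDerivAt_const z.2 (S.q z)).congr_of_eventuallyEq (hγ.eventually h1)

theorem hasDerivAt_q_space {κ : ℝ} {z : ℝ × ℝ} (hz : 0 < z.2) (h : S.ratio z ∉ S.singular κ) :
    HasDerivAt (fun y => S.q (y, z.2)) (S.qy z) z.1 := by
  have hγ : ContinuousAt (fun y : ℝ => (y, z.2)) z.1 := by fun_prop
  by_cases h' : S.ratio z ∈ S.zone
  · have hl := S.lam_pos
    have hg := S.g_pos
    have hp := S.ρp_pos
    have hm := S.ρm_pos
    have hr : HasDerivAt (fun y : ℝ => S.ratio (y, z.2)) (2 / (S.lam * S.g * z.2 ^ 2)) z.1 := by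
      have h1 := (((hasDerivAt_id z.1).const_mul 2).div_const (S.lam * S.g * z.2 ^ 2)).const_add 1
      refine h1.congr_deriv ?_
      field_simp
    refine (hasDerivAt_q_aux hz h' hγ rfl hr).congr_deriv ?_
    rw [qy, on, if_pos h']
    field_simp
  · obtain ⟨h0, h1⟩ := eventually_q_eq hz h h'
    rw [qy, h0, zero_mul]
    exact (hasDerivAt_const z.1 (S.q z)).congr_of_eventuallyEq (hγ.eventually h1)

theorem abs_qt_le {z : ℝ × ℝ} (hz : 0 < z.2) :
    |S.qt z| ≤ S.ρp * (1 + S.ρp / S.ρm) / z.2 := by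
  have hp := S.ρp_pos
  have hm := S.ρm_pos
  obtain ⟨h1, h2⟩ := S.q_mem z
  have hq := S.q_pos z
  have hon : |S.on z| ≤ 1 := by
    rcases S.on_cases hz with ⟨h, -⟩ | ⟨h, -⟩ <;> simp [h]
  have h3 : |1 - S.q z ^ 2 / (S.ρp * S.ρm)| ≤ 1 + S.ρp / S.ρm := by
    have h4 : S.q z ^ 2 / (S.ρp * S.ρm) ≤ S.ρp / S.ρm := by
      rw [div_le_div_iff₀ (by positivity) hm]
      nlinarith [mul_le_mul h2 h2 hq.le hp.le]
    have h5 : 0 ≤ S.q z ^ 2 / (S.ρp * S.ρm) := by positivity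
    rw [abs_le]
    constructor <;> linarith
  rw [qt, abs_mul, abs_div, abs_mul, abs_of_pos hz, abs_of_pos hq]
  calc |S.on z| * (S.q z * |1 - S.q z ^ 2 / (S.ρp * S.ρm)| / z.2)
      ≤ 1 * (S.ρp * (1 + S.ρp / S.ρm) / z.2) := by gcongr
    _ = _ := one_mul _

/-- The initial value of `q`. -/
def q₀ (S : Mixing) (y : ℝ) : ℝ := if 0 < y then S.ρm else S.ρp

/-- The width of the zone is of order `t ^ 2`, so a fixed nonzero height is still unmixed at small
times. -/
theorem eventually_q_eq_q₀ {y : ℝ} (hy : y ≠ 0) : ∀ᶠ t in 𝓝[>] (0 : ℝ), S.q (y, t) = S.q₀ y := by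
  have hl := S.lam_pos
  have hg := S.g_pos
  have hlim : Tendsto (fun t : ℝ => S.lam * S.g * t ^ 2) (𝓝[>] 0) (𝓝[>] 0) := by
    refine tendsto_nhdsWithin_iff.2 ⟨?_, ?_⟩
    · have : Continuous fun t : ℝ => S.lam * S.g * t ^ 2 := by fun_prop
      simpa using (this.tendsto 0).mono_left nhdsWithin_le_nhds
    · filter_upwards [self_mem_nhdsWithin] with t ht
      have : (0 : ℝ) < t := ht
      exact mem_Ioi.2 (by positivity)
  have hinv := tendsto_inv_nhdsGT_zero.comp hlim
  rcases lt_or_gt_of_ne hy with h | h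
  · have h1 := (hinv.const_mul_atTop_of_neg (show 2 * y < 0 by linarith)).eventually
      (eventually_le_atBot (S.ρm / S.ρp - 1))
    filter_upwards [h1] with t ht
    rw [q₀, if_neg h.not_gt]
    refine q_eq_ρp ?_
    simp only [ratio, Function.comp] at ht ⊢
    rw [div_eq_mul_inv (2 * y)]
    linarith
  · have h1 := (hinv.const_mul_atTop (show 0 < 2 * y by linarith)).eventually
      (eventually_ge_atTop (S.ρp / S.ρm - 1))
    filter_upwards [h1] with t ht
    rw [q₀, if_pos h]
    refine q_eq_ρm ?_
    simp only [ratio, Function.comp] at ht ⊢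
    rw [div_eq_mul_inv (2 * y)]
    linarith

/-- A criterion for balance laws between functions of `q`, `y` and `t`. -/
theorem isBalance {A B C A₀ A₁ : ℝ × ℝ × ℝ → ℝ} {c a' : ℝ × ℝ → ℝ} (κ : ℝ)
    (hA : ∀ x : ℝ × ℝ × ℝ, 0 < x.1 → ContinuousAt A x)
    (hB : ∀ x : ℝ × ℝ × ℝ, 0 < x.1 → ContinuousAt B x)
    (hC : ∀ x : ℝ × ℝ × ℝ, 0 < x.1 → ContinuousAt C x)
    (hA₀ : ∀ x : ℝ × ℝ × ℝ, 0 < x.1 → ContinuousAt A₀ x)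
    (hA₁ : ∀ x : ℝ × ℝ × ℝ, 0 < x.1 → ContinuousAt A₁ x)
    (hc : ∀ z, c z = C (S.q z, z))
    (ha' : ∀ z, |a' z| ≤ |A₀ (S.q z, z)| + |S.qt z| * |A₁ (S.q z, z)|) (hm : Measurable a')
    (ht : ∀ z : ℝ × ℝ, 0 < z.2 → S.ratio z ∉ S.singular κ →
      HasDerivAt (fun t => A (S.q (z.1, t), z.1, t)) (a' z) z.2)
    (hy : ∀ z : ℝ × ℝ, 0 < z.2 → S.ratio z ∉ S.singular κ →
      HasDerivAt (fun y => B (S.q (y, z.2), y, z.2)) (-a' z - c z) z.1) :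
    IsBalance (fun z => A (S.q z, z)) (fun z => B (S.q z, z)) c a'
      (fun y => A (S.q₀ y, y, 0)) := by
  have hcont : ∀ {G : ℝ × ℝ × ℝ → ℝ}, (∀ x : ℝ × ℝ × ℝ, 0 < x.1 → ContinuousAt G x) →
      ContinuousOn (fun z => G (S.q z, z)) {z | 0 < z.2} := fun hG z hz =>
    (ContinuousAt.comp (f := fun z : ℝ × ℝ => (S.q z, z)) (hG (S.q z, z) (q_pos z))
      ((continuousAt_q hz).prodMk continuousAt_id)).continuousWithinAt
  have hbdd : ∀ {G : ℝ × ℝ × ℝ → ℝ}, (∀ x : ℝ × ℝ × ℝ, 0 < x.1 → ContinuousAt G x) →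
      ∀ L T : ℝ, ∃ M, ∀ y ∈ Icc (-L) L, ∀ t ∈ Icc 0 T, |G (S.q (y, t), y, t)| ≤ M := by
    intro G hG L T
    have hK : IsCompact (Icc S.ρm S.ρp ×ˢ (Icc (-L) L ×ˢ Icc 0 T)) :=
      isCompact_Icc.prod (isCompact_Icc.prod isCompact_Icc)
    obtain ⟨M, hM⟩ := hK.exists_bound_of_continuousOn (f := G) fun x hx =>
      (hG x (S.ρm_pos.trans_le hx.1.1)).continuousWithinAt
    exact ⟨M, fun y hy t ht => hM _ ⟨q_mem _, hy, ht⟩⟩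
  refine ⟨hcont hA, hcont hB, ?_, hm, fun L τ T hτ => ?_, fun y hy0 => ?_, fun t ht0 => ?_,
    fun y hy0 => ?_, fun L T => ?_⟩
  · exact (hcont hC).congr fun z _ => hc z
  · obtain ⟨M0, h0⟩ := hbdd hA₀ L T
    obtain ⟨M1, h1⟩ := hbdd hA₁ L T
    -- The time derivative of `q` is controlled by a constant over `t`, so the bound degenerates as
    -- `τ` tends to zero.
    have hpos : 0 ≤ S.ρp * (1 + S.ρp / S.ρm) := by
      have := S.ρp_pos
      have := S.ρm_pos
      positivity
    refine ⟨M0 + S.ρp * (1 + S.ρp / S.ρm) / τ * M1, fun y hy t ht => ?_⟩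
    have ht' : t ∈ Icc 0 T := ⟨hτ.le.trans ht.1, ht.2⟩
    refine (ha' _).trans (add_le_add (h0 y hy t ht') ?_)
    refine mul_le_mul ((abs_qt_le (hτ.trans_le ht.1)).trans ?_) (h1 y hy t ht') (abs_nonneg _)
      (by positivity)
    exact div_le_div_of_nonneg_left hpos hτ ht.1
  · refine ⟨_, countable_singular_time (S := S) κ hy0, fun t ht0 hts => ?_⟩
    exact ht (y, t) ht0 fun h => hts ⟨ht0, h⟩
  · exact ⟨_, countable_singular_space (S := S) κ ht0, fun y hys => hy (y, t) ht0 hys⟩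
  · have hpos : 0 < S.q₀ y := by
      unfold q₀
      split_ifs
      · exact S.ρm_pos
      · exact ρp_pos
    have h1 : Tendsto (fun t : ℝ => A (S.q₀ y, y, t)) (𝓝[>] 0) (𝓝 (A (S.q₀ y, y, 0))) :=
      (ContinuousAt.comp (f := fun t : ℝ => (S.q₀ y, y, t)) (hA (S.q₀ y, y, 0) hpos)
        (by fun_prop)).tendsto.mono_left nhdsWithin_le_nhds
    exact h1.congr' ((eventually_q_eq_q₀ (S := S) hy0).mono fun t h => by simp only [h])
  · obtain ⟨M0, h0⟩ := hbdd hA L T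
    obtain ⟨M1, h1⟩ := hbdd hB L T
    obtain ⟨M2, h2⟩ := hbdd hC L T
    refine ⟨max M0 (max M1 M2), fun y hy t ht => ?_⟩
    have ht' : t ∈ Icc 0 T := ⟨ht.1.le, ht.2⟩
    rw [hc]
    exact ⟨(h0 y hy t ht').trans (le_max_left _ _),
      (h1 y hy t ht').trans ((le_max_left _ _).trans (le_max_right _ _)),
      (h2 y hy t ht').trans ((le_max_right _ _).trans (le_max_right _ _))⟩

end Mixing

end

/-! ### Mass, momentum and energy of the profile -/

noncomputable section

namespace Mixing

variable (S : Mixing)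

/-- The variance of the density, as a function of `q`. -/
def H (x : ℝ) : ℝ := (S.ρp - x) * (x - S.ρm)

/-- The flux, as a function of `q`. -/
def F (x : ℝ) : ℝ := -(S.lam * S.H x / x)

/-- The derivative of the flux with respect to the density, as a function of `q`. -/
def D (x : ℝ) : ℝ := S.lam * (S.ρp * S.ρm / x ^ 2 - 1)

/-- The antiderivative, with respect to the density, of the square of `D`. -/
def J (x : ℝ) : ℝ :=
  S.lam ^ 2 * ((S.ρp * S.ρm) ^ 2 / (3 * x ^ 3) - 2 * (S.ρp * S.ρm) / x - x)

/-- The contribution of the velocity fluctuations to the dissipation. -/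
def K (x : ℝ) : ℝ :=
  (S.ρp + S.ρm - x) * (2 * S.H x + 2 * (S.ρp + S.ρm - 2 * x) * x * (1 - x ^ 2 / (S.ρp * S.ρm)))
    + S.H x * (S.ρp * S.ρm - x ^ 2) * x / (S.ρp * S.ρm)
    + 4 * S.H x * (S.ρp + S.ρm - 2 * x) * x ^ 2 / (S.ρp * S.ρm)

/-- The dissipation density, as a function of `q` and `t`. -/
def dissipation (x t : ℝ) : ℝ :=
  t * (-((1 - 2 * S.lam) * S.g ^ 2 * S.lam * S.H x / x) + S.e * S.H x * S.K x)

variable {S}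

theorem hasDerivAt_H (x : ℝ) : HasDerivAt S.H (S.ρp + S.ρm - 2 * x) x :=
  (((hasDerivAt_id x).const_sub S.ρp).mul ((hasDerivAt_id x).sub_const S.ρm)).congr_deriv
    (by simp; ring)

theorem hasDerivAt_F {x : ℝ} (hx : 0 < x) : HasDerivAt S.F (-S.D x) x := by
  refine ((((hasDerivAt_H x).const_mul S.lam).div (hasDerivAt_id x) hx.ne').neg).congr_deriv ?_
  simp only [H, D, id]
  field_simp
  ring

theorem hasDerivAt_D {x : ℝ} (hx : 0 < x) :
    HasDerivAt S.D (-(2 * S.lam * (S.ρp * S.ρm) / x ^ 3)) x := by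
  refine ((((hasDerivAt_const x (S.ρp * S.ρm)).div (hasDerivAt_pow 2 x)
    (by positivity)).sub_const 1).const_mul S.lam).congr_deriv ?_
  field_simp
  ring

theorem hasDerivAt_J {x : ℝ} (hx : 0 < x) : HasDerivAt S.J (-S.D x ^ 2) x := by
  refine (((((hasDerivAt_const x ((S.ρp * S.ρm) ^ 2)).div ((hasDerivAt_pow 3 x).const_mul 3)
    (by positivity)).sub ((hasDerivAt_const x (2 * (S.ρp * S.ρm))).div (hasDerivAt_id x)
    hx.ne')).sub (hasDerivAt_id x)).const_mul (S.lam ^ 2)).congr_deriv ?_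
  simp only [D, id]
  field_simp
  ring

theorem continuousAt_H (x : ℝ) : ContinuousAt S.H x := (hasDerivAt_H x).continuousAt

theorem continuousAt_F {x : ℝ} (hx : 0 < x) : ContinuousAt S.F x := (hasDerivAt_F hx).continuousAt

theorem continuousAt_D {x : ℝ} (hx : 0 < x) : ContinuousAt S.D x := (hasDerivAt_D hx).continuousAt

theorem continuousAt_J {x : ℝ} (hx : 0 < x) : ContinuousAt S.J x := (hasDerivAt_J hx).continuousAt

theorem continuousAt_K {x : ℝ} : ContinuousAt S.K x := by
  have := S.continuousAt_H x
  unfold K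
  fun_prop

theorem measurable_H : Measurable S.H := by unfold H; fun_prop

theorem measurable_F : Measurable S.F := by
  have := S.measurable_H
  unfold F; fun_prop

theorem measurable_D : Measurable S.D := by unfold D; fun_prop

theorem measurable_J : Measurable S.J := by unfold J; fun_prop

theorem measurable_K : Measurable S.K := by
  have := S.measurable_H
  unfold K; fun_prop

theorem H_nonneg {x : ℝ} (hx : x ∈ Icc S.ρm S.ρp) : 0 ≤ S.H x :=
  mul_nonneg (by linarith [hx.2]) (by linarith [hx.1])

section Derivatives

variable {κ : ℝ} {z : ℝ × ℝ} {f : ℝ → ℝ} {f' : ℝ}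

theorem hasDerivAt_comp_time (hz : 0 < z.2) (h : S.ratio z ∉ S.singular κ)
    (hf : HasDerivAt f f' (S.q z)) :
    HasDerivAt (fun t => f (S.q (z.1, t))) (f' * S.qt z) z.2 :=
  hf.comp z.2 (hasDerivAt_q_time hz h)

theorem hasDerivAt_comp_space (hz : 0 < z.2) (h : S.ratio z ∉ S.singular κ)
    (hf : HasDerivAt f f' (S.q z)) :
    HasDerivAt (fun y => f (S.q (y, z.2))) (f' * S.qy z) z.1 :=
  hf.comp z.1 (hasDerivAt_q_space hz h)

end Derivatives

theorem H_ρm : S.H S.ρm = 0 := by simp [H]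

theorem H_ρp : S.H S.ρp = 0 := by simp [H]

theorem F_ρm : S.F S.ρm = 0 := by simp [F, H_ρm]

theorem F_ρp : S.F S.ρp = 0 := by simp [F, H_ρp]

/-- `q` satisfies the characteristic form of the conservation law. -/
theorem qt_eq {z : ℝ × ℝ} (hz : 0 < z.2) : S.qt z = -(S.g * z.2 * S.D (S.q z) * S.qy z) := by
  have hl := S.lam_pos
  have hg := S.g_pos
  have hp := S.ρp_pos
  have hm := S.ρm_pos
  have hq := S.q_pos z
  rw [qt, qy, D]
  field_simp

section CommonDomain

variable {G : ℝ → ℝ} {x : ℝ × ℝ × ℝ}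

theorem continuousAt_fst_comp (h : ContinuousAt G x.1) : ContinuousAt (fun x : ℝ × ℝ × ℝ => G x.1) x :=
  ContinuousAt.comp (f := fun x : ℝ × ℝ × ℝ => x.1) h continuousAt_fst

end CommonDomain

/-- Conservation of mass. -/
theorem isBalance_mass : IsBalance (fun z => S.ρp + S.ρm - S.q z)
    (fun z => S.g * z.2 * S.F (S.q z)) (fun _ => 0) (fun z => -S.qt z)
    (fun y => S.ρp + S.ρm - S.q₀ y) := by
  -- The additional singular level 1 is arbitrary, since these functions have no kink inside the
  -- zone; the same choice is made for momentum and energy.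
  refine isBalance (S := S) (A := fun x => S.ρp + S.ρm - x.1) (B := fun x => S.g * x.2.2 * S.F x.1)
    (C := fun _ => 0) (A₀ := fun _ => 0) (A₁ := fun _ => -1) 1 (fun x hx => by fun_prop)
    (fun x hx => ?_) (fun x hx => by fun_prop) (fun x hx => by fun_prop) (fun x hx => by fun_prop)
    (fun z => rfl) (fun z => by simp) S.measurable_qt.neg (fun z hz h => ?_) (fun z hz h => ?_)
  · have := continuousAt_fst_comp (S.continuousAt_F hx)
    fun_prop
  · exact (hasDerivAt_q_time hz h).const_sub _
  · refine ((hasDerivAt_comp_space hz h (hasDerivAt_F (S := S) (q_pos z))).const_mul (S.g * z.2)).congr_deriv ?_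
    rw [qt_eq hz]
    ring

/-- Balance of vertical momentum; the flux is the sum of the momentum flux and the pressure. -/
theorem isBalance_momentum : IsBalance (fun z => S.g * z.2 * S.F (S.q z))
    (fun z => -((S.ρp + S.ρm - S.q z) * S.g * z.1) + S.g ^ 2 * z.2 ^ 2
      * (S.F (S.q z) / 2 - S.F (S.q z) * S.D (S.q z) / 2 + 3 * S.J (S.q z) / 2))
    (fun z => S.g * (S.ρp + S.ρm - S.q z))
    (fun z => S.g * S.F (S.q z) + S.qt z * (-(S.g * z.2 * S.D (S.q z)))) (fun _ => 0) := by
  have key := isBalance (S := S) (A := fun x => S.g * x.2.2 * S.F x.1)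
    (B := fun x => -((S.ρp + S.ρm - x.1) * S.g * x.2.1) + S.g ^ 2 * x.2.2 ^ 2
      * (S.F x.1 / 2 - S.F x.1 * S.D x.1 / 2 + 3 * S.J x.1 / 2))
    (C := fun x => S.g * (S.ρp + S.ρm - x.1)) (A₀ := fun x => S.g * S.F x.1)
    (A₁ := fun x => -(S.g * x.2.2 * S.D x.1))
    (c := fun z => S.g * (S.ρp + S.ρm - S.q z))
    (a' := fun z => S.g * S.F (S.q z) + S.qt z * (-(S.g * z.2 * S.D (S.q z)))) 1
    (fun x hx => by have := continuousAt_fst_comp (S.continuousAt_F hx); fun_prop)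
    (fun x hx => by
      have h1 := continuousAt_fst_comp (S.continuousAt_F hx)
      have h2 := continuousAt_fst_comp (S.continuousAt_D hx)
      have h3 := continuousAt_fst_comp (S.continuousAt_J hx)
      fun_prop)
    (fun x hx => by fun_prop)
    (fun x hx => by have := continuousAt_fst_comp (S.continuousAt_F hx); fun_prop)
    (fun x hx => by have := continuousAt_fst_comp (S.continuousAt_D hx); fun_prop)
    (fun z => rfl) (fun z => (abs_add_le _ _).trans_eq (congrArg _ (abs_mul _ _)))
    (by
      have h1 := S.measurable_F
      have h2 := S.measurable_q
      have h3 := S.measurable_D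
      have h4 := S.measurable_qt
      fun_prop) (fun z hz h => ?_) (fun z hz h => ?_)
  · simpa using key
  · refine (((hasDerivAt_id z.2).const_mul S.g).mul
      (hasDerivAt_comp_time hz h (hasDerivAt_F (S := S) (q_pos z)))).congr_deriv ?_
    simp
    ring
  · have dq := hasDerivAt_q_space hz h
    have dF := hasDerivAt_comp_space hz h (hasDerivAt_F (S := S) (q_pos z))
    have dD := hasDerivAt_comp_space hz h (hasDerivAt_D (S := S) (q_pos z))
    have dJ := hasDerivAt_comp_space hz h (hasDerivAt_J (S := S) (q_pos z))
    refine (((((dq.const_sub (S.ρp + S.ρm)).mul_const S.g).mul (hasDerivAt_id z.1)).neg).add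
      ((((dF.div_const 2).sub ((dF.mul dD).div_const 2)).add
        ((dJ.const_mul 3).div_const 2)).const_mul (S.g ^ 2 * z.2 ^ 2))).congr_deriv ?_
    have hl := S.lam_pos
    have hg := S.g_pos
    have hp := S.ρp_pos
    have hm := S.ρm_pos
    have hq := S.q_pos z
    rw [qt_eq hz]
    simp only [id, Prod.mk.eta]
    rcases S.on_cases hz with ⟨h1, -, h3⟩ | ⟨h1, h2⟩
    -- Inside the zone the height is the characteristic displacement. This cancels the term from
    -- differentiating the density in the hydrostatic part against `F / 2`.
    · have hy : z.1 = z.2 ^ 2 * S.g * S.D (S.q z) / 2 := by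
        rw [D]
        field_simp
        linarith
      have hqy : S.qy z = -S.q z ^ 3 / (S.ρp * S.ρm * S.lam * S.g * z.2 ^ 2) := by
        rw [qy, h1, one_mul]
      rw [hy]
      -- Since `D` is linear in the height with slope `2 / (g * t ^ 2)`, the product of `F` and its
      -- derivative supplies the explicit time derivative of the momentum.
      have hFqy : S.g ^ 2 * z.2 ^ 2 * (S.F (S.q z) * (-(2 * S.lam * (S.ρp * S.ρm) / S.q z ^ 3))
          * S.qy z) = 2 * S.g * S.F (S.q z) := by
        rw [hqy]
        field_simp
      linear_combination (-1 / 2) * hFqy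
    · have hqy : S.qy z = 0 := by rw [qy, h1, zero_mul]
      have hF : S.F (S.q z) = 0 := by rcases h2 with h2 | h2 <;> rw [h2] <;> simp [F_ρm, F_ρp]
      rw [hqy, hF]
      ring

/-- Balance of kinetic energy. -/
theorem isBalance_energy : IsBalance
    (fun z => (S.ρp + S.ρm - S.q z) * (S.e * z.2 ^ 2 * S.H (S.q z) ^ 2)
      - S.lam * S.g ^ 2 * z.2 ^ 2 * S.F (S.q z) / 2)
    (fun z => -(S.lam / 2 * S.g ^ 3 * z.2 ^ 3 * S.F (S.q z) * S.D (S.q z))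
      + 2 * (S.e * z.2 ^ 2 * S.H (S.q z) ^ 2) * (S.g * z.2 * S.F (S.q z)))
    (fun z => S.g * (S.g * z.2 * S.F (S.q z)) - S.dissipation (S.q z) z.2)
    (fun z => 2 * z.2 * ((S.ρp + S.ρm - S.q z) * S.e * S.H (S.q z) ^ 2
        - S.lam * S.g ^ 2 * S.F (S.q z) / 2)
      + S.qt z * (S.e * z.2 ^ 2 * (2 * (S.ρp + S.ρm - S.q z) * S.H (S.q z)
        * (S.ρp + S.ρm - 2 * S.q z) - S.H (S.q z) ^ 2)
        + S.lam * S.g ^ 2 * z.2 ^ 2 * S.D (S.q z) / 2)) (fun _ => 0) := by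
  have key := isBalance (S := S)
    (A := fun x => (S.ρp + S.ρm - x.1) * (S.e * x.2.2 ^ 2 * S.H x.1 ^ 2)
      - S.lam * S.g ^ 2 * x.2.2 ^ 2 * S.F x.1 / 2)
    (B := fun x => -(S.lam / 2 * S.g ^ 3 * x.2.2 ^ 3 * S.F x.1 * S.D x.1)
      + 2 * (S.e * x.2.2 ^ 2 * S.H x.1 ^ 2) * (S.g * x.2.2 * S.F x.1))
    (C := fun x => S.g * (S.g * x.2.2 * S.F x.1) - S.dissipation x.1 x.2.2)
    (A₀ := fun x => 2 * x.2.2 * ((S.ρp + S.ρm - x.1) * S.e * S.H x.1 ^ 2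
        - S.lam * S.g ^ 2 * S.F x.1 / 2))
    (A₁ := fun x => S.e * x.2.2 ^ 2 * (2 * (S.ρp + S.ρm - x.1) * S.H x.1
        * (S.ρp + S.ρm - 2 * x.1) - S.H x.1 ^ 2) + S.lam * S.g ^ 2 * x.2.2 ^ 2 * S.D x.1 / 2)
    (c := fun z => S.g * (S.g * z.2 * S.F (S.q z)) - S.dissipation (S.q z) z.2)
    (a' := fun z => 2 * z.2 * ((S.ρp + S.ρm - S.q z) * S.e * S.H (S.q z) ^ 2
        - S.lam * S.g ^ 2 * S.F (S.q z) / 2)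
      + S.qt z * (S.e * z.2 ^ 2 * (2 * (S.ρp + S.ρm - S.q z) * S.H (S.q z)
        * (S.ρp + S.ρm - 2 * S.q z) - S.H (S.q z) ^ 2)
        + S.lam * S.g ^ 2 * z.2 ^ 2 * S.D (S.q z) / 2)) 1
    (fun x hx => by
      have h1 := continuousAt_fst_comp (S.continuousAt_F hx)
      have h2 := continuousAt_fst_comp (S.continuousAt_H x.1)
      fun_prop)
    (fun x hx => by
      have h1 := continuousAt_fst_comp (S.continuousAt_F hx)
      have h2 := continuousAt_fst_comp (S.continuousAt_H x.1)
      have h3 := continuousAt_fst_comp (S.continuousAt_D hx)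
      fun_prop)
    (fun x hx => by
      have h1 := continuousAt_fst_comp (S.continuousAt_F hx)
      have h2 := continuousAt_fst_comp (S.continuousAt_H x.1)
      have h3 := continuousAt_fst_comp (S.continuousAt_K (x := x.1))
      have h4 : x.1 ≠ 0 := hx.ne'
      unfold dissipation
      fun_prop (disch := assumption))
    (fun x hx => by
      have h1 := continuousAt_fst_comp (S.continuousAt_F hx)
      have h2 := continuousAt_fst_comp (S.continuousAt_H x.1)
      fun_prop)
    (fun x hx => by
      have h2 := continuousAt_fst_comp (S.continuousAt_H x.1)
      have h3 := continuousAt_fst_comp (S.continuousAt_D hx)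
      fun_prop)
    (fun z => rfl) (fun z => (abs_add_le _ _).trans_eq (congrArg _ (abs_mul _ _)))
    (by
      have h1 := S.measurable_F
      have h2 := S.measurable_q
      have h3 := S.measurable_D
      have h4 := S.measurable_qt
      have h5 := S.measurable_H
      fun_prop) (fun z hz h => ?_) (fun z hz h => ?_)
  · simpa using key
  · have dq := hasDerivAt_q_time hz h
    have dF := hasDerivAt_comp_time hz h (hasDerivAt_F (S := S) (q_pos z))
    have dH := hasDerivAt_comp_time hz h (hasDerivAt_H (S := S) (S.q z))
    have dt := hasDerivAt_pow 2 z.2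
    refine (((dq.const_sub (S.ρp + S.ρm)).mul ((dt.const_mul S.e).mul (dH.pow 2))).sub
      (((dt.const_mul (S.lam * S.g ^ 2)).mul dF).div_const 2)).congr_deriv ?_
    simp
    ring
  · have dF := hasDerivAt_comp_space hz h (hasDerivAt_F (S := S) (q_pos z))
    have dD := hasDerivAt_comp_space hz h (hasDerivAt_D (S := S) (q_pos z))
    have dH := hasDerivAt_comp_space hz h (hasDerivAt_H (S := S) (S.q z))
    refine ((((dF.const_mul (S.lam / 2 * S.g ^ 3 * z.2 ^ 3)).mul dD).neg).add
      ((((dH.pow 2).const_mul (S.e * z.2 ^ 2)).const_mul 2).mul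
        (dF.const_mul (S.g * z.2)))).congr_deriv ?_
    have hl := S.lam_pos
    have hg := S.g_pos
    have hp := S.ρp_pos
    have hm := S.ρm_pos
    have hq := S.q_pos z
    rcases S.on_cases hz with ⟨h1, -, h3⟩ | ⟨h1, h2⟩
    · have hqy : S.qy z = -S.q z ^ 3 / (S.ρp * S.ρm * S.lam * S.g * z.2 ^ 2) := by
        rw [qy, h1, one_mul]
      rw [qt_eq hz, hqy]
      simp only [F, D, dissipation, K, Prod.mk.eta, Pi.pow_apply]
      -- The derivative of `H` is already explicit, so the identity holds with the remaining values
      -- of `H` as a free variable; `K` was defined to collect the fluctuation terms.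
      generalize S.H (S.q z) = h
      simp
      field_simp
      ring
    · have hqy : S.qy z = 0 := by rw [qy, h1, zero_mul]
      have hH : S.H (S.q z) = 0 := by rcases h2 with h2 | h2 <;> rw [h2] <;> simp [H_ρm, H_ρp]
      rw [qt_eq hz, hqy]
      simp [F, hH, dissipation]

end Mixing

end

/-! ### The rarefaction profile is the entropy solution -/

noncomputable section

theorem sign_mul_self_eq_abs (x : ℝ) : Real.sign x * x = |x| := by
  rcases lt_trichotomy x 0 with h | h | h
  · rw [Real.sign_of_neg h, abs_of_neg h]; ring
  · simp [h]
  · rw [Real.sign_of_pos h, abs_of_pos h]; ring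

namespace Mixing

variable (S : Mixing)

/-- The density profile. -/
def dens (z : ℝ × ℝ) : ℝ := S.ρp + S.ρm - S.q z

/-- The sign in the derivative of `|κ - q|`. -/
def side (κ : ℝ) (z : ℝ × ℝ) : ℝ := if S.q z < κ then 1 else -1

variable {S}

theorem measurable_dens : Measurable S.dens := measurable_const.sub S.measurable_q

theorem dens_mem (z : ℝ × ℝ) : S.dens z ∈ Icc S.ρm S.ρp := by
  have := S.q_mem z
  constructor <;> simp only [dens] <;> linarith [this.1, this.2]

theorem flux_sub (x : ℝ) : flux S.ρm S.ρp S.lam (S.ρp + S.ρm - x) = S.F x := by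
  simp only [flux, F, H]
  rw [show S.ρp + S.ρm - (S.ρp + S.ρm - x) = x by ring]
  ring

theorem flux_dens (z : ℝ × ℝ) : flux S.ρm S.ρp S.lam (S.dens z) = S.F (S.q z) := flux_sub _

theorem abs_side_le (κ : ℝ) (z : ℝ × ℝ) : |S.side κ z| ≤ 1 := by
  unfold side
  split_ifs <;> simp

theorem side_mul_eq_abs (κ : ℝ) (z : ℝ × ℝ) : S.side κ z * (κ - S.q z) = |κ - S.q z| := by
  unfold side
  split_ifs with h
  · rw [one_mul, abs_of_pos (sub_pos.2 h)]
  · rw [abs_of_nonpos (by linarith)]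
    ring

theorem hasDerivAt_abs_sub_q {κ : ℝ} {z : ℝ × ℝ} (h : S.q z ≠ κ) :
    HasDerivAt (fun x => |κ - x|) (-S.side κ z) (S.q z) := by
  unfold side
  rcases lt_or_gt_of_ne h with h | h
  · rw [if_pos h]
    refine ((hasDerivAt_id (S.q z)).const_sub κ).congr_of_eventuallyEq ?_
    filter_upwards [eventually_lt_nhds h] with x hx
    exact abs_of_pos (sub_pos.2 hx)
  · rw [if_neg h.not_gt, neg_neg]
    refine ((hasDerivAt_id (S.q z)).sub_const κ).congr_of_eventuallyEq ?_
    filter_upwards [eventually_gt_nhds h] with x hx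
    rw [abs_sub_comm]
    exact abs_of_pos (sub_pos.2 hx)

/-- The entropy equality for the Kruzhkov entropies. -/
theorem isBalance_entropy {κ : ℝ} (hκ : 0 < κ) : IsBalance (fun z => |κ - S.q z|)
    (fun z => S.g * z.2 * (|κ - S.q z| * (S.lam * (S.ρp * S.ρm / (S.q z * κ) - 1)))) (fun _ => 0)
    (fun z => -(S.side κ z * S.qt z)) (fun y => |κ - S.q₀ y|) := by
  -- The extra singular level `ρp * ρm / κ ^ 2` is where `q` equals `κ`, the only kink of the
  -- entropy inside the zone.
  have hne : ∀ {z : ℝ × ℝ}, S.ratio z ∈ S.zone →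
      S.ratio z ∉ S.singular (S.ρp * S.ρm / κ ^ 2) → S.q z ≠ κ := by
    intro z hz hs hq
    apply hs
    have h1 := S.q_sq z
    rw [clamped_eq hz, hq] at h1
    refine Or.inr (Or.inr ?_)
    rw [mem_singleton_iff, ← h1]
    field_simp
  refine isBalance (S := S) (A := fun x => |κ - x.1|)
    (B := fun x => S.g * x.2.2 * (|κ - x.1| * (S.lam * (S.ρp * S.ρm / (x.1 * κ) - 1))))
    (C := fun _ => 0) (A₀ := fun _ => 0) (A₁ := fun _ => 1) (S.ρp * S.ρm / κ ^ 2)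
    (fun x hx => by fun_prop) (fun x hx => ?_) (fun x hx => by fun_prop) (fun x hx => by fun_prop)
    (fun x hx => by fun_prop) (fun z => rfl) (fun z => ?_) ?_ (fun z hz h => ?_) (fun z hz h => ?_)
  · have : x.1 * κ ≠ 0 := by positivity
    fun_prop (disch := assumption)
  · rw [abs_neg, abs_mul]
    have := mul_le_mul_of_nonneg_right (abs_side_le (S := S) κ z) (abs_nonneg (S.qt z))
    simpa using this
  · have : Measurable (S.side κ) :=
      Measurable.ite (measurableSet_lt S.measurable_q measurable_const) measurable_const
        measurable_const
    exact (this.mul S.measurable_qt).neg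
  · by_cases h' : S.ratio z ∈ S.zone
    · exact (hasDerivAt_comp_time hz h (hasDerivAt_abs_sub_q (hne h' h))).congr_deriv (by ring)
    · obtain ⟨h0, h1⟩ := eventually_q_eq hz h h'
      rw [qt, h0]
      have hγ : ContinuousAt (fun t : ℝ => (z.1, t)) z.2 := by fun_prop
      refine ((hasDerivAt_const z.2 |κ - S.q z|).congr_of_eventuallyEq
        ((hγ.eventually h1).mono fun t ht => ?_)).congr_deriv (by ring)
      simp only [ht]
  · by_cases h' : S.ratio z ∈ S.zone
    · have hq := S.q_pos z
      have hp := S.ρp_pos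
      have hm := S.ρm_pos
      have d1 := hasDerivAt_abs_sub_q (hne h' h)
      have d2 : HasDerivAt (fun x => S.lam * (S.ρp * S.ρm / (x * κ) - 1))
          (-(S.lam * (S.ρp * S.ρm) / (S.q z ^ 2 * κ))) (S.q z) := by
        refine ((((hasDerivAt_const (S.q z) (S.ρp * S.ρm)).div ((hasDerivAt_id (S.q z)).mul_const κ)
          (by simp only [id]; positivity)).sub_const 1).const_mul S.lam).congr_deriv ?_
        simp only [id]
        field_simp
        ring
      refine ((hasDerivAt_comp_space hz h (d1.mul d2)).const_mul (S.g * z.2)).congr_deriv ?_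
      rw [← side_mul_eq_abs, qt_eq hz, D]
      field_simp
      ring
    · obtain ⟨h0, h1⟩ := eventually_q_eq hz h h'
      rw [qt, h0]
      have hγ : ContinuousAt (fun y : ℝ => (y, z.2)) z.1 := by fun_prop
      refine ((hasDerivAt_const z.1 (S.g * z.2 * (|κ - S.q z|
        * (S.lam * (S.ρp * S.ρm / (S.q z * κ) - 1))))).congr_of_eventuallyEq
        ((hγ.eventually h1).mono fun y hy => ?_)).congr_deriv (by ring)
      simp only [hy]

theorem sub_q₀ (y : ℝ) : S.ρp + S.ρm - S.q₀ y = flat S.ρm S.ρp y := by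
  unfold q₀ flat
  split_ifs <;> ring

/-- The profile has no shocks at positive times, so the chain rule holds off the singular lines and
every Kruzhkov entropy is conserved exactly; the inequality is an equality. -/
theorem isEntropySolution : IsEntropySolution S.ρm S.ρp S.g (flux S.ρm S.ρp S.lam) S.dens := by
  refine ⟨S.measurable_dens.aestronglyMeasurable, Eventually.of_forall dens_mem, ?_⟩
  intro k hk φ hφ hφc _
  set κ := S.ρp + S.ρm - k with hκ
  have hκ0 : 0 < κ := by linarith [hk.2, S.ρm_pos]
  -- Beyond the radius `M` the test function vanishes, so the initial boundary value problem with
  -- half height and final time both equal to `M` has no boundary terms.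
  obtain ⟨M, hM0, hM⟩ : ∃ M > 0, tsupport φ ⊆ Metric.ball 0 M :=
    (hφc.isCompact.isBounded.subset_ball_lt 0 0).imp fun _ h => h
  have hout : ∀ z : ℝ × ℝ, M ≤ |z.1| ∨ M ≤ |z.2| → z ∉ tsupport φ := by
    intro z hz h
    have := hM h
    rw [mem_ball_zero_iff, Prod.norm_def, max_lt_iff, Real.norm_eq_abs, Real.norm_eq_abs] at this
    rcases hz with hz | hz
    · linarith [this.1]
    · linarith [this.2]
  have h0 : ∀ z : ℝ × ℝ, M ≤ |z.1| ∨ M ≤ |z.2| → φ z = 0 := fun z hz =>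
    image_eq_zero_of_notMem_tsupport (hout z hz)
  have hd0 : ∀ z : ℝ × ℝ, M ≤ |z.1| ∨ M ≤ |z.2| → fderiv ℝ φ z = 0 := fun z hz =>
    image_eq_zero_of_notMem_tsupport fun h => hout z hz (tsupport_fderiv_subset ℝ h)
  have hw := (isBalance_entropy (S := S) hκ0).weak hφ hM0 hM0
    (fun y => h0 _ (Or.inr (le_abs_self M)))
  have e1 : ∫ t in Ioo 0 M, (S.g * t * (|κ - S.q (M, t)| * (S.lam * (S.ρp * S.ρm
      / (S.q (M, t) * κ) - 1))) * φ (M, t) - S.g * t * (|κ - S.q (-M, t)| * (S.lam * (S.ρp * S.ρm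
      / (S.q (-M, t) * κ) - 1))) * φ (-M, t)) = 0 := by
    refine integral_eq_zero_of_ae (Eventually.of_forall fun t => ?_)
    simp [h0 (M, t) (Or.inl (le_abs_self M)), h0 (-M, t) (Or.inl (neg_le_abs (-M) |>.trans' (by simp)))]
  have e2 : ∫ y in Ioo (-M) M, |κ - S.q₀ y| * φ (y, 0) = ∫ y, |flat S.ρm S.ρp y - k| * φ (y, 0) := by
    rw [setIntegral_eq_integral_of_forall_compl_eq_zero]
    · refine integral_congr_ae (Eventually.of_forall fun y => ?_)
      simp only
      rw [← sub_q₀, hκ]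
      congr 2
      ring
    · intro y hy
      rw [h0 _ (Or.inl ?_), mul_zero]
      by_contra! hlt
      exact hy (abs_lt.1 hlt)
  have e3 : ∫ z in Ioo (-M) M ×ˢ Ioo 0 M, (|κ - S.q z| * fderiv ℝ φ z (0, 1)
      + S.g * z.2 * (|κ - S.q z| * (S.lam * (S.ρp * S.ρm / (S.q z * κ) - 1)))
        * fderiv ℝ φ z (1, 0) - 0 * φ z)
      = ∫ z in (univ : Set ℝ) ×ˢ Ioi (0 : ℝ), (|S.dens z - k| * fderiv ℝ φ z (0, 1)
        + S.g * z.2 * (Real.sign (S.dens z - k) * (flux S.ρm S.ρp S.lam (S.dens z)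
          - flux S.ρm S.ρp S.lam k)) * fderiv ℝ φ z (1, 0)) := by
    rw [setIntegral_eq_of_subset_of_forall_sdiff_eq_zero (MeasurableSet.univ.prod measurableSet_Ioi)
      (s := Ioo (-M) M ×ˢ Ioo 0 M) (prod_mono (subset_univ _) fun t ht => ht.1)]
    · refine setIntegral_congr_fun (measurableSet_Ioo.prod measurableSet_Ioo) fun z _ => ?_
      have hd : S.dens z - k = κ - S.q z := by simp only [dens, hκ]; ring
      have hk' : k = S.ρp + S.ρm - κ := by rw [hκ]; ring
      have hq := S.q_pos z
      rw [flux_dens, hd, hk', flux_sub]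
      -- The chord slope of the flux is explicit in the reflected variables, so the sign in the
      -- Kruzhkov flux can be absorbed into an absolute value.
      have hF : S.F (S.q z) - S.F κ = (κ - S.q z) * (S.lam * (S.ρp * S.ρm / (S.q z * κ) - 1)) := by
        simp only [F, H]
        field_simp
        ring
      rw [hF, ← mul_assoc (Real.sign _), sign_mul_self_eq_abs]
      ring
    · intro z hz
      have : M ≤ |z.1| ∨ M ≤ |z.2| := by
        by_contra! hlt
        have := abs_lt.1 hlt.2
        exact hz.2 ⟨abs_lt.1 hlt.1, hz.1.2, this.2⟩
      rw [hd0 z this]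
      simp
  rw [e1, e2, sub_zero] at hw
  rw [← e3]
  exact hw.ge

end Mixing

end

/-! ### The mixing zone and the subsolution -/

noncomputable section

namespace Mixing

variable {S : Mixing}

theorem upper_end (t : ℝ) : S.lam / (1 - atwood S.ρm S.ρp) * atwood S.ρm S.ρp * S.g * t ^ 2
    = S.lam * S.g * t ^ 2 * (S.ρp - S.ρm) / (2 * S.ρm) := by
  have hp := S.ρp_pos
  have hm := S.ρm_pos
  have h : 1 - atwood S.ρm S.ρp = 2 * S.ρm / (S.ρp + S.ρm) := by
    rw [atwood]; field_simp; ring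
  rw [h, atwood]
  field_simp

theorem lower_end (t : ℝ) : S.lam / (1 + atwood S.ρm S.ρp) * atwood S.ρm S.ρp * S.g * t ^ 2
    = S.lam * S.g * t ^ 2 * (S.ρp - S.ρm) / (2 * S.ρp) := by
  have hp := S.ρp_pos
  have hm := S.ρm_pos
  have h : 1 + atwood S.ρm S.ρp = 2 * S.ρp / (S.ρp + S.ρm) := by
    rw [atwood]; field_simp; ring
  rw [h, atwood]
  field_simp

theorem lt_ratio_iff {s t : ℝ} (ht : 0 < t) : S.ρm / S.ρp < S.ratio (s, t) ↔
    -(S.lam * S.g * t ^ 2 * (S.ρp - S.ρm) / (2 * S.ρp)) < s := by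
  have hp := S.ρp_pos
  have hl := S.lam_pos
  have hg := S.g_pos
  have e : S.ratio (s, t) - S.ρm / S.ρp = 2 / (S.lam * S.g * t ^ 2)
      * (s - -(S.lam * S.g * t ^ 2 * (S.ρp - S.ρm) / (2 * S.ρp))) := by
    simp only [ratio]
    field_simp
    ring
  rw [← sub_pos, e, mul_pos_iff_of_pos_left (by positivity), sub_pos]

theorem ratio_lt_iff {s t : ℝ} (ht : 0 < t) : S.ratio (s, t) < S.ρp / S.ρm ↔
    s < S.lam * S.g * t ^ 2 * (S.ρp - S.ρm) / (2 * S.ρm) := by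
  have hm := S.ρm_pos
  have hl := S.lam_pos
  have hg := S.g_pos
  have e : S.ρp / S.ρm - S.ratio (s, t) = 2 / (S.lam * S.g * t ^ 2)
      * (S.lam * S.g * t ^ 2 * (S.ρp - S.ρm) / (2 * S.ρm) - s) := by
    simp only [ratio]
    field_simp
    ring
  rw [← sub_pos, e, mul_pos_iff_of_pos_left (by positivity), sub_pos]

theorem mem_mixingZone_iff {s t : ℝ} (ht : 0 < t) :
    s ∈ mixingZone S.ρm S.ρp S.g S.lam t ↔ S.ratio (s, t) ∈ S.zone := by
  rw [mixingZone, zone, mem_Ioo, mem_Ioo, lt_ratio_iff ht, ratio_lt_iff ht, upper_end, lower_end]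

/-- The mixing zone stays below the height `L` up to time `T`. -/
def Below (S : Mixing) (L T : ℝ) : Prop :=
  S.lam * S.g * T ^ 2 * (S.ρp - S.ρm) / (2 * S.ρm) < L

theorem below_of_closure_subset {L T : ℝ} (hT : 0 < T)
    (h : closure (mixingZone S.ρm S.ρp S.g S.lam T) ⊆ Ioo (-L) L) : S.Below L T := by
  have hp := S.ρp_pos
  have hm := S.ρm_pos
  have hl := S.lam_pos
  have hg := S.g_pos
  have hd := sub_pos.2 S.ρm_lt
  have h1 : 0 < S.lam * S.g * T ^ 2 * (S.ρp - S.ρm) / (2 * S.ρm) := by positivity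
  have h2 : 0 < S.lam * S.g * T ^ 2 * (S.ρp - S.ρm) / (2 * S.ρp) := by positivity
  rw [mixingZone, upper_end, lower_end, closure_Ioo (by linarith)] at h
  exact (h (right_mem_Icc.2 (by linarith))).2

theorem q_eq_ρm_of_le {L T y t : ℝ} (h : S.Below L T) (ht : t ∈ Ioc 0 T) (hy : L ≤ y) :
    S.q (y, t) = S.ρm := by
  refine q_eq_ρm (le_of_not_gt fun h' => ?_)
  rw [ratio_lt_iff ht.1] at h'
  have hm := S.ρm_pos
  have hl := S.lam_pos
  have hg := S.g_pos
  have hd := sub_pos.2 S.ρm_lt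
  have : S.lam * S.g * t ^ 2 * (S.ρp - S.ρm) / (2 * S.ρm)
      ≤ S.lam * S.g * T ^ 2 * (S.ρp - S.ρm) / (2 * S.ρm) := by
    have := ht.1.le
    have := ht.2
    gcongr
  unfold Below at h
  linarith

/-- The lower end of the zone is closer to zero than the upper one, because `ρm < ρp` stand in the
denominators; `Below` therefore controls both ends. -/
theorem q_eq_ρp_of_le {L T y t : ℝ} (h : S.Below L T) (ht : t ∈ Ioc 0 T) (hy : y ≤ -L) :
    S.q (y, t) = S.ρp := by
  refine q_eq_ρp (le_of_not_gt fun h' => ?_)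
  rw [lt_ratio_iff ht.1] at h'
  have hm := S.ρm_pos
  have hp := S.ρp_pos
  have hl := S.lam_pos
  have hg := S.g_pos
  have hd := sub_pos.2 S.ρm_lt
  have : S.lam * S.g * t ^ 2 * (S.ρp - S.ρm) / (2 * S.ρp)
      ≤ S.lam * S.g * T ^ 2 * (S.ρp - S.ρm) / (2 * S.ρm) := by
    have := ht.1.le
    have := ht.2
    have := S.ρm_lt.le
    gcongr
  unfold Below at h
  linarith

/-! ### The subsolution -/

variable (S) in
/-- The variance of the velocity fluctuations. -/
def theta (z : ℝ × ℝ) : ℝ := S.e * z.2 ^ 2 * S.H (S.q z) ^ 2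

variable (S) in
/-- The vertical momentum. -/
def mom (z : ℝ × ℝ) : ℝ := S.g * z.2 * S.F (S.q z)

variable (S) in
/-- The vertical momentum flux. -/
def momFlux (z : ℝ × ℝ) : ℝ := S.dens z * S.theta z - S.lam * S.g ^ 2 * z.2 ^ 2 * S.F (S.q z)

variable (S) in
/-- The kinetic energy. -/
def kinetic (z : ℝ × ℝ) : ℝ :=
  S.dens z * S.theta z - S.lam * S.g ^ 2 * z.2 ^ 2 * S.F (S.q z) / 2

variable (S) in
/-- The flux of kinetic energy. -/
def kinFlux (z : ℝ × ℝ) : ℝ :=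
  -(S.lam / 2 * S.g ^ 3 * z.2 ^ 3 * S.F (S.q z) * S.D (S.q z)) + 2 * S.theta z * S.mom z

variable (S) in
/-- The sum of the vertical momentum flux and the pressure. -/
def total (z : ℝ × ℝ) : ℝ := -(S.dens z * S.g * z.1) + S.g ^ 2 * z.2 ^ 2
      * (S.F (S.q z) / 2 - S.F (S.q z) * S.D (S.q z) / 2 + 3 * S.J (S.q z) / 2)

variable (S) in
/-- The pressure. -/
def pressure (z : ℝ × ℝ) : ℝ := S.total z - S.momFlux z

variable (S) in
/-- The subsolution. -/
def state (z : ℝ × ℝ) : State :=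
  !₂[S.dens z, 0, 0, 0, S.mom z, S.dens z * S.theta z, 0, S.momFlux z, 0, S.kinFlux z]

variable (S) in
/-- A bound for the velocities up to time `T`. -/
def speed (T : ℝ) : ℝ :=
  S.lam * S.g * T * (S.ρp - S.ρm) / S.ρm + 2 * (T * (S.ρp - S.ρm) ^ 2 * √(6 / 7 * S.e))

theorem H_le {x : ℝ} (hx : x ∈ Icc S.ρm S.ρp) : S.H x ≤ (S.ρp - S.ρm) ^ 2 := by
  rw [H, sq]
  exact mul_le_mul (by linarith [hx.1]) (by linarith [hx.2]) (by linarith [hx.1])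
    (by linarith [S.ρm_lt])

theorem H_pos {x : ℝ} (hx : x ∈ Ioo S.ρm S.ρp) : 0 < S.H x :=
  mul_pos (by linarith [hx.2]) (by linarith [hx.1])

/-- The state is the mixture of heavy fluid with fraction `α` and velocity `Vp` and light fluid with
velocity `Vm`, both with variance `theta`. The velocities are determined by zero mean velocity and
mean momentum `mom`. In the open zone the fraction and the fluctuations are nondegenerate, which
makes the mixture interior. -/
theorem state_mem_interior_hull (he : 0 < S.e) {T : ℝ} {z : ℝ × ℝ} (hz : z.2 ∈ Ioc 0 T)
    (hr : S.ratio z ∈ S.zone) : S.state z ∈ interior (hull S.ρm S.ρp (S.speed T)) := by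
  have hq := q_mem_Ioo hr
  have hq0 := S.q_pos z
  have hm := S.ρm_pos
  have hp := S.ρp_pos
  have hl := S.lam_pos
  have hg := S.g_pos
  have hd := sub_pos.2 S.ρm_lt
  have hH := H_pos hq
  have hHle := H_le ⟨hq.1.le, hq.2.le⟩
  have ht := hz.1
  set x := S.q z with hx
  set α := (S.ρp - x) / (S.ρp - S.ρm) with hα
  set Vp := -(S.lam * S.g * z.2 * (x - S.ρm) / x) with hVp
  set Vm := S.lam * S.g * z.2 * (S.ρp - x) / x with hVm
  -- The amplitude is normalized so that the second moment `7 / 6 * a ^ 2` of the twelve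
  -- fluctuations equals `theta`.
  set a := z.2 * S.H x * √(6 / 7 * S.e) with ha
  have hs : √(6 / 7 * S.e) ^ 2 = 6 / 7 * S.e := Real.sq_sqrt (by positivity)
  have hs0 : 0 < √(6 / 7 * S.e) := Real.sqrt_pos.2 (by positivity)
  have hθ : 7 / 6 * a ^ 2 = S.theta z := by
    rw [ha, theta, mul_pow, mul_pow, hs]
    ring
  have hle : ∀ u, 0 ≤ u → u ≤ S.ρp - S.ρm → S.lam * S.g * z.2 * u / x + 2 * a ≤ S.speed T := by
    intro u hu0 hu
    rw [ha, speed]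
    have := hz.2
    have := hq.1.le
    have hT0 : 0 ≤ T := hz.1.le.trans hz.2
    have h1 : 0 ≤ S.lam * S.g * T := by positivity
    have h2 : 0 ≤ S.lam * S.g * T * (S.ρp - S.ρm) := by positivity
    gcongr
  have key := mixture_mem_interior_hull (R := S.speed T) (α := α) (Vp := Vp) (Vm := Vm) (a := a)
    hm S.ρm_lt ⟨div_pos (by linarith [hq.2]) hd, (div_lt_one hd).2 (by linarith [hq.1])⟩
    (by positivity) (by
      rw [hVp, abs_neg, abs_of_nonneg (div_nonneg (mul_nonneg (by positivity)
        (by linarith [hq.1])) hq0.le)]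
      exact hle _ (by linarith [hq.1]) (by linarith [hq.2])) (by
      rw [hVm, abs_of_nonneg (div_nonneg (mul_nonneg (by positivity)
        (by linarith [hq.2])) hq0.le)]
      exact hle _ (by linarith [hq.2]) (by linarith [hq.1]))
  rw [hθ] at key
  convert key using 1
  have hne : S.ρp - S.ρm ≠ 0 := hd.ne'
  apply State.ext <;> simp [state, turbulentState, mom, momFlux, kinFlux, dens, ← hx, hα, hVp, hVm,
    F, D, H] <;> field_simp <;> ring

end Mixing

end

/-! ### Energy of the profile and strength of the fluctuations -/

noncomputable section

theorem measurable_flat (ρm ρp : ℝ) : Measurable (flat ρm ρp) :=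
  Measurable.ite measurableSet_Ioi measurable_const measurable_const

namespace Mixing

variable {S : Mixing}

theorem J_sub : S.J S.ρm - S.J S.ρp
    = S.lam ^ 2 * (S.ρp - S.ρm) ^ 3 / (3 * (S.ρp * S.ρm)) := by
  have hp := S.ρp_pos
  have hm := S.ρm_pos
  rw [J, J]
  field_simp
  ring

theorem continuous_q_space {t : ℝ} (ht : 0 < t) : Continuous fun y => S.q (y, t) :=
  continuous_iff_continuousAt.2 fun y => ContinuousAt.comp (f := fun y : ℝ => (y, t))
    (continuousAt_q (S := S) (z := (y, t)) ht) (by fun_prop)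

theorem continuous_F_space {t : ℝ} (ht : 0 < t) : Continuous fun y => S.F (S.q (y, t)) :=
  continuous_iff_continuousAt.2 fun _ => ContinuousAt.comp (f := fun y : ℝ => S.q (y, t))
    (continuousAt_F (q_pos _)) (continuous_q_space ht).continuousAt

theorem continuous_D_space {t : ℝ} (ht : 0 < t) : Continuous fun y => S.D (S.q (y, t)) :=
  continuous_iff_continuousAt.2 fun _ => ContinuousAt.comp (f := fun y : ℝ => S.q (y, t))
    (continuousAt_D (q_pos _)) (continuous_q_space ht).continuousAt

theorem continuous_J_space {t : ℝ} (ht : 0 < t) : Continuous fun y => S.J (S.q (y, t)) :=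
  continuous_iff_continuousAt.2 fun _ => ContinuousAt.comp (f := fun y : ℝ => S.q (y, t))
    (continuousAt_J (q_pos _)) (continuous_q_space ht).continuousAt

theorem continuous_H_space {t : ℝ} (ht : 0 < t) : Continuous fun y => S.H (S.q (y, t)) :=
  continuous_iff_continuousAt.2 fun _ => ContinuousAt.comp (f := fun y : ℝ => S.q (y, t))
    (continuousAt_H _) (continuous_q_space ht).continuousAt

theorem continuous_dens_space {t : ℝ} (ht : 0 < t) : Continuous fun y => S.dens (y, t) :=
  continuous_const.sub (continuous_q_space ht)

theorem continuous_dens_mul_theta_space {t : ℝ} (ht : 0 < t) :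
    Continuous fun y => S.dens (y, t) * S.theta (y, t) := by
  have h1 := continuous_dens_space (S := S) ht
  have h2 := continuous_H_space (S := S) ht
  unfold theta
  fun_prop

variable (S) in
/-- A primitive of the laminar part of the energy. -/
def primitive (z : ℝ × ℝ) : ℝ :=
  -(S.lam / 4 * S.g ^ 3 * z.2 ^ 4 * (S.F (S.q z) * S.D (S.q z) - S.J (S.q z)))
    + S.g * z.1 ^ 2 * S.dens z / 2 - S.g ^ 3 * z.2 ^ 4 / 8 * S.J (S.q z)
    - S.g * z.1 * ((S.ρp - S.ρm) * |z.1| + (S.ρp + S.ρm) * z.1) / 4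

/-- In the zone `F dy = (g t² / 2) F dD`, which integrates by parts to `(g t² / 2) (F D - J)`;
likewise `y² dρ` is a multiple of `D² dρ = dJ`. The term with `|y|` is the primitive of the flat
profile. -/
theorem hasDerivAt_primitive {κ : ℝ} {z : ℝ × ℝ} (hz : 0 < z.2) (h : S.ratio z ∉ S.singular κ)
    (h0 : z.1 ≠ 0) : HasDerivAt (fun y => S.primitive (y, z.2))
      (-(S.lam * S.g ^ 2 * z.2 ^ 2 * S.F (S.q z) / 2)
        + S.g * z.1 * (S.dens z - flat S.ρm S.ρp z.1)) z.1 := by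
  have hl := S.lam_pos
  have hg := S.g_pos
  have hp := S.ρp_pos
  have hm := S.ρm_pos
  have hq := S.q_pos z
  have dq := hasDerivAt_q_space hz h
  have dF := hasDerivAt_comp_space hz h (hasDerivAt_F (S := S) hq)
  have dD := hasDerivAt_comp_space hz h (hasDerivAt_D (S := S) hq)
  have dJ := hasDerivAt_comp_space hz h (hasDerivAt_J (S := S) hq)
  have dy := hasDerivAt_id z.1
  have dabs := hasDerivAt_abs h0
  have key := ((((((dF.mul dD).sub dJ).const_mul (S.lam / 4 * S.g ^ 3 * z.2 ^ 4)).neg).add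
    ((((dy.pow 2).const_mul S.g).mul (dq.const_sub (S.ρp + S.ρm))).div_const 2)).sub
    (dJ.const_mul (S.g ^ 3 * z.2 ^ 4 / 8))).sub
    (((dy.const_mul S.g).mul ((dabs.const_mul (S.ρp - S.ρm)).add
      (dy.const_mul (S.ρp + S.ρm)))).div_const 4)
  refine key.congr_deriv ?_
  have habs : |z.1| = SignType.sign z.1 * z.1 := (sign_mul_self z.1).symm
  have hflat : flat S.ρm S.ρp z.1
      = ((S.ρp + S.ρm) + (S.ρp - S.ρm) * SignType.sign z.1) / 2 := by
    rw [flat]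
    rcases lt_or_gt_of_ne h0 with h1 | h1
    · rw [if_neg h1.not_gt, sign_neg h1]; norm_num; try ring
    · rw [if_pos h1, sign_pos h1]; norm_num; try ring
  rw [hflat, dens]
  simp only [id, Prod.mk.eta, Pi.pow_apply, Pi.add_apply, Pi.mul_apply]
  rw [habs]
  generalize ((SignType.sign z.1 : SignType) : ℝ) = σ
  rcases S.on_cases hz with ⟨h1, -, h3⟩ | ⟨h1, h2⟩
  · have hy : z.1 = z.2 ^ 2 * S.g * S.D (S.q z) / 2 := by
      rw [D]
      field_simp
      linarith
    have hqy : S.qy z = -S.q z ^ 3 / (S.ρp * S.ρm * S.lam * S.g * z.2 ^ 2) := by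
      rw [qy, h1, one_mul]
    have hFqy : S.g * z.2 ^ 2 * (S.F (S.q z) * (-(2 * S.lam * (S.ρp * S.ρm) / S.q z ^ 3))
        * S.qy z) = 2 * S.F (S.q z) := by
      rw [hqy]
      field_simp
    rw [hy]
    simp
    linear_combination (-S.lam / 4 * S.g ^ 2 * z.2 ^ 2) * hFqy
  · have hqy : S.qy z = 0 := by rw [qy, h1, zero_mul]
    have hF : S.F (S.q z) = 0 := by rcases h2 with h2 | h2 <;> rw [h2] <;> simp [F_ρm, F_ρp]
    rw [hqy, hF]
    simp
    ring

/-- The energy of the subsolution relative to the initial energy, without the contribution of the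
velocity fluctuations. -/
theorem integral_laminar {L T t : ℝ} (hL : 0 < L) (hB : S.Below L T) (ht : t ∈ Ioc 0 T) :
    IntegrableOn (fun y => -(S.lam * S.g ^ 2 * t ^ 2 * S.F (S.q (y, t)) / 2)
      + S.g * y * (S.dens (y, t) - flat S.ρm S.ρp y)) (Ioo (-L) L) ∧
    ∫ y in Ioo (-L) L, (-(S.lam * S.g ^ 2 * t ^ 2 * S.F (S.q (y, t)) / 2)
        + S.g * y * (S.dens (y, t) - flat S.ρm S.ρp y))
      = (S.ρp - S.ρm) * (S.lam ^ 2 * (S.lam - 1 / 2) * (S.g ^ 3 * t ^ 4 * atwood S.ρm S.ρp ^ 2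
        / (3 * (1 - atwood S.ρm S.ρp ^ 2)))) := by
  have hp := S.ρp_pos
  have hm := S.ρm_pos
  have hle : -L ≤ L := by linarith
  have c1 := continuous_F_space (S := S) ht.1
  have c2 := continuous_dens_space (S := S) ht.1
  have c3 := continuous_D_space (S := S) ht.1
  have c4 := continuous_J_space (S := S) ht.1
  have hflat : IntegrableOn (fun y => S.g * y * flat S.ρm S.ρp y) (Icc (-L) L) := by
    refine Integrable.mul_bdd (c := S.ρp) ?_ (measurable_flat _ _).aestronglyMeasurable ?_
    · exact ContinuousOn.integrableOn_compact isCompact_Icc (by fun_prop)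
    · refine Eventually.of_forall fun y => ?_
      have := S.ρm_lt.le
      rw [flat, Real.norm_eq_abs]
      split_ifs
      · rw [abs_of_pos hp]
      · rwa [abs_of_pos hm]
  have hint : IntegrableOn (fun y => -(S.lam * S.g ^ 2 * t ^ 2 * S.F (S.q (y, t)) / 2)
      + S.g * y * (S.dens (y, t) - flat S.ρm S.ρp y)) (Icc (-L) L) := by
    have h1 : IntegrableOn (fun y => -(S.lam * S.g ^ 2 * t ^ 2 * S.F (S.q (y, t)) / 2)
      + S.g * y * S.dens (y, t)) (Icc (-L) L) :=
      ContinuousOn.integrableOn_compact isCompact_Icc (by fun_prop)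
    refine (h1.sub hflat).congr (Eventually.of_forall fun y => ?_)
    simp only [Pi.sub_apply]
    ring
  refine ⟨hint.mono_set Ioo_subset_Icc_self, ?_⟩
  have key := MeasureTheory.integral_eq_of_hasDerivAt_off_countable
    (f := fun y => S.primitive (y, t)) (a := -L) (b := L)
    (f' := fun y => -(S.lam * S.g ^ 2 * t ^ 2 * S.F (S.q (y, t)) / 2)
      + S.g * y * (S.dens (y, t) - flat S.ρm S.ρp y))
    ((countable_singular_space (S := S) 1 ht.1).union (countable_singleton 0))
    (by unfold primitive; fun_prop)
    (fun y hy => hasDerivAt_primitive (S := S) (κ := 1) (z := (y, t)) ht.1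
      (fun h => hy.2 (Or.inl h)) fun h => hy.2 (Or.inr h))
    ((intervalIntegrable_iff_integrableOn_Icc_of_le hle).2 hint)
  rw [intervalIntegral.integral_of_le hle, integral_Ioc_eq_integral_Ioo] at key
  rw [key]
  -- At the two ends the fluid is unmixed, the flux vanishes and the quadratic terms cancel, so only
  -- the difference of the end values of `J` survives.
  simp only [primitive, dens, q_eq_ρm_of_le hB ht le_rfl, q_eq_ρp_of_le hB ht le_rfl, F_ρm, F_ρp,
    abs_neg, abs_of_pos hL]
  have hJ := S.J_sub
  have hA : atwood S.ρm S.ρp ^ 2 / (3 * (1 - atwood S.ρm S.ρp ^ 2))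
      = (S.ρp - S.ρm) ^ 2 / (12 * (S.ρp * S.ρm)) := by
    have h : 1 - atwood S.ρm S.ρp ^ 2 = 4 * (S.ρp * S.ρm) / (S.ρp + S.ρm) ^ 2 := by
      rw [atwood]; field_simp; ring
    rw [h, atwood]
    field_simp
    ring
  have hA' : S.g ^ 3 * t ^ 4 * atwood S.ρm S.ρp ^ 2 / (3 * (1 - atwood S.ρm S.ρp ^ 2))
      = S.g ^ 3 * t ^ 4 * ((S.ρp - S.ρm) ^ 2 / (12 * (S.ρp * S.ρm))) := by
    rw [mul_div_assoc, hA]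
  have hJ' : S.J S.ρm = S.J S.ρp + S.lam ^ 2 * (S.ρp - S.ρm) ^ 3 / (3 * (S.ρp * S.ρm)) := by
    linarith
  rw [hA', hJ']
  field_simp
  ring

theorem theta_eq_zero {z : ℝ × ℝ} (hz : 0 < z.2) (h : S.ratio z ∉ S.zone) : S.theta z = 0 := by
  rcases S.on_cases hz with ⟨h1, -⟩ | ⟨-, h2⟩
  · rw [on, if_neg h] at h1
    exact absurd h1 zero_ne_one
  · rw [theta]
    rcases h2 with h2 | h2 <;> simp [h2, H_ρm, H_ρp]

theorem F_eq_zero {z : ℝ × ℝ} (hz : 0 < z.2) (h : S.ratio z ∉ S.zone) : S.F (S.q z) = 0 := by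
  rcases S.on_cases hz with ⟨h1, -⟩ | ⟨-, h2⟩
  · rw [on, if_neg h] at h1
    exact absurd h1 zero_ne_one
  · rcases h2 with h2 | h2 <;> simp [h2, F_ρm, F_ρp]

variable (S) in
/-- A bound for the energy of the velocity fluctuations. -/
def energyBound : ℝ := S.ρp * (S.ρp - S.ρm) ^ 5 * (S.lam * S.g) * (1 / (2 * S.ρm) + 1 / (2 * S.ρp))

/-- The energy of the velocity fluctuations. -/
theorem abs_integral_fluctuations_le {L t : ℝ} (ht : 0 < t) (he : 0 ≤ S.e) :
    |∫ y in Ioo (-L) L, S.dens (y, t) * S.theta (y, t)| ≤ S.e * S.energyBound * t ^ 4 := by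
  have hp := S.ρp_pos
  have hm := S.ρm_pos
  have hl := S.lam_pos
  have hg := S.g_pos
  have hd := sub_pos.2 S.ρm_lt
  have hzero : ∀ y ∉ mixingZone S.ρm S.ρp S.g S.lam t, S.dens (y, t) * S.theta (y, t) = 0 :=
    fun y hy => by
      rw [mem_mixingZone_iff ht] at hy
      rw [theta_eq_zero (z := (y, t)) ht hy, mul_zero]
  have h1 : ∫ y in Ioo (-L) L, S.dens (y, t) * S.theta (y, t)
      = ∫ y in Ioo (-L) L ∩ mixingZone S.ρm S.ρp S.g S.lam t, S.dens (y, t) * S.theta (y, t) := by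
    refine setIntegral_eq_of_subset_of_forall_sdiff_eq_zero measurableSet_Ioo inter_subset_left ?_
    exact fun y hy => hzero y fun h => hy.2 ⟨hy.1, h⟩
  -- The length of the zone and the variance are both of order `t ^ 2`, hence the power `t ^ 4`.
  have hlen : volume (mixingZone S.ρm S.ρp S.g S.lam t)
      = ENNReal.ofReal (S.lam * S.g * t ^ 2 * (S.ρp - S.ρm) * (1 / (2 * S.ρm) + 1 / (2 * S.ρp))) := by
    rw [mixingZone, upper_end, lower_end, Real.volume_Ioo]
    congr 1
    ring
  have hlt : volume (Ioo (-L) L ∩ mixingZone S.ρm S.ρp S.g S.lam t) < ⊤ :=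
    (measure_mono inter_subset_right).trans_lt (by rw [hlen]; exact ENNReal.ofReal_lt_top)
  have hb : ∀ y ∈ Ioo (-L) L ∩ mixingZone S.ρm S.ρp S.g S.lam t,
      ‖S.dens (y, t) * S.theta (y, t)‖ ≤ S.ρp * (S.e * t ^ 2 * ((S.ρp - S.ρm) ^ 2) ^ 2) := by
    intro y _
    have hH := H_nonneg (S.q_mem (y, t))
    have hH' := H_le (S.q_mem (y, t))
    have hdm := S.dens_mem (y, t)
    rw [Real.norm_eq_abs, abs_mul, abs_of_nonneg (hm.le.trans hdm.1), theta,
      abs_of_nonneg (by positivity)]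
    have := hdm.2
    gcongr
  rw [h1, ← Real.norm_eq_abs]
  refine (norm_setIntegral_le_of_norm_le_const hlt hb).trans ?_
  have hr : volume.real (Ioo (-L) L ∩ mixingZone S.ρm S.ρp S.g S.lam t)
      ≤ S.lam * S.g * t ^ 2 * (S.ρp - S.ρm) * (1 / (2 * S.ρm) + 1 / (2 * S.ρp)) := by
    refine ENNReal.toReal_le_of_le_ofReal (by positivity) ?_
    rw [← hlen]
    exact measure_mono inter_subset_right
  refine (mul_le_mul_of_nonneg_left hr (by positivity)).trans_eq ?_
  rw [energyBound]
  ring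

/-- For weak velocity fluctuations the dissipation density is close to the one of the flux. -/
theorem exists_strength (S : Mixing) (hlam : S.lam < 1 / 2) {ε : ℝ} (hε : 0 < ε) :
    ∃ e > 0, e * S.energyBound / (S.ρp - S.ρm) ≤ ε ∧ ∀ z : ℝ × ℝ, 0 < z.2 →
      ({S with e := e} : Mixing).dissipation (S.q z) z.2 ≤ 0 ∧
      |({S with e := e} : Mixing).dissipation (S.q z) z.2
        - (1 - 2 * S.lam) * S.g ^ 2 * z.2 * flux S.ρm S.ρp S.lam (S.dens z)|
        ≤ ε * z.2 * ((S.ρp - S.dens z) * (S.dens z - S.ρm)) := by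
  have hp := S.ρp_pos
  have hm := S.ρm_pos
  have hl := S.lam_pos
  have hg := S.g_pos
  have hd := sub_pos.2 S.ρm_lt
  obtain ⟨M, hM⟩ := (isCompact_Icc (a := S.ρm) (b := S.ρp)).exists_bound_of_continuousOn
    (f := S.K) fun x _ => S.continuousAt_K.continuousWithinAt
  have hM0 : 0 ≤ M := (norm_nonneg _).trans (hM S.ρm (left_mem_Icc.2 S.ρm_lt.le))
  have hE : 0 < S.energyBound := by unfold energyBound; positivity
  -- Since `q ≤ ρp`, this bounds from below the laminar dissipation per unit of `t * H`.
  -- Fluctuations whose contribution stays below it cannot make the dissipation density positive.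
  have hη : 0 < (1 - 2 * S.lam) * S.g ^ 2 * S.lam / S.ρp := by
    have : 0 < 1 - 2 * S.lam := by linarith
    positivity
  set η := (1 - 2 * S.lam) * S.g ^ 2 * S.lam / S.ρp with hηdef
  have hM1 : 0 < M + 1 := by linarith
  -- The three upper bounds on `e` serve the energy estimate, the distance of the dissipation from
  -- the laminar one, and its sign.
  refine ⟨min (ε * (S.ρp - S.ρm) / S.energyBound) (min ε η / (M + 1)),
    lt_min (by positivity) (div_pos (lt_min hε hη) hM1), ?_, fun z hz => ?_⟩
  · rw [div_le_iff₀ hd, ← le_div_iff₀ hE]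
    exact min_le_left _ _
  set e := min (ε * (S.ρp - S.ρm) / S.energyBound) (min ε η / (M + 1)) with he
  have he0 : 0 < e := lt_min (by positivity) (div_pos (lt_min hε hη) hM1)
  have heM : e * (M + 1) ≤ min ε η := by
    rw [← le_div_iff₀ hM1]
    exact min_le_right _ _
  have hK := hM (S.q z) (S.q_mem z)
  rw [Real.norm_eq_abs] at hK
  have hH := H_nonneg (S.q_mem z)
  have hq := S.q_pos z
  have heK : e * |S.K (S.q z)| ≤ min ε η :=
    (mul_le_mul_of_nonneg_left (by linarith) he0.le).trans heM
  have hdiss : ({S with e := e} : Mixing).dissipation (S.q z) z.2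
      = z.2 * (-((1 - 2 * S.lam) * S.g ^ 2 * S.lam * S.H (S.q z) / S.q z)
        + e * S.H (S.q z) * S.K (S.q z)) := rfl
  rw [hdiss, flux_dens]
  constructor
  · refine mul_nonpos_of_nonneg_of_nonpos hz.le ?_
    have h1 : η ≤ (1 - 2 * S.lam) * S.g ^ 2 * S.lam / S.q z := by
      have : 0 ≤ (1 - 2 * S.lam) * S.g ^ 2 * S.lam :=
        mul_nonneg (mul_nonneg (by linarith) (by positivity)) hl.le
      exact div_le_div_of_nonneg_left this hq (S.q_mem z).2
    have h2 : e * S.K (S.q z) ≤ η :=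
      (mul_le_mul_of_nonneg_left (le_abs_self _) he0.le).trans (heK.trans (min_le_right _ _))
    have h3 := mul_le_mul_of_nonneg_left (h2.trans h1) hH
    have h4 : (1 - 2 * S.lam) * S.g ^ 2 * S.lam * S.H (S.q z) / S.q z
        = S.H (S.q z) * ((1 - 2 * S.lam) * S.g ^ 2 * S.lam / S.q z) := by ring
    rw [h4]
    linarith
  · have h1 : z.2 * (-((1 - 2 * S.lam) * S.g ^ 2 * S.lam * S.H (S.q z) / S.q z)
        + e * S.H (S.q z) * S.K (S.q z)) - (1 - 2 * S.lam) * S.g ^ 2 * z.2 * S.F (S.q z)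
        = z.2 * S.H (S.q z) * (e * S.K (S.q z)) := by
      rw [F]
      ring
    have h2 : (S.ρp - S.dens z) * (S.dens z - S.ρm) = S.H (S.q z) := by
      rw [dens, H]
      ring
    rw [h1, h2, abs_mul, abs_mul, abs_of_pos hz, abs_of_nonneg hH, abs_mul, abs_of_pos he0]
    calc z.2 * S.H (S.q z) * (e * |S.K (S.q z)|) ≤ z.2 * S.H (S.q z) * ε := by
          have := heK.trans (min_le_left _ _)
          gcongr
      _ = _ := by ring

/-! ### Smoothness in the mixing zone -/

theorem contDiffAt_q {z : ℝ × ℝ} (hz : 0 < z.2) (h : S.ratio z ∈ S.zone) :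
    ContDiffAt ℝ 2 S.q z := by
  have hp := S.ρp_pos
  have hm := S.ρm_pos
  have hl := S.lam_pos
  have hg := S.g_pos
  have hr0 : 0 < S.ratio z := left_pos.trans h.1
  have hr : ContDiffAt ℝ 2 S.ratio z := by
    have : S.lam * S.g * z.2 ^ 2 ≠ 0 := by positivity
    unfold ratio
    exact contDiffAt_const.add ((by fun_prop : ContDiffAt ℝ 2 (fun z : ℝ × ℝ => 2 * z.1) z).div
      (by fun_prop) this)
  have h1 : ContDiffAt ℝ 2 (fun z => √(S.ρp * S.ρm / S.ratio z)) z :=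
    (contDiffAt_const.div hr hr0.ne').sqrt (div_pos (mul_pos hp hm) hr0).ne'
  refine h1.congr_of_eventuallyEq ?_
  filter_upwards [(continuousAt_ratio hz).eventually_mem (isOpen_Ioo.mem_nhds h)] with z' hz'
  rw [q, clamped_eq hz']

theorem contDiffAt_pressure {z : ℝ × ℝ} (hz : 0 < z.2) (h : S.ratio z ∈ S.zone) :
    ContDiffAt ℝ 2 S.pressure z := by
  have hq := contDiffAt_q hz h
  have hq0 : S.q z ≠ 0 := (S.q_pos z).ne'
  have h2 : S.q z ^ 2 ≠ 0 := pow_ne_zero _ hq0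
  have h3 : 3 * S.q z ^ 3 ≠ 0 := mul_ne_zero three_ne_zero (pow_ne_zero _ hq0)
  have hH : ContDiffAt ℝ 2 (fun z => S.H (S.q z)) z := by unfold H; fun_prop
  have hF : ContDiffAt ℝ 2 (fun z => S.F (S.q z)) z :=
    ((contDiffAt_const.mul hH).div hq hq0).neg
  have hD : ContDiffAt ℝ 2 (fun z => S.D (S.q z)) z :=
    contDiffAt_const.mul ((contDiffAt_const.div (hq.pow 2) h2).sub contDiffAt_const)
  have hJ : ContDiffAt ℝ 2 (fun z => S.J (S.q z)) z :=
    contDiffAt_const.mul (((contDiffAt_const.div (contDiffAt_const.mul (hq.pow 3)) h3).sub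
      (contDiffAt_const.div hq hq0)).sub hq)
  unfold pressure total momFlux theta dens
  fun_prop

/-- The profile has no continuous extension to time zero, but the pressure is a continuous function
of `(q, y, t)`, which stays in a compact set. -/
theorem abs_pressure_bound (S : Mixing) (L T : ℝ) :
    ∃ C, ∀ y ∈ Icc (-L) L, ∀ t ∈ Icc 0 T, |S.pressure (y, t)| ≤ C := by
  let G : ℝ × ℝ × ℝ → ℝ := fun x => -((S.ρp + S.ρm - x.1) * S.g * x.2.1) + S.g ^ 2 * x.2.2 ^ 2
      * (S.F x.1 / 2 - S.F x.1 * S.D x.1 / 2 + 3 * S.J x.1 / 2)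
      - ((S.ρp + S.ρm - x.1) * (S.e * x.2.2 ^ 2 * S.H x.1 ^ 2) - S.lam * S.g ^ 2 * x.2.2 ^ 2 * S.F x.1)
  have hK : IsCompact (Icc S.ρm S.ρp ×ˢ (Icc (-L) L ×ˢ Icc 0 T)) :=
    isCompact_Icc.prod (isCompact_Icc.prod isCompact_Icc)
  obtain ⟨M, hM⟩ := hK.exists_bound_of_continuousOn (f := G) fun x hx => by
    have hx0 : 0 < x.1 := S.ρm_pos.trans_le hx.1.1
    have h1 := continuousAt_fst_comp (S.continuousAt_F hx0)
    have h2 := continuousAt_fst_comp (S.continuousAt_D hx0)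
    have h3 := continuousAt_fst_comp (S.continuousAt_J hx0)
    have h4 := continuousAt_fst_comp (S.continuousAt_H x.1)
    have : ContinuousAt G x := by fun_prop
    exact this.continuousWithinAt
  exact ⟨M, fun y hy t ht => hM (S.q (y, t), y, t) ⟨S.q_mem _, hy, ht⟩⟩

theorem measurable_theta : Measurable S.theta := by
  have h1 := S.measurable_q
  have h2 := S.measurable_H
  unfold theta; fun_prop

theorem measurable_mom : Measurable S.mom := by
  have h1 := S.measurable_q
  have h2 := S.measurable_F
  unfold mom; fun_prop

theorem measurable_momFlux : Measurable S.momFlux := by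
  have h1 := S.measurable_q
  have h2 := S.measurable_F
  have h3 := S.measurable_theta
  have h4 := S.measurable_dens
  unfold momFlux; fun_prop

theorem measurable_kinFlux : Measurable S.kinFlux := by
  have h1 := S.measurable_q
  have h2 := S.measurable_F
  have h3 := S.measurable_theta
  have h4 := S.measurable_mom
  have h5 := S.measurable_D
  unfold kinFlux; fun_prop

theorem measurable_pressure : Measurable S.pressure := by
  have h1 := S.measurable_q
  have h2 := S.measurable_F
  have h3 := S.measurable_momFlux
  have h4 := S.measurable_dens
  have h5 := S.measurable_D
  have h6 := S.measurable_J
  unfold pressure total; fun_prop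

theorem measurable_dissipation : Measurable fun z : ℝ × ℝ => S.dissipation (S.q z) z.2 := by
  have h1 := S.measurable_q
  have h2 := S.measurable_H
  have h3 := S.measurable_K
  unfold dissipation; fun_prop

theorem continuousAt_state {z : ℝ × ℝ} (hz : 0 < z.2) : ContinuousAt S.state z := by
  have hq := S.continuousAt_q hz
  have hq0 := S.q_pos z
  have hH : ContinuousAt (fun z => S.H (S.q z)) z := ContinuousAt.comp (g := S.H) (f := S.q) (continuousAt_H _) hq
  have hF : ContinuousAt (fun z => S.F (S.q z)) z := ContinuousAt.comp (g := S.F) (f := S.q) (continuousAt_F hq0) hq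
  have hD : ContinuousAt (fun z => S.D (S.q z)) z := ContinuousAt.comp (g := S.D) (f := S.q) (continuousAt_D hq0) hq
  refine (PiLp.continuous_toLp 2 _).continuousAt.comp (continuousAt_pi.2 fun i => ?_)
  unfold kinFlux momFlux mom theta dens
  fin_cases i <;> simp <;> fun_prop

end Mixing

end

/-! ### Coordinates of the channel and reduction to vertical columns -/

noncomputable section

section Slices

variable {d : ℕ}

/-- The vertical coordinate and the time. -/
def col (z : Space d × ℝ) : ℝ × ℝ := (height z.1, z.2)

@[simp] theorem height_atHeight (x' : Fin d → ℝ) (s : ℝ) : height (atHeight x' s) = s := by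
  simp [height, atHeight]

@[simp] theorem atHeight_castSucc (x' : Fin d → ℝ) (s : ℝ) (i : Fin d) :
    atHeight x' s i.castSucc = x' i := by
  simp [atHeight]

@[simp] theorem atHeight_last (x' : Fin d → ℝ) (s : ℝ) :
    atHeight x' s (Fin.last d) = s := by
  simp [atHeight]

@[simp] theorem col_slice (x' : Fin d → ℝ) (y : ℝ × ℝ) : col (atHeight x' y.1, y.2) = y := by
  simp [col]

theorem space_ext {x x' : Space d} (h : ∀ i : Fin d, x i.castSucc = x' i.castSucc)
    (h' : height x = height x') : x = x' := by
  ext i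
  induction i using Fin.lastCases with
  | last => exact h'
  | cast i => exact h i

theorem measurable_height : Measurable (height : Space d → ℝ) :=
  (EuclideanSpace.proj (𝕜 := ℝ) (Fin.last d)).continuous.measurable

theorem continuous_height : Continuous (height : Space d → ℝ) :=
  (EuclideanSpace.proj (𝕜 := ℝ) (Fin.last d)).continuous

theorem continuous_col : Continuous (col : Space d × ℝ → ℝ × ℝ) :=
  (continuous_height.comp continuous_fst).prodMk continuous_snd

theorem measurable_col : Measurable (col : Space d × ℝ → ℝ × ℝ) := continuous_col.measurable

/-- Horizontal and vertical coordinates. -/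
def sliceEquiv (d : ℕ) : ((Fin d → ℝ) × ℝ) ≃ᵐ Space d :=
  (MeasurableEquiv.prodComm.trans
    (MeasurableEquiv.piFinSuccAbove (fun _ : Fin (d + 1) => ℝ) (Fin.last d)).symm).trans
    (MeasurableEquiv.toLp 2 (Fin (d + 1) → ℝ))

theorem sliceEquiv_apply (u : (Fin d → ℝ) × ℝ) : sliceEquiv d u = atHeight u.1 u.2 := by
  have h : sliceEquiv d u = WithLp.toLp 2 ((Fin.last d).insertNth (α := fun _ => ℝ) u.2 u.1) := rfl
  rw [h, Fin.insertNth_last', atHeight]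

theorem measurePreserving_sliceEquiv : MeasurePreserving (sliceEquiv d) volume volume :=
  ((PiLp.volume_preserving_toLp (Fin (d + 1))).comp
    ((volume_preserving_piFinSuccAbove (fun _ : Fin (d + 1) => ℝ) (Fin.last d)).symm)).comp
    (Measure.measurePreserving_swap (μ := (volume : Measure (Fin d → ℝ)))
      (ν := (volume : Measure ℝ)))

/-- Horizontal coordinates on the one hand, vertical coordinate and time on the other hand. -/
def spaceTimeEquiv (d : ℕ) : ((Fin d → ℝ) × (ℝ × ℝ)) ≃ᵐ Space d × ℝ :=
  MeasurableEquiv.prodAssoc.symm.trans ((sliceEquiv d).prodCongr (MeasurableEquiv.refl ℝ))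

theorem spaceTimeEquiv_apply (u : (Fin d → ℝ) × (ℝ × ℝ)) :
    spaceTimeEquiv d u = (atHeight u.1 u.2.1, u.2.2) := by
  have h : spaceTimeEquiv d u = (sliceEquiv d (u.1, u.2.1), u.2.2) := rfl
  rw [h, sliceEquiv_apply]

theorem measurePreserving_spaceTimeEquiv :
    MeasurePreserving (spaceTimeEquiv d) volume volume :=
  (measurePreserving_sliceEquiv.prod (MeasurePreserving.id (volume : Measure ℝ))).comp
    (measurePreserving_prodAssoc (volume : Measure (Fin d → ℝ)) (volume : Measure ℝ)
      (volume : Measure ℝ)).symm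

/-- The vertical section of the channel during a time interval. -/
def strip (L T : ℝ) : Set (ℝ × ℝ) := Ioo (-L) L ×ˢ Ioo 0 T

theorem measurableSet_strip (L T : ℝ) : MeasurableSet (strip L T) :=
  measurableSet_Ioo.prod measurableSet_Ioo

theorem torusCell_eq : torusCell d = univ.pi fun _ => Ico (0 : ℝ) 1 := by
  ext x; simp [torusCell]

theorem measurableSet_torusCell : MeasurableSet (torusCell d) := by
  rw [torusCell_eq]
  exact MeasurableSet.univ_pi fun _ => measurableSet_Ico

theorem volume_torusCell : volume (torusCell d) = 1 := by
  rw [torusCell_eq, Real.volume_pi_Ico]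
  simp

instance : IsProbabilityMeasure (volume.restrict (torusCell d)) :=
  ⟨by rw [Measure.restrict_apply_univ, volume_torusCell]⟩

theorem preimage_spaceTime (L T : ℝ) :
    spaceTimeEquiv d ⁻¹' spaceTime d L T = torusCell d ×ˢ strip L T := by
  ext u
  simp [spaceTimeEquiv_apply, spaceTime, channel, torusCell, strip]
  tauto

theorem preimage_channel (L : ℝ) :
    sliceEquiv d ⁻¹' channel d L = torusCell d ×ˢ Ioo (-L) L := by
  ext u
  simp [sliceEquiv_apply, channel, torusCell]

theorem measurableSet_channel (L : ℝ) : MeasurableSet (channel d L) := by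
  have h := (measurableSet_torusCell (d := d)).prod (measurableSet_Ioo (a := -L) (b := L))
  rw [← preimage_channel (d := d)] at h
  exact (MeasurableEquiv.measurableSet_preimage _).1 h

theorem measurableSet_spaceTime (L T : ℝ) : MeasurableSet (spaceTime d L T) :=
  (measurableSet_channel L).prod measurableSet_Ioo

theorem volume_channel_lt_top (L : ℝ) : volume (channel d L) < ⊤ := by
  rw [← measurePreserving_sliceEquiv.measure_preimage (measurableSet_channel L).nullMeasurableSet,
    preimage_channel, Measure.volume_eq_prod, Measure.prod_prod, volume_torusCell, one_mul]
  exact measure_Ioo_lt_top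

instance (L T : ℝ) : IsFiniteMeasure (volume.restrict (spaceTime d L T)) := by
  refine ⟨?_⟩
  rw [Measure.restrict_apply_univ, spaceTime, Measure.volume_eq_prod, Measure.prod_prod]
  exact ENNReal.mul_lt_top (volume_channel_lt_top L) measure_Ioo_lt_top

variable {F : Type*} [NormedAddCommGroup F] {L T : ℝ}

theorem integrableOn_spaceTime_iff {G : Space d × ℝ → F} :
    IntegrableOn (fun u : (Fin d → ℝ) × (ℝ × ℝ) => G (atHeight u.1 u.2.1, u.2.2))
      (torusCell d ×ˢ strip L T) ↔ IntegrableOn G (spaceTime d L T) := by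
  rw [← measurePreserving_spaceTimeEquiv.integrableOn_comp_preimage
    (spaceTimeEquiv d).measurableEmbedding, preimage_spaceTime]
  exact integrableOn_congr_fun (fun u _ => by rw [Function.comp_apply, spaceTimeEquiv_apply])
    (measurableSet_torusCell.prod (measurableSet_strip L T))

theorem integrableOn_channel_iff {G : Space d → F} :
    IntegrableOn (fun u : (Fin d → ℝ) × ℝ => G (atHeight u.1 u.2))
      (torusCell d ×ˢ Ioo (-L) L) ↔ IntegrableOn G (channel d L) := by
  rw [← measurePreserving_sliceEquiv.integrableOn_comp_preimage
    (sliceEquiv d).measurableEmbedding, preimage_channel]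
  exact integrableOn_congr_fun (fun u _ => by rw [Function.comp_apply, sliceEquiv_apply])
    (measurableSet_torusCell.prod measurableSet_Ioo)

theorem isBounded_channel (L : ℝ) : Bornology.IsBounded (channel d L) := by
  refine (Metric.isBounded_iff_subset_closedBall 0).2 ⟨√(∑ _i : Fin (d + 1), (1 + L ^ 2)), ?_⟩
  intro x hx
  rw [mem_closedBall_zero_iff, EuclideanSpace.norm_eq]
  refine Real.sqrt_le_sqrt (Finset.sum_le_sum fun i _ => ?_)
  rw [Real.norm_eq_abs, sq_abs]
  induction i using Fin.lastCases with
  | last =>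
    have := hx.2
    simp only [height, mem_Ioo] at this
    nlinarith
  | cast i =>
    have := hx.1 i
    nlinarith [this.1, this.2, sq_nonneg L]

theorem isBounded_spaceTime (L T : ℝ) : Bornology.IsBounded (spaceTime d L T) :=
  (isBounded_channel L).prod (Metric.isBounded_Ioo 0 T)

theorem integrableOn_of_continuous_spaceTime {ζ : Space d × ℝ → F} (hζ : Continuous ζ) :
    IntegrableOn ζ (spaceTime d L T) :=
  (hζ.continuousOn.integrableOn_compact (isBounded_spaceTime L T).isCompact_closure).mono_set
    subset_closure

theorem integrableOn_of_continuous_channel {ζ : Space d → F} (hζ : Continuous ζ) :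
    IntegrableOn ζ (channel d L) :=
  (hζ.continuousOn.integrableOn_compact (isBounded_channel L).isCompact_closure).mono_set
    subset_closure

variable [NormedSpace ℝ F]

theorem setIntegral_spaceTime (G : Space d × ℝ → F) : ∫ z in spaceTime d L T, G z
    = ∫ u in torusCell d ×ˢ strip L T, G (atHeight u.1 u.2.1, u.2.2) := by
  rw [← measurePreserving_spaceTimeEquiv.setIntegral_preimage_emb
    (spaceTimeEquiv d).measurableEmbedding, preimage_spaceTime]
  simp only [spaceTimeEquiv_apply]

theorem setIntegral_channel (G : Space d → F) : ∫ x in channel d L, G x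
    = ∫ u in torusCell d ×ˢ Ioo (-L) L, G (atHeight u.1 u.2) := by
  rw [← measurePreserving_sliceEquiv.setIntegral_preimage_emb
    (sliceEquiv d).measurableEmbedding, preimage_channel]
  simp only [sliceEquiv_apply]

theorem setIntegral_spaceTime_columns {G : Space d × ℝ → F}
    (hG : IntegrableOn G (spaceTime d L T)) : ∫ z in spaceTime d L T, G z
    = ∫ x' in torusCell d, ∫ y in strip L T, G (atHeight x' y.1, y.2) := by
  rw [setIntegral_spaceTime, Measure.volume_eq_prod, setIntegral_prod]
  exact integrableOn_spaceTime_iff.2 hG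

theorem setIntegral_spaceTime_rows {G : Space d × ℝ → F}
    (hG : IntegrableOn G (spaceTime d L T)) : ∫ z in spaceTime d L T, G z
    = ∫ y in strip L T, ∫ x' in torusCell d, G (atHeight x' y.1, y.2) := by
  rw [setIntegral_spaceTime, Measure.volume_eq_prod, ← Measure.prod_restrict, integral_prod_symm]
  rw [Measure.prod_restrict]
  exact integrableOn_spaceTime_iff.2 hG

theorem setIntegral_channel_columns {G : Space d → F}
    (hG : IntegrableOn G (channel d L)) : ∫ x in channel d L, G x
    = ∫ x' in torusCell d, ∫ y in Ioo (-L) L, G (atHeight x' y) := by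
  rw [setIntegral_channel, Measure.volume_eq_prod, setIntegral_prod]
  exact integrableOn_channel_iff.2 hG

theorem integrableOn_col_mul {b : ℝ × ℝ → ℝ} {M : ℝ} (hb : Measurable b)
    (hM : ∀ y ∈ strip L T, |b y| ≤ M) {ζ : Space d × ℝ → ℝ} (hζ : Continuous ζ) :
    IntegrableOn (fun z => b (col z) * ζ z) (spaceTime d L T) := by
  refine (integrableOn_of_continuous_spaceTime hζ).bdd_mul (c := M)
    (hb.comp measurable_col).aestronglyMeasurable ?_
  refine (ae_restrict_iff' (measurableSet_spaceTime L T)).2 (Eventually.of_forall fun z hz => ?_)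
  exact hM _ ⟨hz.1.2, hz.2⟩

end Slices

section Linear

variable (d : ℕ)

/-- Space-time coordinates as a linear map. -/
def slice : ((Fin d → ℝ) × (ℝ × ℝ)) →L[ℝ] Space d × ℝ :=
  LinearMap.toContinuousLinearMap
    { toFun := fun u => (atHeight u.1 u.2.1, u.2.2)
      map_add' := fun u v => by
        refine Prod.ext (space_ext (fun i => ?_) ?_) rfl
        · simp
        · simp [height]
      map_smul' := fun c u => by
        refine Prod.ext (space_ext (fun i => ?_) ?_) rfl
        · simp
        · simp [height] }

variable {d}

theorem slice_apply (u : (Fin d → ℝ) × (ℝ × ℝ)) : slice d u = (atHeight u.1 u.2.1, u.2.2) := rfl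

theorem slice_up : slice d (0, (1, 0)) = (eUp d, 0) := by
  refine Prod.ext (space_ext (fun i => ?_) ?_) rfl
  · simp [slice_apply, eUp]
  · simp [slice_apply, eUp, height]

theorem slice_time : slice d (0, (0, 1)) = (0, 1) := by
  refine Prod.ext (space_ext (fun i => ?_) ?_) rfl
  · simp [slice_apply]
  · simp [slice_apply, height]

theorem slice_horizontal (i : Fin d) :
    slice d (Pi.single i 1, 0) = (EuclideanSpace.single i.castSucc 1, 0) := by
  refine Prod.ext (space_ext (fun j => ?_) ?_) rfl
  · simp [slice_apply, Pi.single_apply]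
  · simp [slice_apply, height, (Fin.castSucc_lt_last i).ne']

variable {F : Type*} [NormedAddCommGroup F] [NormedSpace ℝ F] {Ψ : Space d × ℝ → F}

theorem contDiff_column (hΨ : ContDiff ℝ ∞ Ψ) (x' : Fin d → ℝ) :
    ContDiff ℝ ∞ fun y : ℝ × ℝ => Ψ (atHeight x' y.1, y.2) :=
  hΨ.comp ((slice d).contDiff.comp (contDiff_const.prodMk contDiff_id))

theorem fderiv_column (hΨ : ContDiff ℝ ∞ Ψ) (x' : Fin d → ℝ) (y h : ℝ × ℝ) :
    fderiv ℝ (fun y : ℝ × ℝ => Ψ (atHeight x' y.1, y.2)) y h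
      = fderiv ℝ Ψ (atHeight x' y.1, y.2) (slice d (0, h)) := by
  have h1 : HasFDerivAt (fun y : ℝ × ℝ => slice d (x', y))
      ((slice d).comp (ContinuousLinearMap.inr ℝ (Fin d → ℝ) (ℝ × ℝ))) y :=
    (slice d).hasFDerivAt.comp y (hasFDerivAt_prodMk_right x' y)
  have h2 := (hΨ.differentiable (by simp) (slice d (x', y))).hasFDerivAt.comp y h1
  exact congrArg (fun l : ℝ × ℝ →L[ℝ] F => l h) h2.fderiv

theorem contDiff_row (hΨ : ContDiff ℝ ∞ Ψ) (y : ℝ × ℝ) :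
    ContDiff ℝ ∞ fun x' : Fin d → ℝ => Ψ (atHeight x' y.1, y.2) :=
  hΨ.comp ((slice d).contDiff.comp (contDiff_id.prodMk contDiff_const))

theorem fderiv_row (hΨ : ContDiff ℝ ∞ Ψ) (y : ℝ × ℝ) (x' h : Fin d → ℝ) :
    fderiv ℝ (fun x' : Fin d → ℝ => Ψ (atHeight x' y.1, y.2)) x' h
      = fderiv ℝ Ψ (atHeight x' y.1, y.2) (slice d (h, 0)) := by
  have h1 : HasFDerivAt (fun x' : Fin d → ℝ => slice d (x', y))
      ((slice d).comp (ContinuousLinearMap.inl ℝ (Fin d → ℝ) (ℝ × ℝ))) x' :=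
    (slice d).hasFDerivAt.comp x' (hasFDerivAt_prodMk_left x' y)
  have h2 := (hΨ.differentiable (by simp) (slice d (x', y))).hasFDerivAt.comp x' h1
  exact congrArg (fun l : (Fin d → ℝ) →L[ℝ] F => l h) h2.fderiv

end Linear

/-- The integral of a derivative of a periodic function vanishes. -/
theorem integral_fderiv_of_periodic {d : ℕ} {ψ : (Fin d → ℝ) → ℝ} (hψ : ContDiff ℝ ∞ ψ) (i : Fin d)
    (hper : ∀ x, ψ (x + Pi.single i 1) = ψ x) :
    ∫ x in torusCell d, fderiv ℝ ψ x (Pi.single i 1) = 0 := by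
  obtain ⟨n, rfl⟩ : ∃ n, d = n + 1 := ⟨d - 1, by have := i.2; omega⟩
  have hae : (torusCell (n + 1) : Set (Fin (n + 1) → ℝ)) =ᵐ[volume] Icc 0 1 := by
    rw [torusCell_eq, volume_pi]
    exact Measure.univ_pi_Ico_ae_eq_Icc
  have hc : Continuous fun x => fderiv ℝ ψ x (Pi.single i 1) :=
    (hψ.continuous_fderiv (by simp)).clm_apply continuous_const
  rw [setIntegral_congr_set hae]
  have hsum : ∀ x, ∑ j, (if j = i then fderiv ℝ ψ x else 0) (Pi.single j 1)
      = fderiv ℝ ψ x (Pi.single i 1) := fun x => by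
    rw [Finset.sum_eq_single i (fun j _ hj => by simp [hj]) (by simp), if_pos rfl]
  have key := integral_divergence_of_hasFDerivAt_off_countable' (E := ℝ) (0 : Fin (n + 1) → ℝ) 1
    zero_le_one (fun j => if j = i then ψ else 0)
    (fun j x => if j = i then fderiv ℝ ψ x else 0) ∅ countable_empty
    (fun j => by
      by_cases h : j = i
      · simpa [h] using hψ.continuous.continuousOn
      · simp only [if_neg h]
        exact continuousOn_const)
    (fun x _ j => by
      by_cases h : j = i
      · simpa [h] using (hψ.differentiable (by simp) x).hasFDerivAt
      · simp only [if_neg h]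
        exact hasFDerivAt_const 0 x)
    (by
      simp only [hsum]
      exact hc.continuousOn.integrableOn_compact isCompact_Icc)
  simp only [hsum] at key
  rw [key]
  refine Finset.sum_eq_zero fun j _ => ?_
  by_cases h : j = i
  · subst h
    simp only [if_true]
    rw [sub_eq_zero]
    refine integral_congr_ae (Eventually.of_forall fun x => ?_)
    simp only
    refine Eq.trans (congrArg ψ ?_) (hper _)
    ext k
    induction k using Fin.succAboveCases j with
    | x => simp
    | p k => simp [Fin.succAbove_ne]
  · simp [h]

section Tests

variable {d : ℕ} {L T : ℝ}

theorem IsTest.continuous_dt {F : Type*} [NormedAddCommGroup F] [NormedSpace ℝ F]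
    {Ψ : Space d × ℝ → F} (h : ContDiff ℝ ∞ Ψ) : Continuous (dt Ψ) :=
  (h.continuous_fderiv (by simp)).clm_apply continuous_const

theorem IsTest.continuous_dx {F : Type*} [NormedAddCommGroup F] [NormedSpace ℝ F]
    {Ψ : Space d × ℝ → F} (h : ContDiff ℝ ∞ Ψ) (u : Space d) : Continuous fun z => dx Ψ z u :=
  (h.continuous_fderiv (by simp)).clm_apply continuous_const

/-- Horizontally constant functions are orthogonal to horizontal derivatives. -/
theorem integral_col_mul_horizontal {b : ℝ × ℝ → ℝ} {M : ℝ} (hb : Measurable b)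
    (hM : ∀ y ∈ strip L T, |b y| ≤ M) {Ψ : Space d × ℝ → ℝ} (hΨ : ContDiff ℝ ∞ Ψ)
    (hper : HPeriodic Ψ) (i : Fin d) :
    ∫ z in spaceTime d L T, b (col z) * dx Ψ z (EuclideanSpace.single i.castSucc 1) = 0 := by
  rw [setIntegral_spaceTime_rows (integrableOn_col_mul hb hM (IsTest.continuous_dx hΨ _))]
  refine integral_eq_zero_of_ae (Eventually.of_forall fun y => ?_)
  simp only [col_slice, Pi.zero_apply]
  rw [integral_const_mul]
  have h := integral_fderiv_of_periodic (contDiff_row hΨ y) i fun x' => by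
    have h1 := hper (atHeight x' y.1) y.2 i
    rw [← h1]
    congr 2
    refine space_ext (fun j => ?_) ?_
    · simp [Pi.single_apply]
    · simp [height, (Fin.castSucc_lt_last i).ne']
  simp only [fderiv_row hΨ, slice_horizontal] at h
  simp only [dx]
  rw [h, mul_zero]

/-- Horizontally constant balance laws in weak form. -/
theorem IsBalance.weak_spaceTime {a b c a' : ℝ × ℝ → ℝ} {a₀ : ℝ → ℝ} (h : IsBalance a b c a' a₀)
    (hL : 0 < L) (hT : 0 < T) (ha : Measurable a) (hb : Measurable b) (hc : Measurable c)
    (ha₀ : Measurable a₀) {M₀ : ℝ} (hM₀ : ∀ y, |a₀ y| ≤ M₀) {Ψ : Space d × ℝ → ℝ}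
    (hΨ : IsTest T Ψ) :
    (∫ z in spaceTime d L T, (a (col z) * dt Ψ z + b (col z) * dx Ψ z (eUp d) - c (col z) * Ψ z))
      + (∫ x in channel d L, a₀ (height x) * Ψ (x, 0))
      - (∫ y in torusCell d ×ˢ Ioo (0 : ℝ) T, (b (L, y.2) * Ψ (atHeight y.1 L, y.2)
          - b (-L, y.2) * Ψ (atHeight y.1 (-L), y.2))) = 0 := by
  obtain ⟨M, hM⟩ := h.bounded L T
  have hs := hΨ.smooth
  have i1 : IntegrableOn (fun z => a (col z) * dt Ψ z + b (col z) * dx Ψ z (eUp d)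
      - c (col z) * Ψ z) (spaceTime d L T) := by
    refine Integrable.sub (Integrable.add ?_ ?_) ?_
    · exact integrableOn_col_mul ha (fun y hy => (hM y.1 ⟨hy.1.1.le, hy.1.2.le⟩ y.2
        ⟨hy.2.1, hy.2.2.le⟩).1) (IsTest.continuous_dt hs)
    · exact integrableOn_col_mul hb (fun y hy => (hM y.1 ⟨hy.1.1.le, hy.1.2.le⟩ y.2
        ⟨hy.2.1, hy.2.2.le⟩).2.1) (IsTest.continuous_dx hs _)
    · exact integrableOn_col_mul hc (fun y hy => (hM y.1 ⟨hy.1.1.le, hy.1.2.le⟩ y.2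
        ⟨hy.2.1, hy.2.2.le⟩).2.2) hs.continuous
  have i2 : IntegrableOn (fun x => a₀ (height x) * Ψ (x, 0)) (channel d L) := by
    refine (integrableOn_of_continuous_channel (ζ := fun x => Ψ (x, 0))
      (hs.continuous.comp (by fun_prop))).bdd_mul (c := M₀)
      (ha₀.comp measurable_height).aestronglyMeasurable ?_
    exact Eventually.of_forall fun x => hM₀ _
  have hbd : ∀ c ∈ Icc (-L) L, IntegrableOn (fun y : (Fin d → ℝ) × ℝ => b (c, y.2)
      * Ψ (atHeight y.1 c, y.2)) (torusCell d ×ˢ Ioo (0 : ℝ) T) := by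
    intro s hsL
    have hmeas : MeasurableSet (torusCell d ×ˢ Ioo (0 : ℝ) T) :=
      measurableSet_torusCell.prod measurableSet_Ioo
    have hK : IsCompact ((univ.pi fun _ : Fin d => Icc (0 : ℝ) 1) ×ˢ Icc (0 : ℝ) T) :=
      (isCompact_univ_pi fun _ => isCompact_Icc).prod isCompact_Icc
    have hcont : Continuous fun y : (Fin d → ℝ) × ℝ => Ψ (atHeight y.1 s, y.2) :=
      hs.continuous.comp ((slice d).continuous.comp
        (f := fun y : (Fin d → ℝ) × ℝ => (y.1, (s, y.2))) (by fun_prop))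
    refine (((hcont.continuousOn.integrableOn_compact hK).mono_set ?_).bdd_mul (c := M)
      (hb.comp (by fun_prop : Measurable fun y : (Fin d → ℝ) × ℝ =>
        (s, y.2))).aestronglyMeasurable ?_)
    · refine prod_mono ?_ Ioo_subset_Icc_self
      rw [torusCell_eq]
      exact pi_mono fun _ _ => Ico_subset_Icc_self
    · refine (ae_restrict_iff' hmeas).2 (Eventually.of_forall fun y hy => ?_)
      exact (hM s hsL y.2 ⟨hy.2.1, hy.2.2.le⟩).2.1
  have i3 : IntegrableOn (fun y : (Fin d → ℝ) × ℝ => b (L, y.2) * Ψ (atHeight y.1 L, y.2)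
      - b (-L, y.2) * Ψ (atHeight y.1 (-L), y.2)) (torusCell d ×ˢ Ioo (0 : ℝ) T) :=
    (hbd L (right_mem_Icc.2 (by linarith))).sub (hbd (-L) (left_mem_Icc.2 (by linarith)))
  have j1 := integrableOn_spaceTime_iff.2 i1
  have j2 := integrableOn_channel_iff.2 i2
  have j3 := i3
  rw [IntegrableOn, Measure.volume_eq_prod, ← Measure.prod_restrict] at j1 j2 j3
  have e3 : ∫ y in torusCell d ×ˢ Ioo (0 : ℝ) T, (b (L, y.2) * Ψ (atHeight y.1 L, y.2)
      - b (-L, y.2) * Ψ (atHeight y.1 (-L), y.2)) = ∫ x' in torusCell d, ∫ t in Ioo (0 : ℝ) T,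
        (b (L, t) * Ψ (atHeight x' L, t) - b (-L, t) * Ψ (atHeight x' (-L), t)) :=
    setIntegral_prod _ i3
  rw [setIntegral_spaceTime_columns i1, setIntegral_channel_columns i2, e3]
  have k12 := j1.integral_prod_left.add j2.integral_prod_left
  refine (congrArg (· - _) (integral_add j1.integral_prod_left
    j2.integral_prod_left).symm).trans ((integral_sub k12 j3.integral_prod_left).symm.trans ?_)
  -- On each vertical column the restricted test function is admissible for the one-dimensional law,
  -- so the total vanishes column by column.
  refine integral_eq_zero_of_ae (Eventually.of_forall fun x' => ?_)
  obtain ⟨T', hT', hsupp⟩ := hΨ.support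
  have key := h.weak (ψ := fun y => Ψ (atHeight x' y.1, y.2)) (contDiff_column hs x') hL hT
    fun y => hsupp _ _ hT'.le
  simp only [fderiv_column hs, slice_up, slice_time] at key
  simpa [col, dt, dx, strip] using key

end Tests

end

/-! ### Turbulent fields and the equations they inherit -/

noncomputable section

namespace Mixing

variable {S : Mixing}

theorem dens_eq_of_not_mem_zone {z : ℝ × ℝ} (hz : 0 < z.2) (h : S.ratio z ∉ S.zone) :
    S.dens z = S.ρm ∨ S.dens z = S.ρp := by
  rcases S.on_cases hz with ⟨h1, -⟩ | ⟨-, h2⟩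
  · rw [on, if_neg h] at h1
    exact absurd h1 zero_ne_one
  · rw [dens]
    rcases h2 with h2 | h2 <;> simp [h2]

theorem state_eq_pureState {z : ℝ × ℝ} (hz : 0 < z.2) (h : S.ratio z ∉ S.zone) :
    S.state z = pureState (S.dens z) 0 0 := by
  have h1 := theta_eq_zero hz h
  have h2 := F_eq_zero hz h
  apply State.ext <;> simp [state, mom, momFlux, kinFlux, h1, h2]

theorem speed_nonneg {T : ℝ} (hT : 0 < T) : 0 ≤ S.speed T := by
  have hm := S.ρm_pos
  have hl := S.lam_pos
  have hg := S.g_pos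
  have hd := sub_pos.2 S.ρm_lt
  unfold speed
  positivity

theorem state_mem_phaseSet {T : ℝ} {z : ℝ × ℝ} (hz : z.2 ∈ Ioc 0 T) (h : S.ratio z ∉ S.zone) :
    S.state z ∈ phaseSet S.ρm S.ρp (S.speed T) := by
  have hT := speed_nonneg (S := S) (hz.1.trans_le hz.2)
  exact ⟨S.dens z, 0, 0, dens_eq_of_not_mem_zone hz.1 h, by simpa, by simpa,
    state_eq_pureState hz.1 h⟩

theorem state_mem_hull (he : 0 < S.e) {T : ℝ} {z : ℝ × ℝ} (hz : z.2 ∈ Ioc 0 T) :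
    S.state z ∈ hull S.ρm S.ρp (S.speed T) := by
  by_cases h : S.ratio z ∈ S.zone
  · exact interior_subset (state_mem_interior_hull he hz h)
  · exact subset_convexHull ℝ _ (state_mem_phaseSet hz h)

theorem measurable_state : Measurable S.state := by
  refine (MeasurableEquiv.toLp 2 (Fin 10 → ℝ)).measurable.comp (measurable_pi_iff.2 fun i => ?_)
  have h1 := S.measurable_dens
  have h2 := S.measurable_mom
  have h3 := S.measurable_theta
  have h4 := S.measurable_momFlux
  have h5 := S.measurable_kinFlux
  fin_cases i <;> simp <;> fun_prop

theorem measurable_kinetic : Measurable S.kinetic := by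
  have h1 := S.measurable_q
  have h2 := S.measurable_F
  have h3 := S.measurable_theta
  have h4 := S.measurable_dens
  unfold kinetic; fun_prop

theorem measurable_total : Measurable S.total := by
  have h1 := S.measurable_pressure
  have h2 := S.measurable_momFlux
  have h3 : S.total = fun z => S.pressure z + S.momFlux z := by
    funext z; rw [pressure]; ring
  rw [h3]
  fun_prop

theorem balance_mass : IsBalance S.dens S.mom (fun _ => 0) (fun z => -S.qt z)
    (flat S.ρm S.ρp) := by
  have h := S.isBalance_mass
  have e : (fun y => S.ρp + S.ρm - S.q₀ y) = flat S.ρm S.ρp := funext fun y => sub_q₀ y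
  rwa [e] at h

theorem balance_momentum : ∃ a', IsBalance S.mom S.total (fun z => S.g * S.dens z) a'
    (fun _ => 0) := ⟨_, S.isBalance_momentum⟩

theorem balance_energy : ∃ a', IsBalance S.kinetic S.kinFlux
    (fun z => S.g * S.mom z - S.dissipation (S.q z) z.2) a' (fun _ => 0) := ⟨_, S.isBalance_energy⟩

theorem flux_boundary {L T t : ℝ} (hB : S.Below L T) (ht : t ∈ Ioc 0 T) :
    (S.mom (L, t) = 0 ∧ S.kinFlux (L, t) = 0 ∧ S.momFlux (L, t) = 0) ∧
    S.mom (-L, t) = 0 ∧ S.kinFlux (-L, t) = 0 ∧ S.momFlux (-L, t) = 0 := by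
  simp [mom, kinFlux, momFlux, theta, q_eq_ρm_of_le hB ht le_rfl, q_eq_ρp_of_le hB ht le_rfl, F_ρm,
    F_ρp, H_ρm, H_ρp]

end Mixing

section Velocity

variable {d : ℕ}

/-- The velocity of a state. -/
def velocity (d : ℕ) (w : State) : Space d := w 1 • EuclideanSpace.single 0 1 + w 2 • eUp d

theorem inner_velocity (w : State) (x : Space d) :
    inner ℝ (velocity d w) x = w 1 * x 0 + w 2 * height x := by
  rw [velocity, inner_add_left, real_inner_smul_left, real_inner_smul_left, eUp,
    EuclideanSpace.inner_single_left, EuclideanSpace.inner_single_left]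
  simp [height]

theorem velocity_apply_zero (hd : (0 : Fin (d + 1)) ≠ Fin.last d) (w : State) :
    velocity d w 0 = w 1 := by
  simp [velocity, eUp, hd]

theorem height_velocity (hd : (0 : Fin (d + 1)) ≠ Fin.last d) (w : State) :
    height (velocity d w) = w 2 := by
  simp [velocity, eUp, hd.symm, height]

theorem norm_velocity_sq (hd : (0 : Fin (d + 1)) ≠ Fin.last d) (w : State) :
    ‖velocity d w‖ ^ 2 = w 1 ^ 2 + w 2 ^ 2 := by
  rw [← real_inner_self_eq_norm_sq, inner_velocity, velocity_apply_zero hd, height_velocity hd]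
  ring

theorem dx_velocity {F : Type*} [NormedAddCommGroup F] [NormedSpace ℝ F] (Ψ : Space d × ℝ → F)
    (z : Space d × ℝ) (w : State) :
    dx Ψ z (velocity d w) = w 1 • fderiv ℝ Ψ z (dirX d) + w 2 • fderiv ℝ Ψ z (dirY d) := by
  have h : (velocity d w, (0 : ℝ)) = w 1 • dirX d + w 2 • dirY d := by
    refine Prod.ext ?_ ?_ <;> simp [velocity, dirX, dirY, eUp]
  rw [dx, h, map_add, map_smul, map_smul]

theorem dx_smul {F : Type*} [NormedAddCommGroup F] [NormedSpace ℝ F] (Ψ : Space d × ℝ → F)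
    (z : Space d × ℝ) (c : ℝ) (u : Space d) : dx Ψ z (c • u) = c • dx Ψ z u := by
  have h : (c • u, (0 : ℝ)) = c • (u, (0 : ℝ)) := by simp
  rw [dx, h, map_smul, dx]

theorem fderiv_component {Φ : Space d × ℝ → Space d} (hΦ : ContDiff ℝ ∞ Φ) (i : Fin (d + 1))
    (z u : Space d × ℝ) : fderiv ℝ (fun z => Φ z i) z u = fderiv ℝ Φ z u i := by
  have h := (EuclideanSpace.proj (𝕜 := ℝ) i).hasFDerivAt.comp z
    (hΦ.differentiable (by simp) z).hasFDerivAt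
  exact congrArg (fun l : Space d × ℝ →L[ℝ] ℝ => l u) h.fderiv

theorem contDiff_component {Φ : Space d × ℝ → Space d} (hΦ : ContDiff ℝ ∞ Φ) (i : Fin (d + 1)) :
    ContDiff ℝ ∞ fun z => Φ z i :=
  (EuclideanSpace.proj (𝕜 := ℝ) i).contDiff.comp hΦ

end Velocity

section MemLp

variable {d : ℕ} {L T : ℝ}

theorem measurable_nullField {g : ℝ} {p ψ : Space d × ℝ → ℝ} (hp : Measurable p)
    (hψ : ContDiff ℝ ∞ ψ) (j : Fin 7) : Measurable (nullField g p ψ j) := by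
  have h0 := hψ.continuous.measurable
  have h1 := (contDiff_derivX hψ).continuous.measurable
  have h2 := (contDiff_derivY hψ).continuous.measurable
  have h3 := (contDiff_deriv_dir (dirT d) hψ).continuous.measurable
  fin_cases j <;>
    refine (MeasurableEquiv.toLp 2 (Fin 10 → ℝ)).measurable.comp (measurable_pi_iff.2 fun i => ?_)
      <;> fin_cases i <;> simp <;> fun_prop

theorem memLp_top_of_mem_hull {ρm ρp R : ℝ} {μ : Measure (Space d × ℝ)} {w : Space d × ℝ → State}
    (hw : AEStronglyMeasurable w μ) (h : ∀ᵐ z ∂μ, w z ∈ hull ρm ρp R) : MemLp w ⊤ μ := by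
  obtain ⟨C, hC⟩ := (isCompact_hull ρm ρp R).exists_bound_of_continuousOn continuousOn_id
  exact memLp_top_of_bound hw C (h.mono fun z hz => hC _ hz)

theorem memLp_component {μ : Measure (Space d × ℝ)} {w : Space d × ℝ → State} {q : ℝ≥0∞}
    (hw : MemLp w q μ) (i : Fin 10) : MemLp (fun z => w z i) q μ :=
  (EuclideanSpace.proj (𝕜 := ℝ) i).comp_memLp' hw

end MemLp

/-- The two-phase fields with the same horizontal averages as the subsolution. -/
structure Mixing.IsTurbulent (S : Mixing) (d : ℕ) (L T : ℝ) (W : Space d × ℝ → State) : Prop where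
  periodic : HPeriodic W
  measurable : AEStronglyMeasurable W (volume.restrict (spaceTime d L T))
  phases : ∀ᵐ z ∂volume.restrict (spaceTime d L T), W z ∈ phaseSet S.ρm S.ρp (S.speed T)
  null : ∀ j ψ, IsNullTest j ψ → ∫ z in spaceTime d L T, inner ℝ (W z - S.state (col z))
    (nullField S.g (fun z => S.pressure (col z)) ψ j z) = 0
  outside : ∀ᵐ z ∂volume.restrict (spaceTime d L T), S.ratio (col z) ∉ S.zone →
    W z = S.state (col z)

namespace Mixing

variable {S : Mixing} {d : ℕ} {L T : ℝ} {W : Space d × ℝ → State}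

theorem measurable_pressure_col : Measurable fun z : Space d × ℝ => S.pressure (col z) :=
  measurable_pressure.comp measurable_col

theorem memLp_state (he : 0 < S.e) :
    MemLp (fun z : Space d × ℝ => S.state (col z)) ⊤ (volume.restrict (spaceTime d L T)) := by
  refine memLp_top_of_mem_hull (ρm := S.ρm) (ρp := S.ρp) (R := S.speed T)
    (measurable_state.comp measurable_col).aestronglyMeasurable ?_
  refine (ae_restrict_iff' (measurableSet_spaceTime L T)).2 (Eventually.of_forall fun z hz => ?_)
  exact state_mem_hull he ⟨hz.2.1, hz.2.2.le⟩

theorem abs_pressure_col_le (S : Mixing) (d : ℕ) (L T : ℝ) :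
    ∃ C, ∀ z ∈ spaceTime d L T, |S.pressure (col z)| ≤ C := by
  obtain ⟨C, hC⟩ := S.abs_pressure_bound L T
  exact ⟨C, fun z hz => hC _ ⟨hz.1.2.1.le, hz.1.2.2.le⟩ _ ⟨hz.2.1.le, hz.2.2.le⟩⟩

theorem memLp_pressure (S : Mixing) (d : ℕ) (L T : ℝ) :
    MemLp (fun z : Space d × ℝ => S.pressure (col z)) ⊤ (volume.restrict (spaceTime d L T)) := by
  obtain ⟨C, hC⟩ := S.abs_pressure_col_le d L T
  exact memLp_top_of_bound measurable_pressure_col.aestronglyMeasurable C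
    ((ae_restrict_iff' (measurableSet_spaceTime L T)).2 (Eventually.of_forall hC))

theorem memLp_nullField (S : Mixing) {ψ : Space d × ℝ → ℝ} (hψ : ContDiff ℝ ∞ ψ) (j : Fin 7) :
    MemLp (nullField S.g (fun z => S.pressure (col z)) ψ j) 2
      (volume.restrict (spaceTime d L T)) := by
  obtain ⟨C, hC⟩ := S.abs_pressure_col_le d L T
  obtain ⟨M, hM⟩ := exists_bound_nullField (g := S.g) (isBounded_spaceTime L T) hC hψ j
  exact (memLp_top_of_bound (measurable_nullField measurable_pressure_col hψ j).aestronglyMeasurable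
    M ((ae_restrict_iff' (measurableSet_spaceTime L T)).2
      (Eventually.of_forall hM))).mono_exponent le_top

namespace IsTurbulent

theorem memLp (h : S.IsTurbulent d L T W) : MemLp W ⊤ (volume.restrict (spaceTime d L T)) :=
  memLp_top_of_mem_hull h.measurable (h.phases.mono fun _ hz => subset_convexHull ℝ _ hz)

theorem integrable_inner (h : S.IsTurbulent d L T W) {ψ : Space d × ℝ → ℝ} (hψ : ContDiff ℝ ∞ ψ)
    (j : Fin 7) : IntegrableOn (fun z => inner ℝ (W z)
      (nullField S.g (fun z => S.pressure (col z)) ψ j z)) (spaceTime d L T) :=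
  integrable_inner_of_memLp (h.memLp.mono_exponent le_top) (S.memLp_nullField hψ j)

/-- The tested equations are linear in the state. A turbulent field may therefore be replaced in
them by the horizontally constant subsolution, for which only a one-dimensional balance law remains.
-/
theorem integral_inner (h : S.IsTurbulent d L T W) (he : 0 < S.e) {ψ : Space d × ℝ → ℝ} {j : Fin 7}
    (hψ : IsNullTest j ψ) :
    ∫ z in spaceTime d L T, inner ℝ (W z) (nullField S.g (fun z => S.pressure (col z)) ψ j z)
      = ∫ z in spaceTime d L T,
        inner ℝ (S.state (col z)) (nullField S.g (fun z => S.pressure (col z)) ψ j z) := by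
  rw [← sub_eq_zero, ← integral_sub (h.integrable_inner hψ.1 j)
    (integrable_inner_of_memLp ((memLp_state he).mono_exponent le_top) (S.memLp_nullField hψ.1 j))]
  simp only [← inner_sub_left]
  exact h.null j ψ hψ

theorem incompressible (h : S.IsTurbulent d L T W) (he : 0 < S.e) {Ψ : Space d × ℝ → ℝ}
    (hΨ : ContDiff ℝ ∞ Ψ) : ∫ z in spaceTime d L T, dx Ψ z (velocity d (W z)) = 0 := by
  have h1 := h.integral_inner he (j := 0) ⟨hΨ, fun h => absurd h (by decide)⟩
  simp only [nullField, inner_state, along] at h1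
  rw [show (0 : ℝ) = ∫ z in spaceTime d L T, (0 : ℝ) by simp]
  refine Eq.trans (integral_congr_ae (Eventually.of_forall fun z => ?_)) (h1.trans
    (integral_congr_ae (Eventually.of_forall fun z => ?_)))
  · simp [dx_velocity]
  · simp [state]

theorem mass (h : S.IsTurbulent d L T W) (he : 0 < S.e) (hL : 0 < L) (hT : 0 < T)
    (hB : S.Below L T) {Ψ : Space d × ℝ → ℝ} (hΨ : IsTest T Ψ) :
    (∫ z in spaceTime d L T, (W z 0 * dt Ψ z + dx Ψ z (W z 0 • velocity d (W z))))
      + (∫ x in channel d L, flat S.ρm S.ρp (height x) * Ψ (x, 0)) = 0 := by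
  have hp := S.ρp_pos
  have hm := S.ρm_pos
  have h1 := h.integral_inner he (j := 1) ⟨hΨ.smooth, fun h => absurd h (by decide)⟩
  simp only [nullField, inner_state, along] at h1
  have h2 := (balance_mass (S := S)).weak_spaceTime hL hT measurable_dens measurable_mom
    measurable_const (measurable_flat _ _) (M₀ := S.ρp) (fun y => by
      rw [flat]
      have := S.ρm_lt.le
      split_ifs
      · rw [abs_of_pos hp]
      · rwa [abs_of_pos hm]) hΨ
  have h3 : ∫ y in torusCell d ×ˢ Ioo (0 : ℝ) T, (S.mom (L, y.2) * Ψ (atHeight y.1 L, y.2)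
      - S.mom (-L, y.2) * Ψ (atHeight y.1 (-L), y.2)) = 0 := by
    refine setIntegral_eq_zero_of_forall_eq_zero fun y hy => ?_
    obtain ⟨⟨a, -⟩, b, -⟩ := flux_boundary hB ⟨hy.2.1, hy.2.2.le⟩
    simp [a, b]
  rw [h3, sub_zero] at h2
  refine Eq.trans (congrArg (fun x : ℝ => x + _) ?_) h2
  refine Eq.trans (integral_congr_ae ?_) (h1.trans
    (integral_congr_ae (Eventually.of_forall fun z => ?_)))
  · filter_upwards [h.phases] with z hz
    obtain ⟨ρ, a, b, -, -, -, hW⟩ := hz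
    simp [hW, dx_smul, dx_velocity, dt, dirT]
    ring
  · simp [state, dt, dx, dirT, dirY, eUp]

/-- On the phases the fluxes are genuine products of density and velocities, so the linear momentum
equations are the nonlinear ones. The flow has only one horizontal component. In every horizontal
direction the pressure term drops out, as the pressure depends on height and time alone; the
vertical equation is the balance of `total`. -/
theorem momentum (h : S.IsTurbulent d L T W) (hd : (0 : Fin (d + 1)) ≠ Fin.last d) (he : 0 < S.e)
    (hL : 0 < L) (hT : 0 < T) (hB : S.Below L T) {Φ : Space d × ℝ → Space d} (hΦ : IsTest T Φ) :
    (∫ z in spaceTime d L T,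
        (inner ℝ (W z 0 • velocity d (W z)) (dt Φ z)
          + inner ℝ (W z 0 • velocity d (W z)) (dx Φ z (velocity d (W z)))
          + S.pressure (col z) * divergence Φ z - S.g * W z 0 * height (Φ z)))
      - (∫ y in torusCell d ×ˢ Ioo (0 : ℝ) T,
          (S.pressure (L, y.2) * height (Φ (atHeight y.1 L, y.2))
            - S.pressure (-L, y.2) * height (Φ (atHeight y.1 (-L), y.2)))) = 0 := by
  have hs := hΦ.smooth
  have hc := fun i => contDiff_component hs i
  obtain ⟨T', hT', hsupp⟩ := hΦ.support
  have hper : ∀ i, HPeriodic fun z => Φ z i := fun i x t j =>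
    congrArg (fun y : Space d => y i) (hΦ.periodic x t j)
  have hn : IsTest T fun z => Φ z (Fin.last d) :=
    ⟨hc _, hper _, T', hT', fun x t ht => by simp [hsupp x t ht]⟩
  have h2 := h.integral_inner he (j := 2) ⟨hc 0, fun h => absurd h (by decide)⟩
  have h3 := h.integral_inner he (j := 3) ⟨hc (Fin.last d), fun h => absurd h (by decide)⟩
  have i2 := h.integrable_inner (hc 0) 2
  have i3 := h.integrable_inner (hc (Fin.last d)) 3
  obtain ⟨a', hbal⟩ := balance_momentum (S := S)
  have hw := hbal.weak_spaceTime hL hT measurable_mom measurable_total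
    (measurable_const.mul measurable_dens) measurable_const (M₀ := 0) (by simp) hn
  simp only [zero_mul, integral_zero, add_zero] at hw
  obtain ⟨C, hC⟩ := S.abs_pressure_bound L T
  have hC' : ∀ y ∈ strip L T, |S.pressure y| ≤ C := fun y hy =>
    hC y.1 ⟨hy.1.1.le, hy.1.2.le⟩ y.2 ⟨hy.2.1.le, hy.2.2.le⟩
  have ip : ∀ i u, IntegrableOn (fun z => S.pressure (col z) * dx (fun z => Φ z i) z u)
      (spaceTime d L T) := fun i u =>
    integrableOn_col_mul measurable_pressure hC' (IsTest.continuous_dx (hc i) u)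
  have ih : ∀ i ∈ (Finset.univ : Finset (Fin d)), Integrable (fun z => S.pressure (col z)
      * dx (fun z => Φ z i.castSucc) z (EuclideanSpace.single i.castSucc 1))
      (volume.restrict (spaceTime d L T)) := fun i _ => ip i.castSucc _
  have hpz : ∀ i : Fin d, ∫ z in spaceTime d L T, S.pressure (col z)
      * dx (fun z => Φ z i.castSucc) z (EuclideanSpace.single i.castSucc 1) = 0 := fun i =>
    integral_col_mul_horizontal measurable_pressure hC' (hc _) (hper _) i
  have hdiv : ∀ z, S.pressure (col z) * divergence Φ z
      = (∑ i : Fin d, S.pressure (col z)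
        * dx (fun z => Φ z i.castSucc) z (EuclideanSpace.single i.castSucc 1))
        + S.pressure (col z) * dx (fun z => Φ z (Fin.last d)) z (eUp d) := by
    intro z
    rw [divergence, Fin.sum_univ_castSucc, mul_add, Finset.mul_sum]
    simp only [dx, fderiv_component hs, eUp]
  have ipd : IntegrableOn (fun z => S.pressure (col z) * divergence Φ z) (spaceTime d L T) := by
    simp only [hdiv]
    exact (integrable_finsetSum _ ih).add (ip (Fin.last d) _)
  have hpd : ∫ z in spaceTime d L T, S.pressure (col z) * divergence Φ z
      = ∫ z in spaceTime d L T, S.pressure (col z) * dx (fun z => Φ z (Fin.last d)) z (eUp d) := by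
    simp only [hdiv]
    rw [integral_add (integrable_finsetSum _ ih) (ip (Fin.last d) _),
      integral_finsetSum _ ih, Finset.sum_eq_zero fun i _ => hpz i, zero_add]
  -- At top and bottom the fluid is unmixed and at rest, so the momentum flux vanishes there and
  -- `total` is the pressure.
  have hbdry : ∫ y in torusCell d ×ˢ Ioo (0 : ℝ) T,
      (S.pressure (L, y.2) * height (Φ (atHeight y.1 L, y.2))
        - S.pressure (-L, y.2) * height (Φ (atHeight y.1 (-L), y.2)))
      = ∫ y in torusCell d ×ˢ Ioo (0 : ℝ) T,
        (S.total (L, y.2) * Φ (atHeight y.1 L, y.2) (Fin.last d)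
          - S.total (-L, y.2) * Φ (atHeight y.1 (-L), y.2) (Fin.last d)) := by
    refine setIntegral_congr_fun (measurableSet_torusCell.prod measurableSet_Ioo) fun y hy => ?_
    obtain ⟨⟨-, -, a⟩, -, -, b⟩ := flux_boundary hB ⟨hy.2.1, hy.2.2.le⟩
    simp [pressure, a, b, height]
  rw [hbdry]
  refine Eq.trans (congrArg (fun x : ℝ => x - _) ?_) hw
  have hmain : ∫ z in spaceTime d L T,
        (inner ℝ (W z 0 • velocity d (W z)) (dt Φ z)
          + inner ℝ (W z 0 • velocity d (W z)) (dx Φ z (velocity d (W z)))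
          + S.pressure (col z) * divergence Φ z - S.g * W z 0 * height (Φ z))
      = ∫ z in spaceTime d L T, ((inner ℝ (W z)
          (nullField S.g (fun z => S.pressure (col z)) (fun z => Φ z 0) 2 z)
        + inner ℝ (W z)
          (nullField S.g (fun z => S.pressure (col z)) (fun z => Φ z (Fin.last d)) 3 z))
        + S.pressure (col z) * divergence Φ z) := by
    refine integral_congr_ae ?_
    filter_upwards [h.phases] with z hz
    obtain ⟨ρ, a, b, -, -, -, hW⟩ := hz
    simp only [nullField, inner_state, along, fderiv_component hs, real_inner_smul_left,
      inner_velocity, dx_velocity, dt, hW, height, dirT]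
    simp
    ring
  rw [hmain]
  refine (integral_add (i2.add i3) ipd).trans ?_
  refine (congrArg (· + _) (integral_add i2 i3)).trans ?_
  rw [h2, h3, hpd]
  have s2 : MemLp (fun z => S.state (col z)) 2 (volume.restrict (spaceTime d L T)) :=
    (memLp_state he).mono_exponent le_top
  -- The horizontal momentum and the mixed flux of the subsolution are zero and its horizontal flux
  -- is horizontally constant, so periodicity leaves nothing.
  have z2 : ∫ z in spaceTime d L T, inner ℝ (S.state (col z))
      (nullField S.g (fun z => S.pressure (col z)) (fun z => Φ z 0) 2 z) = 0 := by
    obtain ⟨n, rfl⟩ : ∃ n, d = n + 1 := by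
      cases d with
      | zero => exact absurd rfl hd
      | succ n => exact ⟨n, rfl⟩
    obtain ⟨C, hC⟩ := (isCompact_hull S.ρm S.ρp (S.speed T)).exists_bound_of_continuousOn
      (f := fun w : State => w 5) (by fun_prop)
    have := integral_col_mul_horizontal (b := fun y => S.state y 5) (M := C) (L := L) (T := T)
      ((EuclideanSpace.proj (𝕜 := ℝ) (5 : Fin 10)).continuous.measurable.comp measurable_state)
      (fun y hy => hC _ (state_mem_hull he ⟨hy.2.1, hy.2.2.le⟩)) (hc 0) (hper 0) 0
    refine Eq.trans (integral_congr_ae (Eventually.of_forall fun z => ?_)) this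
    simp [nullField, inner_state, state, along, dx, dirX]
  rw [z2, zero_add, ← integral_add (integrable_inner_of_memLp s2 (S.memLp_nullField (hc _) 3))
    (ip _ _)]
  refine integral_congr_ae (Eventually.of_forall fun z => ?_)
  simp [nullField, inner_state, state, along, dx, dt, dirT, dirY, eUp, pressure]
  ring

end IsTurbulent

end Mixing

end

/-! ### Traces, averages and the dissipation measure -/

noncomputable section

section Trace

variable {d : ℕ} {T c σ : ℝ}

/-- Horizontally constant functions which are Lipschitz near the boundary have a trace. -/
theorem hasL1Trace_of_lipschitz {p : ℝ × ℝ → ℝ} (hp : Measurable p) {C M δ : ℝ}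
    (hT : 0 ≤ T) (hM0 : 0 ≤ M) (hC : ∀ t ∈ Ioo 0 T, |p (c, t)| ≤ C) (hδ : 0 < δ)
    (hM : ∀ r ∈ Ioo 0 δ, ∀ t ∈ Ioo 0 T, |p (c - σ * r, t) - p (c, t)| ≤ M * r) :
    HasL1Trace (d := d) T c σ fun z => p (col z) := by
  have hmeas : MeasurableSet (torusCell d ×ˢ Ioo (0 : ℝ) T) :=
    measurableSet_torusCell.prod measurableSet_Ioo
  have hvol : volume (torusCell d ×ˢ Ioo (0 : ℝ) T) = ENNReal.ofReal T := by
    rw [Measure.volume_eq_prod, Measure.prod_prod, volume_torusCell, Real.volume_Ioo]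
    simp
  refine ⟨?_, ?_⟩
  · refine Measure.integrableOn_of_bounded (M := C) (by rw [hvol]; exact ENNReal.ofReal_ne_top) ?_ ?_
    · simp only [col, height_atHeight]
      exact (hp.comp (by fun_prop : Measurable fun y : (Fin d → ℝ) × ℝ =>
        (c, y.2))).aestronglyMeasurable
    · refine (ae_restrict_iff' hmeas).2 (Eventually.of_forall fun y hy => ?_)
      simpa [col] using hC y.2 hy.2
  · have hlim : Tendsto (fun h : ℝ => ENNReal.ofReal (M * T * h)) (𝓝[>] 0) (𝓝 0) := by
      have h1 : Continuous fun h : ℝ => M * T * h := by fun_prop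
      simpa using (ENNReal.tendsto_ofReal (h1.tendsto 0)).mono_left nhdsWithin_le_nhds
    refine tendsto_of_tendsto_of_tendsto_of_le_of_le' tendsto_const_nhds hlim
      (Eventually.of_forall fun _ => zero_le) ?_
    filter_upwards [Ioo_mem_nhdsGT hδ] with h hh
    have hb : ∀ y ∈ (torusCell d ×ˢ Ioo (0 : ℝ) T) ×ˢ Ioo (0 : ℝ) h,
        ‖p (col (atHeight y.1.1 (c - σ * y.2), y.1.2)) - p (col (atHeight y.1.1 c, y.1.2))‖ₑ
          ≤ ENNReal.ofReal (M * h) := by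
      intro y hy
      rw [← ofReal_norm]
      refine ENNReal.ofReal_le_ofReal ?_
      simp only [col, height_atHeight, Real.norm_eq_abs]
      refine (hM y.2 ⟨hy.2.1, hy.2.2.trans hh.2⟩ y.1.2 hy.1.2).trans ?_
      exact mul_le_mul_of_nonneg_left hy.2.2.le hM0
    calc _ ≤ ENNReal.ofReal h⁻¹ * ∫⁻ _ in (torusCell d ×ˢ Ioo (0 : ℝ) T) ×ˢ Ioo (0 : ℝ) h,
          ENNReal.ofReal (M * h) :=
        mul_le_mul_right (setLIntegral_mono' (hmeas.prod measurableSet_Ioo) hb) _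
      _ = ENNReal.ofReal (M * T * h) := by
        have hh0 := hh.1
        rw [setLIntegral_const, Measure.volume_eq_prod ((Fin d → ℝ) × ℝ), Measure.prod_prod, hvol,
          Real.volume_Ioo, sub_zero, ← ENNReal.ofReal_mul hT, ← ENNReal.ofReal_mul (by positivity),
          ← ENNReal.ofReal_mul (by positivity)]
        congr 1
        field_simp

end Trace

section Averages

/-- A function on a product whose integral against all test functions of the second variable
vanishes has vanishing integrals over the first variable. -/
theorem ae_integral_eq_zero_of_orthogonal {α E : Type*} [MeasurableSpace α] {μ : Measure α}
    [SFinite μ] [NormedAddCommGroup E] [NormedSpace ℝ E] [FiniteDimensional ℝ E]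
    [MeasureSpace E] [BorelSpace E] [SFinite (volume : Measure E)] {U : Set E} (hU : IsOpen U)
    {G : α × E → ℝ} (hG : Integrable G (μ.prod (volume.restrict U)))
    (h : ∀ φ : E → ℝ, ContDiff ℝ ∞ φ → HasCompactSupport φ →
      ∫ z, φ z.2 * G z ∂μ.prod (volume.restrict U) = 0) :
    ∀ᵐ u ∂volume.restrict U, ∫ a, G (a, u) ∂μ = 0 := by
  have hloc : LocallyIntegrableOn (fun u => ∫ a, G (a, u) ∂μ) U volume :=
    IntegrableOn.locallyIntegrableOn hG.integral_prod_right
  refine (ae_restrict_iff' hU.measurableSet).2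
    (hU.ae_eq_zero_of_integral_contDiff_smul_eq_zero hloc fun φ hφ hφc hφU => ?_)
  have h0 : ∀ u ∉ U, φ u • ∫ a, G (a, u) ∂μ = 0 := fun u hu => by
    rw [image_eq_zero_of_notMem_tsupport fun h => hu (hφU h), zero_smul]
  rw [← setIntegral_eq_integral_of_forall_compl_eq_zero h0]
  obtain ⟨C, hC⟩ := hφc.exists_bound_of_continuous hφ.continuous
  have hint : Integrable (fun z : α × E => φ z.2 * G z) (μ.prod (volume.restrict U)) :=
    hG.bdd_mul (c := C) (hφ.continuous.measurable.comp measurable_snd).aestronglyMeasurable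
      (Eventually.of_forall fun z => hC _)
  have h1 := h φ hφ hφc
  rw [integral_prod_symm _ hint] at h1
  simpa only [integral_const_mul, smul_eq_mul] using h1

variable {d : ℕ}

/-- `col` as a linear map. -/
def colMap (d : ℕ) : Space d × ℝ →L[ℝ] ℝ × ℝ :=
  ((EuclideanSpace.proj (𝕜 := ℝ) (Fin.last d)).comp (ContinuousLinearMap.fst ℝ (Space d) ℝ)).prod
    (ContinuousLinearMap.snd ℝ (Space d) ℝ)

theorem contDiff_comp_col {φ : ℝ × ℝ → ℝ} (hφ : ContDiff ℝ ∞ φ) :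
    ContDiff ℝ ∞ fun z : Space d × ℝ => φ (col z) :=
  hφ.comp (colMap d).contDiff

theorem isNullTest_comp_col (hd : (0 : Fin (d + 1)) ≠ Fin.last d) {φ : ℝ × ℝ → ℝ}
    (hφ : ContDiff ℝ ∞ φ) (j : Fin 7) : IsNullTest j fun z : Space d × ℝ => φ (col z) := by
  refine ⟨contDiff_comp_col hφ, fun _ z => ?_⟩
  have h1 := ((hφ.differentiable (by simp) (colMap d z)).hasFDerivAt.comp z
    (colMap d).hasFDerivAt).fderiv
  have h2 : colMap d (dirX d) = 0 := by
    simp [colMap, dirX, hd.symm]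
  refine (congrArg (fun l : Space d × ℝ →L[ℝ] ℝ => l (dirX d)) h1).trans ?_
  simp [h2]

theorem memLp_velocity {μ : Measure (Space d × ℝ)} {w : Space d × ℝ → State} {q : ℝ≥0∞}
    (hw : MemLp w q μ) : MemLp (fun z => velocity d (w z)) q μ :=
  ((EuclideanSpace.proj (𝕜 := ℝ) (1 : Fin 10)).smulRight (EuclideanSpace.single 0 1 : Space d)
    + (EuclideanSpace.proj (𝕜 := ℝ) (2 : Fin 10)).smulRight (eUp d)).comp_memLp' hw

theorem integral_channel_height {L : ℝ} {b : ℝ → ℝ} (hb : Integrable (fun x => b (height x))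
    (volume.restrict (channel d L))) : ∫ x in channel d L, b (height x) = ∫ y in Ioo (-L) L, b y := by
  rw [setIntegral_channel_columns hb]
  simp

end Averages

namespace Mixing

variable {S : Mixing} {d : ℕ} {L T : ℝ} {W : Space d × ℝ → State}

theorem exists_below (hB : S.Below L T) : ∃ δ > 0, S.Below (L - δ) T := by
  unfold Below at hB ⊢
  exact ⟨(L - S.lam * S.g * T ^ 2 * (S.ρp - S.ρm) / (2 * S.ρm)) / 2, by linarith, by linarith⟩

/-- A layer of positive thickness below the top stays unmixed up to time `T`. The pressure is
hydrostatic there, that is, affine in the height with slope independent of time. -/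
theorem hasL1Trace_top (hL : 0 < L) (hT : 0 < T) (hB : S.Below L T) :
    HasL1Trace (d := d) T L 1 fun z => S.pressure (col z) := by
  obtain ⟨C, hC⟩ := S.abs_pressure_bound L T
  obtain ⟨δ, hδ, hB'⟩ := exists_below hB
  have hp := S.ρp_pos
  have hg := S.g_pos
  refine hasL1Trace_of_lipschitz measurable_pressure (C := C) (M := S.ρp * S.g) hT.le
    (by positivity) (fun t ht => hC L ⟨by linarith, le_rfl⟩ t ⟨ht.1.le, ht.2.le⟩) hδ
    fun r hr t ht => ?_
  have e1 := q_eq_ρm_of_le hB ⟨ht.1, ht.2.le⟩ le_rfl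
  have e2 := q_eq_ρm_of_le (y := L - 1 * r) hB' ⟨ht.1, ht.2.le⟩ (by linarith [hr.2])
  have h0 : S.pressure (L - 1 * r, t) - S.pressure (L, t) = S.ρp * S.g * r := by
    simp only [pressure, total, momFlux, theta, dens, e1, e2, F_ρm, H_ρm]
    ring
  rw [h0, abs_of_nonneg (by have := hr.1; positivity)]

theorem hasL1Trace_bottom (hL : 0 < L) (hT : 0 < T) (hB : S.Below L T) :
    HasL1Trace (d := d) T (-L) (-1) fun z => S.pressure (col z) := by
  obtain ⟨C, hC⟩ := S.abs_pressure_bound L T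
  obtain ⟨δ, hδ, hB'⟩ := exists_below hB
  have hm := S.ρm_pos
  have hg := S.g_pos
  refine hasL1Trace_of_lipschitz measurable_pressure (C := C) (M := S.ρm * S.g) hT.le
    (by positivity) (fun t ht => hC (-L) ⟨le_rfl, by linarith⟩ t ⟨ht.1.le, ht.2.le⟩) hδ
    fun r hr t ht => ?_
  have e1 := q_eq_ρp_of_le hB ⟨ht.1, ht.2.le⟩ le_rfl
  have e2 := q_eq_ρp_of_le (y := -L - -1 * r) hB' ⟨ht.1, ht.2.le⟩ (by linarith [hr.2])
  have h0 : S.pressure (-L - -1 * r, t) - S.pressure (-L, t) = -(S.ρm * S.g * r) := by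
    simp only [pressure, total, momFlux, theta, dens, e1, e2, F_ρp, H_ρp]
    ring
  rw [h0, abs_neg, abs_of_nonneg (by have := hr.1; positivity)]

namespace IsTurbulent

/-- The dissipation measure. -/
theorem hasDissipation (h : S.IsTurbulent d L T W) (hd : (0 : Fin (d + 1)) ≠ Fin.last d)
    (he : 0 < S.e) (hL : 0 < L) (hT : 0 < T) (hB : S.Below L T) :
    HasDissipation (d := d) S.g L T (fun x => flat S.ρm S.ρp (height x)) (fun _ => 0)
      (fun z => W z 0) (fun z => velocity d (W z)) (fun z => S.pressure (col z))
      (fun y => S.dissipation (S.q y) y.2) := by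
  intro Ψ hΨ
  have hs := hΨ.smooth
  obtain ⟨T', hT', hsupp⟩ := hΨ.support
  have hg : ContDiff ℝ ∞ fun z : Space d × ℝ => S.g * height z.1 :=
    contDiff_const.mul ((EuclideanSpace.proj (𝕜 := ℝ) (Fin.last d)).contDiff.comp contDiff_fst)
  -- The potential energy is balanced by conservation of mass tested with `g * x_n * Ψ`; only the
  -- kinetic energy needs its own relaxed equation.
  have hΨ' : IsTest T fun z => S.g * height z.1 * Ψ z := by
    refine ⟨hg.mul hs, fun x t i => ?_, T', hT', fun x t ht => by simp [hsupp x t ht]⟩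
    simp only
    rw [hΨ.periodic x t i]
    simp [height, (Fin.castSucc_lt_last i).ne']
  have hderiv : ∀ z u, fderiv ℝ (fun z => S.g * height z.1 * Ψ z) z u
      = S.g * height z.1 * fderiv ℝ Ψ z u + S.g * height u.1 * Ψ z := by
    intro z u
    have h1 : HasFDerivAt (fun z : Space d × ℝ => S.g * height z.1)
        (S.g • (EuclideanSpace.proj (𝕜 := ℝ) (Fin.last d)).comp
          (ContinuousLinearMap.fst ℝ (Space d) ℝ)) z :=
      (((EuclideanSpace.proj (𝕜 := ℝ) (Fin.last d)).comp
        (ContinuousLinearMap.fst ℝ (Space d) ℝ)).hasFDerivAt).const_mul S.g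
    refine (congrArg (fun l : Space d × ℝ →L[ℝ] ℝ => l u)
      (h1.mul (hs.differentiable (by simp) z).hasFDerivAt).fderiv).trans ?_
    simp [height]
    ring
  have hm := h.mass he hL hT hB hΨ'
  have h4 := h.integral_inner he (j := 4) ⟨hs, fun h => absurd h (by decide)⟩
  have i4 := h.integrable_inner hs 4
  obtain ⟨a', hbal⟩ := balance_energy (S := S)
  have hw := hbal.weak_spaceTime hL hT measurable_kinetic measurable_kinFlux
    ((measurable_const.mul measurable_mom).sub measurable_dissipation) measurable_const
    (M₀ := 0) (by simp) hΨ
  have hb : ∫ y in torusCell d ×ˢ Ioo (0 : ℝ) T, (S.kinFlux (L, y.2) * Ψ (atHeight y.1 L, y.2)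
      - S.kinFlux (-L, y.2) * Ψ (atHeight y.1 (-L), y.2)) = 0 := by
    refine setIntegral_eq_zero_of_forall_eq_zero fun y hy => ?_
    obtain ⟨⟨-, a, -⟩, -, b, -⟩ := flux_boundary hB ⟨hy.2.1, hy.2.2.le⟩
    simp [a, b]
  rw [hb] at hw
  simp only [zero_mul, integral_zero, add_zero, sub_zero] at hw
  have im : IntegrableOn (fun z => W z 0 * dt (fun z => S.g * height z.1 * Ψ z) z
      + dx (fun z => S.g * height z.1 * Ψ z) z (W z 0 • velocity d (W z))) (spaceTime d L T) := by
    refine (h.integrable_inner hΨ'.smooth 1).congr ?_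
    filter_upwards [h.phases] with z hz
    obtain ⟨ρ, a, b, -, -, -, hW⟩ := hz
    simp [hW, nullField, inner_state, along, dx_smul, dx_velocity, dt, dirT]
    ring
  have hmain : ∫ z in spaceTime d L T,
      ((W z 0 * ‖velocity d (W z)‖ ^ 2 / 2 + W z 0 * S.g * height z.1) * dt Ψ z
        + (W z 0 * ‖velocity d (W z)‖ ^ 2 / 2 + W z 0 * S.g * height z.1 + S.pressure (col z))
          * dx Ψ z (velocity d (W z)))
      = ∫ z in spaceTime d L T, (inner ℝ (W z)
          (nullField S.g (fun z => S.pressure (col z)) Ψ 4 z)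
        + (W z 0 * dt (fun z => S.g * height z.1 * Ψ z) z
          + dx (fun z => S.g * height z.1 * Ψ z) z (W z 0 • velocity d (W z)))) := by
    refine integral_congr_ae ?_
    filter_upwards [h.phases] with z hz
    obtain ⟨ρ, a, b, -, -, -, hW⟩ := hz
    simp only [nullField, inner_state, along, dx_smul, dx_velocity, dt, hderiv,
      norm_velocity_sq hd, hW, dirT, dirX, dirY]
    simp [height, hd.symm]
    ring
  have hinit : ∫ x in channel d L, (flat S.ρm S.ρp (height x) * ‖(0 : Space d)‖ ^ 2 / 2
      + flat S.ρm S.ρp (height x) * S.g * height x) * Ψ (x, 0)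
      = ∫ x in channel d L, flat S.ρm S.ρp (height x) * (S.g * height x * Ψ (x, 0)) := by
    refine integral_congr_ae (Eventually.of_forall fun x => ?_)
    simp
    ring
  rw [energyForm, hmain, hinit, integral_add i4 im, add_assoc, hm, add_zero, h4]
  have s4 : IntegrableOn (fun z => inner ℝ (S.state (col z))
      (nullField S.g (fun z => S.pressure (col z)) Ψ 4 z)) (spaceTime d L T) :=
    integrable_inner_of_memLp ((memLp_state he).mono_exponent le_top) (S.memLp_nullField hs 4)
  obtain ⟨M, hM⟩ := hbal.bounded L T
  have hmomeq : ∀ y : ℝ × ℝ, S.g * S.mom y = S.g * S.state y 4 := fun y => rfl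
  obtain ⟨C, hC⟩ := (isCompact_hull S.ρm S.ρp (S.speed T)).exists_bound_of_continuousOn
    (f := fun w : State => S.g * w 4) (by fun_prop)
  -- The dissipation is the difference of the work of gravity and the source in the energy balance,
  -- both bounded.
  have hdissb : ∀ y ∈ strip L T, |S.dissipation (S.q y) y.2| ≤ C + M := fun y hy => by
    have h1 := hC _ (state_mem_hull (S := S) he (z := y) ⟨hy.2.1, hy.2.2.le⟩)
    have h2 := (hM y.1 ⟨hy.1.1.le, hy.1.2.le⟩ y.2 ⟨hy.2.1, hy.2.2.le⟩).2.2
    have h3 : S.dissipation (S.q y) y.2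
        = S.g * S.state y 4 - (S.g * S.mom y - S.dissipation (S.q y) y.2) := by
      rw [← hmomeq]; ring
    rw [h3]
    exact (abs_sub _ _).trans (add_le_add h1 h2)
  have idiss := integrableOn_col_mul (d := d) (measurable_dissipation (S := S)) hdissb hs.continuous
  rw [eq_neg_iff_add_eq_zero]
  refine (integral_add s4 idiss).symm.trans (Eq.trans ?_ hw)
  refine integral_congr_ae (Eventually.of_forall fun z => ?_)
  simp [nullField, inner_state, state, along, dx, dt, dirT, dirY, eUp, kinetic, momFlux]
  ring

theorem isWeakSolution (h : S.IsTurbulent d L T W) (hd : (0 : Fin (d + 1)) ≠ Fin.last d)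
    (he : 0 < S.e) (hL : 0 < L) (hT : 0 < T) (hB : S.Below L T)
    (hν : ∀ y : ℝ × ℝ, 0 < y.2 → S.dissipation (S.q y) y.2 ≤ 0) :
    IsWeakSolution (d := d) S.g L T (fun x => flat S.ρm S.ρp (height x)) (fun _ => 0)
      (fun z => W z 0) (fun z => velocity d (W z)) (fun z => S.pressure (col z)) where
  periodic_ρ x t i := by simp only [h.periodic x t i]
  periodic_v x t i := by simp only [h.periodic x t i]
  periodic_p x t i := by simp [col, height, (Fin.castSucc_lt_last i).ne']
  bounded_ρ := memLp_component h.memLp 0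
  bounded_v := memLp_velocity h.memLp
  bounded_p := S.memLp_pressure d L T
  trace_top := hasL1Trace_top hL hT hB
  trace_bottom := hasL1Trace_bottom hL hT hB
  momentum Φ hΦ := by
    have := h.momentum hd he hL hT hB hΦ
    simpa [col] using this
  incompressible Ψ hΨ := h.incompressible he hΨ.smooth
  mass Ψ hΨ := h.mass he hL hT hB hΨ
  energy Ψ hΨ hpos := by
    rw [h.hasDissipation hd he hL hT hB Ψ hΨ, neg_nonneg]
    refine setIntegral_nonpos (measurableSet_spaceTime L T) fun z hz => ?_
    exact mul_nonpos_of_nonpos_of_nonneg (hν (col z) hz.2.1)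
      (hpos z.1 z.2 ⟨hz.1.2.1.le, hz.1.2.2.le⟩ ⟨hz.2.1.le, hz.2.2⟩)

end IsTurbulent

end Mixing

end

/-! ### Horizontal averages and total energy -/

noncomputable section

namespace Mixing

variable {S : Mixing} {d : ℕ} {L T : ℝ} {W : Space d × ℝ → State}

theorem dens_abs_le (z : ℝ × ℝ) : |S.dens z| ≤ S.ρp := by
  have h := S.dens_mem z
  have hm := S.ρm_pos
  rw [abs_of_nonneg (by linarith [h.1])]
  exact h.2

theorem integrableOn_state_component (he : 0 < S.e) (i : Fin 10) :
    IntegrableOn (fun z : Space d × ℝ => S.state (col z) i) (spaceTime d L T) :=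
  (memLp_component (memLp_state he) i).integrable le_top

namespace IsTurbulent

theorem integrableOn_component (h : S.IsTurbulent d L T W) (i : Fin 10) :
    IntegrableOn (fun z => W z i) (spaceTime d L T) :=
  (memLp_component h.memLp i).integrable le_top

/-- The horizontal averages of the density are prescribed. -/
theorem average (h : S.IsTurbulent d L T W) (hd : (0 : Fin (d + 1)) ≠ Fin.last d) (he : 0 < S.e) :
    ∀ᵐ y ∂volume.restrict (strip L T), ∫ x' in torusCell d, W (atHeight x' y.1, y.2) 0 = S.dens y := by
  have hi : IntegrableOn (fun z => W z 0 - S.dens (col z)) (spaceTime d L T) :=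
    (h.integrableOn_component 0).sub (integrableOn_state_component he 0)
  have hG : Integrable (fun u : (Fin d → ℝ) × (ℝ × ℝ) => W (atHeight u.1 u.2.1, u.2.2) 0 - S.dens u.2)
      ((volume.restrict (torusCell d)).prod (volume.restrict (strip L T))) := by
    have := integrableOn_spaceTime_iff.2 hi
    rw [IntegrableOn, Measure.volume_eq_prod, ← Measure.prod_restrict] at this
    simpa only [col_slice] using this
  have hopen : IsOpen (strip L T) := isOpen_Ioo.prod isOpen_Ioo
  have hzero := ae_integral_eq_zero_of_orthogonal hopen hG fun φ hφ _ => by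
    have h1 := h.null 5 _ (isNullTest_comp_col hd hφ 5)
    rw [setIntegral_spaceTime, Measure.volume_eq_prod, ← Measure.prod_restrict] at h1
    rw [← h1]
    refine integral_congr_ae (Eventually.of_forall fun u => ?_)
    simp [nullField, inner_state, state]
    ring
  have hs := h.integrableOn_component 0
  have hi0 := integrableOn_spaceTime_iff.2 hs
  rw [IntegrableOn, Measure.volume_eq_prod, ← Measure.prod_restrict] at hi0
  filter_upwards [hzero, hi0.prod_left_ae] with y h1 h2
  rw [integral_sub h2 (integrable_const _), integral_const] at h1
  simpa [sub_eq_zero] using h1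

/-- The total energy is prescribed. -/
theorem totalEnergy_eq (h : S.IsTurbulent d L T W) (hd : (0 : Fin (d + 1)) ≠ Fin.last d)
    (he : 0 < S.e) : ∀ᵐ t ∂volume.restrict (Ioo 0 T),
      totalEnergy S.g L (fun x => W (x, t) 0) (fun x => velocity d (W (x, t)))
        = ∫ y in Ioo (-L) L, (S.kinetic (y, t) + S.g * y * S.dens (y, t)) := by
  have hprod : (volume : Measure (Space d × ℝ)).restrict (spaceTime d L T)
      = (volume.restrict (channel d L)).prod (volume.restrict (Ioo 0 T)) := by
    rw [spaceTime, Measure.volume_eq_prod, Measure.prod_restrict]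
  have hheight : ∀ {f : Space d × ℝ → ℝ}, IntegrableOn f (spaceTime d L T) →
      IntegrableOn (fun z => S.g * height z.1 * f z) (spaceTime d L T) := by
    intro f hf
    refine hf.bdd_mul (c := S.g * L) ?_ ?_
    · exact ((measurable_height.comp measurable_fst).const_mul S.g).aestronglyMeasurable
    · refine (ae_restrict_iff' (measurableSet_spaceTime L T)).2
        (Eventually.of_forall fun z hz => ?_)
      rw [Real.norm_eq_abs, abs_mul, abs_of_pos S.g_pos]
      exact mul_le_mul_of_nonneg_left (abs_le.2 ⟨hz.1.2.1.le, hz.1.2.2.le⟩) S.g_pos.le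
  have iA : IntegrableOn (fun z => (W z 5 + W z 7) / 2 + S.g * height z.1 * W z 0)
      (spaceTime d L T) :=
    (((h.integrableOn_component 5).add (h.integrableOn_component 7)).div_const 2).add
      (hheight (h.integrableOn_component 0))
  have iB : IntegrableOn (fun z => S.kinetic (col z) + S.g * height z.1 * S.dens (col z))
      (spaceTime d L T) := by
    refine ((((integrableOn_state_component he 5).add
      (integrableOn_state_component he 7)).div_const 2).add
      (hheight (integrableOn_state_component he 0))).congr (Eventually.of_forall fun z => ?_)
    simp [state, kinetic, momFlux]
    ring
  have iG := iA.sub iB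
  rw [IntegrableOn, hprod] at iG
  rw [IntegrableOn, hprod] at iA iB
  have hzero := ae_integral_eq_zero_of_orthogonal isOpen_Ioo iG fun φ hφ _ => by
    -- The kinetic part is tested with a function of time alone and the potential part with that
    -- function times `g * y`; both are constant in the first horizontal direction and hence
    -- annihilate the perturbation.
    have hφ' : ContDiff ℝ ∞ fun y : ℝ × ℝ => φ y.2 / 2 := (hφ.comp contDiff_snd).div_const 2
    have hφ'' : ContDiff ℝ ∞ fun y : ℝ × ℝ => S.g * y.1 * φ y.2 :=
      (contDiff_const.mul contDiff_fst).mul (hφ.comp contDiff_snd)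
    have h6 := h.null 6 _ (isNullTest_comp_col hd hφ' 6)
    have h5 := h.null 5 _ (isNullTest_comp_col hd hφ'' 5)
    have hWf : MemLp (fun z => W z - S.state (col z)) 2 (volume.restrict (spaceTime d L T)) :=
      (h.memLp.sub (memLp_state he)).mono_exponent le_top
    have hadd := integral_add
      (integrable_inner_of_memLp hWf (S.memLp_nullField (contDiff_comp_col hφ') 6))
      (integrable_inner_of_memLp hWf (S.memLp_nullField (contDiff_comp_col hφ'') 5))
    rw [h6, h5, add_zero] at hadd
    rw [← hprod, ← hadd]
    refine integral_congr_ae (Eventually.of_forall fun z => ?_)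
    simp [nullField, inner_state, state, kinetic, momFlux, col]
    ring
  have hph := h.phases
  rw [hprod] at hph
  have hph' := Measure.ae_ae_of_ae_prod (Measure.measurePreserving_swap.quasiMeasurePreserving.ae hph)
  filter_upwards [hzero, hph', iA.prod_left_ae, iB.prod_left_ae] with t h1 h2 h3 h4
  have e1 : totalEnergy S.g L (fun x => W (x, t) 0) (fun x => velocity d (W (x, t)))
      = ∫ x in channel d L, ((W (x, t) 5 + W (x, t) 7) / 2 + S.g * height x * W (x, t) 0) := by
    refine integral_congr_ae ?_
    filter_upwards [h2] with x hx
    obtain ⟨ρ, a, b, -, -, -, hW⟩ := hx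
    simp only [Prod.swap_prod_mk] at hW
    simp only [hW, norm_velocity_sq hd]
    simp
    ring
  have e2 := integral_sub h3 h4
  simp only [Pi.sub_apply] at h1
  rw [h1, eq_comm, sub_eq_zero] at e2
  rw [e1, e2]
  exact integral_channel_height (b := fun y => S.kinetic (y, t) + S.g * y * S.dens (y, t)) h4

theorem totalEnergy_close (h : S.IsTurbulent d L T W) (hd : (0 : Fin (d + 1)) ≠ Fin.last d)
    (he : 0 < S.e) (hL : 0 < L) (hB : S.Below L T) : ∀ᵐ t ∂volume.restrict (Ioo 0 T),
      |(totalEnergy S.g L (fun x => W (x, t) 0) (fun x => velocity d (W (x, t)))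
        - totalEnergy S.g L (fun x : Space d => flat S.ρm S.ρp (height x)) (fun _ => 0))
          / (S.ρp - S.ρm)
        - S.lam ^ 2 * (S.lam - 1 / 2) * (S.g ^ 3 * t ^ 4 * atwood S.ρm S.ρp ^ 2
          / (3 * (1 - atwood S.ρm S.ρp ^ 2)))|
        ≤ S.e * S.energyBound / (S.ρp - S.ρm) * t ^ 4 := by
  have hdiff := sub_pos.2 S.ρm_lt
  filter_upwards [h.totalEnergy_eq hd he, ae_restrict_mem measurableSet_Ioo] with t ht htT
  have ht0 : t ∈ Ioc 0 T := ⟨htT.1, htT.2.le⟩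
  obtain ⟨hi, hlam⟩ := S.integral_laminar hL hB ht0
  have hθ := abs_integral_fluctuations_le (S := S) (L := L) htT.1 he.le
  have iθ : IntegrableOn (fun y => S.dens (y, t) * S.theta (y, t)) (Ioo (-L) L) :=
    ((continuous_dens_mul_theta_space htT.1).continuousOn.integrableOn_compact
      isCompact_Icc).mono_set Ioo_subset_Icc_self
  have ibd : ∀ {f : ℝ → ℝ}, Measurable f → (∀ y, |f y| ≤ S.ρp) →
      IntegrableOn (fun y => S.g * y * f y) (Ioo (-L) L) := by
    intro f hf hb
    have h1 : IntegrableOn (fun y : ℝ => S.g * y) (Ioo (-L) L) :=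
      (ContinuousOn.integrableOn_compact isCompact_Icc (by fun_prop)).mono_set Ioo_subset_Icc_self
    exact h1.mul_bdd (c := S.ρp) hf.aestronglyMeasurable (Eventually.of_forall hb)
  have hflat : ∀ y, |flat S.ρm S.ρp y| ≤ S.ρp := fun y => by
    have := S.ρm_pos
    have := S.ρm_lt
    rw [flat]
    split_ifs <;> rw [abs_of_pos] <;> linarith
  have iflat := ibd (measurable_flat S.ρm S.ρp) hflat
  have idens := ibd (f := fun y => S.dens (y, t)) (continuous_dens_space htT.1).measurable
    fun y => dens_abs_le _
  have e0 : totalEnergy S.g L (fun x : Space d => flat S.ρm S.ρp (height x)) (fun _ => 0)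
      = ∫ y in Ioo (-L) L, S.g * y * flat S.ρm S.ρp y := by
    have hint : Integrable (fun x : Space d => S.g * height x * flat S.ρm S.ρp (height x))
        (volume.restrict (channel d L)) := by
      have h1 : IntegrableOn (fun x : Space d => S.g * height x) (channel d L) :=
        integrableOn_of_continuous_channel (continuous_const.mul continuous_height)
      exact h1.mul_bdd (c := S.ρp) ((measurable_flat _ _).comp measurable_height).aestronglyMeasurable
        (Eventually.of_forall fun x => hflat _)
    rw [← integral_channel_height (d := d) (b := fun y => S.g * y * flat S.ρm S.ρp y) hint,
      totalEnergy]
    refine integral_congr_ae (Eventually.of_forall fun x => ?_)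
    simp
    ring
  have ekin : ∀ y, S.kinetic (y, t) + S.g * y * S.dens (y, t) - S.g * y * flat S.ρm S.ρp y
      = (-(S.lam * S.g ^ 2 * t ^ 2 * S.F (S.q (y, t)) / 2)
        + S.g * y * (S.dens (y, t) - flat S.ρm S.ρp y)) + S.dens (y, t) * S.theta (y, t) := by
    intro y
    rw [kinetic]
    ring
  have isum := hi.add iθ
  have itot : IntegrableOn (fun y => S.kinetic (y, t) + S.g * y * S.dens (y, t)) (Ioo (-L) L) := by
    refine (isum.add iflat).congr (Eventually.of_forall fun y => ?_)
    simp only [Pi.add_apply]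
    rw [← ekin]
    ring
  have ediff : totalEnergy S.g L (fun x => W (x, t) 0) (fun x => velocity d (W (x, t)))
      - totalEnergy S.g L (fun x : Space d => flat S.ρm S.ρp (height x)) (fun _ => 0)
      = (S.ρp - S.ρm) * (S.lam ^ 2 * (S.lam - 1 / 2) * (S.g ^ 3 * t ^ 4 * atwood S.ρm S.ρp ^ 2
        / (3 * (1 - atwood S.ρm S.ρp ^ 2)))) + ∫ y in Ioo (-L) L, S.dens (y, t) * S.theta (y, t) := by
    rw [ht, e0, ← integral_sub itot iflat, ← hlam, ← integral_add hi iθ]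
    exact integral_congr_ae (Eventually.of_forall ekin)
  rw [ediff, add_div, mul_div_cancel_left₀ _ hdiff.ne', add_sub_cancel_left, abs_div,
    abs_of_pos hdiff, div_mul_eq_mul_div]
  exact div_le_div_of_nonneg_right hθ hdiff.le

end IsTurbulent

end Mixing

end

/-! ### Periodic continuation and existence of turbulent fields -/

noncomputable section

section Periodize

variable {d : ℕ}

/-- The representative in the fundamental cell. -/
def reduce (z : Space d × ℝ) : Space d × ℝ :=
  (atHeight (fun i => Int.fract (z.1 i.castSucc)) (height z.1), z.2)

theorem reduce_eq {L T : ℝ} {z : Space d × ℝ} (hz : z ∈ spaceTime d L T) : reduce z = z := by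
  refine Prod.ext (space_ext (fun i => ?_) ?_) rfl
  · simp only [reduce, atHeight_castSucc]
    exact Int.fract_eq_self.2 (hz.1.1 i)
  · simp [reduce]

theorem hPeriodic_reduce : HPeriodic (reduce : Space d × ℝ → Space d × ℝ) := by
  intro x t i
  refine Prod.ext (space_ext (fun j => ?_) ?_) rfl
  · simp only [reduce, atHeight_castSucc, PiLp.add_apply]
    by_cases h : j = i
    · subst h
      simp
    · simp [h]
  · simp [reduce, height, (Fin.castSucc_lt_last i).ne']

theorem hPeriodic_col : HPeriodic (col : Space d × ℝ → ℝ × ℝ) := by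
  intro x t i
  simp [col, height, (Fin.castSucc_lt_last i).ne']

theorem ae_coordinate_ne_zero (i : Fin (d + 1)) :
    ∀ᵐ z : Space d × ℝ, z.1 i ≠ 0 := by
  let l : Space d × ℝ →ₗ[ℝ] ℝ :=
    ((EuclideanSpace.proj (𝕜 := ℝ) i).comp (ContinuousLinearMap.fst ℝ (Space d) ℝ)).toLinearMap
  have h : LinearMap.ker l ≠ ⊤ := by
    intro h
    have h1 : ((EuclideanSpace.single i (1 : ℝ) : Space d), (0 : ℝ)) ∈ LinearMap.ker l := by
      rw [h]; trivial
    simp [l] at h1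
  have := Measure.addHaar_submodule (volume : Measure (Space d × ℝ)) _ h
  rw [ae_iff]
  convert this using 2
  ext z
  simp [l]

end Periodize

namespace Mixing

variable (S : Mixing) (d : ℕ) (T : ℝ)

/-- The mixing zone in the interior of the fundamental cell. -/
def region : Set (Space d × ℝ) :=
  {z | (∀ i : Fin d, z.1 i.castSucc ∈ Ioo (0 : ℝ) 1) ∧ z.2 ∈ Ioo 0 T ∧ S.ratio (col z) ∈ S.zone}

variable {S d T} {L : ℝ}

theorem isOpen_region : IsOpen (S.region d T) := by
  rw [isOpen_iff_mem_nhds]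
  intro z hz
  have h1 : ∀ i : Fin d, ∀ᶠ z' : Space d × ℝ in 𝓝 z, z'.1 i.castSucc ∈ Ioo (0 : ℝ) 1 := fun i =>
    ((EuclideanSpace.proj (𝕜 := ℝ) i.castSucc).continuous.comp
      (continuous_fst (X := Space d) (Y := ℝ))).continuousAt.eventually_mem
      (isOpen_Ioo.mem_nhds (hz.1 i))
  have h2 : ∀ᶠ z' : Space d × ℝ in 𝓝 z, z'.2 ∈ Ioo 0 T :=
    continuous_snd.continuousAt.eventually_mem (isOpen_Ioo.mem_nhds hz.2.1)
  have h3 : ∀ᶠ z' : Space d × ℝ in 𝓝 z, S.ratio (col z') ∈ S.zone :=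
    (ContinuousAt.comp (continuousAt_ratio (S := S) (z := col z) hz.2.1.1)
      continuous_col.continuousAt).eventually_mem (isOpen_Ioo.mem_nhds hz.2.2)
  filter_upwards [eventually_all.2 h1, h2, h3] with z' a b c
  exact ⟨a, b, c⟩

theorem region_subset (hB : S.Below L T) : S.region d T ⊆ spaceTime d L T := by
  intro z hz
  have ht : (col z).2 ∈ Ioc 0 T := ⟨hz.2.1.1, hz.2.1.2.le⟩
  have hq := q_mem_Ioo hz.2.2
  refine ⟨⟨fun i => ⟨(hz.1 i).1.le, (hz.1 i).2⟩, ?_, ?_⟩, hz.2.1⟩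
  · by_contra! h
    exact hq.2.ne (q_eq_ρp_of_le (y := height z.1) hB ht h)
  · by_contra! h
    exact hq.1.ne' (q_eq_ρm_of_le (y := height z.1) hB ht h)

theorem region_nonempty (hT : 0 < T) : (S.region d T).Nonempty := by
  refine ⟨(atHeight (fun _ => 1 / 2) 0, T / 2), fun i => ?_, ⟨by positivity, by simpa⟩, ?_⟩
  · simp only [atHeight_castSucc]
    norm_num
  · simp only [col, height_atHeight, ratio, mul_zero, zero_div, add_zero]
    exact ⟨left_lt_one, one_lt_right⟩

theorem contDiffAt_pressure_col {z : Space d × ℝ} (hz : z ∈ S.region d T) :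
    ContDiffAt ℝ 2 (fun z : Space d × ℝ => S.pressure (col z)) z :=
  ContDiffAt.comp (g := S.pressure) (f := colMap d) z
    (contDiffAt_pressure (S := S) (z := col z) hz.2.1.1 hz.2.2) (colMap d).contDiff.contDiffAt

theorem col_add_horizontal (hd : (0 : Fin (d + 1)) ≠ Fin.last d) (z : Space d × ℝ) (s : ℝ) :
    col (z + s • dirX d) = col z := by
  simp [col, dirX, height, hd.symm]

theorem isPressure_region (hd : (0 : Fin (d + 1)) ≠ Fin.last d) :
    IsPressure (S.region d T) (fun z => S.pressure (col z))
      fun z => fderiv ℝ (fun z : Space d × ℝ => S.pressure (col z)) z (dirY d) where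
  continuousOn z hz := (contDiffAt_pressure_col hz).continuousAt.continuousWithinAt
  continuousOn_deriv z hz :=
    ((((contDiffAt_pressure_col hz).fderiv_right (m := 1) (by norm_num)).clm_apply
      contDiffAt_const).continuousAt).continuousWithinAt
  vertical z hz :=
    ((contDiffAt_pressure_col hz).differentiableAt (by norm_num)).hasFDerivAt.hasLineDerivAt _
  horizontal z hz := by
    simp only [HasLineDerivAt, col_add_horizontal hd]
    exact hasDerivAt_const _ _
  horizontal_deriv z hz := by
    have h : ∀ s : ℝ, fderiv ℝ (fun z : Space d × ℝ => S.pressure (col z)) (z + s • dirX d)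
        = fderiv ℝ (fun z : Space d × ℝ => S.pressure (col z)) z := fun s => by
      rw [← fderiv_comp_add_right (s • dirX d)]
      simp only [col_add_horizontal hd]
    simp only [HasLineDerivAt, h]
    exact hasDerivAt_const _ _

/-- There are turbulent fields weakly close to the subsolution. -/
theorem exists_isTurbulent_near (hd : (0 : Fin (d + 1)) ≠ Fin.last d) (he : 0 < S.e)
    (hB : S.Below L T) (F : Finset (Lp State 2 (volume.restrict (spaceTime d L T)))) {ε : ℝ}
    (hε : 0 < ε) : ∃ W : Space d × ℝ → State, S.IsTurbulent d L T W ∧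
      ∀ h ∈ F, |∫ z in spaceTime d L T, inner ℝ (W z - S.state (col z)) (h z)| ≤ ε := by
  classical
  have hO := isOpen_region (S := S) (d := d) (T := T)
  have hsub := region_subset (S := S) (d := d) hB
  have hOm := hO.measurableSet
  have hle : volume.restrict (S.region d T) ≤ volume.restrict (spaceTime d L T) :=
    Measure.restrict_mono hsub le_rfl
  obtain ⟨C, hC⟩ := S.abs_pressure_col_le d L T
  let restr : Lp State 2 (volume.restrict (spaceTime d L T)) →
      Lp State 2 (volume.restrict (S.region d T)) :=
    fun h => ((Lp.memLp h).mono_measure hle).toLp h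
  obtain ⟨w, hwm, hwp, hwn, hwF⟩ := exists_mem_phaseSet_near (g := S.g) hd S.ρm_pos S.ρm_lt hO
    ((isBounded_spaceTime L T).subset hsub) (isPressure_region hd) (fun z hz => hC z (hsub hz))
    (f := fun z => S.state (col z)) (R := S.speed T)
    (fun z hz => (ContinuousAt.comp (continuousAt_state (S := S) (z := col z) hz.2.1.1)
      continuous_col.continuousAt).continuousWithinAt)
    (fun z hz => state_mem_interior_hull (S := S) (z := col z) he ⟨hz.2.1.1, hz.2.1.2.le⟩ hz.2.2)
    (F.image restr) hε
  -- Convex integration acts only in the interior of one cell of the zone. The perturbations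
  -- annihilate all smooth tests, without any periodicity, so cutting and continuing periodically
  -- produces no contribution on the faces.
  let W : Space d × ℝ → State := fun z =>
    if reduce z ∈ S.region d T then w (reduce z) else S.state (col z)
  have hW : ∀ z ∈ spaceTime d L T, W z = (S.region d T).piecewise w (fun z => S.state (col z)) z :=
    fun z hz => by simp only [W, reduce_eq hz, piecewise]
  have hWr : ∀ z ∈ S.region d T, W z = w z := fun z hz => by
    rw [hW z (hsub hz), piecewise_eq_of_mem _ _ _ hz]
  have hWo : ∀ z ∈ spaceTime d L T, z ∉ S.region d T → W z = S.state (col z) := fun z hz hz' => by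
    rw [hW z hz, piecewise_eq_of_notMem _ _ _ hz']
  have hint : ∀ k : Space d × ℝ → State,
      ∫ z in spaceTime d L T, inner ℝ (W z - S.state (col z)) (k z)
        = ∫ z in S.region d T, inner ℝ (w z - S.state (col z)) (k z) := fun k => by
    rw [setIntegral_eq_of_subset_of_forall_sdiff_eq_zero (measurableSet_spaceTime L T) hsub
      fun z hz => by rw [hWo z hz.1 hz.2, sub_self, inner_zero_left]]
    exact setIntegral_congr_fun hOm fun z hz => by simp only [hWr z hz]
  -- Points of the zone missing from the region lie on the faces of the cell, a null set.
  have hinter : ∀ᵐ z ∂volume.restrict (spaceTime d L T), S.ratio (col z) ∈ S.zone →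
      z ∈ S.region d T := by
    have h0 : ∀ᵐ z : Space d × ℝ, ∀ i : Fin d, z.1 i.castSucc ≠ 0 :=
      ae_all_iff.2 fun i => ae_coordinate_ne_zero _
    filter_upwards [ae_restrict_of_ae h0, ae_restrict_mem (measurableSet_spaceTime L T)]
      with z h1 h2 h3
    exact ⟨fun i => ⟨lt_of_le_of_ne (h2.1.1 i).1 (h1 i).symm, (h2.1.1 i).2⟩, h2.2, h3⟩
  have hae : ∀ᵐ z ∂volume.restrict (spaceTime d L T), z ∈ S.region d T →
      w z ∈ phaseSet S.ρm S.ρp (S.speed T) :=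
    ae_restrict_of_ae ((ae_restrict_iff' hOm).1 hwp)
  refine ⟨W, ⟨fun x t i => ?_, ?_, ?_, fun j ψ hψ => ?_, ?_⟩, fun h hh => ?_⟩
  · simp only [W, hPeriodic_reduce x t i, hPeriodic_col x t i]
  · refine AEStronglyMeasurable.congr (f := (S.region d T).piecewise w fun z => S.state (col z))
      ?_ ?_
    · refine AEStronglyMeasurable.piecewise hOm ?_
        (measurable_state.comp measurable_col).aestronglyMeasurable
      rwa [Measure.restrict_restrict hOm, inter_eq_self_of_subset_left hsub]
    · filter_upwards [ae_restrict_mem (measurableSet_spaceTime L T)] with z hz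
      exact (hW z hz).symm
  · filter_upwards [hae, hinter, ae_restrict_mem (measurableSet_spaceTime L T)] with z h1 h2 h3
    by_cases h : z ∈ S.region d T
    · rw [hWr z h]
      exact h1 h
    · rw [hWo z h3 h]
      exact state_mem_phaseSet (z := col z) ⟨h3.2.1, h3.2.2.le⟩ fun h' => h (h2 h')
  · rw [hint]
    exact hwn j ψ hψ
  · filter_upwards [ae_restrict_mem (measurableSet_spaceTime L T)] with z h1 h2
    exact hWo z h1 fun h => h2 h.2.2
  · rw [hint]
    refine le_of_eq_of_le (congrArg _ (integral_congr_ae ?_))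
      (hwF (restr h) (Finset.mem_image_of_mem _ hh))
    filter_upwards [((Lp.memLp h).mono_measure hle).coeFn_toLp] with z hz
    rw [hz]

/-- There is a sequence of turbulent fields which converges weakly to the subsolution. -/
theorem exists_seq_isTurbulent (hd : (0 : Fin (d + 1)) ≠ Fin.last d) (he : 0 < S.e)
    (hB : S.Below L T) : ∃ W : ℕ → Space d × ℝ → State, (∀ k, S.IsTurbulent d L T (W k)) ∧
      ∀ h : Space d × ℝ → State, MemLp h 2 (volume.restrict (spaceTime d L T)) →
        Tendsto (fun k => ∫ z in spaceTime d L T, inner ℝ (W k z - S.state (col z)) (h z)) atTop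
          (𝓝 0) := by
  classical
  have htwo : Fact ((2 : ℝ≥0∞) ≠ ⊤) := ⟨by simp⟩
  let V := Lp State 2 ((volume : Measure (Space d × ℝ)).restrict (spaceTime d L T))
  -- The `k`-th field is tested against the first `k + 1` elements of a dense sequence of L², with
  -- tolerance `1 / (k + 1)`.
  have hex : ∀ k : ℕ, ∃ W : Space d × ℝ → State, S.IsTurbulent d L T W ∧
      ∀ h ∈ (Finset.range (k + 1)).image (TopologicalSpace.denseSeq V),
        |∫ z in spaceTime d L T, inner ℝ (W z - S.state (col z)) (h z)| ≤ 1 / ((k : ℝ) + 1) :=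
    fun k => exists_isTurbulent_near hd he hB _ (by positivity)
  choose W hW hWF using hex
  refine ⟨W, hW, fun h hh => ?_⟩
  obtain ⟨C, hC⟩ := (isCompact_hull S.ρm S.ρp (S.speed T)).exists_bound_of_continuousOn
    (f := fun w : State => w) continuousOn_id
  have hm : ∀ k, MemLp (fun z => W k z - S.state (col z)) 2
      (volume.restrict (spaceTime d L T)) := fun k =>
    ((hW k).memLp.sub (memLp_state he)).mono_exponent le_top
  let D : ℕ → V := fun k => (hm k).toLp _
  -- All states lie in one compact hull; this uniform bound extends convergence from the dense
  -- sequence to every test.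
  have hDb : ∃ B, ∀ k, ‖D k‖ ≤ B := by
    have hC0 : 0 ≤ |C| + |C| := by positivity
    refine ⟨_, fun k => Lp.norm_le_of_ae_bound hC0 ?_⟩
    filter_upwards [(hm k).coeFn_toLp, (hW k).phases, ae_restrict_mem (measurableSet_spaceTime L T)]
      with z h1 h2 h3
    rw [h1]
    exact (norm_sub_le _ _).trans (add_le_add
      ((hC _ (subset_convexHull ℝ _ h2)).trans (le_abs_self C))
      ((hC _ (state_mem_hull he (z := col z) ⟨h3.2.1, h3.2.2.le⟩)).trans (le_abs_self C)))
  obtain ⟨B, hB'⟩ := hDb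
  have hB0 : 0 ≤ B := (norm_nonneg _).trans (hB' 0)
  have hinner : ∀ k (u : V), inner ℝ (D k) u
      = ∫ z in spaceTime d L T, inner ℝ (W k z - S.state (col z)) (u z) := fun k u => by
    rw [L2.inner_def]
    refine integral_congr_ae ?_
    filter_upwards [(hm k).coeFn_toLp] with z hz
    rw [hz]
  have hgoal : ∀ k, ∫ z in spaceTime d L T, inner ℝ (W k z - S.state (col z)) (h z)
      = inner ℝ (D k) (hh.toLp h) := fun k => by
    rw [hinner]
    refine integral_congr_ae ?_
    filter_upwards [hh.coeFn_toLp] with z hz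
    rw [hz]
  simp only [hgoal]
  rw [Metric.tendsto_atTop]
  intro ε hε
  have hδ : 0 < ε / (2 * (B + 1)) := by positivity
  obtain ⟨n, hn⟩ := (TopologicalSpace.denseRange_denseSeq V).exists_dist_lt (hh.toLp h) hδ
  obtain ⟨N, hN⟩ := exists_nat_one_div_lt (half_pos hε)
  refine ⟨max n N, fun k hk => ?_⟩
  have h1 : |inner ℝ (D k) (TopologicalSpace.denseSeq V n)| < ε / 2 := by
    rw [hinner]
    refine (hWF k _ (Finset.mem_image_of_mem _ (Finset.mem_range.2
      (by have := le_max_left n N; omega)))).trans_lt (lt_of_le_of_lt ?_ hN)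
    have : (N : ℝ) ≤ k := by exact_mod_cast (le_max_right n N).trans hk
    gcongr
  have h2 : |inner ℝ (D k) (hh.toLp h - TopologicalSpace.denseSeq V n)| ≤ ε / 2 := by
    refine (abs_real_inner_le_norm _ _).trans ?_
    rw [← dist_eq_norm]
    calc ‖D k‖ * dist (hh.toLp h) (TopologicalSpace.denseSeq V n)
        ≤ (B + 1) * (ε / (2 * (B + 1))) := by
          have := hB' k
          exact mul_le_mul (by linarith) hn.le dist_nonneg (by linarith)
      _ = ε / 2 := by field_simp
  rw [Real.dist_eq, sub_zero]
  have h3 : inner ℝ (D k) (hh.toLp h) = inner ℝ (D k) (TopologicalSpace.denseSeq V n)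
      + inner ℝ (D k) (hh.toLp h - TopologicalSpace.denseSeq V n) := by
    rw [← inner_add_right]
    congr 1
    abel
  rw [h3]
  exact (abs_add_le _ _).trans_lt (by linarith)

end Mixing

end

/-! ### Weak convergence and pairwise different solutions -/

noncomputable section

/-- The states with the given horizontal and vertical components. -/
def embed (d : ℕ) (i j : Fin 10) : Space d →L[ℝ] State :=
  (EuclideanSpace.proj (𝕜 := ℝ) (0 : Fin (d + 1))).smulRight (EuclideanSpace.single i 1 : State)
    + (EuclideanSpace.proj (𝕜 := ℝ) (Fin.last d)).smulRight (EuclideanSpace.single j 1 : State)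

theorem inner_embed {d : ℕ} (i j : Fin 10) (w : State) (x : Space d) :
    inner ℝ w (embed d i j x) = w i * x 0 + w j * height x := by
  rw [embed, add_apply, inner_add_right,
    ContinuousLinearMap.smulRight_apply, ContinuousLinearMap.smulRight_apply,
    real_inner_smul_right, real_inner_smul_right, EuclideanSpace.inner_single_right,
    EuclideanSpace.inner_single_right]
  simp [height]
  ring

namespace Mixing

variable {S : Mixing} {d : ℕ} {L T : ℝ}

theorem IsTurbulent.tendsto {W : ℕ → Space d × ℝ → State} (hW : ∀ k, S.IsTurbulent d L T (W k))
    (he : 0 < S.e) (hlim : ∀ h : Space d × ℝ → State,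
      MemLp h 2 (volume.restrict (spaceTime d L T)) →
        Tendsto (fun k => ∫ z in spaceTime d L T, inner ℝ (W k z - S.state (col z)) (h z)) atTop
          (𝓝 0)) {h : Space d × ℝ → State} (hh : MemLp h 2 (volume.restrict (spaceTime d L T))) :
    Tendsto (fun k => ∫ z in spaceTime d L T, inner ℝ (W k z) (h z)) atTop
      (𝓝 (∫ z in spaceTime d L T, inner ℝ (S.state (col z)) (h z))) := by
  have h1 := (hlim h hh).add_const (∫ z in spaceTime d L T, inner ℝ (S.state (col z)) (h z))
  rw [zero_add] at h1
  refine h1.congr fun k => ?_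
  refine (integral_add (integrable_inner_of_memLp
    (((hW k).memLp.sub (memLp_state he)).mono_exponent le_top) hh)
    (integrable_inner_of_memLp ((memLp_state he).mono_exponent le_top) hh)).symm.trans ?_
  simp [inner_sub_left]

/-- A turbulent density is not the density of the subsolution. -/
theorem IsTurbulent.integral_sq_pos {W : Space d × ℝ → State} (h : S.IsTurbulent d L T W)
    (he : 0 < S.e) (hT : 0 < T) (hB : S.Below L T) :
    0 < ∫ z in spaceTime d L T, (W z 0 - S.dens (col z)) ^ 2 := by
  have hm : MemLp (fun z => W z 0 - S.dens (col z)) 2 (volume.restrict (spaceTime d L T)) :=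
    (memLp_component (h.memLp.sub (memLp_state he)) 0).mono_exponent le_top
  refine lt_of_le_of_ne (integral_nonneg fun z => sq_nonneg _) fun h0 => ?_
  have h1 := (integral_eq_zero_iff_of_nonneg (fun z => sq_nonneg _) hm.integrable_sq).1 h0.symm
  -- In the zone the averaged density lies strictly between the two phase values, so agreement
  -- almost everywhere would make a nonempty open set null.
  have h2 : ∀ᵐ z ∂volume.restrict (spaceTime d L T), z ∉ S.region d T := by
    filter_upwards [h1, h.phases] with z h3 h4 h5
    obtain ⟨ρ, a, b, hρ, -, -, hW⟩ := h4
    have hq := q_mem_Ioo h5.2.2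
    have h6 : W z 0 = S.dens (col z) := sub_eq_zero.1 (pow_eq_zero_iff two_ne_zero |>.1 h3)
    rw [hW, pureState_0, dens] at h6
    rcases hρ with hρ | hρ
    · have := hq.2; linarith
    · have := hq.1; linarith
  have h3 : volume (S.region d T) = 0 := by
    have h4 := (ae_restrict_iff' (measurableSet_spaceTime L T)).1 h2
    refine measure_mono_null (fun z hz => ?_) (ae_iff.1 h4)
    exact fun h => h (region_subset hB hz) hz
  exact (isOpen_region.measure_pos _ (region_nonempty hT)).ne' h3

/-- There is a sequence of pairwise different turbulent fields which converges weakly to the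
subsolution. -/
theorem exists_seq_isTurbulent_ne (hd : (0 : Fin (d + 1)) ≠ Fin.last d) (he : 0 < S.e) (hT : 0 < T)
    (hB : S.Below L T) : ∃ W : ℕ → Space d × ℝ → State, (∀ k, S.IsTurbulent d L T (W k)) ∧
      (∀ h : Space d × ℝ → State, MemLp h 2 (volume.restrict (spaceTime d L T)) →
        Tendsto (fun k => ∫ z in spaceTime d L T, inner ℝ (W k z) (h z)) atTop
          (𝓝 (∫ z in spaceTime d L T, inner ℝ (S.state (col z)) (h z)))) ∧
      ∀ j k, j ≠ k → ¬ (fun z => W j z 0) =ᵐ[volume.restrict (spaceTime d L T)]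
        fun z => W k z 0 := by
  obtain ⟨W, hW, hlim⟩ := exists_seq_isTurbulent (S := S) hd he hB
  -- Tested with the fixed deviation of the `j`-th density, later fields tend to the value of the
  -- subsolution. A later field with the `j`-th density would instead keep the positive value from
  -- `integral_sq_pos`.
  have hev : ∀ j, ∀ᶠ k in atTop, ¬ (fun z => W j z 0)
      =ᵐ[volume.restrict (spaceTime d L T)] fun z => W k z 0 := by
    intro j
    have hpos := (hW j).integral_sq_pos he hT hB
    have hm : MemLp (fun z => W j z - S.state (col z)) 2 (volume.restrict (spaceTime d L T)) :=
      ((hW j).memLp.sub (memLp_state he)).mono_exponent le_top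
    have hφ : MemLp (fun z => (W j z 0 - S.dens (col z)) • (EuclideanSpace.single 0 1 : State)) 2
        (volume.restrict (spaceTime d L T)) :=
      ((EuclideanSpace.proj (𝕜 := ℝ) (0 : Fin 10)).smulRight
        (EuclideanSpace.single 0 1 : State)).comp_memLp' hm
    filter_upwards [(hlim _ hφ).eventually_lt_const hpos] with k hk heq
    refine hk.ne (integral_congr_ae ?_)
    filter_upwards [heq] with z hz
    have hz' : W j z 0 = W k z 0 := hz
    rw [real_inner_smul_right, EuclideanSpace.inner_single_right]
    simp only [PiLp.sub_apply, ← hz']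
    simp [state]
    ring
  -- A greedy choice: each new index lies beyond the chosen ones, with a density different from all
  -- of theirs.
  obtain ⟨f, -, hf⟩ := exists_seq_of_forall_finset_exists (fun _ : ℕ => True)
    (fun j k => j < k ∧ ¬ (fun z => W j z 0)
      =ᵐ[volume.restrict (spaceTime d L T)] fun z => W k z 0) fun s _ => by
    have h1 : ∀ᶠ k in atTop, ∀ j ∈ s, j < k ∧ ¬ (fun z => W j z 0)
        =ᵐ[volume.restrict (spaceTime d L T)] fun z => W k z 0 :=
      (Finset.eventually_all s).2 fun j _ => (eventually_gt_atTop j).and (hev j)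
    obtain ⟨k, hk⟩ := h1.exists
    exact ⟨k, trivial, hk⟩
  have hmono : StrictMono f := fun m n hmn => (hf m n hmn).1
  refine ⟨fun k => W (f k), fun k => hW _, fun h hh => ?_, fun j k hjk => ?_⟩
  · exact (IsTurbulent.tendsto hW he hlim hh).comp hmono.tendsto_atTop
  · rcases lt_or_gt_of_ne hjk with h | h
    · exact (hf j k h).2
    · exact fun h' => (hf k j h).2 h'.symm

theorem dens_eq_flat {z : ℝ × ℝ} (hz : 0 < z.2) (h : S.ratio z ∉ S.zone) :
    S.dens z = flat S.ρm S.ρp z.1 := by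
  have hl := S.lam_pos
  have hg := S.g_pos
  rw [zone, mem_Ioo, not_and_or, not_lt, not_lt] at h
  have hr : S.ratio z = 1 + 2 / (S.lam * S.g * z.2 ^ 2) * z.1 := by
    rw [ratio]; ring
  have hc : 0 < 2 / (S.lam * S.g * z.2 ^ 2) := by positivity
  rcases h with h | h
  · have h1 : z.1 < 0 := by
      have := h.trans_lt left_lt_one
      by_contra! h0
      have := mul_nonneg hc.le h0
      linarith
    rw [dens, q_eq_ρp h, flat, if_neg h1.not_gt]
    ring
  · have h1 : 0 < z.1 := by
      have := one_lt_right.trans_le h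
      by_contra! h0
      have := mul_nonpos_of_nonneg_of_nonpos hc.le h0
      linarith
    rw [dens, q_eq_ρm h, flat, if_pos h1]
    ring

end Mixing

end

end RayleighTaylor

open RayleighTaylor in
/-- Here `n = d + 1`. The hypothesis `hT` says that the (closed) mixing zone stays inside the channel
up to time `T`. -/
theorem theorem1p1 (d : ℕ) (hd : d = 1 ∨ d = 2) (ρm ρp g L T lam : ℝ)
    (hρm : 0 < ρm) (hρ : ρm < ρp) (hg : 0 < g) (hL : 0 < L) (hT0 : 0 < T)
    (hlam : lam ∈ Ioo (0 : ℝ) (1 / 2))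
    (hT : closure (mixingZone ρm ρp g lam T) ⊆ Ioo (-L) L) :
    ∃ r : ℝ × ℝ → ℝ, IsEntropySolution ρm ρp g (flux ρm ρp lam) r ∧
      ∀ ε > 0, ∃ (ν : ℝ × ℝ → ℝ) (p : Space d × ℝ → ℝ)
        (ρ : ℕ → Space d × ℝ → ℝ) (v : ℕ → Space d × ℝ → Space d),
        -- the common dissipation density is nonpositive and close to `ν_λ`
        Measurable ν ∧
        (∀ᵐ y ∂(volume.restrict (Ioo (-L) L ×ˢ Ioo (0 : ℝ) T)),
          ν y ≤ 0 ∧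
          |ν y - (1 - 2 * lam) * g ^ 2 * y.2 * flux ρm ρp lam (r y)|
            ≤ ε * y.2 * ((ρp - r y) * (r y - ρm))) ∧
        -- the solutions are pairwise different as elements of `L^∞`
        (∀ j k, j ≠ k → ¬ (fun z => (ρ j z, v j z))
          =ᵐ[volume.restrict (spaceTime d L T)] (fun z => (ρ k z, v k z))) ∧
        (∀ k,
          IsWeakSolution g L T (fun x => flat ρm ρp (height x)) (fun _ => 0) (ρ k) (v k) p ∧
          HasDissipation g L T (fun x => flat ρm ρp (height x)) (fun _ => 0) (ρ k) (v k) p ν ∧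
          (∀ᵐ z ∂(volume.restrict (spaceTime d L T)), ρ k z = ρm ∨ ρ k z = ρp) ∧
          -- the horizontal average of the density is the entropy solution
          (∀ᵐ y ∂(volume.restrict (Ioo (-L) L ×ˢ Ioo (0 : ℝ) T)),
            ∫ x' in torusCell d, ρ k (atHeight x' y.1, y.2) = r y) ∧
          -- outside the mixing zone the fluid is unmixed and at rest
          (∀ᵐ z ∂(volume.restrict (spaceTime d L T)),
            height z.1 ∉ mixingZone ρm ρp g lam z.2 →
              ρ k z = flat ρm ρp (height z.1) ∧ v k z = 0) ∧
          -- the total energy balance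
          (∀ᵐ t ∂(volume.restrict (Ioo (0 : ℝ) T)),
            |(totalEnergy g L (fun x => ρ k (x, t)) (fun x => v k (x, t))
                - totalEnergy g L (fun x : Space d => flat ρm ρp (height x)) (fun _ => 0))
                / (ρp - ρm)
              - lam ^ 2 * (lam - 1 / 2)
                * (g ^ 3 * t ^ 4 * atwood ρm ρp ^ 2 / (3 * (1 - atwood ρm ρp ^ 2)))|
              ≤ ε * t ^ 4)) ∧
        -- density, velocity and momentum converge weakly in `L²` to the subsolution
        (∀ φ : Space d × ℝ → ℝ, MemLp φ 2 (volume.restrict (spaceTime d L T)) →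
          Tendsto (fun k => ∫ z in spaceTime d L T, ρ k z * φ z) atTop
            (𝓝 (∫ z in spaceTime d L T, r (height z.1, z.2) * φ z))) ∧
        (∀ φ : Space d × ℝ → Space d, MemLp φ 2 (volume.restrict (spaceTime d L T)) →
          Tendsto (fun k => ∫ z in spaceTime d L T, inner ℝ (v k z) (φ z)) atTop (𝓝 0)) ∧
        (∀ φ : Space d × ℝ → Space d, MemLp φ 2 (volume.restrict (spaceTime d L T)) →
          Tendsto (fun k => ∫ z in spaceTime d L T, inner ℝ (ρ k z • v k z) (φ z)) atTop
            (𝓝 (∫ z in spaceTime d L T,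
              inner ℝ ((g * z.2 * flux ρm ρp lam (r (height z.1, z.2))) • eUp d) (φ z)))) := by
  have hd' : (0 : Fin (d + 1)) ≠ Fin.last d := by
    rcases hd with rfl | rfl <;> decide
  let S₀ : Mixing := ⟨ρm, ρp, g, lam, 1, hρm, hρ, hg, hlam.1⟩
  refine ⟨S₀.dens, Mixing.isEntropySolution (S := S₀), fun ε hε => ?_⟩
  obtain ⟨e, he, hE, hν⟩ := S₀.exists_strength hlam.2 hε
  let S : Mixing := ⟨ρm, ρp, g, lam, e, hρm, hρ, hg, hlam.1⟩
  have hB : S.Below L T := Mixing.below_of_closure_subset hT0 hT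
  obtain ⟨W, hW, hlim, hne⟩ := Mixing.exists_seq_isTurbulent_ne (S := S) (T := T) hd' he hT0 hB
  refine ⟨fun y => S.dissipation (S.q y) y.2, fun z => S.pressure (col z), fun k z => W k z 0,
    fun k z => velocity d (W k z), Mixing.measurable_dissipation, ?_, fun j k hjk h => ?_,
    fun k => ⟨?_, ?_, ?_, ?_, ?_, ?_⟩, fun φ hφ => ?_, fun φ hφ => ?_, fun φ hφ => ?_⟩
  · filter_upwards [ae_restrict_mem (measurableSet_strip L T)] with y hy
    exact hν y hy.2.1
  · exact hne j k hjk (h.mono fun z hz => congrArg Prod.fst hz)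
  · exact (hW k).isWeakSolution hd' he hL hT0 hB fun y hy => (hν y hy).1
  · exact (hW k).hasDissipation hd' he hL hT0 hB
  · filter_upwards [(hW k).phases] with z hz
    obtain ⟨r, a, b, hr, -, -, h⟩ := hz
    rw [h]
    exact hr
  · exact (hW k).average hd' he
  · filter_upwards [(hW k).outside, ae_restrict_mem (measurableSet_spaceTime L T)] with z h1 h2 h3
    have hz : 0 < (col z).2 := h2.2.1
    have h4 : S.ratio (col z) ∉ S.zone := fun h => h3 ((Mixing.mem_mixingZone_iff hz).2 h)
    rw [h1 h4, Mixing.state_eq_pureState hz h4]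
    exact ⟨Mixing.dens_eq_flat hz h4, by simp [velocity]⟩
  · filter_upwards [(hW k).totalEnergy_close hd' he hL hB, ae_restrict_mem measurableSet_Ioo]
      with t h1 h2
    refine h1.trans (mul_le_mul_of_nonneg_right hE ?_)
    have := h2.1
    positivity
  · have h1 := hlim _ ((ContinuousLinearMap.smulRight (ContinuousLinearMap.id ℝ ℝ)
      (EuclideanSpace.single 0 1 : State)).comp_memLp' hφ)
    simp only [Function.comp_def, ContinuousLinearMap.smulRight_apply,
      ContinuousLinearMap.id_apply, real_inner_smul_right, EuclideanSpace.inner_single_right] at h1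
    have h2 : Tendsto (fun k => ∫ z in spaceTime d L T, W k z 0 * φ z) atTop
        (𝓝 (∫ z in spaceTime d L T, S.dens (col z) * φ z)) := by
      simpa [mul_comm, Mixing.state] using h1
    exact h2
  · have h1 := hlim _ ((embed d 1 2).comp_memLp' hφ)
    simp only [Function.comp_def, inner_embed] at h1
    simpa [inner_velocity, Mixing.state] using h1
  -- The product of density and velocity is not weakly continuous, but on the phases it equals the
  -- momentum components 3 and 4 of the state, which converge weakly.
  · have h1 := hlim _ ((embed d 3 4).comp_memLp' hφ)
    simp only [Function.comp_def, inner_embed] at h1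
    have h2 : ∀ k, ∫ z in spaceTime d L T, inner ℝ (W k z 0 • velocity d (W k z)) (φ z)
        = ∫ z in spaceTime d L T, (W k z 3 * φ z 0 + W k z 4 * height (φ z)) := fun k => by
      refine integral_congr_ae ?_
      filter_upwards [(hW k).phases] with z hz
      obtain ⟨r, a, b, -, -, -, h⟩ := hz
      simp only [real_inner_smul_left, inner_velocity, h]
      simp
      ring
    have h3 : ∫ z in spaceTime d L T,
        inner ℝ ((g * z.2 * flux ρm ρp lam (S₀.dens (height z.1, z.2))) • eUp d) (φ z)
        = ∫ z in spaceTime d L T, (S.state (col z) 3 * φ z 0 + S.state (col z) 4 * height (φ z)) := by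
      refine integral_congr_ae (Eventually.of_forall fun z => ?_)
      have h4 : flux ρm ρp lam (S₀.dens (height z.1, z.2)) = S.F (S.q (col z)) :=
        Mixing.flux_dens (S := S) (col z)
      simp only [h4, real_inner_smul_left, eUp, EuclideanSpace.inner_single_left]
      simp [Mixing.state, Mixing.mom, height, col, S]
    simp only [h2]
    rw [h3]
    exact h1
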